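/- **Setting.** Let $d\in\{2,3\}$, let $\Omega\subset\mathbb R^d$ be a nonempty bounded open convex polytope, $k\ge 0$ an integer, $\sigma>0$. Let $\mathcal T_h$ be a finite matching simplicial mesh of $\Omega$ with set of $(d-1)$-dimensional faces $\mathcal F_h$ and regularity parameter $\sigma$: every $T\in\mathcal T_h$ satisfies $h_T\le\sigma\rho_T$, where $h_Y$ is the diameter of $Y$ and $\rho_T$ the largest diameter of a ball contained in $T$. For $T\in\mathcal T_h$, $\mathcal F_T$ is its set of faces and $n_{TF}$ the unit normal to $F\in\mathcal F_T$ pointing out of $T$. $\mathcal P^\ell(Y)$ denotes polynomials of total degree $\le\ell$ restricted to $Y$ ($\mathcal P^{-1}=\{0\}$), $\pi^\ell_Y$ the (componentwise) $L^2(Y)$-orthogonal projector on it, and $\mathcal{RTN}^{k+1}(T)=\mathcal P^k(T)^d+x\,\mathcal P^k(T)$. **Spaces.** $\underline U_h^k$ is the space of families $\underline v_h=((v_T)_{T},(v_F)_{F})$ with $v_T\in\mathcal{RTN}^{k+1}(T)$, $v_F\in\mathcal P^k(F)^d$; $\underline P_h^k$ the space of families $\underline q_h=((q_T)_T,(q_F)_F)$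 with $q_T\in\mathcal P^k(T)$, $q_F\in\mathcal P^k(F)$; $v_h,q_h$ are the broken functions equal to $v_T,q_T$ on $T$. $\underline U_{h,0}^k$ is the subspace where $v_F=0$ for $F\subset\partial\Omega$, and $\underline P_{h,0}^k$ the subspace where $\int_\Omega q_h=0$. The interpolator is $\underline I^k_{U,h}v=((I_T v)_T,(\pi^k_Fv)_F)$ for $v\in H^1(\Omega)^d$, where $I_Tv\in\mathcal{RTN}^{k+1}(T)$ is given by $\pi_T^{k-1}I_Tv=\pi_T^{k-1}v$ and $I_Tv\cdot n_{TF}=\pi_F^k(v\cdot n_{TF})$ for all $F\in\mathcal F_T$. **Forms.** For $\underline w_h,\underline v_h,\underline z_h\in\underline U_h^k$ and $\alpha=(\alpha_T)_T$ set $$(\underline w_h,\underline v_h)_{0,h}=\sum_T\Big(\int_Tw_T\cdot v_T+h_T\sum_{F\in\mathcal F_T}\int_F(w_F-w_T)\cdot(v_F-v_T)\Big),\qquad \|\underline v_h\|_{0,h}^2=(\underline v_h,\underline v_h)_{0,h},$$ $$\|\underline v_h\|_{1,h}^2=\sum_T\Big(\|\nabla v_T\|_{L^2(T)}^2+h_T^{-1}\sum_{F\in\mathcal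 F_T}\|v_F-v_T\|_{L^2(F)}^2\Big),$$ $$j_{\alpha,h}(\underline w_h,\underline v_h)=\sum_T\alpha_T\sum_{F\in\mathcal F_T}\int_F(w_F-w_T)\cdot(v_F-v_T),\qquad |\underline v_h|_{\alpha,h}^2=j_{\alpha,h}(\underline v_h,\underline v_h),$$ $$t_h(\underline w_h,\underline v_h,\underline z_h)=\sum_T\Big(\int_T(w_T\cdot\nabla)v_T\cdot z_T+\tfrac12\sum_{F\in\mathcal F_T}\int_F(w_T\cdot n_{TF})(v_F-v_T)\cdot(z_F+z_T)\Big).$$ Let $p_T\underline v_h\in\mathcal P^{k+1}(T)^d$ be given by $\int_T\nabla p_T\underline v_h:\nabla w=-\int_Tv_T\cdot\Delta w+\sum_{F\in\mathcal F_T}\int_Fv_F\cdot(\nabla w\,n_{TF})$ for all $w\in\mathcal P^{k+1}(T)^d$ and $\int_Tp_T\underline v_h=\int_Tv_T$ if $k\ge1$, $\int_Tp_T\underline v_h=\sum_{F\in\mathcal F_T}\frac{d_{TF}}d\int_Fv_F$ if $k=0$, where $d_{TF}$ is the distance from the center of mass of $T$ to the hyperplane containing $F$. With $\delta_T\underline v_h=I_Tp_T\underline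 v_h-v_T$, $\delta_{TF}\underline v_h=\pi_F^kp_T\underline v_h-v_F$ and $\lambda_T=\operatorname{card}(\mathcal F_T)\,h_T^d/|T|$, $$a_h(\underline w_h,\underline v_h)=\sum_T\Big(\int_T\nabla p_T\underline w_h:\nabla p_T\underline v_h+\lambda_Th_T^{-2}\int_T\delta_T\underline w_h\cdot\delta_T\underline v_h+h_T^{-1}\sum_{F\in\mathcal F_T}\int_F\delta_{TF}\underline w_h\cdot\delta_{TF}\underline v_h\Big).$$ Let $G_T\underline q_h\in\mathcal{RTN}^{k+1}(T)$ be given by $\int_TG_T\underline q_h\cdot w=-\int_Tq_T\nabla\cdot w+\sum_{F\in\mathcal F_T}\int_Fq_F\,w\cdot n_{TF}$ for all $w\in\mathcal{RTN}^{k+1}(T)$; set $B_h(\underline v_h,\underline q_h)=\sum_T\int_Tv_T\cdot G_T\underline q_h$ and $\underline Z_{h,0}^k=\{\underline v_h\in\underline U_{h,0}^k: B_h(\underline v_h,\underline q_h)=0\ \forall\underline q_h\in\underline P_{h,0}^k\}$. **Data.** Let $t_F,\nu,\mu>0$; $f,g\in C^0([0,t_F];L^2(\Omega)^d)$; $u_0,b_0\in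 H_0^1(\Omega)^d$ divergence-free; and, for every $T$, $\beta_T,\gamma_T\in C^0([0,t_F];\mathbb R)$, positive on $(0,t_F]$. **Scheme.** Find $(\underline u_h,\underline b_h,\underline p_h,\underline r_h)\in[C^1([0,t_F];\underline U_{h,0}^k)]^2\times[C^0((0,t_F];\underline P_{h,0}^k)]^2$ such that $\underline u_h(0)=\underline I_{U,h}^ku_0$, $\underline b_h(0)=\underline I_{U,h}^kb_0$ and, for all $t\in(0,t_F]$, all $\underline v_h,\underline w_h\in\underline U_{h,0}^k$ and all $\underline q_h\in\underline P_{h,0}^k$, $$(\partial_t\underline u_h,\underline v_h)_{0,h}+\nu a_h(\underline u_h,\underline v_h)+t_h(\underline u_h,\underline u_h,\underline v_h)+j_{\beta,h}(\underline u_h,\underline v_h)-t_h(\underline b_h,\underline b_h,\underline v_h)+B_h(\underline v_h,\underline p_h)=\int_\Omega f\cdot v_h,$$ $$(\partial_t\underline b_h,\underline w_h)_{0,h}+\mu a_h(\underline b_h,\underline w_h)+t_h(\underline u_h,\underline b_h,\underline w_h)+j_{\gamma,h}(\underline b_h,\underline w_h)-t_h(\underline b_h,\underline u_h,\underline w_h)+B_h(\underline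 w_h,\underline r_h)=\int_\Omega g\cdot w_h,$$ $$B_h(\underline u_h,\underline q_h)=B_h(\underline b_h,\underline q_h)=0.$$ **Pressure-free formulation.** Find $(\underline u_h,\underline b_h)\in[C^1([0,t_F];\underline Z_{h,0}^k)]^2$ with the same initial conditions such that, for all $t\in(0,t_F]$, the first two equations without the terms in $B_h$ hold for all $\underline v_h,\underline w_h\in\underline Z_{h,0}^k$. **Theorem 1 (Well-posedness of the scheme).** The scheme has a unique solution, and so does the pressure-free formulation. The two are equivalent: $(\underline u_h,\underline b_h)$ solves the pressure-free formulation if and only if there are $\underline p_h,\underline r_h$ such that $(\underline u_h,\underline b_h,\underline p_h,\underline r_h)$ solves the scheme. Moreover, there is $C>0$ depending only on $d$, $\Omega$, $k$ and $\sigma$ (not on the mesh otherwise, nor on $t_F,\nu,\mu,\beta,\gamma,f,g,u_0,b_0$) such that the solution satisfies $$\max_{[0,t_F]}\|\underline u_h\|_{0,h}^2+\int_0^{t_F}\!\big(\nu\|\underline u_h\|_{1,h}^2+|\underline u_h|_{\beta,h}^2\big)dt+\max_{[0,t_F]}\|\underline b_h\|_{0,h}^2+\int_0^{t_F}\!\big(\mu\|\underline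 b_h\|_{1,h}^2+|\underline b_h|_{\gamma,h}^2\big)dt$$ $$\le C\,e^{t_F}\Big(\|f\|_{L^2(0,t_F;L^2(\Omega)^d)}^2+\|g\|_{L^2(0,t_F;L^2(\Omega)^d)}^2+|u_0|_{H^1(\Omega)^d}^2+|b_0|_{H^1(\Omega)^d}^2\Big).$$ -/

import Mathlib

namespace MHD

noncomputable section

open MeasureTheory Set Filter Topology
open scoped ENNReal ContDiff

/-! ### Ambient space, differential operators, surface measure -/

/-- The Euclidean space of dimension `d`. -/
abbrev E (d : ℕ) : Type := EuclideanSpace ℝ (Fin d)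

/-- The canonical basis vectors. -/
abbrev basisVec {d : ℕ} (i : Fin d) : E d := EuclideanSpace.single i (1 : ℝ)

/-- The `(d-1)`-dimensional area measure in a `d`-dimensional space, restricted to `S`
(length for `d = 2`, surface area for `d = 3`). -/
def surf {d : ℕ} (S : Set (E d)) : Measure (E d) :=
  (Measure.euclideanHausdorffMeasure (d - 1) : Measure (E d)).restrict S

/-- Frobenius product `A : B` of two matrices, seen as linear maps. -/
def frob {d : ℕ} (A B : E d →L[ℝ] E d) : ℝ :=
  ∑ i : Fin d, inner ℝ (A (basisVec i)) (B (basisVec i))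

/-- The divergence of a (differentiable) vector field. -/
def dvg {d : ℕ} (v : E d → E d) (x : E d) : ℝ :=
  ∑ i : Fin d, fderiv ℝ v x (basisVec i) i

/-! ### Sobolev spaces of vector fields -/

/-- `G` is the weak gradient of the vector field `v` in the open set `U`. -/
def HasWeakGrad {d : ℕ} (U : Set (E d)) (v : E d → E d) (G : E d → E d →L[ℝ] E d) : Prop :=
  ∀ φ : E d → ℝ, ContDiff ℝ ∞ φ → HasCompactSupport φ → tsupport φ ⊆ U → ∀ e : E d,
    ∫ x in U, fderiv ℝ φ x e • v x = -∫ x in U, φ x • G x e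

/-- `v ∈ H¹(U)^d`. -/
def MemH1 {d : ℕ} (U : Set (E d)) (v : E d → E d) : Prop :=
  MemLp v 2 (volume.restrict U) ∧
    ∃ G : E d → E d →L[ℝ] E d, MemLp G 2 (volume.restrict U) ∧ HasWeakGrad U v G

/-- The weak gradient of a field in `H¹(U)^d` (unique up to null sets). -/
def weakGrad {d : ℕ} (U : Set (E d)) (v : E d → E d) : E d → E d →L[ℝ] E d :=
  Classical.epsilon fun G => MemLp G 2 (volume.restrict U) ∧ HasWeakGrad U v G

/-- The square of the seminorm of `H¹(U)^d`. -/
def h1SeminormSq {d : ℕ} (U : Set (E d)) (v : E d → E d) : ℝ :=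
  ∫ x in U, frob (weakGrad U v x) (weakGrad U v x)

/-- Convergence in `H¹(U)^d` of a sequence of smooth fields to `v`. -/
def TendstoH1 {d : ℕ} (U : Set (E d)) (φ : ℕ → E d → E d) (v : E d → E d) : Prop :=
  Tendsto (fun n => eLpNorm (fun x => φ n x - v x) 2 (volume.restrict U)) atTop (𝓝 0) ∧
  Tendsto (fun n => eLpNorm (fun x => fderiv ℝ (φ n) x - weakGrad U v x) 2 (volume.restrict U))
    atTop (𝓝 0)

/-- `v ∈ H¹₀(U)^d`, the closure of the smooth compactly supported fields in `H¹(U)^d`. -/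
def MemH10 {d : ℕ} (U : Set (E d)) (v : E d → E d) : Prop :=
  MemH1 U v ∧ ∃ φ : ℕ → E d → E d,
    (∀ n, ContDiff ℝ ∞ (φ n) ∧ HasCompactSupport (φ n) ∧ tsupport (φ n) ⊆ U) ∧ TendstoH1 U φ v

/-- The field `v ∈ H¹(U)^d` is divergence-free. -/
def IsDivFree {d : ℕ} (U : Set (E d)) (v : E d → E d) : Prop :=
  ∀ᵐ x ∂(volume.restrict U), ∑ i : Fin d, weakGrad U v x (basisVec i) i = 0

/-- `g ∈ L²(S)^d` is the trace on `S ⊆ closure U` of `v ∈ H¹(U)^d`: the limit in `L²(S)^d` of the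
restrictions to `S` of smooth fields converging to `v` in `H¹(U)^d`. -/
def IsTrace {d : ℕ} (U S : Set (E d)) (v g : E d → E d) : Prop :=
  MemLp g 2 (surf S) ∧ ∃ φ : ℕ → E d → E d,
    (∀ n, ContDiff ℝ ∞ (φ n)) ∧ TendstoH1 U φ v ∧
      Tendsto (fun n => eLpNorm (fun x => φ n x - g x) 2 (surf S)) atTop (𝓝 0)

/-- The trace on `S` of `v ∈ H¹(U)^d` (unique up to null sets of the area measure). -/
def trace {d : ℕ} (U S : Set (E d)) (v : E d → E d) : E d → E d :=
  Classical.epsilon fun g => IsTrace U S v g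

/-! ### Meshes -/

/-- A matching simplicial mesh of `Ω`: a finite simplicial complex that covers the closure of `Ω`
and all of whose simplices are faces of `d`-dimensional ones. A simplex is given by its set of
vertices. -/
structure SimplicialMesh {d : ℕ} (Ω : Set (E d)) extends Geometry.SimplicialComplex ℝ (E d) where
  finite_faces : faces.Finite
  space_eq : (⋃ s ∈ faces, convexHull ℝ (s : Set (E d))) = closure Ω
  pure_faces : ∀ s ∈ faces, ∃ t ∈ faces, s ⊆ t ∧ t.card = d + 1

/-- The simplex with a given set of vertices. -/
abbrev hull {d : ℕ} (s : Finset (E d)) : Set (E d) := convexHull ℝ (s : Set (E d))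

/-- The diameter of a mesh entity. -/
def diam {d : ℕ} (s : Finset (E d)) : ℝ := Metric.diam (hull s)

variable {d : ℕ} {Ω : Set (E d)}

open scoped Classical in
/-- The elements of the mesh. -/
def SimplicialMesh.elements (M : SimplicialMesh Ω) : Finset (Finset (E d)) :=
  M.finite_faces.toFinset.filter fun s => s.card = d + 1

open scoped Classical in
/-- The `(d-1)`-dimensional faces of the mesh. -/
def SimplicialMesh.facets (M : SimplicialMesh Ω) : Finset (Finset (E d)) :=
  M.finite_faces.toFinset.filter fun s => s.card = d

abbrev SimplicialMesh.Elem (M : SimplicialMesh Ω) : Type := {T : Finset (E d) // T ∈ M.elements}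

abbrev SimplicialMesh.Facet (M : SimplicialMesh Ω) : Type := {F : Finset (E d) // F ∈ M.facets}

open scoped Classical in
/-- The faces of an element `T`. -/
def SimplicialMesh.facetsOf (M : SimplicialMesh Ω) (T : M.Elem) : Finset M.Facet :=
  Finset.univ.filter fun F => F.1 ⊆ T.1

/-- Shape regularity with parameter `σ`: every element `T` contains a ball whose diameter `2 r`
satisfies `h_T ≤ σ (2 r)`. -/
def SimplicialMesh.IsRegular (M : SimplicialMesh Ω) (σ : ℝ) : Prop :=
  ∀ T : M.Elem, ∃ (x : E d) (r : ℝ), 0 < r ∧ Metric.closedBall x r ⊆ hull T.1 ∧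
    diam T.1 ≤ σ * (2 * r)

/-- The unit normal to the face `F` of the simplex `T` pointing out of `T`. -/
def normal (T F : Finset (E d)) : E d :=
  Classical.epsilon fun n => ‖n‖ = 1 ∧ (∀ x ∈ F, ∀ y ∈ F, inner ℝ n (y - x) = 0) ∧
    ∀ x ∈ F, ∀ y ∈ T, y ∉ F → inner ℝ n (y - x) < 0

/-- The distance of the center of mass of `T` from the hyperplane that contains `F`. -/
def centerDist (T F : Finset (E d)) : ℝ :=
  Metric.infDist (T.centroid ℝ id) (affineSpan ℝ (F : Set (E d)) : Set (E d))

/-! ### Polynomial spaces and projectors -/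

/-- Evaluation of polynomials in `d` variables, as a linear map into the functions on `E d`. -/
def evalPoly (d : ℕ) : MvPolynomial (Fin d) ℝ →ₗ[ℝ] (E d → ℝ) :=
  LinearMap.pi fun x => (MvPolynomial.aeval fun i => x i).toLinearMap

/-- Polynomial functions of total degree at most `ℓ` (only `0` if `ℓ < 0`). This is `P^ℓ(T)` for
an element `T`: a polynomial is determined by its restriction to a set with interior points, and
the elements of `P^ℓ(T)` are identified with polynomial functions on the whole space. -/
def poly (d : ℕ) (l : ℤ) : Submodule ℝ (E d → ℝ) :=
  (MvPolynomial.restrictSupport ℝ {m : Fin d →₀ ℕ | (m.degree : ℤ) ≤ l}).map (evalPoly d)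

/-- The operator that replaces a function by `0` outside `S`. -/
def restrictTo (S : Set (E d)) : (E d → ℝ) →ₗ[ℝ] (E d → ℝ) where
  toFun f := S.indicator f
  map_add' f g := Set.indicator_add S f g
  map_smul' c f := Set.indicator_const_smul S c f

/-- `P^ℓ(F)` for a face `F`: restrictions to `F` of polynomials of degree at most `ℓ`. A function
on `F` is represented by its extension by zero. -/
def facetPoly (F : Finset (E d)) (l : ℤ) : Submodule ℝ (E d → ℝ) :=
  (poly d l).map (restrictTo (hull F))

/-- Vector fields all of whose components lie in `V`. -/
def vec (V : Submodule ℝ (E d → ℝ)) : Submodule ℝ (E d → E d) where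
  carrier := {v | ∀ i, (fun x => v x i) ∈ V}
  add_mem' hv hw i := V.add_mem (hv i) (hw i)
  zero_mem' _ := V.zero_mem
  smul_mem' c _ hv i := V.smul_mem c (hv i)

/-- The operator `q ↦ (x ↦ q(x) x)`. -/
def mulPosition (d : ℕ) : (E d → ℝ) →ₗ[ℝ] (E d → E d) where
  toFun q x := q x • x
  map_add' p q := by
    funext x
    exact add_smul (p x) (q x) x
  map_smul' c q := by
    funext x
    exact mul_smul c (q x) x

/-- The Raviart--Thomas--Nédélec space `P^{ℓ-1}(T)^d + x P^{ℓ-1}(T)`. -/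
def RTN (d : ℕ) (l : ℕ) : Submodule ℝ (E d → E d) :=
  vec (poly d ((l : ℤ) - 1)) ⊔ (poly d ((l : ℤ) - 1)).map (mulPosition d)

/-- The orthogonal projection of `f` on the function space `V` in `L²(m)`. -/
def lproj (m : Measure (E d)) (V : Submodule ℝ (E d → ℝ)) (f : E d → ℝ) : E d → ℝ :=
  Classical.epsilon fun p => p ∈ V ∧ ∀ r ∈ V, ∫ x, p x * r x ∂m = ∫ x, f x * r x ∂m

/-- Componentwise orthogonal projection of a vector field. -/
def lprojVec (m : Measure (E d)) (V : Submodule ℝ (E d → ℝ)) (v : E d → E d) : E d → E d :=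
  fun x => WithLp.toLp 2 fun i => lproj m V (fun y => v y i) x

/-! ### Discrete spaces -/

variable (M : SimplicialMesh Ω)

/-- Families of vector fields attached to the elements and to the faces of the mesh. -/
abbrev HybridVec : Type := (M.Elem → E d → E d) × (M.Facet → E d → E d)

/-- Families of scalar fields attached to the elements and to the faces of the mesh. -/
abbrev HybridScal : Type := (M.Elem → E d → ℝ) × (M.Facet → E d → ℝ)

/-- The space of discrete vector fields. -/
def spaceU (k : ℕ) : Submodule ℝ (HybridVec M) :=
  (Submodule.pi univ fun _ : M.Elem => RTN d (k + 1)).prod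
    (Submodule.pi univ fun F : M.Facet => vec (facetPoly F.1 k))

/-- The space of discrete scalar fields. -/
def spaceP (k : ℕ) : Submodule ℝ (HybridScal M) :=
  (Submodule.pi univ fun _ : M.Elem => poly d k).prod
    (Submodule.pi univ fun F : M.Facet => facetPoly F.1 k)

variable {M}

/-- The broken field on `Ω` that coincides with `v_T` inside each element `T` (it is set to zero
on the faces, which form a null set). -/
def broken {Y : Type} [AddCommMonoid Y] (v : M.Elem → E d → Y) : E d → Y :=
  fun x => ∑ T : M.Elem, (interior (hull T.1)).indicator (v T) x

variable (M)

/-- Discrete vector fields that vanish on the boundary faces. -/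
def spaceU0 (k : ℕ) : Set (HybridVec M) :=
  {v | v ∈ spaceU M k ∧ ∀ F : M.Facet, hull F.1 ⊆ frontier Ω → v.2 F = 0}

/-- Discrete scalar fields with zero average. -/
def spaceP0 (k : ℕ) : Set (HybridScal M) :=
  {q | q ∈ spaceP M k ∧ ∫ x in Ω, broken q.1 x = 0}

variable {M}

/-! ### Interpolators -/

/-- The Raviart--Thomas--Nédélec interpolate of order `ℓ` of `v ∈ H¹(T)^d` on the element `T`. -/
def interpRTN (l : ℕ) (T : M.Elem) (v : E d → E d) : E d → E d :=
  Classical.epsilon fun w => w ∈ RTN d l ∧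
    lprojVec (volume.restrict (hull T.1)) (poly d ((l : ℤ) - 2)) w =
      lprojVec (volume.restrict (hull T.1)) (poly d ((l : ℤ) - 2)) v ∧
    ∀ F ∈ M.facetsOf T, ∀ x ∈ hull F.1,
      inner ℝ (w x) (normal T.1 F.1) =
        lproj (surf (hull F.1)) (facetPoly F.1 ((l : ℤ) - 1))
          (fun y => inner ℝ (trace (interior (hull T.1)) (hull F.1) v y) (normal T.1 F.1)) x

/-- The projection on `P^k(F)^d` of the trace on `F` of `v ∈ H¹(U)^d`. -/
def interpFacet (k : ℕ) (U : Set (E d)) (F : M.Facet) (v : E d → E d) : E d → E d :=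
  lprojVec (surf (hull F.1)) (facetPoly F.1 k) (trace U (hull F.1) v)

variable (M) in
/-- The interpolator from `H¹(Ω)^d` to the space of discrete vector fields. -/
def interp (k : ℕ) (v : E d → E d) : HybridVec M :=
  (fun T => interpRTN (k + 1) T v, fun F => interpFacet k Ω F v)

/-! ### Discrete inner product and norms -/

/-- The discrete `L²`-like inner product. -/
def inner0 (w v : HybridVec M) : ℝ :=
  ∑ T : M.Elem, ((∫ x in hull T.1, inner ℝ (w.1 T x) (v.1 T x)) +
    diam T.1 * ∑ F ∈ M.facetsOf T,
      ∫ x, inner ℝ (w.2 F x - w.1 T x) (v.2 F x - v.1 T x) ∂(surf (hull F.1)))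

/-- The square of the discrete `H¹`-like seminorm. -/
def norm1Sq (v : HybridVec M) : ℝ :=
  ∑ T : M.Elem, ((∫ x in hull T.1, frob (fderiv ℝ (v.1 T) x) (fderiv ℝ (v.1 T) x)) +
    (diam T.1)⁻¹ * ∑ F ∈ M.facetsOf T, ∫ x, ‖v.2 F x - v.1 T x‖ ^ 2 ∂(surf (hull F.1)))

/-- The convective stabilization bilinear form with weights `α`. -/
def jForm (α : M.Elem → ℝ) (w v : HybridVec M) : ℝ :=
  ∑ T : M.Elem, α T * ∑ F ∈ M.facetsOf T,
    ∫ x, inner ℝ (w.2 F x - w.1 T x) (v.2 F x - v.1 T x) ∂(surf (hull F.1))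

/-! ### Diffusion -/

/-- The value prescribed for the integral over `T` of the velocity reconstruction. -/
def meanVal (k : ℕ) (T : M.Elem) (v : HybridVec M) : E d :=
  if k = 0 then
    ∑ F ∈ M.facetsOf T, (centerDist T.1 F.1 / d) • ∫ x, v.2 F x ∂(surf (hull F.1))
  else ∫ x in hull T.1, v.1 T x

/-- The velocity reconstruction of degree `k + 1` on the element `T`. -/
def velRec (k : ℕ) (T : M.Elem) (v : HybridVec M) : E d → E d :=
  Classical.epsilon fun p => p ∈ vec (poly d (k + 1)) ∧
    (∀ w ∈ vec (poly d (k + 1)),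
      ∫ x in hull T.1, frob (fderiv ℝ p x) (fderiv ℝ w x) =
        -(∫ x in hull T.1, inner ℝ (v.1 T x) (Laplacian.laplacian w x)) +
          ∑ F ∈ M.facetsOf T,
            ∫ x, inner ℝ (v.2 F x) (fderiv ℝ w x (normal T.1 F.1)) ∂(surf (hull F.1))) ∧
    ∫ x in hull T.1, p x = meanVal k T v

/-- The element component of the difference between the local interpolate of the velocity
reconstruction and the discrete field itself. -/
def deltaT (k : ℕ) (T : M.Elem) (v : HybridVec M) (x : E d) : E d :=
  interpRTN (k + 1) T (velRec k T v) x - v.1 T x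

/-- The face components of the same difference. -/
def deltaF (k : ℕ) (T : M.Elem) (F : M.Facet) (v : HybridVec M) (x : E d) : E d :=
  interpFacet k (interior (hull T.1)) F (velRec k T v) x - v.2 F x

/-- The weight of the element contribution to the diffusive stabilization. -/
def lam (T : M.Elem) : ℝ :=
  (M.facetsOf T).card * (diam T.1 ^ d / volume.real (hull T.1))

/-- The local diffusive stabilization. -/
def sForm (k : ℕ) (T : M.Elem) (w v : HybridVec M) : ℝ :=
  lam T * (diam T.1 ^ 2)⁻¹ * (∫ x in hull T.1, inner ℝ (deltaT k T w x) (deltaT k T v x)) +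
    (diam T.1)⁻¹ * ∑ F ∈ M.facetsOf T,
      ∫ x, inner ℝ (deltaF k T F w x) (deltaF k T F v x) ∂(surf (hull F.1))

/-- The diffusion bilinear form. -/
def aForm (k : ℕ) (w v : HybridVec M) : ℝ :=
  ∑ T : M.Elem, ((∫ x in hull T.1,
    frob (fderiv ℝ (velRec k T w) x) (fderiv ℝ (velRec k T v) x)) + sForm k T w v)

/-! ### Solenoidal coupling -/

/-- The discrete pressure gradient on the element `T`. -/
def gradRec (k : ℕ) (T : M.Elem) (q : HybridScal M) : E d → E d :=
  Classical.epsilon fun g => g ∈ RTN d (k + 1) ∧ ∀ w ∈ RTN d (k + 1),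
    ∫ x in hull T.1, inner ℝ (g x) (w x) =
      -(∫ x in hull T.1, q.1 T x * dvg w x) +
        ∑ F ∈ M.facetsOf T, ∫ x, q.2 F x * inner ℝ (w x) (normal T.1 F.1) ∂(surf (hull F.1))

/-- The velocity-pressure coupling bilinear form. -/
def bForm (k : ℕ) (v : HybridVec M) (q : HybridScal M) : ℝ :=
  ∑ T : M.Elem, ∫ x in hull T.1, inner ℝ (v.1 T x) (gradRec k T q x)

variable (M) in
/-- The discretely divergence-free subspace. -/
def spaceZ0 (k : ℕ) : Set (HybridVec M) :=
  {v | v ∈ spaceU0 M k ∧ ∀ q ∈ spaceP0 M k, bForm k v q = 0}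

/-! ### Convection -/

/-- The convective trilinear form. -/
def tForm (w v z : HybridVec M) : ℝ :=
  ∑ T : M.Elem, ((∫ x in hull T.1, inner ℝ (fderiv ℝ (v.1 T) x (w.1 T x)) (z.1 T x)) +
    1 / 2 * ∑ F ∈ M.facetsOf T,
      ∫ x, inner ℝ (w.1 T x) (normal T.1 F.1) *
        inner ℝ (v.2 F x - v.1 T x) (z.2 F x + z.1 T x) ∂(surf (hull F.1)))

/-! ### The semi-discrete problems -/

/-- `u` is a `C¹` function on `[0, tF]` with values in `W` and time derivative `u'`. The spaces `W`
used below are finite-dimensional spaces of functions, on which the topology of pointwise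
convergence is the only Hausdorff vector space topology; hence derivatives and continuity are
taken pointwise. -/
def IsC1In (W : Set (HybridVec M)) (tF : ℝ) (u u' : ℝ → HybridVec M) : Prop :=
  (∀ t ∈ Icc 0 tF, u t ∈ W) ∧ (∀ t ∈ Icc 0 tF, u' t ∈ W) ∧
  (∀ t ∈ Icc 0 tF,
    (∀ T x, HasDerivWithinAt (fun s => (u s).1 T x) ((u' t).1 T x) (Icc 0 tF) t) ∧
    (∀ F x, HasDerivWithinAt (fun s => (u s).2 F x) ((u' t).2 F x) (Icc 0 tF) t)) ∧
  (∀ T x, ContinuousOn (fun s => (u' s).1 T x) (Icc 0 tF)) ∧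
  (∀ F x, ContinuousOn (fun s => (u' s).2 F x) (Icc 0 tF))

/-- `p` is a continuous function on `(0, tF]` with values in `W`. -/
def IsC0In (W : Set (HybridScal M)) (tF : ℝ) (p : ℝ → HybridScal M) : Prop :=
  (∀ t ∈ Ioc 0 tF, p t ∈ W) ∧
  (∀ T x, ContinuousOn (fun s => (p s).1 T x) (Ioc 0 tF)) ∧
  (∀ F x, ContinuousOn (fun s => (p s).2 F x) (Ioc 0 tF))

/-- `(u, b, p, r)` solves the semi-discrete scheme on `[0, tF]`. -/
def SolvesScheme (M : SimplicialMesh Ω) (k : ℕ) (tF ν μ : ℝ) (β γ : ℝ → M.Elem → ℝ)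
    (f g : ℝ → Lp (E d) 2 (volume.restrict Ω)) (u₀ b₀ : E d → E d)
    (u b : ℝ → HybridVec M) (p r : ℝ → HybridScal M) : Prop :=
  ∃ u' b' : ℝ → HybridVec M,
    IsC1In (spaceU0 M k) tF u u' ∧ IsC1In (spaceU0 M k) tF b b' ∧
    IsC0In (spaceP0 M k) tF p ∧ IsC0In (spaceP0 M k) tF r ∧
    u 0 = interp M k u₀ ∧ b 0 = interp M k b₀ ∧
    ∀ t ∈ Ioc 0 tF,
      (∀ v ∈ spaceU0 M k,
        inner0 (u' t) v + ν * aForm k (u t) v + tForm (u t) (u t) v + jForm (β t) (u t) v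
          - tForm (b t) (b t) v + bForm k v (p t) = ∫ x in Ω, inner ℝ (f t x) (broken v.1 x)) ∧
      (∀ w ∈ spaceU0 M k,
        inner0 (b' t) w + μ * aForm k (b t) w + tForm (u t) (b t) w + jForm (γ t) (b t) w
          - tForm (b t) (u t) w + bForm k w (r t) = ∫ x in Ω, inner ℝ (g t x) (broken w.1 x)) ∧
      ∀ q ∈ spaceP0 M k, bForm k (u t) q = 0 ∧ bForm k (b t) q = 0

/-- `(u, b)` solves the pressure-free formulation of the scheme on the discretely divergence-free
subspace. -/
def SolvesPressureFree (M : SimplicialMesh Ω) (k : ℕ) (tF ν μ : ℝ) (β γ : ℝ → M.Elem → ℝ)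
    (f g : ℝ → Lp (E d) 2 (volume.restrict Ω)) (u₀ b₀ : E d → E d)
    (u b : ℝ → HybridVec M) : Prop :=
  ∃ u' b' : ℝ → HybridVec M,
    IsC1In (spaceZ0 M k) tF u u' ∧ IsC1In (spaceZ0 M k) tF b b' ∧
    u 0 = interp M k u₀ ∧ b 0 = interp M k b₀ ∧
    ∀ t ∈ Ioc 0 tF,
      (∀ v ∈ spaceZ0 M k,
        inner0 (u' t) v + ν * aForm k (u t) v + tForm (u t) (u t) v + jForm (β t) (u t) v
          - tForm (b t) (b t) v = ∫ x in Ω, inner ℝ (f t x) (broken v.1 x)) ∧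
      (∀ w ∈ spaceZ0 M k,
        inner0 (b' t) w + μ * aForm k (b t) w + tForm (u t) (b t) w + jForm (γ t) (b t) w
          - tForm (b t) (u t) w = ∫ x in Ω, inner ℝ (g t x) (broken w.1 x))

/-- The square of the energy norm of a pair of discrete vector fields, functions of time. -/
def energyNormSq (tF ν μ : ℝ) (β γ : ℝ → M.Elem → ℝ) (v w : ℝ → HybridVec M) : ℝ :=
  sSup ((fun t => inner0 (v t) (v t)) '' Icc 0 tF) +
    (∫ t in (0 : ℝ)..tF, (ν * norm1Sq (v t) + jForm (β t) (v t) (v t))) +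
  sSup ((fun t => inner0 (w t) (w t)) '' Icc 0 tF) +
    ∫ t in (0 : ℝ)..tF, (μ * norm1Sq (w t) + jForm (γ t) (w t) (w t))

end

end MHD

/-!
# Well-posedness of the semi-discrete scheme

On the discretely divergence-free subspace the scheme is an ordinary differential equation in a
finite-dimensional space, with a positive definite mass form, a nonnegative dissipation that depends
continuously on time, and a quadratic convective term that is orthogonal to the solution. A discrete
field of that subspace is exactly divergence-free inside the elements and has continuous normal
components across the faces (`dvg_eq_zero_of_mem_spaceZ0`, `sum_normal_component_eq_zero`); so
integration by parts shows that the convective form is skew-symmetric in its last two arguments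
(`tForm_swap`), and the contributions of the velocity and of the magnetic field to the energy
balance cancel. An equation of this type has a global solution: compose the vector field with
the retraction on a large ball, so that it becomes bounded, and let the energy bound show that the
solution never leaves the ball (`exists_solution_of_dissipative`, `GalerkinData.exists_solution`).
Uniqueness and the energy estimate are consequences of Grönwall's inequality (`gronwall_energy`,
`GalerkinData.solution_unique`).

The pressures are Lagrange multipliers of the divergence constraint. They exist, are unique, and
inherit continuity in time because the coupling form has no spurious kernel: a pressure of zero
average that is orthogonal to all discrete fields vanishes (`eq_zero_of_bForm`). Inside an element
this is the unisolvence of the Raviart--Thomas--Nédélec degrees of freedom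
(`exists_RTN_field`); the values in two elements agree because elements are connected through their
faces (`SimplicialMesh.eq_of_forall_adjacent`): a function that is constant in each element and does
not jump across interior faces has zero distributional gradient, so its integral against a bump
function does not change when the bump is transported along a segment joining two elements.

The constant in the energy bound comes from two estimates that are uniform on shape-regular meshes.
The first is the coercivity of the diffusion form with respect to the discrete `H¹` norm
(`exists_coercivity`), and the second the stability of the interpolator
(`exists_interp_bound`). Both rest on the fact that a simplex contains a ball whose radius
is comparable to its diameter, so that inverse, Poincaré and trace inequalities for polynomials
follow from finite-dimensionality after rescaling. The interpolate of a divergence-free field is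
discretely divergence-free (`interp_mem_spaceZ0`). The traces used here are built by density: traces
of smooth fields are controlled by the divergence theorem on a simplex
(`IsSimplex.trace_inequality`), the traces of a field of `H¹₀` on the two sides of a face agree, and
they vanish on the boundary of the domain.
-/

namespace MHD

noncomputable section

open MeasureTheory Set Filter Topology
open scoped ENNReal ContDiff NNReal

variable {d : ℕ}

/-! ### Differential inequalities and dissipative differential equations -/

/-- Grönwall's inequality in the form used for energy estimates: `y` is the energy, `D` the
dissipation rate and `g` the power of the source. The quantity that grows at most exponentially is
the energy plus what has been dissipated plus what the source can still supply. -/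
theorem gronwall_energy {tF K : ℝ} (htF : 0 < tF) (hK : 0 ≤ K) {y y' D g : ℝ → ℝ}
    (hy : ∀ t ∈ Icc 0 tF, HasDerivWithinAt y (y' t) (Icc 0 tF) t)
    (hD : ContinuousOn D (Icc 0 tF)) (hg : ContinuousOn g (Icc 0 tF))
    (hy0 : ∀ t ∈ Icc 0 tF, 0 ≤ y t) (hD0 : ∀ t ∈ Icc 0 tF, 0 ≤ D t)
    (hg0 : ∀ t ∈ Icc 0 tF, 0 ≤ g t) (h : ∀ t ∈ Ioo 0 tF, y' t + D t ≤ K * y t + g t) :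
    (∀ t ∈ Icc 0 tF, y t ≤ Real.exp (K * tF) * (y 0 + ∫ s in (0 : ℝ)..tF, g s)) ∧
      ∫ s in (0 : ℝ)..tF, D s ≤ Real.exp (K * tF) * (y 0 + ∫ s in (0 : ℝ)..tF, g s) := by
  have h0 : (0 : ℝ) ∈ Icc 0 tF := ⟨le_rfl, htF.le⟩
  have hT : tF ∈ Icc 0 tF := ⟨htF.le, le_rfl⟩
  have hi : ∀ {φ : ℝ → ℝ}, ContinuousOn φ (Icc 0 tF) → ∀ t ∈ Icc 0 tF,
      IntervalIntegrable φ volume 0 t := fun hφ t ht =>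
    (hφ.mono (Icc_subset_Icc_right ht.2)).intervalIntegrable_of_Icc ht.1
  set G := ∫ s in (0 : ℝ)..tF, g s
  set W : ℝ → ℝ := fun t => y t + (∫ s in (0 : ℝ)..t, (D s - g s)) + G
  have hDt : ∀ t ∈ Icc 0 tF, 0 ≤ ∫ s in (0 : ℝ)..t, D s := fun t ht =>
    intervalIntegral.integral_nonneg ht.1 fun s hs => hD0 s ⟨hs.1, hs.2.trans ht.2⟩
  have hG : ∀ t ∈ Icc 0 tF, y t + ∫ s in (0 : ℝ)..t, D s ≤ W t := by
    intro t ht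
    have : ∫ s in (0 : ℝ)..t, g s ≤ G := by
      refine intervalIntegral.integral_mono_interval le_rfl ht.1 ht.2 ?_ (hi hg tF hT)
      filter_upwards [ae_restrict_mem measurableSet_Ioc] with s hs
      exact hg0 s ⟨hs.1.le, hs.2⟩
    simp only [W]
    rw [intervalIntegral.integral_sub (hi hD t ht) (hi hg t ht)]
    linarith
  have hd : ∀ t ∈ Ioo 0 tF, HasDerivAt (fun t => Real.exp (-(K * t)) * W t)
      (Real.exp (-(K * t)) * (-K) * W t + Real.exp (-(K * t)) * (y' t + (D t - g t))) t := by
    intro t ht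
    have h1 : HasDerivAt (fun t : ℝ => -(K * t)) (-K) t := by
      simpa using ((hasDerivAt_id t).const_mul K).fun_neg
    have hn := Icc_mem_nhds ht.1 ht.2
    exact h1.exp.mul ((((hy t ⟨ht.1.le, ht.2.le⟩).hasDerivAt hn).add
      (intervalIntegral.integral_hasDerivAt_right (hi (hD.sub hg) t ⟨ht.1.le, ht.2.le⟩)
        (((hD.sub hg).mono Ioo_subset_Icc_self).stronglyMeasurableAtFilter isOpen_Ioo t ht)
        ((hD.sub hg).continuousAt hn))).add_const G)
  have hanti : AntitoneOn (fun t => Real.exp (-(K * t)) * W t) (Icc 0 tF) := by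
    refine antitoneOn_of_hasDerivWithinAt_nonpos (convex_Icc _ _) ?_
      (fun t ht => (hd t (by rwa [interior_Icc] at ht)).hasDerivWithinAt) fun t ht => ?_
    · have h1 := intervalIntegral.continuousOn_primitive_interval' (hi (hD.sub hg) tF hT) left_mem_uIcc
      rw [uIcc_of_le htF.le] at h1
      have h2 : ContinuousOn y (Icc 0 tF) := fun t ht => (hy t ht).continuousWithinAt
      exact ContinuousOn.mul (by fun_prop) ((h2.add h1).add continuousOn_const)
    · rw [interior_Icc] at ht
      have ht' : t ∈ Icc 0 tF := ⟨ht.1.le, ht.2.le⟩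
      have h1 : K * y t ≤ K * W t := by
        gcongr
        linarith [hG t ht', hDt t ht']
      have h2 := h t ht
      have h3 := Real.exp_pos (-(K * t))
      nlinarith
  have key : ∀ t ∈ Icc 0 tF, W t ≤ Real.exp (K * tF) * (y 0 + G) := by
    intro t ht
    have h1 := hanti h0 ht ht.1
    simp only [mul_zero, neg_zero, Real.exp_zero, one_mul] at h1
    have h2 : W 0 = y 0 + G := by simp [W]
    rw [h2, Real.exp_neg, inv_mul_le_iff₀ (Real.exp_pos _)] at h1
    refine h1.trans ?_
    have h3 : 0 ≤ y 0 + G := by linarith [hG 0 h0, hDt 0 h0, hy0 0 h0]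
    gcongr
    exact ht.2
  exact ⟨fun t ht => by linarith [key t ht, hG t ht, hDt t ht],
    by linarith [key tF hT, hG tF hT, hy0 tF hT]⟩

/-- The radial retraction on a ball is Lipschitz. -/
theorem norm_retract_sub_le {H : Type*} [NormedAddCommGroup H] [NormedSpace ℝ H] {R : ℝ}
    (hR : 0 < R) (x y : H) :
    ‖(R / max R ‖x‖) • x - (R / max R ‖y‖) • y‖ ≤ 2 * ‖x - y‖ := by
  set a := max R ‖x‖
  set b := max R ‖y‖
  have ha : R ≤ a := le_max_left _ _
  have hb : R ≤ b := le_max_left _ _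
  have hab : |b - a| ≤ ‖x - y‖ := by
    rw [norm_sub_rev]
    exact (abs_max_sub_max_le_max R ‖y‖ R ‖x‖).trans (by simpa using abs_norm_sub_norm_le y x)
  have ha0 := hR.trans_le ha
  have hb0 := hR.trans_le hb
  have e : (R / a) • x - (R / b) • y = (R / a) • (x - y) + (R / a * ((b - a) / b)) • y := by
    have : R / a * ((b - a) / b) = R / a - R / b := by field_simp
    rw [this]
    module
  rw [e, two_mul]
  have h1 : R / a ≤ 1 := (div_le_one ha0).2 ha
  refine (norm_add_le _ _).trans (add_le_add ?_ ?_)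
  · rw [norm_smul, Real.norm_of_nonneg (by positivity)]
    exact mul_le_of_le_one_left (norm_nonneg _) h1
  · rw [norm_smul, norm_mul, Real.norm_of_nonneg (by positivity : 0 ≤ R / a), norm_div,
      Real.norm_of_nonneg hb0.le, mul_assoc, div_mul_eq_mul_div _ b]
    refine (mul_le_of_le_one_left (by positivity) h1).trans ((div_le_iff₀ hb0).2 ?_)
    exact mul_le_mul hab (le_max_right _ _) (norm_nonneg _) (norm_nonneg _)

/-- Global solvability of `x' = F(t, x)` for a locally Lipschitz field with `⟪F(t, x), x⟫ ≤ c ‖x‖`.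
The field is composed with the retraction on a large ball, which makes it bounded, so that the
Picard--Lindelöf theorem gives a solution on the whole interval at once; the dissipativity survives
and keeps the solution in the ball. -/
theorem exists_solution_of_dissipative {H : Type*} [NormedAddCommGroup H] [InnerProductSpace ℝ H]
    [CompleteSpace H] {tF : ℝ} (htF : 0 < tF) (F : ℝ → H → H)
    (hcont : ∀ x, ContinuousOn (fun t => F t x) (Icc 0 tF))
    (hlip : ∀ R : ℝ, ∃ K : ℝ, 0 ≤ K ∧ ∀ t ∈ Icc 0 tF, ∀ x y : H, ‖x‖ ≤ R → ‖y‖ ≤ R →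
      ‖F t x - F t y‖ ≤ K * ‖x - y‖)
    (c : ℝ) (hdis : ∀ t ∈ Icc 0 tF, ∀ x, inner ℝ (F t x) x ≤ c * ‖x‖) (x₀ : H) :
    ∃ α : ℝ → H, α 0 = x₀ ∧ (∀ t ∈ Icc 0 tF, HasDerivWithinAt α (F t (α t)) (Icc 0 tF) t) ∧
      ContinuousOn (fun t => F t (α t)) (Icc 0 tF) := by
  set B : ℝ := Real.exp (1 * tF) * (‖x₀‖ ^ 2 + ∫ _s in (0 : ℝ)..tF, c ^ 2) with hB
  obtain ⟨R, hR1, hRB⟩ : ∃ R : ℝ, 1 ≤ R ∧ B ≤ R ^ 2 :=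
    ⟨max 1 B, le_max_left _ _, by nlinarith [le_max_left 1 B, le_max_right 1 B]⟩
  have hR0 : 0 < R := by linarith
  let P : H → H := fun x => (R / max R ‖x‖) • x
  have hPn : ∀ x, ‖P x‖ ≤ R := fun x => by
    have h1 : 0 < max R ‖x‖ := hR0.trans_le (le_max_left _ _)
    rw [norm_smul, Real.norm_of_nonneg (by positivity), div_mul_eq_mul_div, div_le_iff₀ h1]
    gcongr
    exact le_max_right _ _
  have hPin : ∀ x, ‖x‖ ≤ R → P x = x := fun x hx => by
    simp only [P]
    rw [max_eq_left hx, div_self hR0.ne', one_smul]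
  obtain ⟨K, hK0, hK⟩ := hlip R
  have hG : ∀ t ∈ Icc 0 tF, ∀ x y, ‖F t (P x) - F t (P y)‖ ≤ K * 2 * ‖x - y‖ :=
    fun t ht x y => (hK t ht _ _ (hPn x) (hPn y)).trans (by
      rw [mul_assoc]
      exact mul_le_mul_of_nonneg_left (norm_retract_sub_le hR0 x y) hK0)
  obtain ⟨b, hb⟩ := isCompact_Icc.exists_bound_of_continuousOn (hcont 0)
  have hL : ∀ t ∈ Icc 0 tF, ∀ x, ‖F t (P x)‖ ≤ |b| + K * R := fun t ht x => by
    have h1 := hK t ht (P x) 0 (hPn x) (by simpa using hR0.le)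
    rw [sub_zero] at h1
    have h2 : K * ‖P x‖ ≤ K * R := mul_le_mul_of_nonneg_left (hPn x) hK0
    have h3 := norm_le_insert' (F t (P x)) (F t 0)
    linarith [hb t ht, le_abs_self b]
  have hPL : IsPicardLindelof (fun t x => F t (P x)) (⟨0, le_rfl, htF.le⟩ : Icc (0 : ℝ) tF) x₀
      ⟨(|b| + K * R) * tF, by positivity⟩ 0 ⟨|b| + K * R, by positivity⟩
      ⟨K * 2, by positivity⟩ := by
    refine ⟨fun t ht => LipschitzOnWith.of_dist_le_mul fun x _ y _ => ?_, fun x _ => hcont _,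
      fun t ht x _ => hL t ht x, ?_⟩
    · rw [dist_eq_norm, dist_eq_norm]
      exact hG t ht x y
    · have : (|b| + K * R) * max (tF - 0) (0 - 0) ≤ (|b| + K * R) * tF - 0 := by simp [htF.le]
      exact this
  obtain ⟨α, hα0, hα⟩ := hPL.exists_eq_forall_mem_Icc_hasDerivWithinAt (x := x₀) (by simp)
  have hαc : ContinuousOn α (Icc 0 tF) := fun t ht => (hα t ht).continuousWithinAt
  have hbound := (gronwall_energy htF zero_le_one (y := fun t => ‖α t‖ ^ 2)
    (y' := fun t => 2 * inner ℝ (α t) (F t (P (α t)))) (D := fun _ => 0) (g := fun _ => c ^ 2)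
    (fun t ht => by simpa using (hα t ht).norm_sq) continuousOn_const continuousOn_const
    (fun t _ => by positivity) (fun _ _ => le_rfl) (fun _ _ => by positivity)
    (fun t ht => by
      have h1 : inner ℝ (F t (P (α t))) (α t) ≤ c * ‖α t‖ := by
        set r := R / max R ‖α t‖
        have hr : 0 < r := div_pos hR0 (hR0.trans_le (le_max_left _ _))
        have h2 := hdis t ⟨ht.1.le, ht.2.le⟩ (P (α t))
        have h3 : P (α t) = r • α t := rfl
        rw [h3] at h2 ⊢
        rw [inner_smul_right, norm_smul, Real.norm_of_nonneg hr.le] at h2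
        exact le_of_mul_le_mul_left (by linarith) hr
      rw [real_inner_comm]
      nlinarith [sq_nonneg (c - ‖α t‖)])).1
  have hPα : ∀ t ∈ Icc 0 tF, P (α t) = α t := fun t ht => hPin _ (by
    have h1 := hbound t ht
    simp only [hα0] at h1
    exact (abs_le_of_sq_le_sq' (h1.trans hRB) hR0.le).2)
  refine ⟨α, hα0, fun t ht => ?_, fun t ht => ?_⟩
  · simpa only [hPα t ht] using hα t ht
  · have h3 : Tendsto (fun s => K * 2 * ‖α s - α t‖) (𝓝[Icc 0 tF] t) (𝓝 0) := by
      simpa using ((hαc t ht).tendsto.sub (tendsto_const_nhds (x := α t))).norm.const_mul (K * 2)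
    have h4 := ((hcont (α t) t ht).tendsto.add (squeeze_zero_norm' (by
      filter_upwards [self_mem_nhdsWithin] with s hs
      have := hG s hs (α s) (α t)
      rwa [hPα s hs, hPα t ht] at this) h3 :
        Tendsto (fun s => F s (α s) - F s (α t)) (𝓝[Icc 0 tF] t) (𝓝 0)))
    simpa [ContinuousWithinAt] using h4

/-- `x` is a continuously differentiable curve on `[0, tF]` with derivative `x'`, in a
finite-dimensional space without a preferred norm: differentiability and continuity are tested with
linear forms. -/
def IsC1Dual {V : Type*} [AddCommGroup V] [Module ℝ V] (tF : ℝ) (x x' : ℝ → V) : Prop :=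
  (∀ φ : Module.Dual ℝ V, ∀ t ∈ Icc 0 tF,
    HasDerivWithinAt (fun s => φ (x s)) (φ (x' t)) (Icc 0 tF) t) ∧
  ∀ φ : Module.Dual ℝ V, ContinuousOn (fun s => φ (x' s)) (Icc 0 tF)

section FiniteDim

variable {V : Type*} [AddCommGroup V] [Module ℝ V]

theorem IsC1Dual.continuousOn {tF : ℝ} {x x' : ℝ → V} (h : IsC1Dual tF x x')
    (φ : Module.Dual ℝ V) : ContinuousOn (fun s => φ (x s)) (Icc 0 tF) :=
  fun t ht => (h.1 φ t ht).continuousWithinAt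

theorem IsC1Dual.sub {tF : ℝ} {x x' z z' : ℝ → V} (h : IsC1Dual tF x x')
    (h' : IsC1Dual tF z z') : IsC1Dual tF (fun t => x t - z t) (fun t => x' t - z' t) := by
  constructor
  · intro φ t ht
    simp only [map_sub]
    exact (h.1 φ t ht).sub (h'.1 φ t ht)
  · intro φ
    simp only [map_sub]
    exact (h.2 φ).sub (h'.2 φ)

theorem bilin_eq_sum {n : ℕ} (b : Module.Basis (Fin n) ℝ V) (B : V →ₗ[ℝ] V →ₗ[ℝ] ℝ) (x y : V) :
    B x y = ∑ i, ∑ j, b.coord i x * b.coord j y * B (b i) (b j) := by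
  conv_lhs => rw [← b.sum_repr x, ← b.sum_repr y]
  simp only [map_sum, map_smul, LinearMap.sum_apply, LinearMap.smul_apply, smul_eq_mul,
    Module.Basis.coord_apply, Finset.mul_sum]
  rw [Finset.sum_comm]
  exact Finset.sum_congr rfl fun i _ => Finset.sum_congr rfl fun j _ => by ring

variable [FiniteDimensional ℝ V]

theorem continuousOn_bilin {s : Set ℝ} {B : ℝ → V →ₗ[ℝ] V →ₗ[ℝ] ℝ} {x y : ℝ → V}
    (hB : ∀ u v, ContinuousOn (fun t => B t u v) s)
    (hx : ∀ φ : Module.Dual ℝ V, ContinuousOn (fun t => φ (x t)) s)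
    (hy : ∀ φ : Module.Dual ℝ V, ContinuousOn (fun t => φ (y t)) s) :
    ContinuousOn (fun t => B t (x t) (y t)) s := by
  have e : (fun t => B t (x t) (y t)) = fun t => ∑ i, ∑ j,
      (Module.finBasis ℝ V).coord i (x t) * (Module.finBasis ℝ V).coord j (y t) *
        B t (Module.finBasis ℝ V i) (Module.finBasis ℝ V j) :=
    funext fun t => bilin_eq_sum _ _ _ _
  rw [e]
  exact continuousOn_finsetSum _ fun i _ => continuousOn_finsetSum _ fun j _ =>
    ((hx _).mul (hy _)).mul (hB _ _)

theorem continuousOn_dual {s : Set ℝ} {l : ℝ → Module.Dual ℝ V} {x : ℝ → V}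
    (hl : ∀ u, ContinuousOn (fun t => l t u) s)
    (hx : ∀ φ : Module.Dual ℝ V, ContinuousOn (fun t => φ (x t)) s) :
    ContinuousOn (fun t => l t (x t)) s := by
  have e : (fun t => l t (x t)) = fun t => ∑ i,
      (Module.finBasis ℝ V).coord i (x t) * l t (Module.finBasis ℝ V i) := by
    funext t
    conv_lhs => rw [← (Module.finBasis ℝ V).sum_repr (x t), map_sum]
    simp only [map_smul, smul_eq_mul, Module.Basis.coord_apply]
  rw [e]
  exact continuousOn_finsetSum _ fun i _ => (hx _).mul (hl _)

theorem IsC1Dual.hasDerivWithinAt_bilin {tF : ℝ} {x x' : ℝ → V} (h : IsC1Dual tF x x')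
    (B : V →ₗ[ℝ] V →ₗ[ℝ] ℝ) {t : ℝ} (ht : t ∈ Icc 0 tF) :
    HasDerivWithinAt (fun s => B (x s) (x s)) (B (x' t) (x t) + B (x t) (x' t)) (Icc 0 tF) t := by
  set b := Module.finBasis ℝ V
  have e : (fun s => B (x s) (x s)) = fun s => ∑ i, ∑ j,
      b.coord i (x s) * b.coord j (x s) * B (b i) (b j) := funext fun t => bilin_eq_sum _ _ _ _
  rw [e, bilin_eq_sum b B (x' t), bilin_eq_sum b B (x t), ← Finset.sum_add_distrib]
  refine HasDerivWithinAt.fun_sum fun i _ => ?_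
  rw [← Finset.sum_add_distrib]
  refine HasDerivWithinAt.fun_sum fun j _ => ?_
  have := ((h.1 (b.coord i) t ht).mul (h.1 (b.coord j) t ht)).mul_const (B (b i) (b j))
  exact this.congr_deriv (by ring)

/-- The data of an abstract Galerkin problem `m(x', y) + A(x, y) + Q(x, x, y) = l(y)`: the mass form
`m` is an inner product, `A` is positive and `Q` vanishes when its three arguments agree. -/
structure GalerkinData (V : Type*) [AddCommGroup V] [Module ℝ V] (tF : ℝ) where
  m : V →ₗ[ℝ] V →ₗ[ℝ] ℝ
  A : ℝ → V →ₗ[ℝ] V →ₗ[ℝ] ℝ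
  Q : V →ₗ[ℝ] V →ₗ[ℝ] V →ₗ[ℝ] ℝ
  l : ℝ → Module.Dual ℝ V
  symm : ∀ x y, m x y = m y x
  pos : ∀ x, x ≠ 0 → 0 < m x x
  contA : ∀ x y, ContinuousOn (fun t => A t x y) (Icc 0 tF)
  contl : ∀ y, ContinuousOn (fun t => l t y) (Icc 0 tF)
  nonneg : ∀ t ∈ Icc 0 tF, ∀ x, 0 ≤ A t x x
  skew : ∀ x, Q x x x = 0

/-- The equation for the value `x` of the solution and the value `x'` of its derivative, tested with
`y`. -/
def GalerkinData.Eqn {tF : ℝ} (P : GalerkinData V tF) (t : ℝ) (x' x y : V) : Prop :=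
  P.m x' y + P.A t x y + P.Q x x y = P.l t y

/-- The inner product given by the mass form. -/
@[reducible]
def GalerkinData.core {tF : ℝ} (P : GalerkinData V tF) : InnerProductSpace.Core ℝ V where
  inner x y := P.m x y
  conj_inner_symm x y := by simpa using P.symm y x
  re_inner_nonneg x := by
    by_cases hx : x = 0
    · simp [hx]
    · simpa using (P.pos x hx).le
  add_left x y z := by simp
  smul_left x y r := by simp
  definite x hx := by
    by_contra h
    exact (P.pos x h).ne' hx

/-- Joint continuity of a family of bilinear forms in finite dimension gives a uniform bound. -/
theorem exists_bilin_bound {V X : Type*} [NormedAddCommGroup V] [NormedSpace ℝ V]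
    [FiniteDimensional ℝ V] [TopologicalSpace X] {s : Set X} (hs : IsCompact s)
    {B : X → V →ₗ[ℝ] V →ₗ[ℝ] ℝ} (hB : ∀ x y, ContinuousOn (fun t => B t x y) s) :
    ∃ C : ℝ, 0 ≤ C ∧ ∀ t ∈ s, ∀ x y, |B t x y| ≤ C * ‖x‖ * ‖y‖ := by
  have h : ContinuousOn (fun t => (B t).toContinuousBilinearMap) s :=
    continuousOn_clm_apply.2 fun x => continuousOn_clm_apply.2 fun y => hB x y
  obtain ⟨C, hC⟩ := IsCompact.exists_bound_of_continuousOn (E := V →L[ℝ] V →L[ℝ] ℝ) hs h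
  refine ⟨|C|, abs_nonneg _, fun t ht x y => ((B t).toContinuousBilinearMap.le_opNorm₂ x y).trans ?_⟩
  gcongr
  exact (hC t ht).trans (le_abs_self C)

theorem exists_trilin_bound {V : Type*} [NormedAddCommGroup V] [NormedSpace ℝ V]
    [FiniteDimensional ℝ V] (Q : V →ₗ[ℝ] V →ₗ[ℝ] V →ₗ[ℝ] ℝ) :
    ∃ C : ℝ, 0 ≤ C ∧ ∀ x y z, |Q x y z| ≤ C * ‖x‖ * ‖y‖ * ‖z‖ := by
  have := FiniteDimensional.proper ℝ V
  obtain ⟨C, hC0, hC⟩ := exists_bilin_bound (isCompact_closedBall (0 : V) 1) (B := Q) fun y z =>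
    ((Q.flip y).flip z).continuous_of_finiteDimensional.continuousOn
  refine ⟨C, hC0, fun x y z => ?_⟩
  rcases eq_or_ne x 0 with rfl | hx
  · simp
  · have h := hC (‖x‖⁻¹ • x) (by simp [norm_smul, hx]) y z
    rw [map_smul, LinearMap.smul_apply, LinearMap.smul_apply, smul_eq_mul, abs_mul, abs_inv,
      abs_norm, inv_mul_le_iff₀ (norm_pos_iff.2 hx)] at h
    exact h.trans_eq (by ring)

theorem GalerkinData.exists_solution {tF : ℝ} (htF : 0 < tF) (P : GalerkinData V tF) (x₀ : V) :
    ∃ x x' : ℝ → V, IsC1Dual tF x x' ∧ x 0 = x₀ ∧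
      ∀ t ∈ Icc 0 tF, ∀ y, P.Eqn t (x' t) (x t) y := by
  let i1 : NormedAddCommGroup V := P.core.toNormedAddCommGroup
  let i2 : InnerProductSpace ℝ V := InnerProductSpace.ofCore P.core.toCore
  have hm : ∀ x y : V, inner ℝ x y = P.m x y := fun _ _ => rfl
  have : CompleteSpace V := FiniteDimensional.complete ℝ V
  let J := (InnerProductSpace.toDual ℝ V).symm
  let F : ℝ → V → V := fun t x =>
    J (LinearMap.toContinuousLinearMap (P.l t - P.A t x - P.Q x x))
  have hF : ∀ t x y, inner ℝ (F t x) y = P.l t y - P.A t x y - P.Q x x y := fun t x y =>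
    InnerProductSpace.toDual_symm_apply
  obtain ⟨CA, hCA0, hCA⟩ := exists_bilin_bound isCompact_Icc P.contA
  obtain ⟨Cl, hCl⟩ : ∃ C : ℝ, ∀ t ∈ Icc 0 tF, ∀ y, P.l t y ≤ C * ‖y‖ := by
    have h1 : ContinuousOn (fun t => LinearMap.toContinuousLinearMap (P.l t)) (Icc 0 tF) :=
      continuousOn_clm_apply.2 P.contl
    obtain ⟨C, hC⟩ := IsCompact.exists_bound_of_continuousOn (E := V →L[ℝ] ℝ) isCompact_Icc h1
    exact ⟨C, fun t ht y => (le_abs_self _).trans (ContinuousLinearMap.le_of_opNorm_le _ (hC t ht) y)⟩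
  obtain ⟨CQ, hCQ0, hCQ⟩ := exists_trilin_bound P.Q
  obtain ⟨α, hα0, hα, hαc⟩ := exists_solution_of_dissipative htF F
    (fun x => J.continuous.comp_continuousOn (continuousOn_clm_apply.2 fun y =>
      ((P.contl y).sub (P.contA x y)).sub continuousOn_const))
    (fun R => by
      refine ⟨CA + 2 * CQ * |R|, by positivity, fun t ht x y hx hy => ?_⟩
      set w := F t x - F t y with hw
      have h1 : inner ℝ w w = -P.A t (x - y) w - P.Q (x - y) x w - P.Q y (x - y) w := by
        have h0 : ∀ v, inner ℝ w v = -P.A t (x - y) v - P.Q (x - y) x v - P.Q y (x - y) v := by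
          intro v
          rw [hw, inner_sub_left, hF, hF]
          simp only [map_sub, LinearMap.sub_apply]
          ring
        exact h0 w
      have h2 : ‖w‖ * ‖w‖ ≤ (CA + 2 * CQ * |R|) * ‖x - y‖ * ‖w‖ := by
        rw [← real_inner_self_eq_norm_mul_norm, h1]
        have a1 := neg_abs_le (P.A t (x - y) w)
        have a2 := neg_abs_le (P.Q (x - y) x w)
        have a3 := neg_abs_le (P.Q y (x - y) w)
        have b1 := hCA t ht (x - y) w
        have b2 := hCQ (x - y) x w
        have b3 := hCQ y (x - y) w
        have c2 : CQ * ‖x - y‖ * ‖x‖ * ‖w‖ ≤ CQ * ‖x - y‖ * |R| * ‖w‖ := by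
          gcongr; exact hx.trans (le_abs_self R)
        have c3 : CQ * ‖y‖ * ‖x - y‖ * ‖w‖ ≤ CQ * |R| * ‖x - y‖ * ‖w‖ := by
          gcongr; exact hy.trans (le_abs_self R)
        nlinarith
      rcases (norm_nonneg w).eq_or_lt with h3 | h3
      · rw [← h3]; positivity
      · exact le_of_mul_le_mul_right h2 h3)
    Cl (fun t ht x => by
      rw [hF, P.skew]
      linarith [P.nonneg t ht x, hCl t ht x]) x₀
  refine ⟨α, fun t => F t (α t), ⟨fun φ t ht => ?_, fun φ => ?_⟩, hα0, fun t ht y => ?_⟩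
  · exact (LinearMap.toContinuousLinearMap φ).hasFDerivAt.comp_hasDerivWithinAt t (hα t ht)
  · exact (LinearMap.toContinuousLinearMap φ).continuous.comp_continuousOn hαc
  · rw [GalerkinData.Eqn, ← hm, hF]
    ring

theorem GalerkinData.solution_unique {tF : ℝ} (htF : 0 < tF) (P : GalerkinData V tF)
    {x x' z z' : ℝ → V} (hx : IsC1Dual tF x x') (hz : IsC1Dual tF z z') (h0 : x 0 = z 0)
    (ex : ∀ t ∈ Ioc 0 tF, ∀ y, P.Eqn t (x' t) (x t) y)
    (ez : ∀ t ∈ Ioc 0 tF, ∀ y, P.Eqn t (z' t) (z t) y) :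
    EqOn x z (Icc 0 tF) := by
  -- the convective terms are bounded by a multiple of the energy of the difference
  obtain ⟨K, hK0, hK⟩ : ∃ K : ℝ, 0 ≤ K ∧ ∀ t ∈ Icc 0 tF, ∀ w,
      -P.Q w (x t) w - P.Q (z t) w w ≤ K * P.m w w := by
    let i1 : NormedAddCommGroup V := P.core.toNormedAddCommGroup
    let i2 : InnerProductSpace ℝ V := InnerProductSpace.ofCore P.core.toCore
    obtain ⟨C, hC0, hC⟩ := exists_bilin_bound isCompact_Icc (B := fun t => -P.Q.flip (x t) - P.Q (z t))
      fun u v => (hx.continuousOn ((P.Q u).flip v)).neg.sub (hz.continuousOn ((P.Q.flip u).flip v))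
    refine ⟨C, hC0, fun t ht w => ?_⟩
    have h1 := (le_abs_self _).trans (hC t ht w w)
    rwa [mul_assoc, ← real_inner_self_eq_norm_mul_norm] at h1
  have hw := hx.sub hz
  have key := (gronwall_energy htF (mul_nonneg two_pos.le hK0)
    (y := fun t => P.m (x t - z t) (x t - z t))
    (D := fun _ => 0) (g := fun _ => 0) (fun t ht => hw.hasDerivWithinAt_bilin P.m ht)
    continuousOn_const continuousOn_const (fun t _ => P.core.re_inner_nonneg _)
    (fun _ _ => le_rfl) (fun _ _ => le_rfl) fun t ht => by
      set w := x t - z t with hwt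
      have h1 : _ = _ := ex t ⟨ht.1, ht.2.le⟩ w
      have h2 : _ = _ := ez t ⟨ht.1, ht.2.le⟩ w
      have h3 := hK t ⟨ht.1.le, ht.2.le⟩ w
      have h4 := P.nonneg t ⟨ht.1.le, ht.2.le⟩ w
      have e1 : P.m (x' t - z' t) w = P.m (x' t) w - P.m (z' t) w := by simp
      have e2 : P.A t w w = P.A t (x t) w - P.A t (z t) w := by
        rw [← LinearMap.sub_apply, ← map_sub]
      have e3 : ∀ v, P.Q (x t - z t) (x t) v + P.Q (z t) (x t - z t) v =
          P.Q (x t) (x t) v - P.Q (z t) (z t) v := fun v => by simp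
      have e4 := e3 w
      rw [← hwt] at e4
      rw [P.symm w]
      linarith).1
  intro t ht
  have h1 := key t ht
  simp only [h0, sub_self, map_zero, intervalIntegral.integral_zero, add_zero, mul_zero] at h1
  by_contra hne
  exact absurd h1 (not_le.2 (P.pos _ (sub_ne_zero.2 hne)))

end FiniteDim

/-! ### Spaces of polynomial functions -/

theorem mem_poly_iff {l : ℤ} {f : E d → ℝ} : f ∈ poly d l ↔
    ∃ P : MvPolynomial (Fin d) ℝ, (∀ m ∈ P.support, (m.degree : ℤ) ≤ l) ∧
      ∀ x : E d, f x = MvPolynomial.eval (fun i => x i) P := by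
  constructor
  · rintro ⟨P, hP, rfl⟩
    exact ⟨P, fun m hm => hP hm, fun x => rfl⟩
  · rintro ⟨P, hP, hf⟩
    exact ⟨P, fun m hm => hP m hm, funext fun x => (hf x).symm⟩

theorem poly_mono {a b : ℤ} (h : a ≤ b) : poly d a ≤ poly d b :=
  Submodule.map_mono (MvPolynomial.restrictSupport_mono ℝ fun _ hm => le_trans hm h)

theorem mul_mem_poly {a b c : ℤ} (h : a + b ≤ c) {f g : E d → ℝ} (hf : f ∈ poly d a)
    (hg : g ∈ poly d b) : (fun x => f x * g x) ∈ poly d c := by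
  obtain ⟨P, hP, hf⟩ := mem_poly_iff.1 hf
  obtain ⟨Q, hQ, hg⟩ := mem_poly_iff.1 hg
  refine mem_poly_iff.2 ⟨P * Q, fun m hm => ?_, fun x => by simp [hf, hg]⟩
  obtain ⟨m₁, h₁, m₂, h₂, rfl⟩ := Finset.mem_add.1 (MvPolynomial.support_mul P Q hm)
  have := hP m₁ h₁
  have := hQ m₂ h₂
  rw [map_add (Finsupp.degree (σ := Fin d) (R := ℕ)) m₁ m₂]
  omega

theorem const_mem_poly {l : ℤ} (hl : 0 ≤ l) (c : ℝ) : (fun _ => c) ∈ poly d l := by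
  refine mem_poly_iff.2 ⟨MvPolynomial.C c, fun m hm => ?_, fun x => by simp⟩
  have : m = 0 := by
    rw [MvPolynomial.mem_support_iff, MvPolynomial.coeff_C] at hm
    by_contra h
    exact hm (if_neg (Ne.symm h))
  subst this
  simpa using hl

theorem coord_mem_poly {l : ℤ} (hl : 1 ≤ l) (i : Fin d) : (fun x : E d => x i) ∈ poly d l := by
  refine mem_poly_iff.2 ⟨MvPolynomial.X i, fun m hm => ?_, fun x => by simp⟩
  rw [MvPolynomial.support_X, Finset.mem_singleton] at hm
  subst hm
  simpa using hl

theorem pow_mem_poly {f : E d → ℝ} {a : ℤ} (hf : f ∈ poly d a) (n : ℕ) :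
    (fun x => f x ^ n) ∈ poly d (n * a) := by
  induction n with
  | zero => simpa using const_mem_poly (d := d) le_rfl 1
  | succ n ih =>
    refine mul_mem_poly (le_of_eq ?_) ih hf
    push_cast
    ring

theorem prod_mem_poly {ι : Type*} (s : Finset ι) (f : ι → E d → ℝ) (a : ι → ℤ)
    (hf : ∀ i ∈ s, f i ∈ poly d (a i)) : (fun x => ∏ i ∈ s, f i x) ∈ poly d (∑ i ∈ s, a i) := by
  classical
  induction s using Finset.induction_on with
  | empty => simpa using const_mem_poly (d := d) le_rfl 1
  | insert i s hi ih =>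
    simp only [Finset.prod_insert hi, Finset.sum_insert hi]
    exact mul_mem_poly le_rfl (hf i (by simp)) (ih fun j hj => hf j (by simp [hj]))

/-- Polynomial functions are linear combinations of monomials. -/
theorem poly_induction {l : ℤ} {p : (E d → ℝ) → Prop} (h0 : p 0)
    (hadd : ∀ f g, p f → p g → p (f + g)) (hsmul : ∀ (c : ℝ) f, p f → p (c • f))
    (hmon : ∀ m : Fin d →₀ ℕ, (m.degree : ℤ) ≤ l → p fun x : E d => ∏ i, x i ^ m i)
    {f : E d → ℝ} (hf : f ∈ poly d l) : p f := by
  have : poly d l ≤ Submodule.span ℝ {g | p g} := by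
    rw [poly, MvPolynomial.restrictSupport_eq_span, Submodule.map_span, Submodule.span_le]
    rintro _ ⟨_, ⟨m, hm, rfl⟩, rfl⟩
    refine Submodule.subset_span ?_
    have e : (evalPoly d) (MvPolynomial.monomial m 1) = fun x : E d => ∏ i, x i ^ m i := by
      funext x
      simp [evalPoly, MvPolynomial.aeval_monomial, Finsupp.prod_fintype]
    rw [e]
    exact hmon m hm
  exact Submodule.span_induction (p := fun g _ => p g) (fun g hg => hg) h0
    (fun a b _ _ => hadd a b) (fun c a _ => hsmul c a) (this hf)

/-- Polynomial functions composed with a map whose coordinates are affine. -/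
theorem comp_mem_poly {l : ℤ} {f : E d → ℝ} (hf : f ∈ poly d l) {g : E d → E d}
    (hg : ∀ i, (fun x => g x i) ∈ poly d 1) : (fun x => f (g x)) ∈ poly d l := by
  refine poly_induction (p := fun f => (fun x => f (g x)) ∈ poly d l) ?_ ?_ ?_ ?_ hf
  · exact (poly d l).zero_mem
  · intro f g hf hg
    exact (poly d l).add_mem hf hg
  · intro c f hf
    exact (poly d l).smul_mem c hf
  · intro m hm
    refine poly_mono hm ?_
    have := prod_mem_poly Finset.univ (fun i x => g x i ^ m i) (fun i => (m i : ℤ) * 1)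
      fun i _ => pow_mem_poly (hg i) (m i)
    convert! this using 2
    simp [Finsupp.degree_eq_sum]

theorem affine_coord_mem_poly {l : ℤ} (hl : 1 ≤ l) (c : E d) (s : ℝ) (i : Fin d) :
    (fun x : E d => (c + s • x) i) ∈ poly d l := by
  have := (poly d l).add_mem (const_mem_poly (by omega) (c i))
    ((poly d l).smul_mem s (coord_mem_poly hl i))
  exact this

theorem comp_affine_mem_poly {l : ℤ} {f : E d → ℝ} (hf : f ∈ poly d l) (c : E d) (s : ℝ) :
    (fun x => f (c + s • x)) ∈ poly d l :=
  comp_mem_poly hf (affine_coord_mem_poly le_rfl c s)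

theorem inner_eq_sum (x y : E d) : inner ℝ x y = ∑ i, x i * y i := by
  exact Finset.sum_congr rfl fun i _ => by simp [mul_comm]

theorem sum_mem_poly {ι : Type*} (s : Finset ι) {l : ℤ} {f : ι → E d → ℝ}
    (hf : ∀ i ∈ s, f i ∈ poly d l) : (fun x => ∑ i ∈ s, f i x) ∈ poly d l := by
  have := (poly d l).sum_mem hf
  convert! this using 1
  funext x
  simp

theorem inner_sub_mem_poly {l : ℤ} (hl : 1 ≤ l) (n c : E d) :
    (fun x : E d => inner ℝ n (x - c)) ∈ poly d l := by
  simp only [inner_eq_sum]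
  refine sum_mem_poly _ fun i _ => ?_
  have := (poly d l).smul_mem (n i)
    ((poly d l).sub_mem (coord_mem_poly hl i) (const_mem_poly (by omega) (c i)))
  exact this

theorem contDiff_of_mem_poly {l : ℤ} {f : E d → ℝ} (hf : f ∈ poly d l) {n : WithTop ℕ∞} :
    ContDiff ℝ n f := by
  refine poly_induction (p := fun f => ContDiff ℝ n f) contDiff_const (fun _ _ => ContDiff.add)
    (fun c _ => ContDiff.const_smul c) (fun m _ => ?_) hf
  fun_prop

theorem continuous_of_mem_poly {l : ℤ} {f : E d → ℝ} (hf : f ∈ poly d l) : Continuous f :=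
  (contDiff_of_mem_poly hf (n := 0)).continuous

theorem differentiable_of_mem_poly {l : ℤ} {f : E d → ℝ} (hf : f ∈ poly d l) :
    Differentiable ℝ f :=
  (contDiff_of_mem_poly hf (n := 1)).differentiable one_ne_zero

theorem fderiv_mem_poly {l : ℤ} {f : E d → ℝ} (hf : f ∈ poly d l) (e : E d) :
    (fun x => fderiv ℝ f x e) ∈ poly d (l - 1) := by
  have key : Differentiable ℝ f ∧ (fun x => fderiv ℝ f x e) ∈ poly d (l - 1) := by
    refine poly_induction
      (p := fun f => Differentiable ℝ f ∧ (fun x => fderiv ℝ f x e) ∈ poly d (l - 1))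
      ?_ ?_ ?_ ?_ hf
    · refine ⟨differentiable_const _, ?_⟩
      have : (fun x => fderiv ℝ (0 : E d → ℝ) x e) = 0 := by funext x; simp
      rw [this]
      exact Submodule.zero_mem _
    · rintro f g ⟨hf, hf'⟩ ⟨hg, hg'⟩
      refine ⟨hf.add hg, ?_⟩
      have : (fun x => fderiv ℝ (f + g) x e) = (fun x => fderiv ℝ f x e) +
          fun x => fderiv ℝ g x e := by
        funext x; simp [fderiv_add (hf x) (hg x)]
      rw [this]
      exact Submodule.add_mem _ hf' hg'
    · rintro c f ⟨hf, hf'⟩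
      refine ⟨hf.const_smul c, ?_⟩
      have : (fun x => fderiv ℝ (c • f) x e) = c • fun x => fderiv ℝ f x e := by
        funext x; simp [fderiv_const_smul (hf x)]
      rw [this]
      exact Submodule.smul_mem _ _ hf'
    · intro m hm
      refine ⟨by fun_prop, ?_⟩
      have hd : ∀ x : E d, HasFDerivAt (fun x : E d => ∏ i, x i ^ m i)
          (∑ i, (∏ j ∈ Finset.univ.erase i, x j ^ m j) •
            ((m i * x i ^ (m i - 1)) • (EuclideanSpace.proj i : E d →L[ℝ] ℝ))) x := by
        intro x
        refine HasFDerivAt.finsetProd fun i _ => ?_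
        simpa using ((EuclideanSpace.proj i : E d →L[ℝ] ℝ).hasFDerivAt).pow (m i)
      have e1 : (fun x => fderiv ℝ (fun x : E d => ∏ i, x i ^ m i) x e) = fun x => ∑ i,
          (e i * m i) * (x i ^ (m i - 1) * ∏ j ∈ Finset.univ.erase i, x j ^ m j) := by
        funext x
        rw [(hd x).fderiv]
        simp only [sum_apply, smul_apply, smul_eq_mul]
        refine Finset.sum_congr rfl fun i _ => ?_
        have : (EuclideanSpace.proj i : E d →L[ℝ] ℝ) e = e i := rfl
        rw [this]
        ring
      rw [e1]
      refine sum_mem_poly _ fun i _ => ?_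
      rcases Nat.eq_zero_or_pos (m i) with h | h
      · simp only [h, Nat.cast_zero, mul_zero, zero_mul]
        exact Submodule.zero_mem _
      · refine (poly d (l - 1)).smul_mem (e i * m i) (mul_mem_poly
          (a := (m i - 1 : ℕ) * 1) (b := ∑ j ∈ Finset.univ.erase i, (m j : ℤ) * 1) ?_
          (pow_mem_poly (coord_mem_poly le_rfl i) _)
          (prod_mem_poly _ (fun j x => x j ^ m j) _
            fun j _ => pow_mem_poly (coord_mem_poly le_rfl j) _))
        have h2 : (m.degree : ℤ) = m i + ∑ j ∈ Finset.univ.erase i, (m j : ℤ) := by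
          rw [Finsupp.degree_eq_sum]
          push_cast
          exact (Finset.add_sum_erase _ _ (Finset.mem_univ i)).symm
        simp only [mul_one]
        omega
  exact key.2

instance (l : ℤ) : FiniteDimensional ℝ (poly d l) := by
  have hfin : {m : Fin d →₀ ℕ | (m.degree : ℤ) ≤ l}.Finite := by
    refine (Finset.finite_toSet (Finset.Iic (Finsupp.equivFunOnFinite.symm
      fun _ : Fin d => l.toNat))).subset fun m hm => ?_
    rw [Finset.mem_coe, Finset.mem_Iic]
    intro i
    have h1 : m i ≤ m.degree := Finsupp.le_degree i m
    have h2 : (m.degree : ℤ) ≤ l := hm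
    change m i ≤ l.toNat
    omega
  have : FiniteDimensional ℝ
      (MvPolynomial.restrictSupport ℝ {m : Fin d →₀ ℕ | (m.degree : ℤ) ≤ l}) := by
    have := hfin.to_subtype
    exact Module.Finite.of_basis (MvPolynomial.basisRestrictSupport ℝ _)
  exact Module.Finite.map _ _

theorem analyticOnNhd_of_mem_poly {l : ℤ} {f : E d → ℝ} (hf : f ∈ poly d l) :
    AnalyticOnNhd ℝ f univ :=
  (contDiff_of_mem_poly hf).analyticOnNhd

/-- A polynomial function is determined by its values on a nonempty open set. -/
theorem eq_zero_of_mem_poly_of_isOpen {l : ℤ} {f : E d → ℝ} (hf : f ∈ poly d l) {U : Set (E d)}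
    (hU : IsOpen U) (hne : U.Nonempty) (h : ∀ x ∈ U, f x = 0) : f = 0 := by
  obtain ⟨x, hx⟩ := hne
  have := (analyticOnNhd_of_mem_poly hf).eqOn_zero_of_preconnected_of_eventuallyEq_zero
    isPreconnected_univ (mem_univ x) (by filter_upwards [hU.mem_nhds hx] with y hy using h y hy)
  funext y
  exact this (mem_univ y)

/-- The decomposition of a polynomial function into homogeneous components. -/
theorem exists_homogeneous_decomposition {k : ℕ} {f : E d → ℝ} (hf : f ∈ poly d k) :
    ∃ g : ℕ → E d → ℝ, (∀ j : ℕ, g j ∈ poly d j) ∧ (∀ j (r : ℝ) x, g j (r • x) = r ^ j * g j x) ∧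
      ∀ x, f x = ∑ j ∈ Finset.range (k + 1), g j x := by
  obtain ⟨P, hP, hf⟩ := mem_poly_iff.1 hf
  refine ⟨fun j x => MvPolynomial.eval (fun i => x i) (P.homogeneousComponent j),
    fun j => ?_, fun j r x => ?_, fun x => ?_⟩
  · refine mem_poly_iff.2 ⟨_, fun m hm => ?_, fun x => rfl⟩
    rw [MvPolynomial.support_homogeneousComponent, Finset.mem_filter] at hm
    exact_mod_cast hm.2.le
  · simp only
    rw [MvPolynomial.eval_eq, MvPolynomial.eval_eq, Finset.mul_sum]
    refine Finset.sum_congr rfl fun m hm => ?_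
    have hmj : ∑ i ∈ m.support, m i = j := by
      rw [MvPolynomial.support_homogeneousComponent, Finset.mem_filter] at hm
      exact hm.2
    have : ∏ i ∈ m.support, (r • x) i ^ m i = r ^ j * ∏ i ∈ m.support, x i ^ m i := by
      simp only [PiLp.smul_apply, smul_eq_mul, mul_pow, Finset.prod_mul_distrib]
      rw [Finset.prod_pow_eq_pow_sum, hmj]
    rw [this]
    ring
  · rw [hf x]
    have hdeg : P.totalDegree ≤ k := by
      refine Finset.sup_le fun m hm => ?_
      have h1 := hP m hm
      have h2 : (m.sum fun _ e => e) = m.degree := rfl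
      rw [h2]
      exact_mod_cast h1
    conv_lhs => rw [← MvPolynomial.sum_homogeneousComponent P]
    rw [map_sum]
    refine Finset.sum_subset (by
      intro j hj
      simp only [Finset.mem_range] at hj ⊢
      omega) fun j _ hj => ?_
    rw [MvPolynomial.homogeneousComponent_eq_zero]
    · simp
    · simp only [Finset.mem_range, not_lt] at hj
      omega

/-- A polynomial given on the hyperplane `⟪n, x - v⟫ = h` has an extension of the same degree `k`
that is homogeneous of degree `k` about `v`. -/
theorem exists_homogeneous_extension {k : ℕ} {f : E d → ℝ} (hf : f ∈ poly d k) (n v : E d)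
    {h : ℝ} (hh : h ≠ 0) : ∃ q ∈ poly d k, (∀ x, inner ℝ n (x - v) = h → q x = f x) ∧
      ∀ (r : ℝ) x, q (v + r • (x - v)) = r ^ k * q x := by
  obtain ⟨g, hg, hgr, hgs⟩ := exists_homogeneous_decomposition
    (comp_affine_mem_poly hf v 1)
  refine ⟨fun x => ∑ j ∈ Finset.range (k + 1), g j (x - v) * (h⁻¹ * inner ℝ n (x - v)) ^ (k - j),
    ?_, fun x hx => ?_, fun r x => ?_⟩
  · refine sum_mem_poly _ fun j hj => ?_
    have hjk : j ≤ k := by simpa [Nat.lt_succ_iff] using hj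
    refine mul_mem_poly (a := j) (b := (k - j : ℕ) * 1) (by push_cast [hjk]; omega) ?_
      (pow_mem_poly ((poly d 1).smul_mem h⁻¹ (inner_sub_mem_poly le_rfl n v)) (k - j))
    have := comp_affine_mem_poly (hg j) (-v) 1
    convert! this using 2 with x
    rw [one_smul]
    abel_nf
  · simp only [hx, inv_mul_cancel₀ hh, one_pow, mul_one]
    rw [← hgs (x - v)]
    simp
  · simp only
    rw [Finset.mul_sum]
    refine Finset.sum_congr rfl fun j hj => ?_
    have hjk : j ≤ k := by simpa [Nat.lt_succ_iff] using hj
    rw [add_sub_cancel_left, hgr, inner_smul_right, mul_left_comm h⁻¹ r, mul_pow]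
    have : r ^ k = r ^ j * r ^ (k - j) := by rw [← pow_add]; congr 1; omega
    rw [this]
    ring

/-- The operator `q ↦ d q + x · ∇ q` does not lower the degree. -/
theorem mem_poly_of_euler {k : ℕ} {c : ℝ} (hc : 0 < c + k) {f : E d → ℝ} (hf : f ∈ poly d k)
    (h : (fun x => c * f x + fderiv ℝ f x x) ∈ poly d ((k : ℤ) - 1)) :
    f ∈ poly d ((k : ℤ) - 1) := by
  obtain ⟨g, hg, hgr, hgs⟩ := exists_homogeneous_decomposition hf
  have heul : ∀ j x, fderiv ℝ (g j) x x = j * g j x := by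
    intro j x
    have h1 : HasDerivAt (fun r : ℝ => r • x) x 1 := by
      simpa using (hasDerivAt_id (1 : ℝ)).smul_const x
    have h2 : HasDerivAt (fun r : ℝ => g j (r • x)) (fderiv ℝ (g j) ((1 : ℝ) • x) x) 1 :=
      (differentiable_of_mem_poly (hg j) _).hasFDerivAt.comp_hasDerivAt (1 : ℝ) h1
    have h3 : HasDerivAt (fun r : ℝ => g j (r • x)) ((j : ℝ) * g j x) 1 := by
      simp only [hgr]
      simpa using (hasDerivAt_pow j (1 : ℝ)).mul_const (g j x)
    rw [one_smul] at h2
    exact h2.unique h3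
  have hf' : ∀ x, fderiv ℝ f x x = ∑ j ∈ Finset.range (k + 1), j * g j x := by
    intro x
    rw [funext hgs, fderiv_fun_sum fun j _ => differentiable_of_mem_poly (hg j) x]
    simp [heul]
  set low : E d → ℝ := fun x => ∑ j ∈ Finset.range k, g j x with hlow
  have hlowm : low ∈ poly d ((k : ℤ) - 1) := sum_mem_poly _ fun j hj =>
    poly_mono (by have := Finset.mem_range.1 hj; omega) (hg j)
  have hlow2 : (fun x => ∑ j ∈ Finset.range k, (c + j) * g j x) ∈ poly d ((k : ℤ) - 1) :=
    sum_mem_poly _ fun j hj => (poly d ((k : ℤ) - 1)).smul_mem (c + j)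
      (poly_mono (by have := Finset.mem_range.1 hj; omega) (hg j))
  have htop : g k ∈ poly d ((k : ℤ) - 1) := by
    convert! ((poly d ((k : ℤ) - 1)).smul_mem (c + k)⁻¹ ((poly d ((k : ℤ) - 1)).sub_mem h hlow2))
      using 1
    funext x
    simp only [Pi.smul_apply, Pi.sub_apply, smul_eq_mul]
    rw [hf' x, hgs x, Finset.mul_sum, ← Finset.sum_add_distrib, Finset.sum_range_succ]
    have : ∑ j ∈ Finset.range k, (c * g j x + j * g j x) =
        ∑ j ∈ Finset.range k, (c + j) * g j x :=
      Finset.sum_congr rfl fun j _ => by ring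
    rw [this]
    field_simp
    ring
  have : f = low + g k := by
    funext x
    rw [hgs x, Finset.sum_range_succ]
    rfl
  rw [this]
  exact Submodule.add_mem _ hlowm htop

/-! ### Polynomial vector fields and Raviart--Thomas--Nédélec fields -/

instance (V : Submodule ℝ (E d → ℝ)) [FiniteDimensional ℝ V] : FiniteDimensional ℝ (vec V) := by
  let φ : vec V →ₗ[ℝ] (Fin d → V) :=
    { toFun := fun v i => ⟨fun x => v.1 x i, v.2 i⟩
      map_add' := fun _ _ => rfl
      map_smul' := fun _ _ => rfl }
  refine FiniteDimensional.of_injective φ fun v w h => ?_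
  ext x i
  exact congrFun (congrArg Subtype.val (congrFun h i)) x

theorem contDiff_of_mem_vec {l : ℤ} {v : E d → E d} (hv : v ∈ vec (poly d l)) {n : WithTop ℕ∞} :
    ContDiff ℝ n v := by
  rw [contDiff_euclidean]
  exact fun i => contDiff_of_mem_poly (hv i)

theorem continuous_of_mem_vec {l : ℤ} {v : E d → E d} (hv : v ∈ vec (poly d l)) : Continuous v :=
  (contDiff_of_mem_vec hv (n := 0)).continuous

theorem differentiable_of_mem_vec {l : ℤ} {v : E d → E d} (hv : v ∈ vec (poly d l)) :
    Differentiable ℝ v :=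
  (contDiff_of_mem_vec hv (n := 1)).differentiable one_ne_zero

theorem fderiv_apply_coord {v : E d → E d} {x : E d} (hv : DifferentiableAt ℝ v x) (e : E d)
    (i : Fin d) : fderiv ℝ v x e i = fderiv ℝ (fun y => v y i) x e := by
  have h2 : HasFDerivAt (fun y => v y i)
      ((EuclideanSpace.proj i : E d →L[ℝ] ℝ).comp (fderiv ℝ v x)) x := (EuclideanSpace.proj i : E d
        →L[ℝ] ℝ).hasFDerivAt.comp x hv.hasFDerivAt
  rw [h2.fderiv]
  rfl

theorem fderiv_mem_vec {l : ℤ} {v : E d → E d} (hv : v ∈ vec (poly d l)) (e : E d) :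
    (fun x => fderiv ℝ v x e) ∈ vec (poly d (l - 1)) := by
  intro i
  simp only [fderiv_apply_coord (differentiable_of_mem_vec hv _)]
  exact fderiv_mem_poly (hv i) e

theorem dvg_mem_poly {l : ℤ} {v : E d → E d} (hv : v ∈ vec (poly d l)) :
    dvg v ∈ poly d (l - 1) :=
  sum_mem_poly _ fun i _ => fderiv_mem_vec hv _ i

theorem inner_mem_poly {a b c : ℤ} (h : a + b ≤ c) {v w : E d → E d} (hv : v ∈ vec (poly d a))
    (hw : w ∈ vec (poly d b)) : (fun x => inner ℝ (v x) (w x)) ∈ poly d c := by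
  simp only [inner_eq_sum]
  exact sum_mem_poly _ fun i _ => mul_mem_poly h (hv i) (hw i)

theorem const_mem_vec {l : ℤ} (hl : 0 ≤ l) (c : E d) : (fun _ => c) ∈ vec (poly d l) :=
  fun i => const_mem_poly hl (c i)

theorem eq_zero_of_mem_vec_of_isOpen {l : ℤ} {v : E d → E d} (hv : v ∈ vec (poly d l))
    {U : Set (E d)} (hU : IsOpen U) (hne : U.Nonempty) (h : ∀ x ∈ U, v x = 0) : v = 0 := by
  funext x
  ext i
  exact congrFun (eq_zero_of_mem_poly_of_isOpen (hv i) hU hne fun y hy => by simp [h y hy]) x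

theorem mem_RTN_iff {k : ℕ} {w : E d → E d} : w ∈ RTN d (k + 1) ↔
    ∃ a ∈ vec (poly d k), ∃ q ∈ poly d k, ∀ x, w x = a x + q x • x := by
  have e : ((k + 1 : ℕ) : ℤ) - 1 = k := by push_cast; ring
  rw [RTN, e, Submodule.mem_sup]
  constructor
  · rintro ⟨a, ha, _, ⟨q, hq, rfl⟩, rfl⟩
    exact ⟨a, ha, q, hq, fun x => rfl⟩
  · rintro ⟨a, ha, q, hq, h⟩
    exact ⟨a, ha, _, ⟨q, hq, rfl⟩, funext fun x => (h x).symm⟩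

theorem RTN_le_vec (k : ℕ) : RTN d (k + 1) ≤ vec (poly d (k + 1)) := by
  intro w hw i
  obtain ⟨a, ha, q, hq, h⟩ := mem_RTN_iff.1 hw
  have e : (fun x => w x i) = (fun x => a x i) + fun x => q x * x i := by
    funext x
    simp [h x]
  rw [e]
  exact Submodule.add_mem _ (poly_mono (by omega) (ha i))
    (mul_mem_poly le_rfl hq (coord_mem_poly le_rfl i))

instance (k : ℕ) : FiniteDimensional ℝ (RTN d (k + 1)) :=
  Submodule.finiteDimensional_of_le (RTN_le_vec k)

theorem vec_le_RTN (k : ℕ) : vec (poly d k) ≤ RTN d (k + 1) := fun w hw =>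
  mem_RTN_iff.2 ⟨w, hw, 0, Submodule.zero_mem _, fun x => by simp⟩

theorem sub_smul_mem_RTN {k : ℕ} {q : E d → ℝ} (hq : q ∈ poly d k) (v : E d) :
    (fun x => q x • (x - v)) ∈ RTN d (k + 1) := by
  refine mem_RTN_iff.2 ⟨fun x => -(q x • v), fun i => ?_, q, hq, fun x => by module⟩
  have := (poly d k).smul_mem (-(v i)) hq
  convert! this using 1
  funext x
  simp [mul_comm]

theorem fderiv_smul_self {a : E d → E d} {q : E d → ℝ} (ha : Differentiable ℝ a)
    (hq : Differentiable ℝ q) {w : E d → E d} (h : ∀ x, w x = a x + q x • x) (x : E d) :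
    dvg w x = dvg a x + (d * q x + fderiv ℝ q x x) := by
  have h1 : HasFDerivAt w (fderiv ℝ a x + (q x • ContinuousLinearMap.id ℝ (E d) +
      (fderiv ℝ q x).smulRight x)) x := by
    rw [funext h]
    exact (ha x).hasFDerivAt.add ((hq x).hasFDerivAt.smul (hasFDerivAt_id x))
  unfold dvg
  rw [h1.fderiv]
  simp only [add_apply, PiLp.add_apply, Finset.sum_add_distrib,
    smul_apply, ContinuousLinearMap.id_apply, PiLp.smul_apply,
    ContinuousLinearMap.smulRight_apply, smul_eq_mul]
  congr 2
  · simp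
  · have hx : x = ∑ i, x i • basisVec i := by
      have := (EuclideanSpace.basisFun (Fin d) ℝ).sum_repr x
      simpa using this.symm
    conv_rhs => rw [hx, map_sum]
    refine Finset.sum_congr rfl fun i _ => ?_
    rw [← hx, map_smul, smul_eq_mul, mul_comm]

theorem dvg_mem_poly_of_mem_RTN {k : ℕ} {w : E d → E d} (hw : w ∈ RTN d (k + 1)) :
    dvg w ∈ poly d k := by
  exact poly_mono (by omega) (dvg_mem_poly (RTN_le_vec k hw))

/-- A divergence-free Raviart--Thomas--Nédélec field is a polynomial field of degree `k`. -/
theorem mem_vec_of_dvg_eq_zero (hd : 0 < d) {k : ℕ} {w : E d → E d} (hw : w ∈ RTN d (k + 1))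
    (h : dvg w = 0) : w ∈ vec (poly d k) := by
  obtain ⟨a, ha, q, hq, hw⟩ := mem_RTN_iff.1 hw
  have hq' : q ∈ poly d ((k : ℤ) - 1) := by
    refine mem_poly_of_euler (c := d) (by positivity) hq ?_
    convert! ((poly d ((k : ℤ) - 1)).neg_mem (dvg_mem_poly ha)) using 1
    funext x
    have h2 := fderiv_smul_self (differentiable_of_mem_vec ha) (differentiable_of_mem_poly hq) hw x
    rw [h] at h2
    simp only [Pi.zero_apply] at h2
    simp only [Pi.neg_apply]
    linarith
  intro i
  have e : (fun x => w x i) = (fun x => a x i) + fun x => q x * x i := by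
    funext x
    simp [hw x]
  rw [e]
  exact Submodule.add_mem _ (ha i) (mul_mem_poly (by omega) hq' (coord_mem_poly le_rfl i))

/-- On a hyperplane `⟪n, x⟫ = c` the normal component of a Raviart--Thomas--Nédélec field is a
polynomial of degree `k`. -/
theorem exists_poly_normal {k : ℕ} {w : E d → E d} (hw : w ∈ RTN d (k + 1)) (n : E d) (c : ℝ) :
    ∃ Q ∈ poly d k, ∀ x, inner ℝ n x = c → inner ℝ (w x) n = Q x := by
  obtain ⟨a, ha, q, hq, h⟩ := mem_RTN_iff.1 hw
  refine ⟨fun x => inner ℝ (a x) n + c * q x, Submodule.add_mem _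
    (inner_mem_poly (by omega) ha (const_mem_vec le_rfl n)) (Submodule.smul_mem _ c hq),
    fun x hx => ?_⟩
  rw [h x, inner_add_left, real_inner_smul_left, real_inner_comm n x, hx]
  ring

/-! ### Geometry of a simplex -/

/-- `T` is the vertex set of a nondegenerate simplex of full dimension. -/
structure IsSimplex (T : Finset (E d)) : Prop where
  indep : AffineIndependent ℝ ((↑) : T → E d)
  card : T.card = d + 1

theorem isCompact_hull (s : Finset (E d)) : IsCompact (hull s) :=
  s.finite_toSet.isCompact_convexHull ℝ

theorem measurableSet_hull (s : Finset (E d)) : MeasurableSet (hull s) :=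
  (isCompact_hull s).measurableSet

/-- The distance from the vertex `v` of the simplex `T` to the opposite face (computed as the average
of the signed distances from `v` to the vertices of that face, which are all equal). -/
def height (T : Finset (E d)) (v : E d) : ℝ :=
  (d : ℝ)⁻¹ * ∑ y ∈ T.erase v, inner ℝ (normal T (T.erase v)) (y - v)

/-- The barycentric coordinate of `x` with respect to the vertex `v` of the simplex `T`. -/
def bary (T : Finset (E d)) (v x : E d) : ℝ :=
  1 - (height T v)⁻¹ * inner ℝ (normal T (T.erase v)) (x - v)

namespace IsSimplex

variable {T : Finset (E d)} (hT : IsSimplex T)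

/-- The vertices of a simplex as an affine basis. -/
def toBasis : AffineBasis T ℝ (E d) :=
  ⟨(↑), hT.indep, by
    have h := hT.indep.affineSpan_eq_top_iff_card_eq_finrank_add_one
    rw [h]
    simp [hT.card]⟩

theorem toBasis_apply (v : T) : hT.toBasis v = v := rfl

theorem range_toBasis : range hT.toBasis = (T : Set (E d)) := by
  ext x
  simp [toBasis_apply]

theorem coord_apply {v w : T} : hT.toBasis.coord v w = if v = w then 1 else 0 := by
  classical
  exact hT.toBasis.coord_apply v w

include hT

theorem nonempty : T.Nonempty := by
  rw [← Finset.card_pos, hT.card]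
  omega

theorem interior_nonempty : (interior (hull T)).Nonempty := by
  rw [interior_convexHull_nonempty_iff_affineSpan_eq_top, ← hT.range_toBasis]
  exact hT.toBasis.tot

theorem closure_interior : closure (interior (hull T)) = hull T := by
  rw [(convex_convexHull ℝ _).closure_interior_eq_closure_of_nonempty_interior
    hT.interior_nonempty, (isCompact_hull T).isClosed.closure_eq]

variable [NeZero d]

theorem erase_nonempty {v : E d} (hv : v ∈ T) : (T.erase v).Nonempty := by
  have := NeZero.pos d
  rw [← Finset.card_pos, Finset.card_erase_of_mem hv, hT.card]
  omega

theorem normal_spec {v : E d} (hv : v ∈ T) :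
    ‖normal T (T.erase v)‖ = 1 ∧
      (∀ x ∈ T.erase v, ∀ y ∈ T.erase v, inner ℝ (normal T (T.erase v)) (y - x) = 0) ∧
      ∀ x ∈ T.erase v, ∀ y ∈ T, y ∉ T.erase v → inner ℝ (normal T (T.erase v)) (y - x) < 0 := by
  let L : E d →L[ℝ] ℝ := LinearMap.toContinuousLinearMap (hT.toBasis.coord ⟨v, hv⟩).linear
  let g : E d := (InnerProductSpace.toDual ℝ (E d)).symm L
  have hg : ∀ x y, inner ℝ g (y - x) = hT.toBasis.coord ⟨v, hv⟩ y - hT.toBasis.coord ⟨v, hv⟩ x := by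
    intro x y
    rw [InnerProductSpace.toDual_symm_apply]
    change (hT.toBasis.coord ⟨v, hv⟩).linear (y - x) = _
    exact (hT.toBasis.coord ⟨v, hv⟩).linearMap_vsub y x
  have h1 : ∀ x ∈ T.erase v, hT.toBasis.coord ⟨v, hv⟩ x = 0 := by
    intro x hx
    have := hT.coord_apply (v := ⟨v, hv⟩) (w := ⟨x, Finset.mem_of_mem_erase hx⟩)
    rw [this, if_neg]
    intro h
    exact Finset.ne_of_mem_erase hx (congrArg Subtype.val h).symm
  have h2 : hT.toBasis.coord ⟨v, hv⟩ v = 1 := by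
    simpa using hT.coord_apply (v := ⟨v, hv⟩) (w := ⟨v, hv⟩)
  obtain ⟨x₀, hx₀⟩ := hT.erase_nonempty hv
  have hg0 : g ≠ 0 := by
    intro h
    have := hg x₀ v
    rw [h, inner_zero_left, h1 x₀ hx₀, h2] at this
    norm_num at this
  have hgn : 0 < ‖g‖ := norm_pos_iff.2 hg0
  have hex : ∃ n : E d, ‖n‖ = 1 ∧ (∀ x ∈ T.erase v, ∀ y ∈ T.erase v, inner ℝ n (y - x) = 0) ∧
      ∀ x ∈ T.erase v, ∀ y ∈ T, y ∉ T.erase v → inner ℝ n (y - x) < 0 := by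
    refine ⟨-(‖g‖⁻¹ • g), ?_, fun x hx y hy => ?_, fun x hx y hy hy' => ?_⟩
    · rw [norm_neg, norm_smul, norm_inv, norm_norm, inv_mul_cancel₀ hgn.ne']
    · rw [inner_neg_left, real_inner_smul_left, hg, h1 x hx, h1 y hy]
      simp
    · have : y = v := by
        by_contra h
        exact hy' (Finset.mem_erase.2 ⟨h, hy⟩)
      rw [this, inner_neg_left, real_inner_smul_left, hg, h1 x hx, h2]
      simpa using hgn
  exact Classical.epsilon_spec hex

theorem norm_normal {v : E d} (hv : v ∈ T) : ‖normal T (T.erase v)‖ = 1 := (hT.normal_spec hv).1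

theorem inner_normal_eq_height {v : E d} (hv : v ∈ T) {y : E d} (hy : y ∈ T.erase v) :
    inner ℝ (normal T (T.erase v)) (y - v) = height T v := by
  have hd : (0 : ℝ) < d := by exact_mod_cast NeZero.pos d
  have h : ∀ z ∈ T.erase v, inner ℝ (normal T (T.erase v)) (z - v) =
      inner ℝ (normal T (T.erase v)) (y - v) := by
    intro z hz
    have := (hT.normal_spec hv).2.1 y hy z hz
    rw [← sub_eq_zero, ← inner_sub_right]
    simpa using this
  rw [height, Finset.sum_congr rfl h, Finset.sum_const, Finset.card_erase_of_mem hv, hT.card]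
  simp only [Nat.add_sub_cancel, nsmul_eq_mul]
  field_simp

theorem height_pos {v : E d} (hv : v ∈ T) : 0 < height T v := by
  obtain ⟨y, hy⟩ := hT.erase_nonempty hv
  rw [← hT.inner_normal_eq_height hv hy]
  have := (hT.normal_spec hv).2.2 y hy v hv (Finset.notMem_erase _ _)
  rw [← neg_sub, inner_neg_right] at this
  linarith

omit [NeZero d] hT in
theorem bary_self (v : E d) : bary T v v = 1 := by simp [bary]

theorem bary_of_ne {v w : E d} (hv : v ∈ T) (hw : w ∈ T) (h : w ≠ v) : bary T v w = 0 := by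
  rw [bary, hT.inner_normal_eq_height hv (Finset.mem_erase.2 ⟨h, hw⟩),
    inv_mul_cancel₀ (hT.height_pos hv).ne', sub_self]

theorem bary_eq_coord {v : E d} (hv : v ∈ T) (x : E d) :
    bary T v x = hT.toBasis.coord ⟨v, hv⟩ x := by
  classical
  have hx := hT.toBasis.linear_combination_coord_eq_self x
  have h1 := hT.toBasis.sum_coord_apply_eq_one x
  have e : ∀ w : T, bary T v w = if ⟨v, hv⟩ = w then 1 else 0 := by
    intro w
    split_ifs with h
    · rw [← h]; exact bary_self v
    · exact hT.bary_of_ne hv w.2 fun h' => h (Subtype.ext h'.symm)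
  have h2 : bary T v x = ∑ w, hT.toBasis.coord w x * bary T v w := by
    have h3 : x - v = ∑ w, hT.toBasis.coord w x • ((w : E d) - v) := by
      simp only [smul_sub, Finset.sum_sub_distrib, ← Finset.sum_smul, h1, one_smul]
      congr 1
      exact hx.symm
    unfold bary
    simp only [mul_sub, mul_one, Finset.sum_sub_distrib, h1]
    rw [h3, inner_sum, Finset.mul_sum]
    congr 1
    exact Finset.sum_congr rfl fun w _ => by rw [inner_smul_right]; ring
  rw [h2]
  simp [e]

theorem mem_hull_iff {x : E d} : x ∈ hull T ↔ ∀ v ∈ T, 0 ≤ bary T v x := by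
  rw [hull, ← hT.range_toBasis, hT.toBasis.convexHull_eq_nonneg_coord]
  constructor
  · intro h v hv
    rw [hT.bary_eq_coord hv]
    exact h ⟨v, hv⟩
  · intro h v
    have := h v v.2
    rwa [hT.bary_eq_coord v.2] at this

theorem sum_bary (x : E d) : ∑ v ∈ T, bary T v x = 1 := by
  rw [← hT.toBasis.sum_coord_apply_eq_one x, ← Finset.sum_coe_sort]
  exact Finset.sum_congr rfl fun v _ => hT.bary_eq_coord v.2 x

theorem sum_bary_smul (x : E d) : ∑ v ∈ T, bary T v x • v = x := by
  conv_rhs => rw [← hT.toBasis.linear_combination_coord_eq_self x]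
  rw [← Finset.sum_coe_sort]
  exact Finset.sum_congr rfl fun v _ => by rw [hT.bary_eq_coord v.2 x, hT.toBasis_apply]

omit [NeZero d] hT in
theorem bary_affine (v : E d) (x y : E d) (r : ℝ) :
    bary T v (x + r • (y - x)) = (1 - r) * bary T v x + r * bary T v y := by
  have : x + r • (y - x) - v = (1 - r) • (x - v) + r • (y - v) := by
    module
  rw [bary, bary, bary, this, inner_add_right, inner_smul_right, inner_smul_right]
  ring

theorem mem_face_iff {v : E d} (hv : v ∈ T) {x : E d} :
    x ∈ hull (T.erase v) ↔ x ∈ hull T ∧ bary T v x = 0 := by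
  constructor
  · intro h
    refine ⟨convexHull_mono (by simp) h, ?_⟩
    have hconv : Convex ℝ {x | bary T v x = 0} := by
      intro a ha b hb s t _ _ hst
      have : s • a + t • b = a + t • (b - a) := by
        rw [← eq_sub_iff_add_eq] at hst
        rw [hst]
        module
      rw [mem_ofPred_eq, this, bary_affine, ha, hb]
      simp
    exact convexHull_min (fun w hw => hT.bary_of_ne hv (Finset.mem_of_mem_erase hw)
      (Finset.ne_of_mem_erase hw)) hconv h
  · rintro ⟨h, h0⟩
    rw [hT.mem_hull_iff] at h
    have e1 := hT.sum_bary x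
    have e2 := hT.sum_bary_smul x
    rw [← Finset.add_sum_erase _ _ hv, h0] at e1 e2
    rw [zero_smul, zero_add] at e2
    rw [zero_add] at e1
    rw [← e2]
    exact (convex_convexHull ℝ _).sum_mem (fun w hw => h w (Finset.mem_of_mem_erase hw)) e1
      fun w hw => subset_convexHull ℝ _ hw

theorem inner_normal_of_mem_face {v : E d} (hv : v ∈ T) {x : E d} (hx : x ∈ hull (T.erase v)) :
    inner ℝ (normal T (T.erase v)) (x - v) = height T v := by
  have h := ((hT.mem_face_iff hv).1 hx).2
  have h2 := hT.height_pos hv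
  rw [bary, sub_eq_zero] at h
  field_simp at h
  exact h.symm

/-- The faces through `v` are conical with apex `v`. -/
theorem inner_normal_vertex_of_mem_face {v w : E d} (hv : v ∈ T) (hw : w ∈ T) (hne : v ≠ w)
    {x : E d} (hx : x ∈ hull (T.erase w)) : inner ℝ (normal T (T.erase w)) (x - v) = 0 := by
  have h1 := hT.inner_normal_of_mem_face hw hx
  have h2 := hT.inner_normal_eq_height hw (Finset.mem_erase.2 ⟨hne, hv⟩)
  have : x - v = (x - w) - (v - w) := by abel
  rw [this, inner_sub_right, h1, h2, sub_self]

/-- The cone with apex `v` over the opposite face is the simplex. -/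
theorem mem_hull_cone_iff {v : E d} (hv : v ∈ T) {x : E d} (hx : bary T v x = 0) {r : ℝ}
    (hr : r ≠ 0) : v + r • (x - v) ∈ hull T ↔ r ∈ Ioc (0 : ℝ) 1 ∧ x ∈ hull (T.erase v) := by
  have hb : ∀ w ∈ T, bary T w (v + r • (x - v)) = if w = v then 1 - r else r * bary T w x := by
    intro w hw
    rw [bary_affine]
    split_ifs with h
    · rw [h, bary_self, hx]; ring
    · rw [hT.bary_of_ne hw hv (Ne.symm h)]; ring
  rw [hT.mem_hull_iff, hT.mem_face_iff hv, hT.mem_hull_iff]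
  constructor
  · intro h
    have h1 := h v hv
    rw [hb v hv, if_pos rfl] at h1
    have h0 : 0 < r := by
      by_contra hneg
      have hneg' : r < 0 := lt_of_le_of_ne (not_lt.1 hneg) hr
      have h2 : ∀ w ∈ T.erase v, bary T w x ≤ 0 := by
        intro w hw
        have := h w (Finset.mem_of_mem_erase hw)
        rw [hb w (Finset.mem_of_mem_erase hw), if_neg (Finset.ne_of_mem_erase hw)] at this
        by_contra hc
        nlinarith
      have h3 := hT.sum_bary x
      rw [← Finset.add_sum_erase _ _ hv, hx, zero_add] at h3
      have := Finset.sum_nonpos h2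
      linarith
    refine ⟨⟨h0, by linarith⟩, fun w hw => ?_, hx⟩
    by_cases hwv : w = v
    · rw [hwv, hx]
    · have := h w hw
      rw [hb w hw, if_neg hwv] at this
      exact nonneg_of_mul_nonneg_right this h0
  · rintro ⟨⟨h0, h1⟩, h2, _⟩ w hw
    rw [hb w hw]
    split_ifs with h
    · linarith
    · exact mul_nonneg h0.le (h2 w hw)

end IsSimplex

/-! ### Disintegration of the volume of a simplex over a face -/

/-- Coordinates adapted to a unit vector `n`: the distance along `n`, and isometric coordinates in the
orthogonal hyperplane. -/
theorem exists_isometry_orthogonal {m : ℕ} {n : E (m + 1)} (hn : ‖n‖ = 1) :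
    ∃ J : E m →ₗᵢ[ℝ] E (m + 1), (∀ y, inner ℝ n (J y) = 0) ∧ (∀ x, inner ℝ n x = 0 → ∃ y, J y = x) ∧
      MeasurePreserving (fun p : ℝ × E m => p.1 • n + J p.2) := by
  have hfin : Fact (Module.finrank ℝ (E (m + 1)) = m + 1) := ⟨by simp⟩
  have hn0 : n ≠ 0 := by
    rintro rfl
    simp at hn
  let B := OrthonormalBasis.fromOrthogonalSpanSingleton (𝕜 := ℝ) m hn0
  let J : E m →ₗᵢ[ℝ] E (m + 1) := (Submodule.subtypeₗᵢ (ℝ ∙ n)ᗮ).comp B.repr.symm.toLinearIsometry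
  have hJ : ∀ y, inner ℝ n (J y) = 0 := fun y =>
    Submodule.mem_orthogonal_singleton_iff_inner_right.1 (B.repr.symm y).2
  refine ⟨J, hJ, fun x hx => ?_, ?_⟩
  · refine ⟨B.repr ⟨x, Submodule.mem_orthogonal_singleton_iff_inner_right.2 hx⟩, ?_⟩
    simp [J]
  · let Φ₀ : WithLp 2 (ℝ × E m) →ₗ[ℝ] E (m + 1) :=
      { toFun := fun p => p.fst • n + J p.snd
        map_add' := fun p q => by
          simp only [WithLp.add_fst, WithLp.add_snd, add_smul, map_add]; abel
        map_smul' := fun c p => by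
          simp only [WithLp.smul_fst, WithLp.smul_snd, map_smul, smul_add, RingHom.id_apply,
            smul_eq_mul, mul_smul] }
    let Φ₁ : WithLp 2 (ℝ × E m) →ₗᵢ[ℝ] E (m + 1) :=
      { Φ₀ with
        norm_map' := fun p => by
          have h1 : ‖p.fst • n + J p.snd‖ ^ 2 = ‖p‖ ^ 2 := by
            rw [norm_add_sq_real, real_inner_smul_left, hJ, WithLp.prod_norm_sq_eq_of_L2,
              norm_smul, hn, J.norm_map]
            simp
          exact (sq_eq_sq₀ (norm_nonneg _) (norm_nonneg _)).1 h1 }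
    have hfr : Module.finrank ℝ (WithLp 2 (ℝ × E m)) = Module.finrank ℝ (E (m + 1)) := by
      rw [LinearEquiv.finrank_eq (WithLp.linearEquiv 2 ℝ (ℝ × E m))]
      simp [add_comm]
    let Φ := Φ₁.toLinearIsometryEquiv hfr
    have h1 : MeasurePreserving Φ := Φ.measurePreserving
    have h2 := h1.comp (WithLp.volume_preserving_toLp ℝ (E m))
    exact h2

/-- Isometric coordinates on the hyperplane of the face opposite to `v`. -/
theorem IsSimplex.exists_cone_coordinates {m : ℕ} {T : Finset (E (m + 1))} (hT : IsSimplex T)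
    {v : E (m + 1)} (hv : v ∈ T) : ∃ ι : E m → E (m + 1), Isometry ι ∧
      (∀ y, bary T v (ι y) = 0) ∧ hull (T.erase v) ⊆ range ι ∧
      MeasurePreserving (fun p : ℝ × E m => v + p.1 • normal T (T.erase v) + (ι p.2 - ι 0)) ∧
      (∀ y, ι y = v + height T v • normal T (T.erase v) + (ι y - ι 0)) ∧
      ∀ (r : ℝ) y, ι (r • y) - ι 0 = r • (ι y - ι 0) := by
  set n := normal T (T.erase v) with hn
  have hn1 : ‖n‖ = 1 := hT.norm_normal hv
  have hh := hT.height_pos hv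
  obtain ⟨J, hJ, hJs, hJm⟩ := exists_isometry_orthogonal hn1
  have hnn : inner ℝ n n = 1 := by rw [real_inner_self_eq_norm_sq, hn1]; norm_num
  refine ⟨fun y => v + height T v • n + J y, ?_, fun y => ?_, fun x hx => ?_, ?_, fun y => ?_,
    fun r y => ?_⟩
  · exact Isometry.of_dist_eq fun y z => by simp [J.dist_map]
  · rw [bary, ← hn]
    have : v + height T v • n + J y - v = height T v • n + J y := by abel
    rw [this, inner_add_right, inner_smul_right, hJ, hnn]
    field_simp
    simp
  · obtain ⟨y, hy⟩ := hJs (x - (v + height T v • n)) (by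
      have := hT.inner_normal_of_mem_face hv hx
      have e : x - (v + height T v • n) = (x - v) - height T v • n := by abel
      rw [e, inner_sub_right, inner_smul_right, hnn, this]
      ring)
    exact ⟨y, by simp [hy]⟩
  · have h1 : MeasurePreserving (fun x : E (m + 1) => v + x) := measurePreserving_add_left volume v
    have h2 := h1.comp hJm
    convert! h2 using 1
    funext p
    simp [add_assoc]
  · simp
  · simp

theorem setIntegral_face {m : ℕ} {ι : E m → E (m + 1)} (hι : Isometry ι) {F : Finset (E (m + 1))}
    (hF : hull F ⊆ range ι) (g : E (m + 1) → ℝ) :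
    ∫ x, g x ∂(surf (hull F)) = ∫ y in ι ⁻¹' hull F, g (ι y) := by
  have h1 : (Measure.euclideanHausdorffMeasure m : Measure (E (m + 1))).restrict (range ι) =
      (volume : Measure (E m)).map ι := by
    rw [← hι.map_euclideanHausdorffMeasure, EuclideanSpace.euclideanHausdorffMeasure_eq_volume]
  have h2 : surf (hull F) = ((volume : Measure (E m)).map ι).restrict (hull F) := by
    rw [← h1, Measure.restrict_restrict_of_subset hF]
    rfl
  have he : MeasurableEmbedding ι := hι.isClosedEmbedding.measurableEmbedding
  rw [h2, he.setIntegral_map]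

instance isFiniteMeasure_surf_of_isSimplex {T : Finset (E d)} [NeZero d] [hT : Fact (IsSimplex T)]
    {v : E d} [hv : Fact (v ∈ T)] : IsFiniteMeasure (surf (hull (T.erase v))) := by
  obtain ⟨m, rfl⟩ := Nat.exists_eq_succ_of_ne_zero (NeZero.ne d)
  obtain ⟨ι, hι, -, hF, -⟩ := hT.out.exists_cone_coordinates hv.out
  have h1 : (Measure.euclideanHausdorffMeasure m : Measure (E (m + 1))).restrict (range ι) =
      (volume : Measure (E m)).map ι := by
    rw [← hι.map_euclideanHausdorffMeasure, EuclideanSpace.euclideanHausdorffMeasure_eq_volume]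
  have h2 : surf (hull (T.erase v)) = ((volume : Measure (E m)).map ι).restrict
      (hull (T.erase v)) := by
    rw [← h1, Measure.restrict_restrict_of_subset hF]
    rfl
  have he : MeasurableEmbedding ι := hι.isClosedEmbedding.measurableEmbedding
  refine ⟨?_⟩
  rw [h2, Measure.restrict_apply_univ, he.map_apply]
  exact (hι.isClosedEmbedding.isCompact_preimage (isCompact_hull _)).measure_lt_top

/-- **The cone formula**: integration over a simplex in polar coordinates with respect to one of its
vertices. -/
theorem IsSimplex.integral_cone [NeZero d] {T : Finset (E d)} (hT : IsSimplex T) {v : E d}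
    (hv : v ∈ T) {g : E d → ℝ} (hg : Continuous g) :
    ∫ x in hull T, g x = height T v * ∫ r in (0 : ℝ)..1, r ^ (d - 1) *
      ∫ y, g (v + r • (y - v)) ∂(surf (hull (T.erase v))) := by
  obtain ⟨m, rfl⟩ := Nat.exists_eq_succ_of_ne_zero (NeZero.ne d)
  obtain ⟨ι, hι, hb, hF, hmp, hιn, hιr⟩ := hT.exists_cone_coordinates hv
  have hh := hT.height_pos hv
  set n := normal T (T.erase v)
  set h := height T v
  let Ψ : ℝ × E m → E (m + 1) := fun p => v + p.1 • n + (ι p.2 - ι 0)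
  have hΨc : Continuous Ψ := by
    have := hι.continuous
    fun_prop
  let G : E (m + 1) → ℝ := (hull T).indicator g
  have hGint : Integrable G := (hg.continuousOn.integrableOn_compact (isCompact_hull T)).integrable_indicator
    (measurableSet_hull T)
  have hGΨ : Integrable (fun p => G (Ψ p)) (volume.prod volume) := hmp.integrable_comp_of_integrable hGint
  have e1 : ∫ x in hull T, g x = ∫ p : ℝ × E m, G (Ψ p) := by
    rw [← integral_indicator (measurableSet_hull T), ← hmp.map_eq, integral_map hΨc.aemeasurable]
    rw [hmp.map_eq]
    exact hGint.aestronglyMeasurable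
  have e2 : ∫ p : ℝ × E m, G (Ψ p) = ∫ t : ℝ, ∫ y : E m, G (Ψ (t, y)) := integral_prod _ hGΨ
  have e3 : ∫ t : ℝ, ∫ y : E m, G (Ψ (t, y)) = h * ∫ r : ℝ, ∫ y : E m, G (Ψ (r * h, y)) := by
    rw [Measure.integral_comp_mul_right (fun t => ∫ y : E m, G (Ψ (t, y))) h, abs_of_pos (inv_pos.2 hh),
      smul_eq_mul, ← mul_assoc, mul_inv_cancel₀ hh.ne', one_mul]
  have e4 : ∀ r : ℝ, r ≠ 0 → ∫ y : E m, G (Ψ (r * h, y)) =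
      (Ioc (0 : ℝ) 1).indicator (fun r => r ^ m *
        ∫ y, g (v + r • (y - v)) ∂(surf (hull (T.erase v)))) r := by
    intro r hr
    have hΨr : ∀ y, Ψ (r * h, r • y) = v + r • (ι y - v) := by
      intro y
      have h1 : Ψ (r * h, r • y) = v + (r * h) • n + (ι (r • y) - ι 0) := rfl
      have h2 : ι y - v = h • n + (ι y - ι 0) := by
        rw [sub_eq_iff_eq_add', ← add_assoc]
        exact hιn y
      rw [h1, hιr, h2, smul_add, mul_smul, add_assoc]
    have hGr : ∀ y, G (Ψ (r * h, r • y)) = (Ioc (0 : ℝ) 1).indicator (fun r =>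
        (ι ⁻¹' hull (T.erase v)).indicator (fun y => g (v + r • (ι y - v))) y) r := by
      intro y
      rw [hΨr]
      have hiff := hT.mem_hull_cone_iff hv (hb y) hr
      by_cases hr1 : r ∈ Ioc (0 : ℝ) 1
      · rw [indicator_of_mem hr1]
        by_cases hy : ι y ∈ hull (T.erase v)
        · rw [indicator_of_mem (show y ∈ ι ⁻¹' hull (T.erase v) from hy)]
          exact indicator_of_mem (hiff.2 ⟨hr1, hy⟩) g
        · rw [indicator_of_notMem (show y ∉ ι ⁻¹' hull (T.erase v) from hy)]
          exact indicator_of_notMem (fun h' => hy (hiff.1 h').2) g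
      · rw [indicator_of_notMem hr1]
        exact indicator_of_notMem (fun h' => hr1 (hiff.1 h').1) g
    have h1 := Measure.integral_comp_smul (volume : Measure (E m)) (fun y => G (Ψ (r * h, y))) r
    simp only [hGr] at h1
    by_cases hr1 : r ∈ Ioc (0 : ℝ) 1
    · simp only [indicator_of_mem hr1] at h1 ⊢
      have hmeas : MeasurableSet (ι ⁻¹' hull (T.erase v)) :=
        hι.continuous.measurable (measurableSet_hull _)
      rw [integral_indicator hmeas, ← setIntegral_face hι hF (fun x => g (v + r • (x - v)))] at h1
      have hfr : Module.finrank ℝ (E m) = m := by simp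
      rw [h1, hfr, abs_of_pos (inv_pos.2 (pow_pos hr1.1 m)), smul_eq_mul, ← mul_assoc,
        mul_inv_cancel₀ (pow_pos hr1.1 m).ne', one_mul]
    · simp only [indicator_of_notMem hr1, integral_zero] at h1 ⊢
      have hfr : (0 : ℝ) < |(r ^ Module.finrank ℝ (E m))⁻¹| :=
        abs_pos.2 (inv_ne_zero (pow_ne_zero _ hr))
      rw [smul_eq_mul, zero_eq_mul] at h1
      exact h1.resolve_left hfr.ne'
  rw [e1, e2, e3, intervalIntegral.integral_of_le zero_le_one, ← integral_indicator measurableSet_Ioc]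
  congr 1
  refine integral_congr_ae ?_
  have : ∀ᵐ r : ℝ, r ≠ 0 := by simp [ae_iff]
  filter_upwards [this] with r hr
  exact e4 r hr

/-- A finite measure on each face. -/
theorem IsSimplex.isFiniteMeasure_surf [NeZero d] {T : Finset (E d)} (hT : IsSimplex T) {v : E d}
    (hv : v ∈ T) : IsFiniteMeasure (surf (hull (T.erase v))) := by
  have := Fact.mk hT
  have := Fact.mk hv
  infer_instance

theorem ae_mem_hull_surf (F : Finset (E d)) : ∀ᵐ x ∂(surf (hull F)), x ∈ hull F :=
  ae_restrict_mem (measurableSet_hull F)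

theorem integral_surf_congr {F : Finset (E d)} {f g : E d → ℝ} (h : ∀ x ∈ hull F, f x = g x) :
    ∫ x, f x ∂(surf (hull F)) = ∫ x, g x ∂(surf (hull F)) :=
  integral_congr_ae ((ae_mem_hull_surf F).mono h)

theorem integrable_surf {F : Finset (E d)} [IsFiniteMeasure (surf (hull F))] {G : Type*}
    [NormedAddCommGroup G] {g : E d → G} (hg : ContinuousOn g (hull F)) :
    Integrable g (surf (hull F)) := by
  have h1 : IntegrableOn g (hull F) (surf (hull F)) :=
    hg.integrableOn_compact (isCompact_hull F)
  have h2 : (surf (hull F)).restrict (hull F) = surf (hull F) := by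
    rw [surf, Measure.restrict_restrict (measurableSet_hull F), inter_self]
  rwa [IntegrableOn, h2] at h1

/-- The divergence theorem for the field `φ(x) (x - v)`, which is tangent to all faces but one. -/
theorem IsSimplex.integral_div_cone [NeZero d] {T : Finset (E d)} (hT : IsSimplex T) {v : E d}
    (hv : v ∈ T) {φ : E d → ℝ} (hφ : ContDiff ℝ 1 φ) :
    ∫ x in hull T, (d * φ x + fderiv ℝ φ x (x - v)) =
      height T v * ∫ y, φ y ∂(surf (hull (T.erase v))) := by
  have hfin := hT.isFiniteMeasure_surf hv
  have hφ' : Continuous fun x => fderiv ℝ φ x := hφ.continuous_fderiv one_ne_zero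
  have hφc : Continuous φ := hφ.continuous
  have hd : d - 1 + 1 = d := Nat.succ_pred_eq_of_pos (NeZero.pos d)
  rw [hT.integral_cone hv (g := fun x => d * φ x + fderiv ℝ φ x (x - v)) (by fun_prop)]
  congr 1
  let k : ℝ → E d → ℝ := fun r y =>
    r ^ (d - 1) * (d * φ (v + r • (y - v)) + fderiv ℝ φ (v + r • (y - v)) (v + r • (y - v) - v))
  have hk : Continuous (Function.uncurry k) := by
    simp only [k, Function.uncurry_def]
    fun_prop
  have e1 : ∀ y, ∫ r in (0 : ℝ)..1, k r y = φ y := by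
    intro y
    have hder : ∀ r : ℝ, HasDerivAt (fun r => r ^ d * φ (v + r • (y - v))) (k r y) r := by
      intro r
      have h1 : HasDerivAt (fun r : ℝ => v + r • (y - v)) (y - v) r := by
        simpa using ((hasDerivAt_id r).smul_const (y - v)).const_add v
      have h2 := ((hφ.differentiable one_ne_zero) (v + r • (y - v))).hasFDerivAt.comp_hasDerivAt r h1
      have h3 := (hasDerivAt_pow d r).mul h2
      refine h3.congr_deriv ?_
      simp only [k, add_sub_cancel_left, map_smul, smul_eq_mul, Function.comp]
      have : r ^ d = r ^ (d - 1) * r := by rw [← pow_succ, hd]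
      rw [this]
      ring
    have hkc : Continuous fun r => k r y := by
      simp only [k]
      fun_prop
    rw [intervalIntegral.integral_eq_sub_of_hasDerivAt (fun r _ => hder r)
      (hkc.intervalIntegrable _ _)]
    simp [NeZero.ne d]
  have hint : Integrable (Function.uncurry k) ((volume.restrict (Ioc (0 : ℝ) 1)).prod
      (surf (hull (T.erase v)))) := by
    obtain ⟨C, hC⟩ := (isCompact_Icc.prod (isCompact_hull (T.erase v))).exists_bound_of_continuousOn
      (s := Icc (0 : ℝ) 1 ×ˢ hull (T.erase v)) hk.continuousOn
    refine Integrable.of_bound hk.aestronglyMeasurable C ?_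
    have h2 : (volume.restrict (Ioc (0 : ℝ) 1)).prod (surf (hull (T.erase v))) =
        ((volume : Measure ℝ).prod (surf (hull (T.erase v)))).restrict
          (Ioc (0 : ℝ) 1 ×ˢ hull (T.erase v)) := by
      rw [← Measure.prod_restrict]
      congr 1
      rw [surf, Measure.restrict_restrict (measurableSet_hull _), inter_self]
    rw [h2]
    filter_upwards [ae_restrict_mem (measurableSet_Ioc.prod (measurableSet_hull _))] with p hp
    exact hC p ⟨Ioc_subset_Icc_self hp.1, hp.2⟩
  calc ∫ r in (0 : ℝ)..1, r ^ (d - 1) * ∫ y, (d * φ (v + r • (y - v)) +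
        fderiv ℝ φ (v + r • (y - v)) (v + r • (y - v) - v)) ∂(surf (hull (T.erase v)))
      = ∫ r in (0 : ℝ)..1, ∫ y, k r y ∂(surf (hull (T.erase v))) := by
        simp only [k, integral_const_mul]
    _ = ∫ y, (∫ r in (0 : ℝ)..1, k r y) ∂(surf (hull (T.erase v))) := by
        rw [intervalIntegral.integral_of_le zero_le_one, integral_integral_swap hint]
        simp only [intervalIntegral.integral_of_le zero_le_one]
    _ = ∫ y, φ y ∂(surf (hull (T.erase v))) := by simp only [e1]

theorem integrableOn_hull {T : Finset (E d)} {G : Type*} [NormedAddCommGroup G] {g : E d → G}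
    (hg : Continuous g) : IntegrableOn g (hull T) :=
  hg.continuousOn.integrableOn_compact (isCompact_hull T)

theorem IsSimplex.integral_fderiv_edge [NeZero d] {T : Finset (E d)} (hT : IsSimplex T) {v w : E d}
    (hv : v ∈ T) (hw : w ∈ T) {φ : E d → ℝ} (hφ : ContDiff ℝ 1 φ) :
    ∫ x in hull T, fderiv ℝ φ x (w - v) =
      height T v * ∫ y, φ y ∂(surf (hull (T.erase v))) -
        height T w * ∫ y, φ y ∂(surf (hull (T.erase w))) := by
  have hφ' : Continuous fun x => fderiv ℝ φ x := hφ.continuous_fderiv one_ne_zero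
  have hφc : Continuous φ := hφ.continuous
  rw [← hT.integral_div_cone hv hφ, ← hT.integral_div_cone hw hφ, ← integral_sub
    (integrableOn_hull (by fun_prop)) (integrableOn_hull (by fun_prop))]
  congr 1
  funext x
  have : w - v = (x - v) - (x - w) := by abel
  rw [this, map_sub]
  ring

/-- **The divergence theorem** on a simplex: the integral of a partial derivative. -/
theorem IsSimplex.integral_fderiv [NeZero d] {T : Finset (E d)} (hT : IsSimplex T) {φ : E d → ℝ}
    (hφ : ContDiff ℝ 1 φ) (e : E d) :
    ∫ x in hull T, fderiv ℝ φ x e = ∑ v ∈ T, inner ℝ e (normal T (T.erase v)) *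
      ∫ y, φ y ∂(surf (hull (T.erase v))) := by
  obtain ⟨v, hv⟩ := hT.nonempty
  have hφ' : Continuous fun x => fderiv ℝ φ x := hφ.continuous_fderiv one_ne_zero
  -- the edges issued from a vertex span the space
  have he : e = ∑ w ∈ T, bary T w (v + e) • (w - v) := by
    simp only [smul_sub, Finset.sum_sub_distrib, ← Finset.sum_smul, hT.sum_bary, hT.sum_bary_smul]
    simp
  set c : E d → ℝ := fun w => bary T w (v + e)
  have hin : ∀ w ∈ T, ∀ u ∈ T, inner ℝ (w - v) (normal T (T.erase u)) =
      (if u = v then height T v else 0) - (if u = w then height T w else 0) := by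
    intro w hw u hu
    have key : ∀ z ∈ T, inner ℝ (z - u) (normal T (T.erase u)) =
        height T u - if u = z then height T z else 0 := by
      intro z hz
      split_ifs with h
      · rw [h]; simp
      · rw [real_inner_comm, hT.inner_normal_eq_height hu (Finset.mem_erase.2 ⟨Ne.symm h, hz⟩)]
        ring
    have : w - v = (w - u) - (v - u) := by abel
    rw [this, inner_sub_left, key w hw, key v hv]
    ring
  have hsum : ∀ w ∈ T, ∫ x in hull T, fderiv ℝ φ x (w - v) =
      ∑ u ∈ T, inner ℝ (w - v) (normal T (T.erase u)) * ∫ y, φ y ∂(surf (hull (T.erase u))) := by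
    intro w hw
    rw [hT.integral_fderiv_edge hv hw hφ, Finset.sum_congr rfl fun u hu => by rw [hin w hw u hu]]
    simp only [sub_mul, ite_mul, zero_mul, Finset.sum_sub_distrib, Finset.sum_ite_eq', hv, hw, if_true]
  have e1 : ∀ x, fderiv ℝ φ x e = ∑ w ∈ T, c w * fderiv ℝ φ x (w - v) := by
    intro x
    conv_lhs => rw [he]
    rw [map_sum]
    exact Finset.sum_congr rfl fun w _ => by rw [map_smul, smul_eq_mul]
  simp only [e1]
  rw [integral_finsetSum _ fun w _ => integrableOn_hull (by fun_prop)]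
  simp only [integral_const_mul]
  rw [Finset.sum_congr rfl fun w hw => by rw [hsum w hw]]
  simp only [Finset.mul_sum]
  rw [Finset.sum_comm]
  refine Finset.sum_congr rfl fun u hu => ?_
  conv_rhs => rw [he]
  rw [sum_inner, Finset.sum_mul]
  refine Finset.sum_congr rfl fun w hw => ?_
  rw [real_inner_smul_left]
  ring

/-- A nonnegative continuous function with zero integral over a face vanishes on the face. -/
theorem IsSimplex.eq_zero_of_integral_face [NeZero d] {T : Finset (E d)} (hT : IsSimplex T)
    {v : E d} (hv : v ∈ T) {f : E d → ℝ} (hf : Continuous f) (hf0 : ∀ x, 0 ≤ f x)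
    (h : ∫ y, f y ∂(surf (hull (T.erase v))) = 0) : ∀ x ∈ hull (T.erase v), f x = 0 := by
  have hfin := hT.isFiniteMeasure_surf hv
  -- extend `f` along the rays from `v`, with a cut-off near `v`
  let ℓ : E d → ℝ := fun x => 1 - bary T v x
  have hℓ : Continuous ℓ := by
    simp only [ℓ, bary]
    fun_prop
  let G : E d → ℝ := fun x => f (v + (max (ℓ x) 2⁻¹)⁻¹ • (x - v)) * max (ℓ x - 2⁻¹) 0
  have hmax : ∀ x, max (ℓ x) 2⁻¹ ≠ 0 := fun x =>
    ((by norm_num : (0 : ℝ) < 2⁻¹).trans_le (le_max_right _ _)).ne'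
  have hG : Continuous G := by
    have : Continuous fun x => (max (ℓ x) 2⁻¹)⁻¹ :=
      (hℓ.max continuous_const).inv₀ hmax
    simp only [G]
    fun_prop
  have hG0 : ∀ x, 0 ≤ G x := fun x => mul_nonneg (hf0 _) (le_max_right _ _)
  have hcone : ∀ r ∈ Ioc (0 : ℝ) 1, ∀ y ∈ hull (T.erase v),
      G (v + r • (y - v)) = f y * max (r - 2⁻¹) 0 := by
    intro r hr y hy
    have hy0 := ((hT.mem_face_iff hv).1 hy).2
    have e : ℓ (v + r • (y - v)) = r := by
      simp only [ℓ, bary_affine, bary_self, hy0]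
      ring
    simp only [G, e]
    by_cases h2 : 2⁻¹ ≤ r
    · rw [max_eq_left h2, add_sub_cancel_left, smul_smul, inv_mul_cancel₀ hr.1.ne', one_smul,
        add_sub_cancel]
    · rw [max_eq_right (a := r - 2⁻¹) (by linarith [not_le.1 h2])]
      simp
  have hint : ∫ x in hull T, G x = 0 := by
    rw [hT.integral_cone hv hG, intervalIntegral.integral_of_le zero_le_one]
    have : ∀ r ∈ Ioc (0 : ℝ) 1, r ^ (d - 1) * ∫ y, G (v + r • (y - v)) ∂(surf (hull (T.erase v))) =
        0 := by
      intro r hr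
      have e : ∫ y, G (v + r • (y - v)) ∂(surf (hull (T.erase v))) =
          ∫ y, f y * max (r - 2⁻¹) 0 ∂(surf (hull (T.erase v))) := by
        refine integral_surf_congr fun y hy => ?_
        exact hcone r hr y hy
      rw [e, integral_mul_const, h]
      simp
    rw [setIntegral_congr_fun measurableSet_Ioc this]
    simp
  have hint0 : ∀ x ∈ interior (hull T), G x = 0 := by
    have h1 := (setIntegral_eq_zero_iff_of_nonneg_ae (ae_of_all _ hG0) (integrableOn_hull hG)).1 hint
    have h2 : G =ᵐ[volume.restrict (interior (hull T))] 0 :=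
      ae_restrict_of_ae_restrict_of_subset interior_subset h1
    have := Measure.eqOn_of_ae_eq h2 hG.continuousOn continuousOn_const
      (by rw [isOpen_interior.interior_eq]; exact subset_closure)
    exact this
  have hclosed : ∀ x ∈ hull T, G x = 0 := by
    intro x hx
    rw [← hT.closure_interior] at hx
    have : IsClosed {x | G x = 0} := isClosed_eq hG continuous_const
    exact this.closure_subset_iff.2 hint0 hx
  intro x hx
  have h1 := hclosed x ((hT.mem_face_iff hv).1 hx).1
  have h2 := hcone 1 ⟨one_pos, le_rfl⟩ x hx
  rw [one_smul, add_sub_cancel, h1] at h2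
  have h3 : max ((1 : ℝ) - 2⁻¹) 0 = 2⁻¹ := by norm_num
  rw [h3] at h2
  linarith

/-- A homogeneous extension of a function from a face has a comparable norm. -/
theorem IsSimplex.integral_homogeneous [NeZero d] {T : Finset (E d)} (hT : IsSimplex T) {v : E d}
    (hv : v ∈ T) {q : E d → ℝ} (hq : Continuous q) {k : ℕ}
    (hqr : ∀ (r : ℝ) x, q (v + r • (x - v)) = r ^ k * q x) :
    ∫ x in hull T, q x ^ 2 ≤ height T v * ∫ y, q y ^ 2 ∂(surf (hull (T.erase v))) := by
  rw [hT.integral_cone hv (g := fun x => q x ^ 2) (by fun_prop)]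
  refine mul_le_mul_of_nonneg_left ?_ (hT.height_pos hv).le
  have hI : 0 ≤ ∫ y, q y ^ 2 ∂(surf (hull (T.erase v))) := integral_nonneg fun y => sq_nonneg _
  simp only [hqr, mul_pow, integral_const_mul]
  calc _ ≤ ∫ r in (0 : ℝ)..1, ∫ y, q y ^ 2 ∂(surf (hull (T.erase v))) := by
        refine intervalIntegral.integral_mono_on zero_le_one
          (Continuous.intervalIntegrable (by fun_prop) _ _) (by simp) fun r hr => ?_
        have h1 : r ^ (d - 1) ≤ 1 := pow_le_one₀ hr.1 hr.2
        have h2 : (r ^ k) ^ 2 ≤ 1 := pow_le_one₀ (by have := hr.1; positivity)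
          (pow_le_one₀ hr.1 hr.2)
        have h3 : 0 ≤ (r ^ k) ^ 2 := sq_nonneg _
        calc r ^ (d - 1) * ((r ^ k) ^ 2 * _) ≤ 1 * (1 * ∫ y, q y ^ 2 ∂(surf (hull (T.erase v)))) := by
              gcongr
          _ = _ := by ring
    _ = _ := by simp

/-! ### Linear dependence on a vector of a subspace -/

section IsLinOn

variable {X Y Z : Type*} [AddCommGroup X] [Module ℝ X] [AddCommGroup Y] [Module ℝ Y]
  [AddCommGroup Z] [Module ℝ Z]

/-- `f` is linear on the subspace `V`. -/
def IsLinOn (V : Submodule ℝ X) (f : X → Y) : Prop :=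
  (∀ x ∈ V, ∀ y ∈ V, f (x + y) = f x + f y) ∧ ∀ (c : ℝ), ∀ x ∈ V, f (c • x) = c • f x

namespace IsLinOn

variable {V : Submodule ℝ X} {f g : X → Y}

/-- The linear map on `V` that coincides with `f`. -/
def toLin (h : IsLinOn V f) : V →ₗ[ℝ] Y where
  toFun x := f x
  map_add' x y := h.1 x x.2 y y.2
  map_smul' c x := h.2 c x x.2

theorem add (hf : IsLinOn V f) (hg : IsLinOn V g) : IsLinOn V fun x => f x + g x :=
  ⟨fun x hx y hy => by beta_reduce; rw [hf.1 x hx y hy, hg.1 x hx y hy]; abel,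
    fun c x hx => by beta_reduce; rw [hf.2 c x hx, hg.2 c x hx, smul_add]⟩

theorem sub (hf : IsLinOn V f) (hg : IsLinOn V g) : IsLinOn V fun x => f x - g x :=
  ⟨fun x hx y hy => by beta_reduce; rw [hf.1 x hx y hy, hg.1 x hx y hy]; abel,
    fun c x hx => by beta_reduce; rw [hf.2 c x hx, hg.2 c x hx, smul_sub]⟩

theorem neg (hf : IsLinOn V f) : IsLinOn V fun x => -f x :=
  ⟨fun x hx y hy => by beta_reduce; rw [hf.1 x hx y hy]; abel,
    fun c x hx => by beta_reduce; rw [hf.2 c x hx, smul_neg]⟩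

theorem comp (hf : IsLinOn V f) (L : Y →ₗ[ℝ] Z) : IsLinOn V fun x => L (f x) :=
  ⟨fun x hx y hy => by beta_reduce; rw [hf.1 x hx y hy, map_add],
    fun c x hx => by beta_reduce; rw [hf.2 c x hx, map_smul]⟩

theorem const_smul (hf : IsLinOn V f) (c : ℝ) : IsLinOn V fun x => c • f x :=
  hf.comp (LinearMap.lsmul ℝ Y c)

theorem const_mul {f : X → ℝ} (hf : IsLinOn V f) (c : ℝ) : IsLinOn V fun x => c * f x :=
  hf.const_smul c

theorem mul_const {f : X → ℝ} (hf : IsLinOn V f) (c : ℝ) : IsLinOn V fun x => f x * c := by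
  simpa only [mul_comm] using hf.const_mul c

theorem smul_const {f : X → ℝ} (hf : IsLinOn V f) (y : Y) : IsLinOn V fun x => f x • y :=
  hf.comp ((LinearMap.lsmul ℝ Y).flip y)

theorem sum {ι : Type*} {s : Finset ι} {f : ι → X → Y} (hf : ∀ i ∈ s, IsLinOn V (f i)) :
    IsLinOn V fun x => ∑ i ∈ s, f i x :=
  ⟨fun x hx y hy => by
    rw [← Finset.sum_add_distrib]
    exact Finset.sum_congr rfl fun i hi => (hf i hi).1 x hx y hy,
    fun c x hx => by
      rw [Finset.smul_sum]
      exact Finset.sum_congr rfl fun i hi => (hf i hi).2 c x hx⟩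

theorem inner_right {f : X → E d} (hf : IsLinOn V f) (y : E d) :
    IsLinOn V fun x => (inner ℝ y (f x) : ℝ) :=
  hf.comp (innerₗ (E d) y)

theorem inner_left {f : X → E d} (hf : IsLinOn V f) (y : E d) :
    IsLinOn V fun x => (inner ℝ (f x) y : ℝ) := by
  have h := hf.inner_right y
  rwa [funext fun x => real_inner_comm _ _]

theorem eval {α : Type*} {V : Submodule ℝ (α → Y)} (a : α) : IsLinOn V fun f : α → Y => f a :=
  ⟨fun _ _ _ _ => rfl, fun _ _ _ => rfl⟩

theorem integral {G : Type*} [NormedAddCommGroup G] [NormedSpace ℝ G]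
    {α : Type*} [MeasurableSpace α] {m : Measure α} {f : X → α → G}
    (hf : ∀ a, IsLinOn V fun x => f x a) (hi : ∀ x ∈ V, Integrable (f x) m) :
    IsLinOn V fun x => ∫ a, f x a ∂m :=
  ⟨fun x hx y hy => by
    beta_reduce
    rw [← integral_add (hi x hx) (hi y hy)]
    congr 1
    funext a
    exact (hf a).1 x hx y hy,
    fun c x hx => by
      beta_reduce
      rw [← MeasureTheory.integral_smul]
      congr 1
      funext a
      exact (hf a).2 c x hx⟩

theorem map_zero (hf : IsLinOn V f) : f 0 = 0 := by
  simpa using hf.2 0 0 V.zero_mem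

theorem map_sub (hf : IsLinOn V f) {x y : X} (hx : x ∈ V) (hy : y ∈ V) : f (x - y) = f x - f y := by
  have := hf.1 x hx ((-1 : ℝ) • y) (V.smul_mem _ hy)
  rw [hf.2 _ y hy] at this
  simpa [sub_eq_add_neg] using this

theorem congr (hg : IsLinOn V g) (h : ∀ x ∈ V, f x = g x) : IsLinOn V f :=
  ⟨fun x hx y hy => by rw [h _ hx, h _ hy, h _ (V.add_mem hx hy), hg.1 x hx y hy],
   fun c x hx => by rw [h _ hx, h _ (V.smul_mem c hx), hg.2 c x hx]⟩

theorem add_eq {W : Submodule ℝ Z} {g : Z → Y} (hf : IsLinOn V f) (hg : IsLinOn W g) {x y : X}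
    {z w : Z} (hx : x ∈ V) (hy : y ∈ V) (hz : z ∈ W) (hw : w ∈ W) (h₁ : f x = g z)
    (h₂ : f y = g w) : f (x + y) = g (z + w) := by
  rw [hf.1 x hx y hy, hg.1 z hz w hw, h₁, h₂]

theorem smul_eq {W : Submodule ℝ Z} {g : Z → Y} (hf : IsLinOn V f) (hg : IsLinOn W g) (c : ℝ)
    {x : X} {z : Z} (hx : x ∈ V) (hz : z ∈ W) (h : f x = g z) : f (c • x) = g (c • z) := by
  rw [hf.2 c x hx, hg.2 c z hz, h]

/-- A positive definite bilinear form on a finite-dimensional space represents all functionals. -/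
theorem exists_represents [FiniteDimensional ℝ V] {B : X → X → ℝ}
    (hB₁ : ∀ y ∈ V, IsLinOn V fun x => B x y) (hB₂ : ∀ x ∈ V, IsLinOn V (B x))
    (hpos : ∀ x ∈ V, B x x = 0 → x = 0) {ℓ : X → ℝ} (hℓ : IsLinOn V ℓ) :
    ∃ x ∈ V, ∀ y ∈ V, B x y = ℓ y := by
  let Φ : V →ₗ[ℝ] Module.Dual ℝ V :=
    { toFun := fun x => (hB₂ x x.2).toLin
      map_add' := fun x y => LinearMap.ext fun z => (hB₁ z z.2).1 x x.2 y y.2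
      map_smul' := fun c x => LinearMap.ext fun z => (hB₁ z z.2).2 c x x.2 }
  have hinj : Function.Injective Φ := by
    rw [← LinearMap.ker_eq_bot, LinearMap.ker_eq_bot']
    intro x hx
    have := LinearMap.congr_fun hx x
    exact Subtype.ext (hpos x x.2 this)
  obtain ⟨x, hx⟩ := ((LinearMap.injective_iff_surjective_of_finrank_eq_finrank
    (Subspace.dual_finrank_eq).symm).1 hinj) hℓ.toLin
  exact ⟨x, x.2, fun y hy => LinearMap.congr_fun hx ⟨y, hy⟩⟩

end IsLinOn

end IsLinOn

/-! ### Square integrable functions -/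

section L2

variable {α : Type*} [MeasurableSpace α] {m : Measure α}

theorem integral_norm_sq_toLp {G : Type*} [NormedAddCommGroup G] {f : α → G}
    (hf : MemLp f 2 m) : ∫ x, ‖f x‖ ^ 2 ∂m = ‖hf.toLp f‖ ^ 2 := by
  have h0 : (2 : ℝ≥0∞) ≠ 0 := by norm_num
  have h1 : (2 : ℝ≥0∞) ≠ ⊤ := by norm_num
  rw [Lp.norm_toLp, hf.eLpNorm_eq_integral_rpow_norm h0 h1]
  simp only [ENNReal.toReal_ofNat, Real.rpow_two]
  rw [ENNReal.toReal_ofReal (by positivity), ← one_div, ← Real.sqrt_eq_rpow, Real.sq_sqrt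
    (integral_nonneg fun x => sq_nonneg _)]

theorem MemLp.coord {f : α → E d} (hf : MemLp f 2 m) (i : Fin d) : MemLp (fun x => f x i) 2 m :=
  (EuclideanSpace.proj (𝕜 := ℝ) i).comp_memLp' hf

theorem integrable_inner_of_memLp {f g : α → E d} (hf : MemLp f 2 m) (hg : MemLp g 2 m) :
    Integrable (fun x => (inner ℝ (f x) (g x) : ℝ)) m := by
  simp only [inner_eq_sum]
  exact integrable_finsetSum _ fun i _ => (MemLp.coord hf i).integrable_mul (MemLp.coord hg i)

theorem sq_integral_inner_le {f g : α → E d} (hf : MemLp f 2 m) (hg : MemLp g 2 m) :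
    (∫ x, inner ℝ (f x) (g x) ∂m) ^ 2 ≤ (∫ x, ‖f x‖ ^ 2 ∂m) * ∫ x, ‖g x‖ ^ 2 ∂m := by
  have h1 : ∫ x, inner ℝ (f x) (g x) ∂m = inner ℝ (hf.toLp f) (hg.toLp g) := by
    refine integral_congr_ae ?_
    filter_upwards [hf.coeFn_toLp, hg.coeFn_toLp] with x h1 h2
    rw [h1, h2]
  rw [h1, integral_norm_sq_toLp hf, integral_norm_sq_toLp hg, ← mul_pow, sq_le_sq,
    abs_of_nonneg (by positivity : 0 ≤ ‖hf.toLp f‖ * ‖hg.toLp g‖)]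
  exact abs_real_inner_le_norm _ _

theorem integrable_norm_sq {G : Type*} [NormedAddCommGroup G] {f : α → G} (hf : MemLp f 2 m) :
    Integrable (fun x => ‖f x‖ ^ 2) m :=
  hf.integrable_norm_pow (by norm_num)

theorem norm_add_sq_le {G : Type*} [NormedAddCommGroup G] [InnerProductSpace ℝ G] (a b : G) :
    ‖a + b‖ ^ 2 ≤ 2 * ‖a‖ ^ 2 + 2 * ‖b‖ ^ 2 := by
  have h1 := norm_add_le a b
  nlinarith [norm_nonneg (a + b), sq_nonneg (‖a‖ - ‖b‖)]

theorem norm_sum_sq_le {ι : Type*} {s : Finset ι} {G : Type*} [NormedAddCommGroup G] (f : ι → G) :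
    ‖∑ i ∈ s, f i‖ ^ 2 ≤ s.card * ∑ i ∈ s, ‖f i‖ ^ 2 := by
  have h1 : ‖∑ i ∈ s, f i‖ ≤ ∑ i ∈ s, ‖f i‖ := norm_sum_le _ _
  calc ‖∑ i ∈ s, f i‖ ^ 2 ≤ (∑ i ∈ s, ‖f i‖) ^ 2 := by gcongr
    _ ≤ _ := sq_sum_le_card_mul_sum_sq

/-- Two linear operators from a finite-dimensional space to square integrable functions are
comparable as soon as their kernels are. -/
theorem exists_integral_le {X : Type*} [AddCommGroup X] [Module ℝ X] [FiniteDimensional ℝ X]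
    {G₁ G₂ : Type*} [NormedAddCommGroup G₁] [NormedSpace ℝ G₁] [NormedAddCommGroup G₂]
    [NormedSpace ℝ G₂] {m₁ m₂ : Measure α} (A₁ : X →ₗ[ℝ] α → G₁) (A₂ : X →ₗ[ℝ] α → G₂)
    (h₁ : ∀ x, MemLp (A₁ x) 2 m₁) (h₂ : ∀ x, MemLp (A₂ x) 2 m₂)
    (hker : ∀ x, A₂ x =ᵐ[m₂] 0 → A₁ x =ᵐ[m₁] 0) :
    ∃ C : ℝ, 0 < C ∧ ∀ x, ∫ a, ‖A₁ x a‖ ^ 2 ∂m₁ ≤ C * ∫ a, ‖A₂ x a‖ ^ 2 ∂m₂ := by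
  let L₁ : X →ₗ[ℝ] Lp G₁ 2 m₁ :=
    { toFun := fun x => (h₁ x).toLp _
      map_add' := fun x y => by
        rw [← MemLp.toLp_add]
        congr 1
        rw [map_add]
      map_smul' := fun c x => by
        rw [RingHom.id_apply, ← MemLp.toLp_const_smul]
        congr 1
        rw [map_smul] }
  let L₂ : X →ₗ[ℝ] Lp G₂ 2 m₂ :=
    { toFun := fun x => (h₂ x).toLp _
      map_add' := fun x y => by
        rw [← MemLp.toLp_add]
        congr 1
        rw [map_add]
      map_smul' := fun c x => by
        rw [RingHom.id_apply, ← MemLp.toLp_const_smul]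
        congr 1
        rw [map_smul] }
  have hk : LinearMap.ker L₂ ≤ LinearMap.ker L₁ := by
    intro x hx
    have e1 := (MemLp.toLp_eq_toLp_iff (h₁ x) MemLp.zero).2 (hker x ((MemLp.toLp_eq_toLp_iff (h₂ x)
        MemLp.zero).1 (by rw [MemLp.toLp_zero]; exact hx)))
    exact e1
  let g : LinearMap.range L₂ →ₗ[ℝ] Lp G₁ 2 m₁ :=
    ((LinearMap.ker L₂).liftQ L₁ hk).comp L₂.quotKerEquivRange.symm.toLinearMap
  let gc := LinearMap.toContinuousLinearMap g
  have hg : ∀ x, gc ⟨L₂ x, x, rfl⟩ = L₁ x := by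
    intro x
    have : L₂.quotKerEquivRange.symm ⟨L₂ x, x, rfl⟩ = (LinearMap.ker L₂).mkQ x := by
      rw [LinearEquiv.symm_apply_eq]
      rfl
    change ((LinearMap.ker L₂).liftQ L₁ hk) (L₂.quotKerEquivRange.symm ⟨L₂ x, x, rfl⟩) = _
    rw [this]
    rfl
  refine ⟨‖gc‖ ^ 2 + 1, by positivity, fun x => ?_⟩
  rw [integral_norm_sq_toLp (h₁ x), integral_norm_sq_toLp (h₂ x)]
  have h3 : ‖L₁ x‖ ≤ ‖gc‖ * ‖L₂ x‖ := by
    rw [← hg]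
    exact gc.le_opNorm _
  calc ‖L₁ x‖ ^ 2 ≤ (‖gc‖ * ‖L₂ x‖) ^ 2 := by gcongr
    _ ≤ (‖gc‖ ^ 2 + 1) * ‖L₂ x‖ ^ 2 := by nlinarith [sq_nonneg ‖L₂ x‖]

end L2

/-! ### Orthogonal projectors -/

/-- A finite-dimensional space of square integrable functions none of which vanishes almost
everywhere, except for the zero function. -/
structure IsL2Space (m : Measure (E d)) (V : Submodule ℝ (E d → ℝ)) : Prop where
  finite : FiniteDimensional ℝ V
  memLp : ∀ p ∈ V, MemLp p 2 m
  definite : ∀ p ∈ V, ∫ x, p x ^ 2 ∂m = 0 → p = 0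

namespace IsL2Space

variable {m : Measure (E d)} {V : Submodule ℝ (E d → ℝ)} (hV : IsL2Space m V)

include hV

theorem integrable_mul {p r : E d → ℝ} (hp : MemLp p 2 m) (hr : r ∈ V) :
    Integrable (fun x => p x * r x) m :=
  hp.integrable_mul (hV.memLp r hr)

theorem exists_unique_proj {f : E d → ℝ} (hf : MemLp f 2 m) :
    (∃ p, p ∈ V ∧ ∀ r ∈ V, ∫ x, p x * r x ∂m = ∫ x, f x * r x ∂m) ∧
      ∀ p ∈ V, ∀ q ∈ V, (∀ r ∈ V, ∫ x, p x * r x ∂m = ∫ x, q x * r x ∂m) → p = q := by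
  have := hV.finite
  have hlin : ∀ g : E d → ℝ, MemLp g 2 m → IsLinOn V fun r : E d → ℝ => ∫ x, g x * r x ∂m :=
    fun g hg => IsLinOn.integral (fun a => (IsLinOn.eval a).const_mul (g a))
      fun r hr => hV.integrable_mul hg hr
  have hlin' : ∀ g ∈ V, IsLinOn V fun r : E d → ℝ => ∫ x, r x * g x ∂m :=
    fun g hg => by simpa only [mul_comm] using hlin g (hV.memLp g hg)
  constructor
  · exact IsLinOn.exists_represents (B := fun p r => ∫ x, p x * r x ∂m) (fun y hy => hlin' y hy)
      (fun x hx => hlin x (hV.memLp x hx)) (fun p hp h => hV.definite p hp (by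
        simpa only [sq] using h)) (hlin f hf)
  · intro p hp q hq h
    have hs := V.sub_mem hp hq
    have h1 := (hlin' _ hs).map_sub hp hq
    rw [h _ hs, sub_self] at h1
    have h2 := hV.definite _ hs (by simpa only [sq] using h1)
    exact sub_eq_zero.1 h2

theorem lproj_spec {f : E d → ℝ} (hf : MemLp f 2 m) : lproj m V f ∈ V ∧
    ∀ r ∈ V, ∫ x, lproj m V f x * r x ∂m = ∫ x, f x * r x ∂m :=
  Classical.epsilon_spec (hV.exists_unique_proj hf).1

theorem lproj_eq {f p : E d → ℝ} (hf : MemLp f 2 m) (hp : p ∈ V)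
    (h : ∀ r ∈ V, ∫ x, p x * r x ∂m = ∫ x, f x * r x ∂m) : lproj m V f = p :=
  (hV.exists_unique_proj hf).2 _ (hV.lproj_spec hf).1 _ hp fun r hr => by
    rw [(hV.lproj_spec hf).2 r hr, h r hr]

theorem lproj_eq_lproj_iff {f g : E d → ℝ} (hf : MemLp f 2 m) (hg : MemLp g 2 m) :
    lproj m V f = lproj m V g ↔ ∀ r ∈ V, ∫ x, f x * r x ∂m = ∫ x, g x * r x ∂m := by
  constructor
  · intro h r hr
    rw [← (hV.lproj_spec hf).2 r hr, h, (hV.lproj_spec hg).2 r hr]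
  · intro h
    refine hV.lproj_eq hf (hV.lproj_spec hg).1 fun r hr => ?_
    rw [(hV.lproj_spec hg).2 r hr, h r hr]

theorem lproj_self {p : E d → ℝ} (hp : p ∈ V) : lproj m V p = p :=
  hV.lproj_eq (hV.memLp p hp) hp fun _ _ => rfl

theorem lproj_congr {f g : E d → ℝ} (hf : MemLp f 2 m) (h : f =ᵐ[m] g) :
    lproj m V f = lproj m V g := by
  refine (hV.lproj_eq_lproj_iff hf ((memLp_congr_ae h).1 hf)).2 fun r _ => integral_congr_ae ?_
  filter_upwards [h] with x hx
  rw [hx]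

theorem integral_lproj_sq_le {f : E d → ℝ} (hf : MemLp f 2 m) :
    ∫ x, lproj m V f x ^ 2 ∂m ≤ ∫ x, f x ^ 2 ∂m := by
  obtain ⟨h1, h2⟩ := hV.lproj_spec hf
  have h3 := h2 _ h1
  simp only [← sq] at h3
  have h4 : 0 ≤ ∫ x, (f x - lproj m V f x) ^ 2 ∂m := integral_nonneg fun x => sq_nonneg _
  have h5 : ∫ x, (f x - lproj m V f x) ^ 2 ∂m = ∫ x, f x ^ 2 ∂m -
      2 * (∫ x, f x * lproj m V f x ∂m) + ∫ x, lproj m V f x ^ 2 ∂m := by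
    have e1 := (hV.integrable_mul hf h1).const_mul 2
    have e2 : Integrable (fun x => f x ^ 2 - 2 * (f x * lproj m V f x)) m := hf.integrable_sq.sub e1
    rw [← integral_const_mul, ← integral_sub hf.integrable_sq e1,
      ← integral_add e2 (hV.memLp _ h1).integrable_sq]
    congr 1
    funext x
    ring
  linarith

theorem lproj_add {f g : E d → ℝ} (hf : MemLp f 2 m) (hg : MemLp g 2 m) :
    lproj m V (f + g) = lproj m V f + lproj m V g := by
  obtain ⟨m₁, s₁⟩ := hV.lproj_spec hf
  obtain ⟨m₂, s₂⟩ := hV.lproj_spec hg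
  refine hV.lproj_eq (hf.add hg) (V.add_mem m₁ m₂) fun r hr => ?_
  simp only [Pi.add_apply, add_mul]
  rw [integral_add (hV.integrable_mul (hV.memLp _ m₁) hr) (hV.integrable_mul (hV.memLp _ m₂) hr),
    integral_add (hV.integrable_mul hf hr) (hV.integrable_mul hg hr), s₁ r hr, s₂ r hr]

theorem lproj_smul (c : ℝ) {f : E d → ℝ} (hf : MemLp f 2 m) :
    lproj m V (c • f) = c • lproj m V f := by
  obtain ⟨m₁, s₁⟩ := hV.lproj_spec hf
  refine hV.lproj_eq (hf.const_smul c) (V.smul_mem c m₁) fun r hr => ?_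
  simp only [Pi.smul_apply, smul_eq_mul, mul_assoc, integral_const_mul, s₁ r hr]

theorem isLinOn_lproj {X : Type*} [AddCommGroup X] [Module ℝ X] {W : Submodule ℝ X}
    {A : X → E d → ℝ} (hA : ∀ x, IsLinOn W fun w => A w x) (hm : ∀ w ∈ W, MemLp (A w) 2 m) :
    IsLinOn W fun w => lproj m V (A w) :=
  ⟨fun x hx y hy => by
    beta_reduce
    rw [← hV.lproj_add (hm x hx) (hm y hy)]
    exact congrArg _ (funext fun a => (hA a).1 x hx y hy),
   fun c x hx => by
    beta_reduce
    rw [← hV.lproj_smul c (hm x hx)]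
    exact congrArg _ (funext fun a => (hA a).2 c x hx)⟩

theorem memLp_vec {v : E d → E d} (hv : v ∈ vec V) : MemLp v 2 m :=
  MemLp.of_eval_piLp fun i => hV.memLp _ (hv i)

theorem lprojVec_mem {v : E d → E d} (hv : MemLp v 2 m) : lprojVec m V v ∈ vec V := fun i =>
  (hV.lproj_spec (MemLp.coord hv i)).1

theorem lprojVec_spec {v : E d → E d} (hv : MemLp v 2 m) {r : E d → E d} (hr : r ∈ vec V) :
    ∫ x, inner ℝ (lprojVec m V v x) (r x) ∂m = ∫ x, inner ℝ (v x) (r x) ∂m := by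
  simp only [inner_eq_sum]
  rw [integral_finsetSum _ fun i _ => hV.integrable_mul (MemLp.coord (hV.memLp_vec (hV.lprojVec_mem
    hv)) i) (hr i),
    integral_finsetSum _ fun i _ => hV.integrable_mul (MemLp.coord hv i) (hr i)]
  exact Finset.sum_congr rfl fun i _ => (hV.lproj_spec (MemLp.coord hv i)).2 _ (hr i)

omit hV in
theorem single_mem_vec {p : E d → ℝ} (hp : p ∈ V) (i : Fin d) :
    (fun x => p x • basisVec i) ∈ vec V := by
  intro j
  by_cases h : j = i
  · subst h
    simpa using hp
  · have : (fun x => (p x • basisVec i : E d) j) = 0 := by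
      funext x
      simp [h]
    rw [this]
    exact V.zero_mem

theorem lprojVec_eq {v p : E d → E d} (hv : MemLp v 2 m) (hp : p ∈ vec V)
    (h : ∀ r ∈ vec V, ∫ x, inner ℝ (p x) (r x) ∂m = ∫ x, inner ℝ (v x) (r x) ∂m) :
    lprojVec m V v = p := by
  have : ∀ i, lproj m V (fun y => v y i) = fun x => p x i := by
    intro i
    refine hV.lproj_eq (MemLp.coord hv i) (hp i) fun r hr => ?_
    have := h _ (single_mem_vec hr i)
    simpa [real_inner_smul_right, EuclideanSpace.inner_single_right, mul_comm] using this
  funext x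
  ext i
  exact congrFun (this i) x

theorem lprojVec_eq_lprojVec_iff {f g : E d → E d} (hf : MemLp f 2 m) (hg : MemLp g 2 m) :
    lprojVec m V f = lprojVec m V g ↔
      ∀ r ∈ vec V, ∫ x, inner ℝ (f x) (r x) ∂m = ∫ x, inner ℝ (g x) (r x) ∂m := by
  constructor
  · intro h r hr
    rw [← hV.lprojVec_spec hf hr, h, hV.lprojVec_spec hg hr]
  · intro h
    exact hV.lprojVec_eq hf (hV.lprojVec_mem hg) fun r hr => by
      rw [hV.lprojVec_spec hg hr, h r hr]

theorem lprojVec_self {p : E d → E d} (hp : p ∈ vec V) : lprojVec m V p = p :=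
  hV.lprojVec_eq (hV.memLp_vec hp) hp fun _ _ => rfl

theorem lprojVec_congr {f g : E d → E d} (hf : MemLp f 2 m) (h : f =ᵐ[m] g) :
    lprojVec m V f = lprojVec m V g := by
  refine (hV.lprojVec_eq_lprojVec_iff hf ((memLp_congr_ae h).1 hf)).2 fun r _ =>
    integral_congr_ae ?_
  filter_upwards [h] with x hx
  rw [hx]

theorem integral_lprojVec_sq_le {v : E d → E d} (hv : MemLp v 2 m) :
    ∫ x, ‖lprojVec m V v x‖ ^ 2 ∂m ≤ ∫ x, ‖v x‖ ^ 2 ∂m := by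
  simp only [EuclideanSpace.real_norm_sq_eq]
  rw [integral_finsetSum _ fun i _ => (MemLp.coord (hV.memLp_vec (hV.lprojVec_mem hv))
    i).integrable_sq,
    integral_finsetSum _ fun i _ => (MemLp.coord hv i).integrable_sq]
  exact Finset.sum_le_sum fun i _ => hV.integral_lproj_sq_le (MemLp.coord hv i)

theorem isLinOn_lprojVec {X : Type*} [AddCommGroup X] [Module ℝ X] {W : Submodule ℝ X}
    {A : X → E d → E d} (hA : ∀ x, IsLinOn W fun w => A w x) (hm : ∀ w ∈ W, MemLp (A w) 2 m)
    (x : E d) : IsLinOn W fun w => lprojVec m V (A w) x := by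
  have h : ∀ i, IsLinOn W fun w => lproj m V (fun y => A w y i) := fun i =>
    hV.isLinOn_lproj (fun y => (hA y).comp (EuclideanSpace.proj (𝕜 := ℝ) i).toLinearMap)
      fun w hw => MemLp.coord (hm w hw) i
  constructor
  · intro a ha b hb
    ext i
    exact congrFun ((h i).1 a ha b hb) x
  · intro c a ha
    ext i
    exact congrFun ((h i).2 c a ha) x

end IsL2Space

section RegularSimplices

open scoped Pointwise

/-! ### Frobenius and operator norms -/

theorem frob_self (A : E d →L[ℝ] E d) : frob A A = ∑ i : Fin d, ‖A (basisVec i)‖ ^ 2 := by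
  simp only [frob, real_inner_self_eq_norm_sq]

theorem frob_self_nonneg (A : E d →L[ℝ] E d) : 0 ≤ frob A A := by
  rw [frob_self]
  positivity

theorem norm_apply_sq_le_frob (A : E d →L[ℝ] E d) (x : E d) : ‖A x‖ ^ 2 ≤ frob A A * ‖x‖ ^ 2 := by
  have hx : A x = ∑ i, x i • A (basisVec i) := by
    conv_lhs => rw [← (EuclideanSpace.basisFun (Fin d) ℝ).sum_repr x]
    simp [map_sum]
  rw [hx, frob_self, EuclideanSpace.real_norm_sq_eq x]
  calc ‖∑ i, x i • A (basisVec i)‖ ^ 2 ≤ (∑ i, |x i| * ‖A (basisVec i)‖) ^ 2 := by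
        gcongr
        exact (norm_sum_le _ _).trans_eq (Finset.sum_congr rfl fun i _ => by
          rw [norm_smul, Real.norm_eq_abs])
    _ ≤ (∑ i, |x i| ^ 2) * ∑ i, ‖A (basisVec i)‖ ^ 2 := Finset.sum_mul_sq_le_sq_mul_sq _ _ _
    _ = _ := by
        simp only [sq_abs]
        ring

theorem opNorm_sq_le_frob (A : E d →L[ℝ] E d) : ‖A‖ ^ 2 ≤ frob A A := by
  have h : ‖A‖ ≤ √(frob A A) := A.opNorm_le_bound (Real.sqrt_nonneg _) fun x => by
    refine le_of_sq_le_sq ?_ (by positivity)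
    rw [mul_pow, Real.sq_sqrt (frob_self_nonneg A)]
    exact norm_apply_sq_le_frob A x
  calc ‖A‖ ^ 2 ≤ √(frob A A) ^ 2 := by gcongr
    _ = _ := Real.sq_sqrt (frob_self_nonneg A)

theorem frob_le_opNorm_sq (A : E d →L[ℝ] E d) : frob A A ≤ d * ‖A‖ ^ 2 := by
  rw [frob_self]
  calc ∑ i : Fin d, ‖A (basisVec i)‖ ^ 2 ≤ ∑ i : Fin d, ‖A‖ ^ 2 := by
        gcongr with i
        simpa using A.le_opNorm (basisVec i)
    _ = _ := by simp

theorem continuous_frob {A B : E d → E d →L[ℝ] E d} (hA : Continuous A) (hB : Continuous B) :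
    Continuous fun x => frob (A x) (B x) := by
  unfold frob
  fun_prop

/-! ### Polynomials on simplices and on their faces -/

theorem memLp_hull {T : Finset (E d)} {G : Type*} [NormedAddCommGroup G] {g : E d → G}
    (hg : Continuous g) : MemLp g 2 (volume.restrict (hull T)) := by
  have : IsFiniteMeasure (volume.restrict (hull T)) :=
    ⟨by simpa using (isCompact_hull T).measure_lt_top⟩
  obtain ⟨C, hC⟩ := (isCompact_hull T).exists_bound_of_continuousOn hg.continuousOn
  exact MemLp.of_bound (integrableOn_hull hg).aestronglyMeasurable C
    ((ae_restrict_mem (measurableSet_hull T)).mono fun x hx => hC x hx)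

theorem memLp_surf {F : Finset (E d)} [IsFiniteMeasure (surf (hull F))] {G : Type*}
    [NormedAddCommGroup G] {g : E d → G} (hg : ContinuousOn g (hull F)) :
    MemLp g 2 (surf (hull F)) := by
  obtain ⟨C, hC⟩ := (isCompact_hull F).exists_bound_of_continuousOn hg
  exact MemLp.of_bound (integrable_surf hg).aestronglyMeasurable C
    ((ae_mem_hull_surf F).mono fun x hx => hC x hx)

theorem IsSimplex.isL2Space_poly [NeZero d] {T : Finset (E d)} (hT : IsSimplex T) (l : ℤ) :
    IsL2Space (volume.restrict (hull T)) (poly d l) where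
  finite := inferInstance
  memLp p hp := memLp_hull (continuous_of_mem_poly hp)
  definite p hp h := by
    have hpc := continuous_of_mem_poly hp
    have h1 := (setIntegral_eq_zero_iff_of_nonneg_ae (ae_of_all _ fun x => sq_nonneg (p x))
      (integrableOn_hull (by fun_prop))).1 h
    have h3 := Measure.eqOn_of_ae_eq (ae_restrict_of_ae_restrict_of_subset interior_subset h1) (by
        fun_prop) continuousOn_const
      (by rw [isOpen_interior.interior_eq]; exact subset_closure)
    exact eq_zero_of_mem_poly_of_isOpen hp isOpen_interior hT.interior_nonempty fun x hx =>
      pow_eq_zero_iff two_ne_zero |>.1 (h3 hx)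

theorem mem_facetPoly_iff {F : Finset (E d)} {l : ℤ} {p : E d → ℝ} :
    p ∈ facetPoly F l ↔ ∃ q ∈ poly d l, (hull F).indicator q = p := Iff.rfl

theorem IsSimplex.isL2Space_facetPoly [NeZero d] {T : Finset (E d)} (hT : IsSimplex T) {v : E d}
    (hv : v ∈ T) (l : ℤ) :
    IsL2Space (surf (hull (T.erase v))) (facetPoly (T.erase v) l) where
  finite := by
    unfold facetPoly
    infer_instance
  memLp p hp := by
    have := hT.isFiniteMeasure_surf hv
    obtain ⟨q, hq, rfl⟩ := mem_facetPoly_iff.1 hp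
    refine memLp_surf ((continuous_of_mem_poly hq).continuousOn.congr fun x hx => ?_)
    exact indicator_of_mem hx q
  definite p hp h := by
    obtain ⟨q, hq, rfl⟩ := mem_facetPoly_iff.1 hp
    have hqc := continuous_of_mem_poly hq
    have h1 : ∫ x, q x ^ 2 ∂(surf (hull (T.erase v))) = 0 := by
      rw [← h]
      refine integral_surf_congr fun x hx => ?_
      rw [indicator_of_mem hx]
    funext x
    by_cases hx : x ∈ hull (T.erase v)
    · rw [indicator_of_mem hx]
      exact pow_eq_zero_iff two_ne_zero |>.1 ((hT.eq_zero_of_integral_face hv (f := fun x => q x ^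
        2) (by fun_prop) (fun x => sq_nonneg _) h1) x hx)
    · rw [indicator_of_notMem hx]
      rfl

/-! ### Shape regularity -/

/-- The simplex `T` contains a ball of center `x` and radius `r`, with `h_T ≤ 2 σ r`. -/
structure HasInball (σ : ℝ) (T : Finset (E d)) (x : E d) (r : ℝ) : Prop where
  isSimplex : IsSimplex T
  pos : 0 < r
  subset : Metric.closedBall x r ⊆ hull T
  diam_le : diam T ≤ σ * (2 * r)

theorem diam_nonneg (T : Finset (E d)) : 0 ≤ diam T := Metric.diam_nonneg

theorem dist_le_diam {T : Finset (E d)} {x y : E d} (hx : x ∈ hull T) (hy : y ∈ hull T) :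
    dist x y ≤ diam T := Metric.dist_le_diam_of_mem (isCompact_hull T).isBounded hx hy

theorem hull_subset_closedBall {T : Finset (E d)} {x : E d} (hx : x ∈ hull T) :
    hull T ⊆ Metric.closedBall x (diam T) := fun _ hy => dist_le_diam hy hx

namespace IsSimplex

variable [NeZero d] {T : Finset (E d)} (hT : IsSimplex T) {v : E d} (hv : v ∈ T)

include hT hv

theorem inner_normal_mem_Icc {x : E d} (hx : x ∈ hull T) :
    inner ℝ (normal T (T.erase v)) (x - v) ∈ Icc 0 (height T v) := by
  have h0 := hT.height_pos hv
  have h1 := hT.mem_hull_iff.1 hx v hv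
  have h2 : bary T v x ≤ 1 := by
    rw [← hT.sum_bary x]
    exact Finset.single_le_sum (fun w hw => hT.mem_hull_iff.1 hx w hw) hv
  rw [bary] at h1 h2
  have e : inner ℝ (normal T (T.erase v)) (x - v) =
      height T v * ((height T v)⁻¹ * inner ℝ (normal T (T.erase v)) (x - v)) := by
    field_simp
  rw [e]
  constructor
  · exact mul_nonneg h0.le (by linarith)
  · nlinarith

theorem height_le_diam : height T v ≤ diam T := by
  obtain ⟨y, hy⟩ := hT.erase_nonempty hv
  rw [← hT.inner_normal_eq_height hv hy]
  refine (real_inner_le_norm _ _).trans ?_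
  rw [hT.norm_normal hv, one_mul, ← dist_eq_norm]
  exact dist_le_diam (subset_convexHull ℝ _ (Finset.mem_of_mem_erase hy)) (subset_convexHull ℝ _ hv)

end IsSimplex

theorem IsSimplex.diam_pos [NeZero d] {T : Finset (E d)} (hT : IsSimplex T) : 0 < diam T := by
  obtain ⟨v, hv⟩ := hT.nonempty
  exact (hT.height_pos hv).trans_le (hT.height_le_diam hv)

namespace HasInball

variable [NeZero d] {σ : ℝ} {T : Finset (E d)} {x₀ : E d} {r : ℝ} (hT : HasInball σ T x₀ r)

include hT

omit [NeZero d] in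
theorem center_mem : x₀ ∈ hull T := hT.subset (Metric.mem_closedBall_self hT.pos.le)

theorem two_mul_le_height {v : E d} (hv : v ∈ T) : 2 * r ≤ height T v := by
  set n := normal T (T.erase v)
  have hn : ‖n‖ = 1 := hT.isSimplex.norm_normal hv
  have hnn : inner ℝ n n = 1 := by rw [real_inner_self_eq_norm_sq, hn]; norm_num
  have hr := hT.pos
  have h1 : x₀ + r • n ∈ hull T := hT.subset (by
    simp [norm_smul, hn, abs_of_pos hr])
  have h2 : x₀ - r • n ∈ hull T := hT.subset (by
    simp [Metric.mem_closedBall, norm_smul, hn, abs_of_pos hr])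
  have h3 := (hT.isSimplex.inner_normal_mem_Icc hv h1).2
  have h4 := (hT.isSimplex.inner_normal_mem_Icc hv h2).1
  have e1 : x₀ + r • n - v = (x₀ - v) + r • n := by abel
  have e2 : x₀ - r • n - v = (x₀ - v) - r • n := by abel
  rw [e1, inner_add_right, inner_smul_right, hnn] at h3
  rw [e2, inner_sub_right, inner_smul_right, hnn] at h4
  linarith

theorem diam_pos : 0 < diam T := hT.isSimplex.diam_pos

theorem two_mul_le_diam : 2 * r ≤ diam T := by
  obtain ⟨v, hv⟩ := hT.isSimplex.nonempty
  exact (hT.two_mul_le_height hv).trans (hT.isSimplex.height_le_diam hv)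

theorem one_le : 1 ≤ σ := by
  have h1 := hT.two_mul_le_diam
  have h2 := hT.diam_le
  have h3 := hT.pos
  by_contra h
  nlinarith

theorem diam_le_height {v : E d} (hv : v ∈ T) : diam T ≤ σ * height T v := by
  have h1 := hT.one_le
  exact hT.diam_le.trans (by gcongr; exact hT.two_mul_le_height hv)

end HasInball

/-! ### The trace inequality -/

/-- The multiplicative trace inequality, a consequence of the divergence theorem applied to
`‖φ(x)‖² (x - v)`. -/
theorem IsSimplex.trace_inequality [NeZero d] {T : Finset (E d)} (hT : IsSimplex T) {v : E d}
    (hv : v ∈ T) {G : Type*} [NormedAddCommGroup G] [InnerProductSpace ℝ G] {φ : E d → G}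
    (hφ : ContDiff ℝ 1 φ) :
    height T v * ∫ y, ‖φ y‖ ^ 2 ∂(surf (hull (T.erase v))) ≤
      (d + 1) * (∫ x in hull T, ‖φ x‖ ^ 2) + diam T ^ 2 * ∫ x in hull T, ‖fderiv ℝ φ x‖ ^ 2 := by
  have hsq : ContDiff ℝ 1 fun x => ‖φ x‖ ^ 2 := hφ.norm_sq ℝ
  have hsq' : Continuous fun x => fderiv ℝ (fun x => ‖φ x‖ ^ 2) x := hsq.continuous_fderiv one_ne_zero
  rw [← hT.integral_div_cone hv hsq, ← integral_const_mul, ← integral_const_mul, ← integral_add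
    (integrableOn_hull (by fun_prop)) (integrableOn_hull (by fun_prop))]
  refine setIntegral_mono_on (integrableOn_hull (by fun_prop)) (integrableOn_hull (by fun_prop))
    (measurableSet_hull T) fun x hx => ?_
  have h1 : fderiv ℝ (fun x => ‖φ x‖ ^ 2) x (x - v) = 2 * inner ℝ (φ x) (fderiv ℝ φ x (x - v)) := by
    have := ((hφ.differentiable one_ne_zero) x).hasFDerivAt.norm_sq
    rw [this.fderiv]
    simp
  have h2 : ‖x - v‖ ≤ diam T := by
    rw [← dist_eq_norm]
    exact dist_le_diam hx (subset_convexHull ℝ _ hv)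
  have h3 : inner ℝ (φ x) (fderiv ℝ φ x (x - v)) ≤ ‖φ x‖ * (‖fderiv ℝ φ x‖ * diam T) :=
    (real_inner_le_norm _ _).trans (by
      gcongr
      exact ((fderiv ℝ φ x).le_opNorm _).trans (by gcongr))
  nlinarith [sq_nonneg (‖φ x‖ - ‖fderiv ℝ φ x‖ * diam T)]

/-! ### Scaling -/

theorem integral_closedBall_scale (x₀ : E d) {h : ℝ} (hh : 0 < h) (ρ : ℝ) (f : E d → ℝ) :
    ∫ x in Metric.closedBall x₀ (h * ρ), f x =
      h ^ d * ∫ y in Metric.closedBall (0 : E d) ρ, f (x₀ + h • y) := by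
  have h1 := Measure.setIntegral_comp_smul_of_pos (volume : Measure (E d)) (fun y => f (x₀ + y))
    (Metric.closedBall (0 : E d) ρ) hh
  have h2 : h • Metric.closedBall (0 : E d) ρ = Metric.closedBall 0 (h * ρ) := by
    rw [smul_closedBall' hh.ne', smul_zero, Real.norm_eq_abs, abs_of_pos hh]
  have h3 : Metric.closedBall (0 : E d) (h * ρ) =
      (fun y => x₀ + y) ⁻¹' Metric.closedBall x₀ (h * ρ) := by
    ext y
    simp
  have h4 := (measurePreserving_add_left (volume : Measure (E d)) x₀).setIntegral_preimage_emb
    (measurableEmbedding_addLeft x₀) f (Metric.closedBall x₀ (h * ρ))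
  rw [h1, h2, h3, h4]
  simp only [finrank_euclideanSpace, Fintype.card_fin, smul_eq_mul]
  rw [← mul_assoc, mul_inv_cancel₀ (pow_pos hh d).ne', one_mul]

namespace HasInball

variable [NeZero d] {σ : ℝ} {T : Finset (E d)} {x₀ : E d} {r : ℝ} (hT : HasInball σ T x₀ r)

include hT

theorem integral_hull_le {f : E d → ℝ} (hf : Continuous f) (hf0 : ∀ x, 0 ≤ f x) :
    ∫ x in hull T, f x ≤
      diam T ^ d * ∫ y in Metric.closedBall (0 : E d) 1, f (x₀ + diam T • y) := by
  rw [← integral_closedBall_scale x₀ hT.diam_pos, mul_one]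
  exact setIntegral_mono_set (hf.continuousOn.integrableOn_compact (isCompact_closedBall _ _))
    (ae_of_all _ hf0) (hull_subset_closedBall hT.center_mem).eventuallyLE

theorem le_integral_ball {f : E d → ℝ} (hf : Continuous f) (hf0 : ∀ x, 0 ≤ f x) :
    diam T ^ d * ∫ y in Metric.closedBall (0 : E d) (4 * σ)⁻¹, f (x₀ + diam T • y) ≤
      ∫ x in Metric.closedBall x₀ (r / 2), f x := by
  rw [← integral_closedBall_scale x₀ hT.diam_pos]
  refine setIntegral_mono_set (hf.continuousOn.integrableOn_compact (isCompact_closedBall _ _))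
    (ae_of_all _ hf0) (Metric.closedBall_subset_closedBall ?_).eventuallyLE
  have h1 := hT.one_le
  have h2 := hT.diam_le
  rw [← div_eq_mul_inv, div_le_iff₀ (by positivity)]
  linarith

omit [NeZero d] in
theorem ball_half_subset : Metric.closedBall x₀ (r / 2) ⊆ hull T :=
  (Metric.closedBall_subset_closedBall (by have := hT.pos; linarith)).trans hT.subset

omit [NeZero d] in
theorem integral_ball_le {f : E d → ℝ} (hf : Continuous f) (hf0 : ∀ x, 0 ≤ f x) :
    ∫ x in Metric.closedBall x₀ (r / 2), f x ≤ ∫ x in hull T, f x :=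
  setIntegral_mono_set (integrableOn_hull hf) (ae_of_all _ hf0) hT.ball_half_subset.eventuallyLE

end HasInball

theorem memLp_closedBall {G : Type*} [NormedAddCommGroup G] {g : E d → G} (hg : Continuous g)
    (ρ : ℝ) : MemLp g 2 (volume.restrict (Metric.closedBall 0 ρ)) := by
  have : IsFiniteMeasure (volume.restrict (Metric.closedBall (0 : E d) ρ)) :=
    ⟨by simpa using (isCompact_closedBall _ _).measure_lt_top⟩
  obtain ⟨C, hC⟩ := (isCompact_closedBall (0 : E d) ρ).exists_bound_of_continuousOn hg.continuousOn
  exact MemLp.of_bound (hg.continuousOn.integrableOn_compact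
    (isCompact_closedBall _ _)).aestronglyMeasurable C
      ((ae_restrict_mem measurableSet_closedBall).mono fun x hx => hC x hx)

theorem eq_zero_of_ae_closedBall {G : Type*} [NormedAddCommGroup G] {g : E d → G}
    (hg : Continuous g) {ρ : ℝ} (h : g =ᵐ[volume.restrict (Metric.closedBall 0 ρ)] 0) :
    ∀ x ∈ Metric.ball (0 : E d) ρ, g x = 0 := by
  have h2 : g =ᵐ[volume.restrict (Metric.ball 0 ρ)] 0 :=
    ae_restrict_of_ae_restrict_of_subset Metric.ball_subset_closedBall h
  exact Measure.eqOn_of_ae_eq h2 hg.continuousOn continuousOn_const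
    (by rw [Metric.isOpen_ball.interior_eq]; exact subset_closure)

/-- The differential, as a linear operator on polynomial fields. -/
def fderivVec (d : ℕ) (m : ℤ) : vec (poly d m) →ₗ[ℝ] E d → E d →L[ℝ] E d where
  toFun w x := fderiv ℝ w.1 x
  map_add' w z := by
    funext x
    exact fderiv_add ((differentiable_of_mem_vec w.2) x) ((differentiable_of_mem_vec z.2) x)
  map_smul' c w := by
    funext x
    exact fderiv_const_smul ((differentiable_of_mem_vec w.2) x) c

theorem continuous_fderiv_of_mem_vec {m : ℤ} {w : E d → E d} (hw : w ∈ vec (poly d m)) :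
    Continuous fun x => fderiv ℝ w x :=
  (contDiff_of_mem_vec hw (n := 1)).continuous_fderiv one_ne_zero

theorem comp_affine_mem_vec {m : ℤ} {w : E d → E d} (hw : w ∈ vec (poly d m)) (c : E d) (s : ℝ) :
    (fun x => w (c + s • x)) ∈ vec (poly d m) := fun i => comp_affine_mem_poly (hw i) c s

theorem fderiv_comp_scale {w : E d → E d} (hw : Differentiable ℝ w) (x₀ : E d) (h : ℝ) (y : E d) :
    fderiv ℝ (fun y => w (x₀ + h • y)) y = h • fderiv ℝ w (x₀ + h • y) := by
  have h1 : HasFDerivAt (fun y : E d => x₀ + h • y) (h • ContinuousLinearMap.id ℝ (E d)) y :=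
    ((hasFDerivAt_id y).const_smul h).const_add x₀
  have h2 := (hw (x₀ + h • y)).hasFDerivAt.comp y h1
  rw [show (fun y => w (x₀ + h • y)) = w ∘ fun y => x₀ + h • y from rfl, h2.fderiv]
  ext z
  simp

/-- A polynomial field on a shape regular simplex is controlled by its restriction to a ball. -/
theorem exists_integral_hull_le_ball [NeZero d] (m : ℤ) {σ : ℝ} (hσ : 1 ≤ σ) :
    ∃ C : ℝ, 0 < C ∧ ∀ (T : Finset (E d)) (x₀ : E d) (r : ℝ), HasInball σ T x₀ r →
      ∀ w ∈ vec (poly d m),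
        ∫ x in hull T, ‖w x‖ ^ 2 ≤ C * ∫ x in Metric.closedBall x₀ (r / 2), ‖w x‖ ^ 2 := by
  obtain ⟨C, hC, h⟩ := exists_integral_le (X := vec (poly d m))
    (m₁ := volume.restrict (Metric.closedBall (0 : E d) 1))
    (m₂ := volume.restrict (Metric.closedBall (0 : E d) (4 * σ)⁻¹))
    (vec (poly d m)).subtype (vec (poly d m)).subtype
    (fun w => memLp_closedBall (continuous_of_mem_vec w.2) _)
    (fun w => memLp_closedBall (continuous_of_mem_vec w.2) _)
    (fun w hw => by
      have h1 := eq_zero_of_ae_closedBall (continuous_of_mem_vec w.2) hw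
      have h2 : w.1 = 0 := eq_zero_of_mem_vec_of_isOpen w.2 Metric.isOpen_ball
        (Metric.nonempty_ball.2 (by positivity)) h1
      simp [h2])
  refine ⟨C, hC, fun T x₀ r hT w hw => ?_⟩
  have hwc := continuous_of_mem_vec hw
  have hd := pow_pos hT.diam_pos d
  calc ∫ x in hull T, ‖w x‖ ^ 2 ≤ diam T ^ d * ∫ y in Metric.closedBall (0 : E d) 1,
        ‖w (x₀ + diam T • y)‖ ^ 2 := hT.integral_hull_le (by fun_prop) fun x => sq_nonneg _
    _ ≤ diam T ^ d * (C * ∫ y in Metric.closedBall (0 : E d) (4 * σ)⁻¹,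
        ‖w (x₀ + diam T • y)‖ ^ 2) := by
        gcongr
        exact h ⟨_, comp_affine_mem_vec hw x₀ (diam T)⟩
    _ = C * (diam T ^ d * ∫ y in Metric.closedBall (0 : E d) (4 * σ)⁻¹,
        ‖w (x₀ + diam T • y)‖ ^ 2) := by ring
    _ ≤ _ := by
        gcongr
        exact hT.le_integral_ball (f := fun x => ‖w x‖ ^ 2) (by fun_prop) fun x => sq_nonneg _

/-- The inverse inequality for polynomial fields on shape regular simplices. -/
theorem exists_inverse_inequality [NeZero d] (m : ℤ) {σ : ℝ} (hσ : 1 ≤ σ) :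
    ∃ C : ℝ, 0 < C ∧ ∀ (T : Finset (E d)) (x₀ : E d) (r : ℝ), HasInball σ T x₀ r →
      ∀ w ∈ vec (poly d m),
        diam T ^ 2 * ∫ x in hull T, ‖fderiv ℝ w x‖ ^ 2 ≤ C * ∫ x in hull T, ‖w x‖ ^ 2 := by
  obtain ⟨C, hC, h⟩ := exists_integral_le (X := vec (poly d m))
    (m₁ := volume.restrict (Metric.closedBall (0 : E d) 1))
    (m₂ := volume.restrict (Metric.closedBall (0 : E d) (4 * σ)⁻¹))
    (fderivVec d m) (vec (poly d m)).subtype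
    (fun w => memLp_closedBall (continuous_fderiv_of_mem_vec w.2) _)
    (fun w => memLp_closedBall (continuous_of_mem_vec w.2) _)
    (fun w hw => by
      have h1 := eq_zero_of_ae_closedBall (continuous_of_mem_vec w.2) hw
      have h2 : w.1 = 0 := eq_zero_of_mem_vec_of_isOpen w.2 Metric.isOpen_ball
        (Metric.nonempty_ball.2 (by positivity)) h1
      have h3 : w = 0 := Subtype.ext h2
      rw [h3, map_zero])
  refine ⟨C, hC, fun T x₀ r hT w hw => ?_⟩
  have hwc := continuous_of_mem_vec hw
  have hwd := continuous_fderiv_of_mem_vec hw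
  have hd := pow_pos hT.diam_pos d
  calc diam T ^ 2 * ∫ x in hull T, ‖fderiv ℝ w x‖ ^ 2
      ≤ diam T ^ 2 * (diam T ^ d * ∫ y in Metric.closedBall (0 : E d) 1,
        ‖fderiv ℝ w (x₀ + diam T • y)‖ ^ 2) := by
        gcongr
        exact hT.integral_hull_le (f := fun x => ‖fderiv ℝ w x‖ ^ 2) (by fun_prop)
          fun x => sq_nonneg _
    _ = diam T ^ d * ∫ y in Metric.closedBall (0 : E d) 1,
        ‖fderiv ℝ (fun y => w (x₀ + diam T • y)) y‖ ^ 2 := by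
        simp only [fderiv_comp_scale (differentiable_of_mem_vec hw), norm_smul, mul_pow,
          integral_const_mul, Real.norm_eq_abs, sq_abs]
        ring
    _ ≤ diam T ^ d * (C * ∫ y in Metric.closedBall (0 : E d) (4 * σ)⁻¹,
        ‖w (x₀ + diam T • y)‖ ^ 2) := by
        gcongr
        exact h ⟨_, comp_affine_mem_vec hw x₀ (diam T)⟩
    _ = C * (diam T ^ d * ∫ y in Metric.closedBall (0 : E d) (4 * σ)⁻¹,
        ‖w (x₀ + diam T • y)‖ ^ 2) := by ring
    _ ≤ C * ∫ x in Metric.closedBall x₀ (r / 2), ‖w x‖ ^ 2 := by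
        gcongr
        exact hT.le_integral_ball (f := fun x => ‖w x‖ ^ 2) (by fun_prop) fun x => sq_nonneg _
    _ ≤ _ := mul_le_mul_of_nonneg_left (hT.integral_ball_le (f := fun x => ‖w x‖ ^ 2)
        (by fun_prop) fun x => sq_nonneg _) hC.le

/-- The Poincaré inequality for polynomial fields on shape regular simplices. -/
theorem exists_poincare_inequality [NeZero d] {m : ℤ} (hm : 0 ≤ m) {σ : ℝ} (hσ : 1 ≤ σ) :
    ∃ C : ℝ, 0 < C ∧ ∀ (T : Finset (E d)) (x₀ : E d) (r : ℝ), HasInball σ T x₀ r →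
      ∀ w ∈ vec (poly d m),
        ∫ x in hull T, ‖w x - w x₀‖ ^ 2 ≤ C * (diam T ^ 2 * ∫ x in hull T, ‖fderiv ℝ w x‖ ^ 2) := by
  let A : vec (poly d m) →ₗ[ℝ] E d → E d :=
    { toFun := fun w x => w.1 x - w.1 0
      map_add' := fun w z => by
        funext x
        exact add_sub_add_comm _ _ _ _
      map_smul' := fun c w => by
        funext x
        exact (smul_sub c (w.1 x) (w.1 0)).symm }
  obtain ⟨C, hC, h⟩ := exists_integral_le (X := vec (poly d m))
    (m₁ := volume.restrict (Metric.closedBall (0 : E d) 1))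
    (m₂ := volume.restrict (Metric.closedBall (0 : E d) (4 * σ)⁻¹))
    A (fderivVec d m)
    (fun w => memLp_closedBall ((continuous_of_mem_vec w.2).sub continuous_const) _)
    (fun w => memLp_closedBall (continuous_fderiv_of_mem_vec w.2) _)
    (fun w hw => by
      have hρ : 0 < (4 * σ)⁻¹ := by positivity
      have h2 : ∀ x ∈ Metric.ball (0 : E d) (4 * σ)⁻¹, w.1 x - w.1 0 = 0 := fun x hx =>
        sub_eq_zero.2 (Metric.isOpen_ball.is_const_of_fderiv_eq_zero
          (convex_ball _ _).isPreconnected (differentiable_of_mem_vec w.2).differentiableOn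
          (fun x hx => (eq_zero_of_ae_closedBall (continuous_fderiv_of_mem_vec w.2) hw) x hx) hx
            (Metric.mem_ball_self hρ))
      have h3 : A w = 0 := eq_zero_of_mem_vec_of_isOpen (l := m)
        ((vec (poly d m)).sub_mem w.2 (const_mem_vec hm _)) Metric.isOpen_ball
        (Metric.nonempty_ball.2 hρ) h2
      rw [h3])
  refine ⟨C, hC, fun T x₀ r hT w hw => ?_⟩
  have hwc := continuous_of_mem_vec hw
  have hwd := continuous_fderiv_of_mem_vec hw
  have hd := pow_pos hT.diam_pos d
  calc ∫ x in hull T, ‖w x - w x₀‖ ^ 2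
      ≤ diam T ^ d * ∫ y in Metric.closedBall (0 : E d) 1,
        ‖w (x₀ + diam T • y) - w x₀‖ ^ 2 :=
        hT.integral_hull_le (f := fun x => ‖w x - w x₀‖ ^ 2) (by fun_prop) fun x => sq_nonneg _
    _ ≤ diam T ^ d * (C * ∫ y in Metric.closedBall (0 : E d) (4 * σ)⁻¹,
        ‖fderiv ℝ (fun y => w (x₀ + diam T • y)) y‖ ^ 2) := by
        gcongr
        have := h ⟨_, comp_affine_mem_vec hw x₀ (diam T)⟩
        simpa only [A, fderivVec, LinearMap.coe_mk, AddHom.coe_mk, smul_zero, add_zero] using this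
    _ = C * (diam T ^ 2 * (diam T ^ d * ∫ y in Metric.closedBall (0 : E d) (4 * σ)⁻¹,
        ‖fderiv ℝ w (x₀ + diam T • y)‖ ^ 2)) := by
        simp only [fderiv_comp_scale (differentiable_of_mem_vec hw), norm_smul, mul_pow,
          integral_const_mul, Real.norm_eq_abs, sq_abs]
        ring
    _ ≤ C * (diam T ^ 2 * ∫ x in Metric.closedBall x₀ (r / 2), ‖fderiv ℝ w x‖ ^ 2) := by
        gcongr
        exact hT.le_integral_ball (f := fun x => ‖fderiv ℝ w x‖ ^ 2) (by fun_prop)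
          fun x => sq_nonneg _
    _ ≤ _ := mul_le_mul_of_nonneg_left (mul_le_mul_of_nonneg_left
        (hT.integral_ball_le (f := fun x => ‖fderiv ℝ w x‖ ^ 2) (by fun_prop)
          fun x => sq_nonneg _) (sq_nonneg _)) hC.le

end RegularSimplices

/-! ### Green's formula -/

theorem dvg_smul {p : E d → ℝ} {ψ : E d → E d} {x : E d} (hp : DifferentiableAt ℝ p x)
    (hψ : DifferentiableAt ℝ ψ x) :
    dvg (fun x => p x • ψ x) x = p x * dvg ψ x + fderiv ℝ p x (ψ x) := by
  unfold dvg
  have h : fderiv ℝ (fun x => p x • ψ x) x = p x • fderiv ℝ ψ x + (fderiv ℝ p x).smulRight (ψ x) :=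
    (hp.hasFDerivAt.smul hψ.hasFDerivAt).fderiv
  have e : fderiv ℝ p x (ψ x) = ∑ i, ψ x i * fderiv ℝ p x (basisVec i) := by
    conv_lhs => rw [← (EuclideanSpace.basisFun (Fin d) ℝ).sum_repr (ψ x)]
    simp [map_sum]
  rw [h, e, Finset.mul_sum, ← Finset.sum_add_distrib]
  refine Finset.sum_congr rfl fun i _ => ?_
  simp [mul_comm]

theorem continuous_dvg {ψ : E d → E d} (hψ : ContDiff ℝ 1 ψ) : Continuous (dvg ψ) := by
  have : Continuous fun x => fderiv ℝ ψ x := hψ.continuous_fderiv one_ne_zero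
  unfold dvg
  fun_prop

section Green

variable [NeZero d] {T : Finset (E d)} (hT : IsSimplex T)

include hT

theorem IsSimplex.integral_dvg {ψ : E d → E d} (hψ : ContDiff ℝ 1 ψ) :
    ∫ x in hull T, dvg ψ x =
      ∑ v ∈ T, ∫ y, inner ℝ (ψ y) (normal T (T.erase v)) ∂(surf (hull (T.erase v))) := by
  have hψ' : Continuous fun x => fderiv ℝ ψ x := hψ.continuous_fderiv one_ne_zero
  have hψc := hψ.continuous
  unfold dvg
  rw [integral_finsetSum _ fun i _ => integrableOn_hull (by fun_prop)]
  have h : ∀ i : Fin d, ∫ x in hull T, fderiv ℝ ψ x (basisVec i) i = ∑ v ∈ T,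
      ∫ y, normal T (T.erase v) i * ψ y i ∂(surf (hull (T.erase v))) := by
    intro i
    have hψi : ContDiff ℝ 1 fun x => ψ x i := (contDiff_euclidean.1 hψ) i
    simp only [fderiv_apply_coord (hψ.differentiable one_ne_zero _)]
    rw [hT.integral_fderiv hψi]
    refine Finset.sum_congr rfl fun v _ => ?_
    rw [integral_const_mul, EuclideanSpace.inner_single_left]
    simp
  rw [Finset.sum_congr rfl fun i _ => h i, Finset.sum_comm]
  refine Finset.sum_congr rfl fun v hv => ?_
  have := hT.isFiniteMeasure_surf hv
  rw [← integral_finsetSum _ fun i _ => integrable_surf (by fun_prop)]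
  simp only [inner_eq_sum, mul_comm]

/-- **Green's formula** on a simplex. -/
theorem IsSimplex.integral_mul_dvg {p : E d → ℝ} {ψ : E d → E d} (hp : ContDiff ℝ 1 p)
    (hψ : ContDiff ℝ 1 ψ) :
    (∫ x in hull T, p x * dvg ψ x) + ∫ x in hull T, fderiv ℝ p x (ψ x) =
      ∑ v ∈ T, ∫ y, p y * inner ℝ (ψ y) (normal T (T.erase v)) ∂(surf (hull (T.erase v))) := by
  have hp' : Continuous fun x => fderiv ℝ p x := hp.continuous_fderiv one_ne_zero
  have hpc := hp.continuous
  have hψc := hψ.continuous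
  have hdc := continuous_dvg hψ
  have h := hT.integral_dvg (ψ := fun x => p x • ψ x) (hp.smul hψ)
  simp only [real_inner_smul_left] at h
  rw [← h, ← integral_add (integrableOn_hull (by fun_prop)) (integrableOn_hull (by fun_prop))]
  congr 1
  funext x
  rw [dvg_smul (hp.differentiable one_ne_zero x) (hψ.differentiable one_ne_zero x)]

theorem IsSimplex.eq_zero_of_inner_normal {e : E d}
    (h : ∀ v ∈ T, inner ℝ (normal T (T.erase v)) e = 0) : e = 0 := by
  have h1 := hT.sum_bary_smul (0 + e)
  have h2 := hT.sum_bary_smul 0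
  rw [Finset.sum_congr rfl fun v hv => by
    rw [show bary T v (0 + e) = bary T v 0 by
      rw [bary, bary, add_sub_right_comm, inner_add_right, h v hv, add_zero]], h2] at h1
  simpa using h1.symm

end Green

/-! ### Unisolvence of the Raviart--Thomas--Nédélec element -/

/-- The gradient of a scalar function. -/
def gradVec (p : E d → ℝ) (x : E d) : E d := WithLp.toLp 2 fun i => fderiv ℝ p x (basisVec i)

theorem inner_gradVec (p : E d → ℝ) (x w : E d) : inner ℝ w (gradVec p x) = fderiv ℝ p x w := by
  conv_rhs => rw [← (EuclideanSpace.basisFun (Fin d) ℝ).sum_repr w]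
  rw [inner_eq_sum]
  simp [map_sum, gradVec]

theorem gradVec_mem_vec {k : ℤ} {p : E d → ℝ} (hp : p ∈ poly d k) :
    gradVec p ∈ vec (poly d (k - 1)) := fun i => fderiv_mem_poly hp (basisVec i)

theorem smul_const_mem_vec {l : ℤ} {p : E d → ℝ} (hp : p ∈ poly d l) (n : E d) :
    (fun x => p x • n) ∈ vec (poly d l) := fun i => by
  have := (poly d l).smul_mem (n i) hp
  convert! this using 1
  funext x
  simp [mul_comm]

theorem contDiff_of_mem_RTN {k : ℕ} {w : E d → E d} (hw : w ∈ RTN d (k + 1)) {n : WithTop ℕ∞} :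
    ContDiff ℝ n w := contDiff_of_mem_vec (RTN_le_vec k hw)

theorem continuous_of_mem_RTN {k : ℕ} {w : E d → E d} (hw : w ∈ RTN d (k + 1)) : Continuous w :=
  continuous_of_mem_vec (RTN_le_vec k hw)

theorem integral_surf_eq_zero {F : Finset (E d)} {f : E d → ℝ} (h : ∀ x ∈ hull F, f x = 0) :
    ∫ x, f x ∂(surf (hull F)) = 0 :=
  integral_eq_zero_of_ae ((ae_mem_hull_surf F).mono h)

section Unisolvence

variable [NeZero d] {T : Finset (E d)} (hT : IsSimplex T)

include hT

theorem IsSimplex.dvg_eq_zero_of_dofs {k : ℕ} {w : E d → E d} (hw : w ∈ RTN d (k + 1))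
    (hn : ∀ v ∈ T, ∀ x ∈ hull (T.erase v), inner ℝ (w x) (normal T (T.erase v)) = 0)
    (hm : ∀ s ∈ vec (poly d ((k : ℤ) - 1)), ∫ x in hull T, inner ℝ (w x) (s x) = 0) :
    dvg w = 0 := by
  have hp := dvg_mem_poly_of_mem_RTN hw
  refine (hT.isL2Space_poly k).definite _ hp ?_
  have h := hT.integral_mul_dvg (contDiff_of_mem_poly hp) (contDiff_of_mem_RTN hw)
  have h1 : ∫ x in hull T, fderiv ℝ (dvg w) x (w x) = 0 := by
    rw [← hm _ (gradVec_mem_vec hp)]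
    simp only [inner_gradVec]
  rw [h1, add_zero, Finset.sum_eq_zero] at h
  · simpa only [sq] using h
  · exact fun v hv => integral_surf_eq_zero fun x hx => by rw [hn v hv x hx, mul_zero]

/-- A Raviart--Thomas--Nédélec field with vanishing degrees of freedom is zero. -/
theorem IsSimplex.eq_zero_of_dofs {k : ℕ} {w : E d → E d} (hw : w ∈ RTN d (k + 1))
    (hn : ∀ v ∈ T, ∀ x ∈ hull (T.erase v), inner ℝ (w x) (normal T (T.erase v)) = 0)
    (hm : ∀ s ∈ vec (poly d ((k : ℤ) - 1)), ∫ x in hull T, inner ℝ (w x) (s x) = 0) : w = 0 := by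
  have hwk := mem_vec_of_dvg_eq_zero (NeZero.pos d) hw (hT.dvg_eq_zero_of_dofs hw hn hm)
  suffices h : ∀ v ∈ T, (fun x => inner ℝ (w x) (normal T (T.erase v))) = 0 by
    funext x
    exact hT.eq_zero_of_inner_normal fun v hv => by
      rw [real_inner_comm]
      exact congrFun (h v hv) x
  intro v hv
  set n := normal T (T.erase v)
  set g : E d → ℝ := fun x => inner ℝ (w x) n with hg_def
  have hg : g ∈ poly d k := inner_mem_poly (b := 0) (by omega) hwk (const_mem_vec le_rfl n)
  have hgs : ContDiff ℝ 2 g := contDiff_of_mem_poly hg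
  have hg1 : ContDiff ℝ 1 g := contDiff_of_mem_poly hg
  have horth : ∀ q ∈ poly d ((k : ℤ) - 1), ∫ x in hull T, g x * q x = 0 := by
    intro q hq
    rw [← hm _ (smul_const_mem_vec hq n)]
    simp only [real_inner_smul_right, hg_def, mul_comm]
  -- the normal component vanishes on the other faces
  have hgj : ∀ w' ∈ T, ∀ x ∈ hull (T.erase w'), g x = 0 := by
    intro w' hw'
    have hq := fderiv_mem_poly hg (w' - v)
    have h1 := hT.integral_fderiv_edge hv hw' (φ := fun x => g x ^ 2) (hg1.pow 2)
    rw [integral_surf_eq_zero (f := fun x => g x ^ 2) (F := T.erase v) fun x hx => by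
      rw [hg_def]; simp [n, hn v hv x hx], mul_zero, zero_sub] at h1
    have h2 : ∀ x, fderiv ℝ (fun x => g x ^ 2) x (w' - v) =
        2 * (g x * fderiv ℝ g x (w' - v)) := by
      intro x
      rw [fderiv_fun_pow 2 (hg1.differentiable one_ne_zero x)]
      simp
      ring
    simp only [h2] at h1
    rw [integral_const_mul, horth _ hq, mul_zero, zero_eq_neg, mul_eq_zero] at h1
    have h3 := hT.eq_zero_of_integral_face hw' (f := fun x => g x ^ 2)
      (hg1.continuous.pow 2) (fun x => sq_nonneg _) (h1.resolve_left (hT.height_pos hw').ne')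
    exact fun x hx => pow_eq_zero_iff two_ne_zero |>.1 (h3 x hx)
  -- hence its derivatives along the edges vanish
  have hder : ∀ w' ∈ T, (fun x => fderiv ℝ g x (w' - v)) = 0 := by
    intro w' hw'
    set q : E d → ℝ := fun x => fderiv ℝ g x (w' - v) with hq_def
    have hq : q ∈ poly d ((k : ℤ) - 1) := fderiv_mem_poly hg (w' - v)
    have hq1 : ContDiff ℝ 1 q := contDiff_of_mem_poly hq
    have hqq : (fun x => fderiv ℝ q x (w' - v)) ∈ poly d ((k : ℤ) - 1) :=
      poly_mono (by omega) (fderiv_mem_poly hq (w' - v))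
    have h1 := hT.integral_fderiv_edge hv hw' (φ := fun x => g x * q x) (hg1.mul hq1)
    rw [integral_surf_eq_zero (F := T.erase v) fun x hx => by rw [hgj v hv x hx, zero_mul],
      integral_surf_eq_zero (F := T.erase w') fun x hx => by
        rw [hgj w' hw' x hx, zero_mul]] at h1
    have h2 : ∀ x, fderiv ℝ (fun x => g x * q x) x (w' - v) =
        g x * fderiv ℝ q x (w' - v) + q x ^ 2 := by
      intro x
      rw [fderiv_fun_mul (hg1.differentiable one_ne_zero x) (hq1.differentiable one_ne_zero x)]
      simp [hq_def]
      ring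
    have hqc := hq1.continuous
    have hgc := hg1.continuous
    have hqqc := continuous_of_mem_poly hqq
    simp only [h2] at h1
    rw [integral_add (integrableOn_hull (by fun_prop)) (integrableOn_hull (by fun_prop)),
      horth _ hqq] at h1
    exact (hT.isL2Space_poly _).definite q hq (by linarith)
  have hfd : ∀ x, fderiv ℝ g x = 0 := by
    intro x
    ext e
    have he : e = ∑ w ∈ T, bary T w (v + e) • (w - v) := by
      simp only [smul_sub, Finset.sum_sub_distrib, ← Finset.sum_smul, hT.sum_bary, hT.sum_bary_smul]
      simp
    rw [he, map_sum]
    refine Finset.sum_eq_zero fun w' hw' => ?_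
    rw [map_smul, show fderiv ℝ g x (w' - v) = 0 from congrFun (hder w' hw') x, smul_zero]
  obtain ⟨y, hy⟩ := hT.erase_nonempty hv
  funext x
  rw [is_const_of_fderiv_eq_zero (hg1.differentiable one_ne_zero) hfd x y]
  exact hgj v hv y (subset_convexHull ℝ _ hy)

end Unisolvence

/-! ### Bubbles -/

/-- The field built on `s` that has no normal component on the boundary of the simplex `T`. -/
def bubble (T : Finset (E d)) (s : E d → E d) (x : E d) : E d :=
  -∑ v ∈ T, (bary T v x * inner ℝ (s x) v) • (x - v)

theorem bary_mem_poly (T : Finset (E d)) (v : E d) : bary T v ∈ poly d 1 :=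
  (poly d 1).sub_mem (const_mem_poly zero_le_one 1)
    ((poly d 1).smul_mem _ (inner_sub_mem_poly le_rfl _ _))

theorem bubble_mem_RTN (T : Finset (E d)) {k : ℕ} {s : E d → E d}
    (hs : s ∈ vec (poly d ((k : ℤ) - 1))) : bubble T s ∈ RTN d (k + 1) := by
  have e : bubble T s = -∑ v ∈ T, fun x => (bary T v x * inner ℝ (s x) v) • (x - v) := by
    funext x
    simp [bubble]
  rw [e]
  refine Submodule.neg_mem _ (Submodule.sum_mem _ fun v _ => sub_smul_mem_RTN ?_ v)
  exact mul_mem_poly (a := 1) (b := (k : ℤ) - 1) (by omega) (bary_mem_poly T v)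
    (inner_mem_poly (b := 0) (by omega) hs (const_mem_vec le_rfl v))

section Bubble

variable [NeZero d] {T : Finset (E d)} (hT : IsSimplex T)

include hT

theorem IsSimplex.inner_bubble_normal (s : E d → E d) {v : E d} (hv : v ∈ T) {x : E d}
    (hx : x ∈ hull (T.erase v)) : inner ℝ (bubble T s x) (normal T (T.erase v)) = 0 := by
  rw [bubble, inner_neg_left, sum_inner, Finset.sum_eq_zero, neg_zero]
  intro w hw
  rw [real_inner_smul_left, real_inner_comm (normal T (T.erase v))]
  by_cases h : w = v
  · rw [h, ((hT.mem_face_iff hv).1 hx).2]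
    ring
  · rw [hT.inner_normal_vertex_of_mem_face hw hv h hx, mul_zero]

/-- The bubbles are given by a nonnegative symmetric matrix that depends on the point. -/
theorem IsSimplex.inner_bubble (s : E d → E d) (x e : E d) :
    2 * inner ℝ (bubble T s x) e = ∑ v ∈ T, ∑ w ∈ T, bary T v x * bary T w x *
      (inner ℝ (s x) (w - v) * inner ℝ e (w - v)) := by
  have h1 := hT.sum_bary x
  have h2 := hT.sum_bary_smul x
  set b := fun v => bary T v x
  have hx : ∀ a : E d, inner ℝ a x = ∑ v ∈ T, b v * inner ℝ a v := by
    intro a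
    conv_lhs => rw [← h2]
    simp only [inner_sum, real_inner_smul_right, b]
  have hR : ∑ v ∈ T, ∑ w ∈ T, b v * b w * (inner ℝ (s x) (w - v) * inner ℝ e (w - v)) =
      2 * (∑ v ∈ T, b v * (inner ℝ (s x) v * inner ℝ e v)) - 2 * (inner ℝ (s x) x * inner ℝ e x) := by
    have e1 : ∀ v w, b v * b w * (inner ℝ (s x) (w - v) * inner ℝ e (w - v)) =
        b v * (b w * (inner ℝ (s x) w * inner ℝ e w)) + b w * (b v * (inner ℝ (s x) v * inner ℝ e v))
        - (b v * inner ℝ (s x) v) * (b w * inner ℝ e w)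
        - (b w * inner ℝ (s x) w) * (b v * inner ℝ e v) := by
      intro v w
      rw [inner_sub_right, inner_sub_right]
      ring
    simp only [e1, Finset.sum_sub_distrib, Finset.sum_add_distrib, ← Finset.mul_sum,
      ← Finset.sum_mul, hx (s x), hx e]
    rw [show ∑ v ∈ T, b v = 1 from h1]
    ring
  change _ = ∑ v ∈ T, ∑ w ∈ T, b v * b w * (inner ℝ (s x) (w - v) * inner ℝ e (w - v))
  rw [hR, bubble, inner_neg_left, sum_inner]
  have e3 : ∀ v, inner ℝ ((bary T v x * inner ℝ (s x) v) • (x - v)) e =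
      (b v * inner ℝ (s x) v) * inner ℝ e x - b v * (inner ℝ (s x) v * inner ℝ e v) := by
    intro v
    rw [real_inner_smul_left, real_inner_comm e (x - v), inner_sub_right]
    ring
  simp only [e3, Finset.sum_sub_distrib, ← Finset.sum_mul, ← hx (s x)]
  ring

theorem IsSimplex.norm_bubble_le (s : E d → E d) {x : E d} (hx : x ∈ hull T) :
    2 * ‖bubble T s x‖ ≤ diam T ^ 2 * ‖s x‖ := by
  have h := hT.inner_bubble s x (bubble T s x)
  have hb := hT.mem_hull_iff.1 hx
  have h1 := hT.sum_bary x
  have hD := diam_nonneg T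
  rw [real_inner_self_eq_norm_sq] at h
  have h2 : 2 * ‖bubble T s x‖ ^ 2 ≤ diam T ^ 2 * ‖s x‖ * ‖bubble T s x‖ := by
    rw [h]
    calc _ ≤ ∑ v ∈ T, ∑ w ∈ T, bary T v x * bary T w x *
          (diam T ^ 2 * ‖s x‖ * ‖bubble T s x‖) := by
          refine Finset.sum_le_sum fun v hv => Finset.sum_le_sum fun w hw => ?_
          refine mul_le_mul_of_nonneg_left ?_ (mul_nonneg (hb v hv) (hb w hw))
          have hvw : ‖w - v‖ ≤ diam T := (dist_eq_norm w v).symm.trans_le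
            (dist_le_diam (subset_convexHull ℝ _ hw) (subset_convexHull ℝ _ hv))
          have key : ∀ a : E d, |inner ℝ a (w - v)| ≤ ‖a‖ * diam T := fun a =>
            (abs_real_inner_le_norm _ _).trans (by gcongr)
          exact (le_abs_self _).trans ((abs_mul _ _).trans_le ((mul_le_mul (key _) (key _)
            (abs_nonneg _) (by positivity)).trans_eq (by ring)))
      _ = _ := by
          simp only [← Finset.sum_mul, ← Finset.mul_sum, h1]
          ring
  rcases eq_or_lt_of_le (norm_nonneg (bubble T s x)) with h0 | h0
  · rw [← h0, mul_zero]
    positivity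
  · exact le_of_mul_le_mul_right (by nlinarith) h0

theorem IsSimplex.inner_bubble_self_nonneg (s : E d → E d) {x : E d} (hx : x ∈ hull T) :
    0 ≤ inner ℝ (bubble T s x) (s x) := by
  have h := hT.inner_bubble s x (s x)
  have hb := hT.mem_hull_iff.1 hx
  have : 0 ≤ ∑ v ∈ T, ∑ w ∈ T, bary T v x * bary T w x *
      (inner ℝ (s x) (w - v) * inner ℝ (s x) (w - v)) :=
    Finset.sum_nonneg fun v hv => Finset.sum_nonneg fun w hw =>
      mul_nonneg (mul_nonneg (hb v hv) (hb w hw)) (mul_self_nonneg _)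
  linarith

end Bubble

namespace HasInball

variable [NeZero d] {σ : ℝ} {T : Finset (E d)} {x₀ : E d} {r : ℝ} (hT : HasInball σ T x₀ r)

include hT

theorem le_bary {v : E d} (hv : v ∈ T) {x : E d} (hx : x ∈ Metric.closedBall x₀ (r / 2)) :
    (4 * σ)⁻¹ ≤ bary T v x := by
  set n := normal T (T.erase v)
  have hn : ‖n‖ = 1 := hT.isSimplex.norm_normal hv
  have hnn : inner ℝ n n = 1 := by rw [real_inner_self_eq_norm_sq, hn]; norm_num
  have hr := hT.pos
  have h0 := hT.isSimplex.height_pos hv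
  have h1 : x + (r / 2) • n ∈ hull T := hT.subset (by
    rw [Metric.mem_closedBall]
    have h2 : dist (x + (r / 2) • n) x = r / 2 := by
      simp [norm_smul, hn, abs_of_pos hr]
    have := dist_triangle (x + (r / 2) • n) x x₀
    rw [Metric.mem_closedBall] at hx
    linarith)
  have h3 := (hT.isSimplex.inner_normal_mem_Icc hv h1).2
  have e1 : x + (r / 2) • n - v = (x - v) + (r / 2) • n := by abel
  rw [e1, inner_add_right, inner_smul_right, hnn, mul_one] at h3
  have hσ := hT.one_le
  refine le_of_mul_le_mul_right ?_ h0
  rw [bary, sub_mul, one_mul, mul_right_comm, inv_mul_cancel₀ h0.ne', one_mul]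
  have h4 : (4 * σ)⁻¹ * height T v ≤ r / 2 := by
    rw [inv_mul_le_iff₀ (by positivity)]
    linarith [hT.diam_le, hT.isSimplex.height_le_diam hv]
  linarith

omit [NeZero d] in
theorem exists_width (e : E d) : ∃ v ∈ T, ∃ w ∈ T, 2 * r * ‖e‖ ≤ inner ℝ e (w - v) := by
  by_cases he : e = 0
  · obtain ⟨v, hv⟩ := hT.isSimplex.nonempty
    exact ⟨v, hv, v, hv, by simp [he]⟩
  have hen : 0 < ‖e‖ := norm_pos_iff.2 he
  have hr := hT.pos
  have key : ∀ b : E d, ∀ y ∈ hull T, ∃ w ∈ T, inner ℝ b y ≤ inner ℝ b w := fun b y hy =>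
    ((innerSL ℝ b).toLinearMap.convexOn convex_univ).exists_ge_of_mem_convexHull (subset_univ _) hy
  set a := (r / ‖e‖) • e
  have ha : ‖a‖ = r := by simp [a, norm_smul, abs_of_pos hr, hen.ne']
  have hea : inner ℝ e a = r * ‖e‖ := by
    rw [real_inner_smul_right, real_inner_self_eq_norm_sq]
    field_simp
  obtain ⟨w, hw, hw'⟩ := key e (x₀ + a) (hT.subset (by simp [ha]))
  obtain ⟨v, hv, hv'⟩ := key (-e) (x₀ - a) (hT.subset (by simp [ha]))
  refine ⟨v, hv, w, hw, ?_⟩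
  simp only [inner_neg_left, inner_add_right, inner_sub_right, hea] at hw' hv' ⊢
  linarith

theorem le_inner_bubble (s : E d → E d) {x : E d} (hx : x ∈ Metric.closedBall x₀ (r / 2)) :
    (32 * σ ^ 4)⁻¹ * (diam T ^ 2 * ‖s x‖ ^ 2) ≤ inner ℝ (bubble T s x) (s x) := by
  have h := hT.isSimplex.inner_bubble s x (s x)
  obtain ⟨v, hv, w, hw, hvw⟩ := hT.exists_width (s x)
  have hb := hT.isSimplex.mem_hull_iff.1 (hT.ball_half_subset hx)
  have hσ := hT.one_le
  set f : E d → E d → ℝ := fun v w =>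
    bary T v x * bary T w x * (inner ℝ (s x) (w - v) * inner ℝ (s x) (w - v))
  have hf : ∀ v ∈ T, ∀ w ∈ T, 0 ≤ f v w := fun v hv w hw =>
    mul_nonneg (mul_nonneg (hb v hv) (hb w hw)) (mul_self_nonneg _)
  have h1 : f v w ≤ ∑ v ∈ T, ∑ w ∈ T, f v w := (Finset.single_le_sum (hf v hv) hw).trans
    (Finset.single_le_sum (f := fun v => ∑ w ∈ T, f v w)
      (fun v hv => Finset.sum_nonneg (hf v hv)) hv)
  have h2 : (4 * σ)⁻¹ * (4 * σ)⁻¹ * ((diam T / σ * ‖s x‖) * (diam T / σ * ‖s x‖)) ≤ f v w := by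
    have hv1 := hT.le_bary hv hx
    have hw1 := hT.le_bary hw hx
    have hd : diam T / σ * ‖s x‖ ≤ inner ℝ (s x) (w - v) := by
      refine le_trans ?_ hvw
      gcongr
      rw [div_le_iff₀ (by positivity)]
      linarith [hT.diam_le]
    have hD := diam_nonneg T
    have hv0 := hb v hv
    have hd0 : 0 ≤ inner ℝ (s x) (w - v) := le_trans (by positivity) hd
    have hvw0 := mul_nonneg (hb v hv) (hb w hw)
    simp only [f]
    gcongr
  have h3 : (4 * σ)⁻¹ * (4 * σ)⁻¹ * ((diam T / σ * ‖s x‖) * (diam T / σ * ‖s x‖)) =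
      2 * ((32 * σ ^ 4)⁻¹ * (diam T ^ 2 * ‖s x‖ ^ 2)) := by
    field_simp
    ring
  linarith

end HasInball

/-! ### Stable interpolation in the Raviart--Thomas--Nédélec space -/

theorem integral_norm_add_sq_le {α G : Type*} [MeasurableSpace α] {m : Measure α}
    [NormedAddCommGroup G] [InnerProductSpace ℝ G] {f g : α → G} (hf : MemLp f 2 m)
    (hg : MemLp g 2 m) :
    ∫ x, ‖f x + g x‖ ^ 2 ∂m ≤ 2 * (∫ x, ‖f x‖ ^ 2 ∂m) + 2 * ∫ x, ‖g x‖ ^ 2 ∂m := by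
  have h1 := (integrable_norm_sq hf).const_mul 2
  have h2 := (integrable_norm_sq hg).const_mul 2
  rw [← integral_const_mul, ← integral_const_mul, ← integral_add h1 h2]
  exact integral_mono (integrable_norm_sq (hf.add hg)) (h1.add h2) fun x => norm_add_sq_le _ _

theorem integral_norm_sub_sq_le {α G : Type*} [MeasurableSpace α] {m : Measure α}
    [NormedAddCommGroup G] [InnerProductSpace ℝ G] {f g : α → G} (hf : MemLp f 2 m)
    (hg : MemLp g 2 m) :
    ∫ x, ‖f x - g x‖ ^ 2 ∂m ≤ 2 * (∫ x, ‖f x‖ ^ 2 ∂m) + 2 * ∫ x, ‖g x‖ ^ 2 ∂m := by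
  simpa [← sub_eq_add_neg] using integral_norm_add_sq_le hf hg.neg

theorem isLinOn_bubble (T : Finset (E d)) (V : Submodule ℝ (E d → E d)) (x : E d) :
    IsLinOn V fun s => bubble T s x := by
  unfold bubble
  exact (IsLinOn.sum fun v _ => ((((IsLinOn.eval x).inner_left v).const_mul (bary T v x)).smul_const
    (x - v))).neg

namespace HasInball

variable [NeZero d] {σ : ℝ} {T : Finset (E d)} {x₀ : E d} {r : ℝ} (hT : HasInball σ T x₀ r)

include hT

/-- A field with prescribed normal components, built from extensions of these components that are
homogeneous about the opposite vertices. -/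
theorem exists_facet_lift {k : ℕ} {q : E d → E d → ℝ} (hq : ∀ v ∈ T, q v ∈ poly d k) :
    ∃ w ∈ RTN d (k + 1),
      (∀ v ∈ T, ∀ x ∈ hull (T.erase v), inner ℝ (w x) (normal T (T.erase v)) = q v x) ∧
      ∫ x in hull T, ‖w x‖ ^ 2 ≤
        (d + 1) * σ * (diam T * ∑ v ∈ T, ∫ x, q v x ^ 2 ∂(surf (hull (T.erase v)))) := by
  have hS := hT.isSimplex
  have hex : ∀ v : T, ∃ Q ∈ poly d k, (∀ x ∈ hull (T.erase v), Q x = q v x) ∧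
      ∀ (r : ℝ) x, Q (v + r • (x - v)) = r ^ k * Q x := by
    intro v
    obtain ⟨Q, hQ, h1, h2⟩ := exists_homogeneous_extension (hq v v.2) (normal T (T.erase v)) v
      (hS.height_pos v.2).ne'
    exact ⟨Q, hQ, fun x hx => h1 x (hS.inner_normal_of_mem_face v.2 hx), h2⟩
  choose Q hQ hQ1 hQ2 using hex
  let w : E d → E d := ∑ v : T, (height T v)⁻¹ • fun x => Q v x • (x - v)
  have hwx : ∀ x, w x = ∑ v : T, (height T v)⁻¹ • (Q v x • (x - v)) := by
    intro x
    simp [w]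
  have hw : w ∈ RTN d (k + 1) := Submodule.sum_mem _ fun v _ =>
    Submodule.smul_mem _ _ (sub_smul_mem_RTN (hQ v) v)
  refine ⟨w, hw, fun v hv x hx => ?_, ?_⟩
  · rw [hwx, sum_inner, Finset.sum_eq_single ⟨v, hv⟩]
    · rw [real_inner_smul_left, real_inner_smul_left, real_inner_comm (normal T (T.erase v)),
        hS.inner_normal_of_mem_face hv hx, hQ1 ⟨v, hv⟩ x hx]
      have := (hS.height_pos hv).ne'
      field_simp
    · intro u _ hu
      rw [real_inner_smul_left, real_inner_smul_left, real_inner_comm (normal T (T.erase v)),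
        hS.inner_normal_vertex_of_mem_face u.2 hv (fun h => hu (Subtype.ext h)) hx]
      ring
    · exact fun h => absurd (Finset.mem_univ _) h
  · have hwc := continuous_of_mem_RTN hw
    have hQc : ∀ v, Continuous (Q v) := fun v => continuous_of_mem_poly (hQ v)
    have hD := hT.diam_pos
    have hσ := hT.one_le
    have hcard : ((Finset.univ : Finset T).card : ℝ) = d + 1 := by
      rw [Finset.card_univ, Fintype.card_coe, hS.card]
      push_cast
      ring
    have hI : ∀ v : T, 0 ≤ ∫ x, q v x ^ 2 ∂(surf (hull (T.erase v))) := fun v =>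
      integral_nonneg fun x => sq_nonneg _
    calc ∫ x in hull T, ‖w x‖ ^ 2
        ≤ ∫ x in hull T, ∑ v : T, (d + 1) * ((height T v)⁻¹ * diam T) ^ 2 * Q v x ^ 2 := by
          refine setIntegral_mono_on (integrableOn_hull (by fun_prop))
            (integrableOn_hull (by fun_prop)) (measurableSet_hull T) fun x hx => ?_
          rw [hwx]
          refine (norm_sum_sq_le _).trans ?_
          rw [hcard, Finset.mul_sum]
          refine Finset.sum_le_sum fun v _ => ?_
          have h1 : ‖x - v‖ ≤ diam T := by
            rw [← dist_eq_norm]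
            exact dist_le_diam hx (subset_convexHull ℝ _ v.2)
          have h0 := hS.height_pos v.2
          rw [norm_smul, norm_smul, Real.norm_eq_abs, Real.norm_eq_abs, mul_pow, mul_pow, sq_abs,
            sq_abs, mul_pow, mul_assoc, mul_assoc, mul_comm (diam T ^ 2)]
          gcongr
      _ = ∑ v : T, (d + 1) * ((height T v)⁻¹ * diam T) ^ 2 * ∫ x in hull T, Q v x ^ 2 := by
          rw [integral_finsetSum _ fun v _ => integrableOn_hull (by have := hQc v; fun_prop)]
          simp only [integral_const_mul]
      _ ≤ ∑ v : T, (d + 1) * σ * (diam T * ∫ x, q v x ^ 2 ∂(surf (hull (T.erase v)))) := by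
          refine Finset.sum_le_sum fun v _ => ?_
          have h1 := hS.integral_homogeneous v.2 (hQc v) (hQ2 v)
          have h2 : ∫ x, Q v x ^ 2 ∂(surf (hull (T.erase v))) =
              ∫ x, q v x ^ 2 ∂(surf (hull (T.erase v))) := by
            refine integral_surf_congr fun x hx => ?_
            rw [hQ1 v x hx]
          rw [h2] at h1
          have h0 := hS.height_pos v.2
          have h3 := hT.diam_le_height v.2
          have h4 := hI v
          set I := ∫ x, q v x ^ 2 ∂(surf (hull (T.erase v)))
          calc (d + 1 : ℝ) * ((height T v)⁻¹ * diam T) ^ 2 * ∫ x in hull T, Q v x ^ 2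
              ≤ (d + 1 : ℝ) * ((height T v)⁻¹ * diam T) ^ 2 * (height T v * I) := by gcongr
            _ = (d + 1 : ℝ) * ((height T v)⁻¹ * diam T) * (diam T * I) := by
                field_simp
            _ ≤ (d + 1 : ℝ) * σ * (diam T * I) := by
                gcongr
                rw [inv_mul_le_iff₀ h0]
                linarith
      _ = _ := by
          rw [← Finset.mul_sum, ← Finset.mul_sum,
            ← Finset.sum_coe_sort T fun v => ∫ x, q v x ^ 2 ∂(surf (hull (T.erase v)))]

theorem integral_inner_bubble_ge {k : ℕ} {s : E d → E d} (hs : s ∈ vec (poly d ((k : ℤ) - 1))) :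
    (32 * σ ^ 4)⁻¹ * (diam T ^ 2 * ∫ x in Metric.closedBall x₀ (r / 2), ‖s x‖ ^ 2) ≤
      ∫ x in hull T, inner ℝ (bubble T s x) (s x) := by
  have hsc := continuous_of_mem_vec hs
  have hbc := continuous_of_mem_RTN (bubble_mem_RTN T hs)
  rw [← integral_const_mul, ← integral_const_mul]
  calc _ ≤ ∫ x in Metric.closedBall x₀ (r / 2), inner ℝ (bubble T s x) (s x) := by
        refine setIntegral_mono_on ?_ ?_ measurableSet_closedBall fun x hx =>
          hT.le_inner_bubble s hx
        · exact ContinuousOn.integrableOn_compact (isCompact_closedBall _ _) (by fun_prop)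
        · exact ContinuousOn.integrableOn_compact (isCompact_closedBall _ _) (by fun_prop)
    _ ≤ _ := setIntegral_mono_set (integrableOn_hull (by fun_prop))
        ((ae_restrict_mem (measurableSet_hull T)).mono fun x hx =>
          hT.isSimplex.inner_bubble_self_nonneg s hx) hT.ball_half_subset.eventuallyLE

end HasInball

theorem IsL2Space.eq_zero_of_integral_norm_sq {m : Measure (E d)} {V : Submodule ℝ (E d → ℝ)}
    (hV : IsL2Space m V) {v : E d → E d} (hv : v ∈ vec V) (h : ∫ x, ‖v x‖ ^ 2 ∂m = 0) : v = 0 := by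
  have hm := hV.memLp_vec hv
  have key : ∀ i, (fun x => v x i) = 0 := by
    intro i
    refine hV.definite _ (hv i) (le_antisymm ?_ (integral_nonneg fun x => sq_nonneg _))
    rw [← h]
    refine integral_mono (MemLp.coord hm i).integrable_sq (integrable_norm_sq hm) fun x => ?_
    simp only [EuclideanSpace.real_norm_sq_eq]
    exact Finset.single_le_sum (f := fun i => v x i ^ 2) (fun j _ => sq_nonneg _)
      (Finset.mem_univ i)
  funext x
  ext i
  exact congrFun (key i) x

/-- The degrees of freedom of a Raviart--Thomas--Nédélec field can be prescribed, with a stable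
dependence on the data. -/
theorem exists_RTN_field [NeZero d] (k : ℕ) {σ : ℝ} (hσ : 1 ≤ σ) :
    ∃ C : ℝ, 0 < C ∧ ∀ (T : Finset (E d)) (x₀ : E d) (r : ℝ), HasInball σ T x₀ r →
      ∀ (a : E d → E d), MemLp a 2 (volume.restrict (hull T)) →
      ∀ (q : E d → E d → ℝ), (∀ v ∈ T, q v ∈ poly d k) →
      ∃ w ∈ RTN d (k + 1),
        (∀ s ∈ vec (poly d ((k : ℤ) - 1)),
          ∫ x in hull T, inner ℝ (w x) (s x) = ∫ x in hull T, inner ℝ (a x) (s x)) ∧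
        (∀ v ∈ T, ∀ x ∈ hull (T.erase v), inner ℝ (w x) (normal T (T.erase v)) = q v x) ∧
        ∫ x in hull T, ‖w x‖ ^ 2 ≤ C * ((∫ x in hull T, ‖a x‖ ^ 2) +
          diam T * ∑ v ∈ T, ∫ x, q v x ^ 2 ∂(surf (hull (T.erase v)))) := by
  obtain ⟨C₀, hC₀, hball⟩ := exists_integral_hull_le_ball (d := d) ((k : ℤ) - 1) hσ
  set K : ℝ := C₀ * (32 * σ ^ 4) with hK
  have hKpos : 0 < K := by positivity
  refine ⟨(2 + K ^ 2) * ((d + 1) * σ + 1), by positivity, fun T x₀ r hT a ha q hq => ?_⟩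
  obtain ⟨w₁, hw₁, hn₁, hb₁⟩ := hT.exists_facet_lift hq
  have hD := hT.diam_pos
  have hcoer : ∀ s ∈ vec (poly d ((k : ℤ) - 1)), diam T ^ 2 * ∫ x in hull T, ‖s x‖ ^ 2 ≤
      K * ∫ x in hull T, inner ℝ (bubble T s x) (s x) := by
    intro s hs
    have h1 := hball T x₀ r hT s hs
    have h2 := hT.integral_inner_bubble_ge hs
    rw [inv_mul_le_iff₀ (by positivity)] at h2
    rw [hK]
    linarith [mul_le_mul_of_nonneg_left h1 (sq_nonneg (diam T)), mul_le_mul_of_nonneg_left h2 hC₀.le]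
  have hint : ∀ s ∈ vec (poly d ((k : ℤ) - 1)), ∀ b, MemLp b 2 (volume.restrict (hull T)) →
      Integrable (fun x => (inner ℝ (b x) (s x) : ℝ)) (volume.restrict (hull T)) := fun s hs b hb =>
    integrable_inner_of_memLp hb (memLp_hull (continuous_of_mem_vec hs))
  have hmb : ∀ s ∈ vec (poly d ((k : ℤ) - 1)), MemLp (bubble T s) 2 (volume.restrict (hull T)) :=
    fun s hs => memLp_hull (continuous_of_mem_RTN (bubble_mem_RTN T hs))
  have hm₁ : MemLp w₁ 2 (volume.restrict (hull T)) := memLp_hull (continuous_of_mem_RTN hw₁)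
  have hD' : MemLp (fun x => a x - w₁ x) 2 (volume.restrict (hull T)) := ha.sub hm₁
  obtain ⟨s, hs, hsd⟩ := IsLinOn.exists_represents (V := vec (poly d ((k : ℤ) - 1)))
    (B := fun s s' => ∫ x in hull T, inner ℝ (bubble T s x) (s' x))
    (fun y hy => IsLinOn.integral (fun x => (isLinOn_bubble T _ x).inner_left (y x))
      fun s hs => hint y hy _ (hmb s hs))
    (fun s hs => IsLinOn.integral (fun x => (IsLinOn.eval x).inner_right (bubble T s x))
      fun y hy => hint y hy _ (hmb s hs))
    (fun s hs h0 => by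
      have h1 := hcoer s hs
      rw [h0, mul_zero] at h1
      exact (hT.isSimplex.isL2Space_poly _).eq_zero_of_integral_norm_sq hs (le_antisymm
        (nonpos_of_mul_nonpos_right h1 (pow_pos hD 2)) (integral_nonneg fun x => sq_nonneg _)))
    (ℓ := fun s' => ∫ x in hull T, inner ℝ (a x - w₁ x) (s' x))
    (IsLinOn.integral (fun x => (IsLinOn.eval x).inner_right _) fun y hy => hint y hy _ hD')
  refine ⟨w₁ + bubble T s, Submodule.add_mem _ hw₁ (bubble_mem_RTN T hs), fun s' hs' => ?_,
    fun v hv x hx => ?_, ?_⟩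
  · have h := hsd s' hs'
    simp only [inner_sub_left] at h
    simp only [Pi.add_apply, inner_add_left]
    rw [integral_sub (hint s' hs' _ ha) (hint s' hs' _ hm₁)] at h
    rw [integral_add (hint s' hs' _ hm₁) (hint s' hs' _ (hmb s hs)), h]
    ring
  · rw [Pi.add_apply, inner_add_left, hn₁ v hv x hx, hT.isSimplex.inner_bubble_normal s hv hx,
      add_zero]
  · have h1 := hcoer s hs
    rw [hsd s hs] at h1
    have h2 := sq_integral_inner_le hD' (memLp_hull (T := T) (continuous_of_mem_vec hs))
    have hbb : ∫ x in hull T, ‖bubble T s x‖ ^ 2 ≤ diam T ^ 4 / 4 * ∫ x in hull T, ‖s x‖ ^ 2 := by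
      rw [← integral_const_mul]
      refine setIntegral_mono_on (integrable_norm_sq (hmb s hs))
        ((integrable_norm_sq (memLp_hull (continuous_of_mem_vec hs))).const_mul _)
        (measurableSet_hull T) fun x hx => ?_
      have := hT.isSimplex.norm_bubble_le s hx
      have h3 : (2 * ‖bubble T s x‖) ^ 2 ≤ (diam T ^ 2 * ‖s x‖) ^ 2 := by gcongr
      nlinarith
    have haw : ∫ x in hull T, ‖a x - w₁ x‖ ^ 2 ≤
        2 * (∫ x in hull T, ‖a x‖ ^ 2) + 2 * ∫ x in hull T, ‖w₁ x‖ ^ 2 :=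
      integral_norm_sub_sq_le ha hm₁
    have hww : ∫ x in hull T, ‖(w₁ + bubble T s) x‖ ^ 2 ≤
        2 * (∫ x in hull T, ‖w₁ x‖ ^ 2) + 2 * ∫ x in hull T, ‖bubble T s x‖ ^ 2 :=
      integral_norm_add_sq_le hm₁ (hmb s hs)
    have hS0 : 0 ≤ ∫ x in hull T, ‖s x‖ ^ 2 := integral_nonneg fun x => sq_nonneg _
    have hA0 : 0 ≤ ∫ x in hull T, ‖a x‖ ^ 2 := integral_nonneg fun x => sq_nonneg _
    have hL0 : 0 ≤ ∫ x in hull T, ‖a x - w₁ x‖ ^ 2 := integral_nonneg fun x => sq_nonneg _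
    have hQ0 : 0 ≤ diam T * ∑ v ∈ T, ∫ x, q v x ^ 2 ∂(surf (hull (T.erase v))) :=
      mul_nonneg hD.le (Finset.sum_nonneg fun v _ => integral_nonneg fun x => sq_nonneg _)
    set S := ∫ x in hull T, ‖s x‖ ^ 2
    set A := ∫ x in hull T, ‖a x‖ ^ 2
    set L := ∫ x in hull T, ‖a x - w₁ x‖ ^ 2
    set W := ∫ x in hull T, ‖w₁ x‖ ^ 2
    set J := ∫ x in hull T, inner ℝ (a x - w₁ x) (s x)
    set Q := diam T * ∑ v ∈ T, ∫ x, q v x ^ 2 ∂(surf (hull (T.erase v)))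
    have h3 : diam T ^ 4 * S ≤ K ^ 2 * L := by
      rcases hS0.eq_or_lt with h0 | h0
      · rw [← h0, mul_zero]
        positivity
      · have h4 : (diam T ^ 2 * S) ^ 2 ≤ (K * J) ^ 2 := by gcongr
        have h5 : diam T ^ 4 * S * S ≤ K ^ 2 * L * S := by nlinarith
        exact le_of_mul_le_mul_right h5 h0
    have h6 := mul_le_mul_of_nonneg_left haw (sq_nonneg K)
    have h7 := mul_le_mul_of_nonneg_left hb₁ (by positivity : 0 ≤ 2 + K ^ 2)
    have h8 : 0 ≤ (2 + K ^ 2) * ((d + 1) * σ * A) := by positivity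
    linarith [mul_nonneg (sq_nonneg K) hQ0]

/-! ### Convergence in the space of square integrable functions -/

section L2Limits

variable {α : Type*} [MeasurableSpace α] {m : Measure α} {G : Type*} [NormedAddCommGroup G]
  {f : ℕ → α → G} {g : α → G}

theorem eLpNorm_two_eq {f : α → G} (hf : MemLp f 2 m) :
    eLpNorm f 2 m = ENNReal.ofReal √(∫ x, ‖f x‖ ^ 2 ∂m) := by
  rw [integral_norm_sq_toLp hf, Real.sqrt_sq (norm_nonneg _), Lp.norm_toLp,
    ENNReal.ofReal_toReal hf.2.ne]

theorem tendsto_integral_norm_sq (hf : ∀ n, MemLp (f n) 2 m) (hg : MemLp g 2 m)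
    (h : Tendsto (fun n => eLpNorm (fun x => f n x - g x) 2 m) atTop (𝓝 0)) :
    Tendsto (fun n => ∫ x, ‖f n x‖ ^ 2 ∂m) atTop (𝓝 (∫ x, ‖g x‖ ^ 2 ∂m)) := by
  have h1 := (Lp.tendsto_Lp_iff_tendsto_eLpNorm'' f hf g hg).2 h
  simp only [fun n => integral_norm_sq_toLp (hf n), integral_norm_sq_toLp hg]
  exact (h1.norm).pow 2

theorem tendsto_integral_inner [InnerProductSpace ℝ G] {a : α → G} (ha : MemLp a 2 m)
    (hf : ∀ n, MemLp (f n) 2 m) (hg : MemLp g 2 m)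
    (h : Tendsto (fun n => eLpNorm (fun x => f n x - g x) 2 m) atTop (𝓝 0)) :
    Tendsto (fun n => ∫ x, inner ℝ (a x) (f n x) ∂m) atTop (𝓝 (∫ x, inner ℝ (a x) (g x) ∂m)) := by
  have h1 := (Lp.tendsto_Lp_iff_tendsto_eLpNorm'' f hf g hg).2 h
  have key : ∀ (b : α → G) (hb : MemLp b 2 m), ∫ x, inner ℝ (a x) (b x) ∂m =
      inner ℝ (ha.toLp a) (hb.toLp b) := by
    intro b hb
    rw [L2.inner_def]
    exact integral_congr_ae (EventuallyEq.comp₂ ha.coeFn_toLp (inner ℝ)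
      hb.coeFn_toLp).symm
  simp only [fun n => key _ (hf n), key _ hg]
  exact tendsto_const_nhds.inner h1

theorem tendsto_zero_of_le {a b : ℕ → ℝ≥0∞} (hb : Tendsto b atTop (𝓝 0)) (h : ∀ n, a n ≤ b n) :
    Tendsto a atTop (𝓝 0) :=
  tendsto_of_tendsto_of_tendsto_of_le_of_le tendsto_const_nhds hb (fun _ => zero_le) h

theorem tendsto_eLpNorm_mono {m' : Measure α} (hle : m' ≤ m)
    (h : Tendsto (fun n => eLpNorm (f n) 2 m) atTop (𝓝 0)) :
    Tendsto (fun n => eLpNorm (f n) 2 m') atTop (𝓝 0) :=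
  tendsto_zero_of_le h fun _ => eLpNorm_mono_measure _ hle

theorem eLpNorm_sub_le_of_le {m' : Measure α} (hle : m' ≤ m) {f₁ f₂ : α → G}
    (h₁ : AEStronglyMeasurable f₁ m) (h₂ : AEStronglyMeasurable f₂ m)
    (hg : AEStronglyMeasurable g m) : eLpNorm (fun x => f₁ x - f₂ x) 2 m' ≤
      eLpNorm (fun x => f₁ x - g x) 2 m + eLpNorm (fun x => f₂ x - g x) 2 m := by
  rw [show (fun x => f₁ x - f₂ x) = (fun x => f₁ x - g x) - fun x => f₂ x - g x by ext; simp]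
  exact (eLpNorm_mono_measure _ hle).trans (eLpNorm_sub_le (h₁.sub hg) (h₂.sub hg) (by norm_num))

/-- A sequence with small mutual distances converges in `L²`. -/
theorem exists_limit_of_eLpNorm_sub_le [CompleteSpace G] (hf : ∀ n, MemLp (f n) 2 m)
    {a : ℕ → ℝ≥0∞} (ha : Tendsto a atTop (𝓝 0))
    (h : ∀ i j, eLpNorm (fun x => f i x - f j x) 2 m ≤ a i + a j) :
    ∃ g, MemLp g 2 m ∧ Tendsto (fun n => eLpNorm (fun x => f n x - g x) 2 m) atTop (𝓝 0) := by
  have hc : CauchySeq fun n => (hf n).toLp (f n) := by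
    rw [EMetric.cauchySeq_iff]
    intro ε hε
    obtain ⟨N, hN⟩ := eventually_atTop.1 (ha.eventually_lt_const (ENNReal.half_pos hε.ne'))
    refine ⟨N, fun i hi j hj => ?_⟩
    rw [Lp.edist_toLp_toLp]
    exact (h i j).trans_lt ((ENNReal.add_lt_add (hN i hi) (hN j hj)).trans_eq
      (ENNReal.add_halves ε))
  obtain ⟨g, hg⟩ := cauchySeq_tendsto_of_complete hc
  refine ⟨g, Lp.memLp g, ?_⟩
  refine (Lp.tendsto_Lp_iff_tendsto_eLpNorm'' f hf g (Lp.memLp g)).1 ?_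
  rwa [Lp.toLp_coeFn]

end L2Limits

/-! ### Weak gradients -/

theorem fderiv_eq_zero_of_tsupport_subset {G : Type*} [NormedAddCommGroup G] [NormedSpace ℝ G]
    {φ : E d → G} {U : Set (E d)} (hφ : tsupport φ ⊆ U) {x : E d} (hx : x ∉ U) :
    φ x = 0 ∧ fderiv ℝ φ x = 0 := by
  have : x ∉ tsupport φ := fun h => hx (hφ h)
  exact ⟨image_eq_zero_of_notMem_tsupport this, fderiv_of_notMem_tsupport ℝ this⟩

theorem HasWeakGrad.mono {U V : Set (E d)} (hU : IsOpen U) (hVU : V ⊆ U)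
    {v : E d → E d} {G : E d → E d →L[ℝ] E d} (h : HasWeakGrad U v G) : HasWeakGrad V v G := by
  intro φ hφ hc hs e
  have h1 := h φ hφ hc (hs.trans hVU) e
  rw [setIntegral_eq_of_subset_of_forall_sdiff_eq_zero hU.measurableSet hVU,
    setIntegral_eq_of_subset_of_forall_sdiff_eq_zero hU.measurableSet hVU] at h1
  · exact h1
  · intro x hx
    rw [(fderiv_eq_zero_of_tsupport_subset hs hx.2).1, zero_smul]
  · intro x hx
    rw [(fderiv_eq_zero_of_tsupport_subset hs hx.2).2]
    simp

/-- Weak gradients are unique up to null sets. -/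
theorem HasWeakGrad.ae_eq {U : Set (E d)} (hU : IsOpen U) {v : E d → E d}
    {G₁ G₂ : E d → E d →L[ℝ] E d} (hm₁ : MemLp G₁ 2 (volume.restrict U))
    (hm₂ : MemLp G₂ 2 (volume.restrict U)) (h₁ : HasWeakGrad U v G₁) (h₂ : HasWeakGrad U v G₂) :
    G₁ =ᵐ[volume.restrict U] G₂ := by
  have key : ∀ i : Fin d, ∀ᵐ x ∂(volume.restrict U), G₁ x (basisVec i) = G₂ x (basisVec i) := by
    intro i
    have hl : ∀ G : E d → E d →L[ℝ] E d, MemLp G 2 (volume.restrict U) →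
        LocallyIntegrable (fun x => G x (basisVec i)) (volume.restrict U) := fun G hG =>
      ((ContinuousLinearMap.apply ℝ (E d) (basisVec i)).comp_memLp' hG).locallyIntegrable
        (by norm_num)
    have h0 := hU.ae_eq_zero_of_integral_contDiff_smul_eq_zero (μ := volume)
      (f := fun x => G₁ x (basisVec i) - G₂ x (basisVec i))
      (locallyIntegrableOn_of_locallyIntegrable_restrict ((hl _ hm₁).sub (hl _ hm₂)))
      (fun φ hφ hc hs => by
        rw [← setIntegral_eq_integral_of_forall_compl_eq_zero (s := U) fun x hx => by
          rw [(fderiv_eq_zero_of_tsupport_subset hs hx).1, zero_smul]]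
        simp only [smul_sub]
        rw [integral_sub ((hl _ hm₁).integrable_smul_left_of_hasCompactSupport hφ.continuous hc)
          ((hl _ hm₂).integrable_smul_left_of_hasCompactSupport hφ.continuous hc)]
        exact sub_eq_zero.2 (neg_inj.1 ((h₁ φ hφ hc hs _).symm.trans (h₂ φ hφ hc hs _))))
    rw [ae_restrict_iff' hU.measurableSet]
    filter_upwards [h0] with x hx hxU
    exact sub_eq_zero.1 (hx hxU)
  filter_upwards [ae_all_iff.2 key] with x hx
  ext1 y
  rw [← (EuclideanSpace.basisFun (Fin d) ℝ).sum_repr y]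
  simp only [map_sum, map_smul]
  exact Finset.sum_congr rfl fun i _ => by
    rw [EuclideanSpace.basisFun_apply, hx i]

theorem MemH1.weakGrad_spec {U : Set (E d)} {v : E d → E d} (h : MemH1 U v) :
    MemLp (weakGrad U v) 2 (volume.restrict U) ∧ HasWeakGrad U v (weakGrad U v) :=
  Classical.epsilon_spec h.2

theorem hasWeakGrad_of_contDiff {U : Set (E d)} {ψ : E d → E d} (hψ : ContDiff ℝ 1 ψ) :
    HasWeakGrad U ψ fun x => fderiv ℝ ψ x := by
  intro φ hφ hc hs e
  have hφc := hφ.continuous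
  have hφ' : Continuous fun x => fderiv ℝ φ x := hφ.continuous_fderiv (by simp)
  have hψc := hψ.continuous
  have hψ' : Continuous fun x => fderiv ℝ ψ x := hψ.continuous_fderiv one_ne_zero
  have hc' : HasCompactSupport fun x => fderiv ℝ φ x e := hc.fderiv_apply ℝ e
  rw [setIntegral_eq_integral_of_forall_compl_eq_zero fun x hx => by
      rw [(fderiv_eq_zero_of_tsupport_subset hs hx).2]; simp,
    setIntegral_eq_integral_of_forall_compl_eq_zero fun x hx => by
      rw [(fderiv_eq_zero_of_tsupport_subset hs hx).1, zero_smul]]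
  rw [integral_smul_fderiv_eq_neg_fderiv_smul_of_integrable, neg_neg]
  · exact (by fun_prop : Continuous fun x => fderiv ℝ φ x e • ψ x).integrable_of_hasCompactSupport
      hc'.smul_right
  · exact (by fun_prop : Continuous fun x => φ x • fderiv ℝ ψ x e).integrable_of_hasCompactSupport
      hc.smul_right
  · exact (by fun_prop : Continuous fun x => φ x • ψ x).integrable_of_hasCompactSupport
      hc.smul_right
  · exact fun x _ => hφ.differentiable (by simp) x
  · exact fun x _ => hψ.differentiable one_ne_zero x

theorem MemH1.mono {U V : Set (E d)} (hU : IsOpen U) (hVU : V ⊆ U) {v : E d → E d}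
    (h : MemH1 U v) : MemH1 V v :=
  ⟨h.1.mono_measure (Measure.restrict_mono hVU le_rfl), weakGrad U v,
    h.weakGrad_spec.1.mono_measure (Measure.restrict_mono hVU le_rfl),
    h.weakGrad_spec.2.mono hU hVU⟩

theorem MemH1.weakGrad_ae_eq {U : Set (E d)} (hU : IsOpen U) {v : E d → E d} (h : MemH1 U v)
    {G : E d → E d →L[ℝ] E d} (hG : MemLp G 2 (volume.restrict U)) (hw : HasWeakGrad U v G) :
    weakGrad U v =ᵐ[volume.restrict U] G :=
  HasWeakGrad.ae_eq hU h.weakGrad_spec.1 hG h.weakGrad_spec.2 hw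

theorem TendstoH1.mono {U V : Set (E d)} (hU : IsOpen U) (hV : IsOpen V) (hVU : V ⊆ U)
    {v : E d → E d} (h : MemH1 U v) {φ : ℕ → E d → E d} (ht : TendstoH1 U φ v) :
    TendstoH1 V φ v := by
  have hle := Measure.restrict_mono hVU (le_refl (volume : Measure (E d)))
  have hG := (h.mono hU hVU).weakGrad_ae_eq hV (h.weakGrad_spec.1.mono_measure hle)
    (h.weakGrad_spec.2.mono hU hVU)
  refine ⟨tendsto_eLpNorm_mono hle ht.1, (tendsto_eLpNorm_mono hle ht.2).congr fun n =>
    eLpNorm_congr_ae ?_⟩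
  filter_upwards [hG] with x hx
  rw [hx]

theorem IsTrace.mono {U V S : Set (E d)} (hU : IsOpen U) (hV : IsOpen V) (hVU : V ⊆ U)
    {v g : E d → E d} (h : MemH1 U v) (ht : IsTrace U S v g) : IsTrace V S v g := by
  obtain ⟨h1, φ, h2, h3, h4⟩ := ht
  exact ⟨h1, φ, h2, h3.mono hU hV hVU h, h4⟩

/-! ### Traces -/

section Trace

variable [NeZero d] {T : Finset (E d)} (hT : IsSimplex T) {v : E d} (hv : v ∈ T)

omit [NeZero d] in
theorem restrict_hull_eq (T : Finset (E d)) :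
    (volume.restrict (hull T) : Measure (E d)) = volume.restrict (interior (hull T)) :=
  Measure.restrict_congr_set (interior_ae_eq_of_null_frontier
    ((convex_convexHull ℝ _).addHaar_frontier volume)).symm

omit [NeZero d] in
theorem memLp_interior {T : Finset (E d)} {G : Type*} [NormedAddCommGroup G] {g : E d → G}
    (hg : Continuous g) : MemLp g 2 (volume.restrict (interior (hull T))) := by
  rw [← restrict_hull_eq]
  exact memLp_hull hg

include hT hv

theorem IsSimplex.exists_eLpNorm_trace_le : ∃ C : ℝ, ∀ ψ : E d → E d,
    ContDiff ℝ 1 ψ → eLpNorm ψ 2 (surf (hull (T.erase v))) ≤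
      ENNReal.ofReal C * (eLpNorm ψ 2 (volume.restrict (interior (hull T))) +
        eLpNorm (fun x => fderiv ℝ ψ x) 2 (volume.restrict (interior (hull T)))) := by
  have hfin := hT.isFiniteMeasure_surf hv
  have h0 := hT.height_pos hv
  have hc : 0 ≤ (height T v)⁻¹ * ((d + 1) + diam T ^ 2) := by positivity
  refine ⟨√((height T v)⁻¹ * ((d + 1) + diam T ^ 2)), fun ψ hψ => ?_⟩
  have hψc := hψ.continuous
  have hψ' : Continuous fun x => fderiv ℝ ψ x := hψ.continuous_fderiv one_ne_zero
  rw [eLpNorm_two_eq (memLp_surf hψc.continuousOn), eLpNorm_two_eq (memLp_interior hψc),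
    eLpNorm_two_eq (memLp_interior hψ'), ← ENNReal.ofReal_add (by positivity) (by positivity),
    ← ENNReal.ofReal_mul (by positivity), ← restrict_hull_eq]
  refine ENNReal.ofReal_le_ofReal (Real.sqrt_le_iff.2 ⟨by positivity, ?_⟩)
  have h1 := hT.trace_inequality hv hψ
  have hA : 0 ≤ ∫ x in hull T, ‖ψ x‖ ^ 2 := integral_nonneg fun x => sq_nonneg _
  have hB : 0 ≤ ∫ x in hull T, ‖fderiv ℝ ψ x‖ ^ 2 := integral_nonneg fun x => sq_nonneg _
  rw [← le_inv_mul_iff₀ h0] at h1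
  refine h1.trans ?_
  rw [mul_pow, Real.sq_sqrt hc, mul_assoc, add_sq, Real.sq_sqrt hA, Real.sq_sqrt hB]
  gcongr
  set A := ∫ x in hull T, ‖ψ x‖ ^ 2
  set B := ∫ x in hull T, ‖fderiv ℝ ψ x‖ ^ 2
  have h2 : 0 ≤ ((d + 1) + diam T ^ 2) * (2 * √A * √B) := by positivity
  have h3 : 0 ≤ diam T ^ 2 * A := by positivity
  have h4 : 0 ≤ (d + 1 : ℝ) * B := by positivity
  linarith

variable {U : Set (E d)} (hTU : interior (hull T) ⊆ U) {u : E d → E d}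
  (hu : MemH1 U u)

include hTU hu

/-- On smooth fields, the distance of the traces is controlled by the distances to `u` in `H¹`. -/
theorem IsSimplex.exists_trace_sub_le : ∃ a : (E d → E d) → ℝ≥0∞,
    (∀ φ₁ φ₂ : E d → E d, ContDiff ℝ ∞ φ₁ → ContDiff ℝ ∞ φ₂ →
      eLpNorm (fun x => φ₁ x - φ₂ x) 2 (surf (hull (T.erase v))) ≤ a φ₁ + a φ₂) ∧
    ∀ φ : ℕ → E d → E d, TendstoH1 U φ u → Tendsto (fun n => a (φ n)) atTop (𝓝 0) := by
  obtain ⟨C, hC⟩ := hT.exists_eLpNorm_trace_le hv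
  refine ⟨fun φ => ENNReal.ofReal C * (eLpNorm (fun x => φ x - u x) 2 (volume.restrict U) +
    eLpNorm (fun x => fderiv ℝ φ x - weakGrad U u x) 2 (volume.restrict U)),
    fun φ₁ φ₂ h₁ h₂ => ?_, fun φ ht => ?_⟩
  · have h₁' : ContDiff ℝ 1 φ₁ := h₁.of_le (by simp)
    have h₂' : ContDiff ℝ 1 φ₂ := h₂.of_le (by simp)
    have hle := Measure.restrict_mono hTU (le_refl (volume : Measure (E d)))
    refine (hC _ (h₁'.sub h₂')).trans ?_
    rw [← mul_add, add_add_add_comm, show (fun x => fderiv ℝ (fun y => φ₁ y - φ₂ y) x) =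
      fun x => fderiv ℝ φ₁ x - fderiv ℝ φ₂ x from funext fun x => fderiv_fun_sub
        (h₁'.differentiable one_ne_zero x) (h₂'.differentiable one_ne_zero x)]
    exact mul_le_mul_right (add_le_add
      (eLpNorm_sub_le_of_le hle h₁.continuous.aestronglyMeasurable
        h₂.continuous.aestronglyMeasurable hu.1.1)
      (eLpNorm_sub_le_of_le hle (h₁'.continuous_fderiv one_ne_zero).aestronglyMeasurable
        (h₂'.continuous_fderiv one_ne_zero).aestronglyMeasurable hu.weakGrad_spec.1.1)) _
  · simpa using ENNReal.Tendsto.const_mul (a := ENNReal.ofReal C) (ht.1.add ht.2)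
      (Or.inr ENNReal.ofReal_ne_top)

/-- The traces of smooth approximations converge. -/
theorem IsSimplex.exists_trace_limit {φ : ℕ → E d → E d} (hφ : ∀ n, ContDiff ℝ ∞ (φ n))
    (ht : TendstoH1 U φ u) : ∃ g, MemLp g 2 (surf (hull (T.erase v))) ∧
      Tendsto (fun n => eLpNorm (fun x => φ n x - g x) 2 (surf (hull (T.erase v)))) atTop (𝓝 0) := by
  have hfin := hT.isFiniteMeasure_surf hv
  obtain ⟨a, ha, ha'⟩ := hT.exists_trace_sub_le hv hTU hu
  exact exists_limit_of_eLpNorm_sub_le (fun n => memLp_surf (hφ n).continuous.continuousOn)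
    (ha' φ ht) fun i j => ha _ _ (hφ i) (hφ j)

/-- Traces are unique up to null sets. -/
theorem IsSimplex.isTrace_ae_eq {g₁ g₂ : E d → E d} (h₁ : IsTrace U (hull (T.erase v)) u g₁)
    (h₂ : IsTrace U (hull (T.erase v)) u g₂) : g₁ =ᵐ[surf (hull (T.erase v))] g₂ := by
  have hfin := hT.isFiniteMeasure_surf hv
  obtain ⟨a, ha, ha'⟩ := hT.exists_trace_sub_le hv hTU hu
  obtain ⟨m₁, φ₁, s₁, t₁, l₁⟩ := h₁
  obtain ⟨m₂, φ₂, s₂, t₂, l₂⟩ := h₂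
  have c₁ := (Lp.tendsto_Lp_iff_tendsto_eLpNorm'' _ (fun n => memLp_surf
    (s₁ n).continuous.continuousOn) _ m₁).2 l₁
  have c₂ := (Lp.tendsto_Lp_iff_tendsto_eLpNorm'' _ (fun n => memLp_surf
    (s₂ n).continuous.continuousOn) _ m₂).2 l₂
  exact (MemLp.toLp_eq_toLp_iff m₁ m₂).1 (edist_eq_zero.1 (tendsto_nhds_unique (c₁.edist c₂)
    (tendsto_zero_of_le (by simpa using (ha' _ t₁).add (ha' _ t₂)) fun n =>
      (Lp.edist_toLp_toLp _ _ _ _).trans_le (ha _ _ (s₁ n) (s₂ n)))))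

theorem IsSimplex.trace_spec {φ : ℕ → E d → E d} (hφ : ∀ n, ContDiff ℝ ∞ (φ n))
    (ht : TendstoH1 U φ u) : IsTrace U (hull (T.erase v)) u (trace U (hull (T.erase v)) u) ∧
      Tendsto (fun n => eLpNorm (fun x => φ n x - trace U (hull (T.erase v)) u x) 2
        (surf (hull (T.erase v)))) atTop (𝓝 0) := by
  obtain ⟨g, hg, hlim⟩ := hT.exists_trace_limit hv hTU hu hφ ht
  have hgt : IsTrace U (hull (T.erase v)) u g := ⟨hg, φ, hφ, ht, hlim⟩
  have htr : IsTrace U (hull (T.erase v)) u (trace U (hull (T.erase v)) u) :=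
    Classical.epsilon_spec ⟨g, hgt⟩
  refine ⟨htr, ?_⟩
  refine hlim.congr fun n => eLpNorm_congr_ae ?_
  filter_upwards [hT.isTrace_ae_eq hv hTU hu hgt htr] with x hx
  rw [hx]

/-- The trace inequality in `H¹`. -/
theorem IsSimplex.trace_inequality_of_isTrace {g : E d → E d}
    (hg : IsTrace U (hull (T.erase v)) u g) :
    height T v * ∫ y, ‖g y‖ ^ 2 ∂(surf (hull (T.erase v))) ≤
      (d + 1) * (∫ x in hull T, ‖u x‖ ^ 2) +
        diam T ^ 2 * ∫ x in hull T, ‖weakGrad U u x‖ ^ 2 := by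
  have hfin := hT.isFiniteMeasure_surf hv
  obtain ⟨hm, φ, hφ, ht, hlim⟩ := hg
  have hφ1 : ∀ n, ContDiff ℝ 1 (φ n) := fun n => (hφ n).of_le (by simp)
  have hφ' : ∀ n, Continuous fun x => fderiv ℝ (φ n) x := fun n =>
    (hφ1 n).continuous_fderiv one_ne_zero
  have hle := Measure.restrict_mono hTU (le_refl (volume : Measure (E d)))
  have h1 := tendsto_integral_norm_sq (fun n => memLp_surf (hφ n).continuous.continuousOn) hm hlim
  have h2 := tendsto_integral_norm_sq (m := volume.restrict (interior (hull T)))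
    (fun n => memLp_interior (hφ n).continuous) (hu.1.mono_measure hle)
    (tendsto_eLpNorm_mono hle ht.1)
  have h3 := tendsto_integral_norm_sq (m := volume.restrict (interior (hull T)))
    (fun n => memLp_interior (hφ' n)) (hu.weakGrad_spec.1.mono_measure hle)
    (tendsto_eLpNorm_mono hle ht.2)
  rw [restrict_hull_eq]
  refine le_of_tendsto_of_tendsto' (h1.const_mul _) ((h2.const_mul _).add (h3.const_mul _))
    fun n => ?_
  rw [← restrict_hull_eq]
  exact hT.trace_inequality hv (hφ1 n)

omit hv in
/-- Green's formula in `H¹`. -/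
theorem IsSimplex.green_of_tendstoH1 {φ : ℕ → E d → E d} (hφ : ∀ n, ContDiff ℝ ∞ (φ n))
    (ht : TendstoH1 U φ u) {q : E d → ℝ} (hq : ContDiff ℝ 1 q) :
    (∫ x in hull T, q x * ∑ i, weakGrad U u x (basisVec i) i) +
      ∫ x in hull T, inner ℝ (gradVec q x) (u x) =
      ∑ v ∈ T, ∫ y, q y * inner ℝ (trace U (hull (T.erase v)) u y) (normal T (T.erase v))
        ∂(surf (hull (T.erase v))) := by
  have hφ1 : ∀ n, ContDiff ℝ 1 (φ n) := fun n => (hφ n).of_le (by simp)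
  have hφ' : ∀ n, Continuous fun x => fderiv ℝ (φ n) x := fun n =>
    (hφ1 n).continuous_fderiv one_ne_zero
  have hqc := hq.continuous
  have hq' : Continuous fun x => fderiv ℝ q x := hq.continuous_fderiv one_ne_zero
  have hgc : Continuous (gradVec q) := by
    unfold gradVec
    fun_prop
  have hle := Measure.restrict_mono hTU (le_refl (volume : Measure (E d)))
  let D : (E d →L[ℝ] E d) →L[ℝ] ℝ := ∑ i : Fin d,
    (EuclideanSpace.proj (𝕜 := ℝ) i).comp (ContinuousLinearMap.apply ℝ (E d) (basisVec i))
  have hD : ∀ (a : ℝ) A, inner ℝ a (D A) = a * ∑ i, A (basisVec i) i := by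
    simp [D, mul_comm]
  have l1 : Tendsto (fun n => ∫ x in interior (hull T), inner ℝ (q x) (D (fderiv ℝ (φ n) x))) atTop
      (𝓝 (∫ x in interior (hull T), inner ℝ (q x) (D (weakGrad U u x)))) := by
    refine tendsto_integral_inner (memLp_interior hqc)
      (fun n => memLp_interior (D.continuous.comp (hφ' n)))
      (D.comp_memLp' (hu.weakGrad_spec.1.mono_measure hle)) ?_
    have hz := ENNReal.Tendsto.const_mul (a := ENNReal.ofReal ‖D‖) ht.2
      (Or.inr ENNReal.ofReal_ne_top)
    refine tendsto_zero_of_le (by simpa using hz) fun n => (eLpNorm_mono_measure _ hle).trans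
      (eLpNorm_le_mul_eLpNorm_of_ae_le_mul (ae_of_all _ fun x => ?_) 2)
    rw [← map_sub]
    exact D.le_opNorm _
  have l2 : Tendsto (fun n => ∫ x in interior (hull T), inner ℝ (gradVec q x) (φ n x)) atTop
      (𝓝 (∫ x in interior (hull T), inner ℝ (gradVec q x) (u x))) :=
    tendsto_integral_inner (memLp_interior hgc) (fun n => memLp_interior (hφ n).continuous)
      (hu.1.mono_measure hle) (tendsto_eLpNorm_mono hle ht.1)
  have l3 : ∀ w ∈ T, Tendsto (fun n => ∫ y, inner ℝ (q y • normal T (T.erase w)) (φ n y)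
      ∂(surf (hull (T.erase w)))) atTop (𝓝 (∫ y, inner ℝ (q y • normal T (T.erase w))
        (trace U (hull (T.erase w)) u y) ∂(surf (hull (T.erase w))))) := by
    intro w hw
    have hfin := hT.isFiniteMeasure_surf hw
    obtain ⟨⟨hm, -⟩, hlim⟩ := hT.trace_spec hw hTU hu hφ ht
    exact tendsto_integral_inner (memLp_surf (by fun_prop))
      (fun n => memLp_surf (hφ n).continuous.continuousOn) hm hlim
  have e3 : ∀ (y n a : E d), inner ℝ (q y • n) a = q y * inner ℝ a n := by
    intro y n a
    rw [real_inner_smul_left, real_inner_comm]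
  have hG : ∀ n, (∫ x in interior (hull T), inner ℝ (q x) (D (fderiv ℝ (φ n) x))) +
      ∫ x in interior (hull T), inner ℝ (gradVec q x) (φ n x) = ∑ w ∈ T,
      ∫ y, inner ℝ (q y • normal T (T.erase w)) (φ n y) ∂(surf (hull (T.erase w))) := by
    intro n
    rw [← restrict_hull_eq]
    simpa only [dvg, hD, real_inner_comm _ (gradVec q _), inner_gradVec, e3] using
      hT.integral_mul_dvg hq (hφ1 n)
  have hfinal := tendsto_nhds_unique ((l1.add l2).congr hG) (tendsto_finsetSum T l3)
  rw [restrict_hull_eq]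
  simpa only [hD, e3] using hfinal

end Trace

/-! ### Fields in `H¹₀` -/

/-- The Poincaré inequality for smooth compactly supported fields. -/
theorem poincare_of_contDiff [NeZero d] {Ω : Set (E d)} {R : ℝ}
    (hR : ∀ x ∈ Ω, ‖x‖ ≤ R) {φ : E d → E d} (hφ : ContDiff ℝ ∞ φ) (hc : HasCompactSupport φ)
    (hs : tsupport φ ⊆ Ω) :
    ∫ x in Ω, ‖φ x‖ ^ 2 ≤ 4 * R ^ 2 * ∫ x in Ω, ‖fderiv ℝ φ x‖ ^ 2 := by
  have hφ1 : ContDiff ℝ 1 φ := hφ.of_le (by simp)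
  have hd := fun x hx => fderiv_eq_zero_of_tsupport_subset hs (x := x) hx
  rw [setIntegral_eq_integral_of_forall_compl_eq_zero fun x hx => by rw [(hd x hx).1]; simp,
    setIntegral_eq_integral_of_forall_compl_eq_zero fun x hx => by rw [(hd x hx).2]; simp]
  set e : E d := basisVec 0
  have he : ‖e‖ = 1 := by simp [e]
  let ℓ : E d → ℝ := fun x => inner ℝ e x
  let g : E d → ℝ := fun x => ‖φ x‖ ^ 2
  have hg : ContDiff ℝ 1 g := hφ1.norm_sq ℝ
  have hgc : HasCompactSupport g := hc.comp_left (g := fun y => ‖y‖ ^ 2) (by simp)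
  have hgd : ∀ x, fderiv ℝ g x e = 2 * inner ℝ (φ x) (fderiv ℝ φ x e) := by
    intro x
    have := ((hφ1.differentiable one_ne_zero) x).hasFDerivAt.norm_sq
    rw [show fderiv ℝ g x = _ from this.fderiv]
    simp
  have hℓ : ∀ x, fderiv ℝ ℓ x e = 1 := by
    intro x
    have : HasFDerivAt ℓ (innerSL ℝ e) x := (innerSL ℝ e).hasFDerivAt
    rw [this.fderiv]
    simp [he]
  have hg2 : HasCompactSupport fun x => fderiv ℝ g x e := hgc.fderiv_apply ℝ e
  have hgcont := hg.continuous
  have hibp : ∫ x, ℓ x * fderiv ℝ g x e = -∫ x, fderiv ℝ ℓ x e * g x := by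
    refine integral_mul_fderiv_eq_neg_fderiv_mul_of_integrable ?_ ?_ ?_ ?_ ?_
    · simp only [hℓ, one_mul]
      exact hgcont.integrable_of_hasCompactSupport hgc
    · exact (by fun_prop : Continuous fun x => ℓ x * fderiv ℝ g x e).integrable_of_hasCompactSupport
        hg2.mul_left
    · exact (by fun_prop : Continuous fun x => ℓ x * g x).integrable_of_hasCompactSupport
        hgc.mul_left
    · exact fun x _ => ((innerSL ℝ e).differentiable) x
    · exact fun x _ => hg.differentiable one_ne_zero x
  simp only [hℓ, one_mul] at hibp
  have hint2 : Integrable fun x => ‖fderiv ℝ φ x‖ ^ 2 :=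
    (by fun_prop : Continuous fun x => ‖fderiv ℝ φ x‖ ^ 2).integrable_of_hasCompactSupport
      ((hc.fderiv ℝ).comp_left (g := fun y => ‖y‖ ^ 2) (by simp))
  have hint1 : Integrable fun x => ‖φ x‖ ^ 2 := hgcont.integrable_of_hasCompactSupport hgc
  have hle : ∫ x, g x ≤ ∫ x, (2⁻¹ * ‖φ x‖ ^ 2 + 2 * R ^ 2 * ‖fderiv ℝ φ x‖ ^ 2) := by
    rw [← neg_eq_iff_eq_neg.2 hibp, ← integral_neg]
    refine integral_mono ?_ ((hint1.const_mul _).add (hint2.const_mul _)) fun x => ?_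
    · exact ((by fun_prop : Continuous fun x => ℓ x * fderiv ℝ g x e).integrable_of_hasCompactSupport
        hg2.mul_left).neg
    · change -(ℓ x * fderiv ℝ g x e) ≤ 2⁻¹ * ‖φ x‖ ^ 2 + 2 * R ^ 2 * ‖fderiv ℝ φ x‖ ^ 2
      by_cases hx : x ∈ Ω
      · have h1 : |ℓ x| ≤ R := (abs_real_inner_le_norm _ _).trans (by
          rw [he, one_mul]; exact hR x hx)
        have h2 : |inner ℝ (φ x) (fderiv ℝ φ x e)| ≤ ‖φ x‖ * ‖fderiv ℝ φ x‖ :=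
          (abs_real_inner_le_norm _ _).trans (by
            gcongr
            simpa [he] using (fderiv ℝ φ x).le_opNorm e)
        have h3 : |ℓ x * inner ℝ (φ x) (fderiv ℝ φ x e)| ≤ R * (‖φ x‖ * ‖fderiv ℝ φ x‖) := by
          rw [abs_mul]
          exact mul_le_mul h1 h2 (abs_nonneg _) ((abs_nonneg _).trans h1)
        rw [hgd]
        nlinarith [neg_abs_le (ℓ x * inner ℝ (φ x) (fderiv ℝ φ x e)),
          sq_nonneg (‖φ x‖ - 2 * R * ‖fderiv ℝ φ x‖)]
      · rw [hgd, (hd x hx).1, (hd x hx).2]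
        simp
  rw [integral_add (hint1.const_mul _) (hint2.const_mul _), integral_const_mul,
    integral_const_mul] at hle
  linarith

theorem MemH10.poincare [NeZero d] {Ω : Set (E d)} {R : ℝ}
    (hR : ∀ x ∈ Ω, ‖x‖ ≤ R) {u : E d → E d} (hu : MemH10 Ω u) :
    ∫ x in Ω, ‖u x‖ ^ 2 ≤ 4 * R ^ 2 * ∫ x in Ω, ‖weakGrad Ω u x‖ ^ 2 := by
  obtain ⟨h1, φ, hφ, ht⟩ := hu
  have l1 := tendsto_integral_norm_sq (m := volume.restrict Ω)
    (fun n => ((hφ n).1.continuous.memLp_of_hasCompactSupport (hφ n).2.1).restrict Ω) h1.1 ht.1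
  have l2 := tendsto_integral_norm_sq (m := volume.restrict Ω)
    (fun n => (((hφ n).1.continuous_fderiv (by simp)).memLp_of_hasCompactSupport
      ((hφ n).2.1.fderiv ℝ)).restrict Ω)
    h1.weakGrad_spec.1 ht.2
  exact le_of_tendsto_of_tendsto' l1 (l2.const_mul _) fun n =>
    poincare_of_contDiff hR (hφ n).1 (hφ n).2.1 (hφ n).2.2

section Trace

variable [NeZero d] {T : Finset (E d)} (hT : IsSimplex T) {v : E d} (hv : v ∈ T)
  {Ω : Set (E d)} (hΩ : IsOpen Ω) (hTΩ : interior (hull T) ⊆ Ω)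

include hT hv hΩ hTΩ

/-- Fields of `H¹₀` have no trace on the boundary. -/
theorem IsSimplex.trace_ae_eq_zero (hF : hull (T.erase v) ⊆ frontier Ω) {u : E d → E d}
    (hu : MemH10 Ω u) : trace Ω (hull (T.erase v)) u =ᵐ[surf (hull (T.erase v))] 0 := by
  obtain ⟨h1, φ, hφ, ht⟩ := hu
  refine hT.isTrace_ae_eq hv hTΩ h1 (hT.trace_spec hv hTΩ h1 (fun n => (hφ n).1) ht).1
    ⟨MemLp.zero, φ, fun n => (hφ n).1, ht, tendsto_const_nhds.congr fun n =>
      ((eLpNorm_congr_ae (g := 0) ?_).trans eLpNorm_zero).symm⟩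
  filter_upwards [ae_mem_hull_surf (T.erase v)] with x hx
  have h2 := hF hx
  rw [hΩ.frontier_eq] at h2
  simp [(fderiv_eq_zero_of_tsupport_subset (hφ n).2.2 h2.2).1]

/-- The trace may be computed in the domain or inside a simplex. -/
theorem IsSimplex.trace_interior_ae_eq {u : E d → E d} (hu : MemH10 Ω u) :
    trace (interior (hull T)) (hull (T.erase v)) u =ᵐ[surf (hull (T.erase v))]
      trace Ω (hull (T.erase v)) u := by
  obtain ⟨h1, φ, hφ, ht⟩ := hu
  obtain ⟨htr, -⟩ := hT.trace_spec hv hTΩ h1 (fun n => (hφ n).1) ht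
  have h2 := h1.mono hΩ hTΩ
  obtain ⟨htr2, -⟩ := hT.trace_spec hv Subset.rfl h2 (fun n => (hφ n).1)
    (ht.mono hΩ isOpen_interior hTΩ h1)
  exact hT.isTrace_ae_eq hv Subset.rfl h2 htr2 (htr.mono hΩ isOpen_interior hTΩ h1)

end Trace

theorem memH1_of_contDiff {T : Finset (E d)} {ψ : E d → E d} (hψ : ContDiff ℝ 1 ψ) :
    MemH1 (interior (hull T)) ψ :=
  ⟨memLp_interior hψ.continuous, _, memLp_interior (hψ.continuous_fderiv one_ne_zero),
    hasWeakGrad_of_contDiff hψ⟩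

theorem tendstoH1_const {T : Finset (E d)} {ψ : E d → E d} (hψ : ContDiff ℝ 1 ψ) :
    TendstoH1 (interior (hull T)) (fun _ => ψ) ψ := by
  constructor
  · simp
  · have : eLpNorm (fun x => fderiv ℝ ψ x - weakGrad (interior (hull T)) ψ x) 2
        (volume.restrict (interior (hull T))) = 0 := by
      rw [← eLpNorm_zero (α := E d) (ε := E d →L[ℝ] E d) (p := 2)
        (μ := volume.restrict (interior (hull T)))]
      refine eLpNorm_congr_ae ?_
      filter_upwards [(memH1_of_contDiff (T := T) hψ).weakGrad_ae_eq isOpen_interior (memLp_interior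
        (hψ.continuous_fderiv one_ne_zero)) (hasWeakGrad_of_contDiff hψ)] with x hx
      simp [hx]
    exact tendsto_const_nhds.congr fun _ => this.symm

/-- The trace of a smooth field is its restriction. -/
theorem IsSimplex.trace_ae_eq_self [NeZero d] {T : Finset (E d)} (hT : IsSimplex T) {v : E d}
    (hv : v ∈ T) {ψ : E d → E d} (hψ : ContDiff ℝ ∞ ψ) :
    trace (interior (hull T)) (hull (T.erase v)) ψ =ᵐ[surf (hull (T.erase v))] ψ := by
  have hfin := hT.isFiniteMeasure_surf hv
  have h1 : ContDiff ℝ 1 ψ := hψ.of_le (by simp)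
  obtain ⟨htr, -⟩ := hT.trace_spec hv Subset.rfl (memH1_of_contDiff h1) (fun _ => hψ)
    (tendstoH1_const h1)
  exact hT.isTrace_ae_eq hv Subset.rfl (memH1_of_contDiff h1) htr
    ⟨memLp_surf hψ.continuous.continuousOn, fun _ => ψ, fun _ => hψ, tendstoH1_const h1, by simp⟩

/-! ### More on barycentric coordinates -/

theorem bary_sum {T : Finset (E d)} (v : E d) {s : Finset (E d)} {a : E d → ℝ}
    (ha : ∑ w ∈ s, a w = 1) : bary T v (∑ w ∈ s, a w • w) = ∑ w ∈ s, a w * bary T v w := by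
  have h : ∑ w ∈ s, a w • w - v = ∑ w ∈ s, a w • (w - v) := by
    simp only [smul_sub, Finset.sum_sub_distrib, ← Finset.sum_smul, ha, one_smul]
  simp only [bary, h, inner_sum, real_inner_smul_right, mul_sub, mul_one, Finset.sum_sub_distrib, ha,
    Finset.mul_sum]
  congr 1
  exact Finset.sum_congr rfl fun w _ => by ring

section

variable [NeZero d] {T : Finset (E d)} (hT : IsSimplex T)

include hT

theorem IsSimplex.bary_pos_of_mem_interior {v : E d} (hv : v ∈ T) {x : E d}
    (hx : x ∈ interior (hull T)) : 0 < bary T v x := by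
  obtain ⟨ε, hε, hb⟩ := Metric.isOpen_iff.1 isOpen_interior x hx
  set n := normal T (T.erase v)
  have hn : ‖n‖ = 1 := hT.norm_normal hv
  have hnn : inner ℝ n n = 1 := by rw [real_inner_self_eq_norm_sq, hn]; norm_num
  have h0 := hT.height_pos hv
  have h1 : x + (ε / 2) • n ∈ hull T := interior_subset (hb (by
    simp [norm_smul, hn, abs_of_pos hε]
    linarith))
  have h2 := (hT.inner_normal_mem_Icc hv h1).2
  have e1 : x + (ε / 2) • n - v = (x - v) + (ε / 2) • n := by abel
  rw [e1, inner_add_right, inner_smul_right, hnn, mul_one] at h2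
  have h6 : bary T v x = (height T v)⁻¹ * (height T v - inner ℝ n (x - v)) := by
    rw [bary, mul_sub, inv_mul_cancel₀ h0.ne']
  rw [h6]
  have : 0 < height T v - inner ℝ n (x - v) := by linarith
  positivity

/-- A face contains points that are interior relatively to the face, near each of its points. -/
theorem IsSimplex.exists_relint {v : E d} (hv : v ∈ T) {y : E d} (hy : y ∈ hull (T.erase v))
    {U : Set (E d)} (hU : IsOpen U) (hyU : y ∈ U) :
    ∃ z ∈ U, z ∈ hull (T.erase v) ∧ ∀ w ∈ T.erase v, 0 < bary T w z := by
  have hdpos : (0 : ℝ) < d := by exact_mod_cast NeZero.pos d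
  have hcard : (T.erase v).card = d := by
    rw [Finset.card_erase_of_mem hv, hT.card, Nat.add_sub_cancel]
  set a : E d → ℝ := fun _ => (d : ℝ)⁻¹
  have ha : ∑ w ∈ T.erase v, a w = 1 := by
    simp [a, hcard, hdpos.ne']
  set c := ∑ w ∈ T.erase v, a w • w
  have hc : c ∈ hull (T.erase v) := (convex_convexHull ℝ _).sum_mem (fun w _ => by positivity) ha
    fun w hw => subset_convexHull ℝ _ hw
  have hcb : ∀ w ∈ T.erase v, 0 < bary T w c := by
    intro w hw
    rw [bary_sum w ha, Finset.sum_eq_single w]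
    · rw [IsSimplex.bary_self]
      positivity
    · intro u hu huw
      rw [hT.bary_of_ne (Finset.mem_of_mem_erase hw) (Finset.mem_of_mem_erase hu) huw, mul_zero]
    · exact fun h => absurd hw h
  have hcont : Continuous fun s : ℝ => y + s • (c - y) := by fun_prop
  have hnear : ∀ᶠ s in 𝓝 (0 : ℝ), y + s • (c - y) ∈ U :=
    hcont.continuousAt.eventually_mem (hU.mem_nhds (by simpa using hyU))
  obtain ⟨ε, hε, hball⟩ := Metric.eventually_nhds_iff.1 hnear
  set s := min (ε / 2) 1
  have hs0 : 0 < s := by positivity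
  have hs1 : s ≤ 1 := min_le_right _ _
  refine ⟨y + s • (c - y), hball ?_, ?_, fun w hw => ?_⟩
  · rw [dist_zero_right, Real.norm_eq_abs, abs_of_pos hs0]
    exact (min_le_left _ _).trans_lt (by linarith)
  · have e : y + s • (c - y) = (1 - s) • y + s • c := by module
    rw [e]
    exact convex_convexHull ℝ _ hy hc (by linarith) hs0.le (by ring)
  · rw [IsSimplex.bary_affine]
    have h1 := hT.mem_hull_iff.1 ((hT.mem_face_iff hv).1 hy).1 w (Finset.mem_of_mem_erase hw)
    have h2 := hcb w hw
    have h3 : 0 ≤ (1 - s) * bary T w y := mul_nonneg (by linarith) h1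
    have h4 := mul_pos hs0 h2
    linarith

end

/-! ### Geometry of the mesh -/

namespace SimplicialMesh

variable {Ω : Set (E d)} (M : SimplicialMesh Ω)

theorem mem_elements {T : Finset (E d)} : T ∈ M.elements ↔ T ∈ M.faces ∧ T.card = d + 1 := by
  classical
  simp [elements]

theorem mem_facets {F : Finset (E d)} : F ∈ M.facets ↔ F ∈ M.faces ∧ F.card = d := by
  classical
  simp [facets]

variable {M} in
theorem mem_facetsOf {T : M.Elem} {F : M.Facet} : F ∈ M.facetsOf T ↔ F.1 ⊆ T.1 := by
  classical
  simp [facetsOf]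

variable {M} in
theorem isSimplex (T : M.Elem) : IsSimplex T.1 :=
  ⟨M.indep (M.mem_elements.1 T.2).1, (M.mem_elements.1 T.2).2⟩

variable [NeZero d]

theorem erase_mem_facets (T : M.Elem) {v : E d} (hv : v ∈ T.1) : T.1.erase v ∈ M.facets := by
  refine M.mem_facets.2 ⟨M.down_closed (M.mem_elements.1 T.2).1 (Finset.erase_subset _ _)
    ((isSimplex T).erase_nonempty hv), ?_⟩
  rw [Finset.card_erase_of_mem hv, (isSimplex T).card, Nat.add_sub_cancel]

/-- The face of `T` opposite to the vertex `v`. -/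
def oppFacet (T : M.Elem) (v : T.1) : M.Facet := ⟨T.1.erase v, M.erase_mem_facets T v.2⟩

variable {M}

theorem oppFacet_mem (T : M.Elem) (v : T.1) : M.oppFacet T v ∈ M.facetsOf T :=
  mem_facetsOf.2 (Finset.erase_subset _ _)

omit [NeZero d] in
theorem exists_eq_erase {T : M.Elem} {F : M.Facet} (hF : F ∈ M.facetsOf T) :
    ∃ v ∈ T.1, F.1 = T.1.erase v := by
  have h1 := mem_facetsOf.1 hF
  have hc : F.1.card < T.1.card := by
    rw [(M.mem_facets.1 F.2).2, (isSimplex T).card]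
    omega
  obtain ⟨v, hv, hvF⟩ := Finset.exists_mem_notMem_of_card_lt_card hc
  refine ⟨v, hv, Finset.eq_of_subset_of_card_le (fun w hw => Finset.mem_erase.2
    ⟨fun h => hvF (h ▸ hw), h1 hw⟩) ?_⟩
  rw [Finset.card_erase_of_mem hv, (isSimplex T).card, (M.mem_facets.1 F.2).2]
  omega

theorem oppFacet_injective (T : M.Elem) : Function.Injective (M.oppFacet T) := by
  intro v w h
  have h1 : T.1.erase v = T.1.erase w := congrArg Subtype.val h
  by_contra hne
  have : (w : E d) ∈ T.1.erase v := Finset.mem_erase.2 ⟨fun h' => hne (Subtype.ext h'.symm), w.2⟩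
  rw [h1] at this
  exact Finset.notMem_erase _ _ this

theorem sum_facetsOf (T : M.Elem) {Y : Type*} [AddCommMonoid Y] (f : M.Facet → Y) :
    ∑ F ∈ M.facetsOf T, f F = ∑ v : T.1, f (M.oppFacet T v) := by
  symm
  refine Finset.sum_bij (fun v _ => M.oppFacet T v) (fun v _ => oppFacet_mem T v)
    (fun v _ w _ h => oppFacet_injective T h) (fun F hF => ?_) fun _ _ => rfl
  obtain ⟨v, hv, h⟩ := exists_eq_erase hF
  exact ⟨⟨v, hv⟩, Finset.mem_univ _, Subtype.ext h.symm⟩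

theorem sum_facetsOf_eq (T : M.Elem) {Y : Type*} [AddCommMonoid Y] (f : Finset (E d) → Y) :
    ∑ F ∈ M.facetsOf T, f F.1 = ∑ v ∈ T.1, f (T.1.erase v) := by
  rw [sum_facetsOf T fun F => f F.1, ← Finset.sum_coe_sort T.1]
  rfl

omit [NeZero d] in
theorem exists_elem (F : M.Facet) : ∃ T : M.Elem, F ∈ M.facetsOf T := by
  obtain ⟨t, ht, hFt, hc⟩ := M.pure_faces F.1 (M.mem_facets.1 F.2).1
  exact ⟨⟨t, M.mem_elements.2 ⟨ht, hc⟩⟩, mem_facetsOf.2 hFt⟩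

theorem isFiniteMeasure_surf (F : M.Facet) : IsFiniteMeasure (surf (hull F.1)) := by
  obtain ⟨T, hT⟩ := exists_elem F
  obtain ⟨v, hv, h⟩ := exists_eq_erase hT
  rw [h]
  exact (isSimplex T).isFiniteMeasure_surf hv

theorem isL2Space_facetPoly (F : M.Facet) (l : ℤ) :
    IsL2Space (surf (hull F.1)) (facetPoly F.1 l) := by
  obtain ⟨T, hT⟩ := exists_elem F
  obtain ⟨v, hv, h⟩ := exists_eq_erase hT
  rw [h]
  exact (isSimplex T).isL2Space_facetPoly hv l

omit [NeZero d] in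
theorem hull_subset_closure (T : M.Elem) : hull T.1 ⊆ closure Ω := by
  rw [← M.space_eq]
  exact subset_biUnion_of_mem (u := fun s : Finset (E d) => convexHull ℝ (s : Set (E d)))
    (M.mem_elements.1 T.2).1

omit [NeZero d] in
theorem closure_eq_iUnion : closure Ω = ⋃ T : M.Elem, hull T.1 := by
  refine subset_antisymm ?_ (iUnion_subset fun T => hull_subset_closure T)
  rw [← M.space_eq]
  refine iUnion₂_subset fun s hs => ?_
  obtain ⟨t, ht, hst, hc⟩ := M.pure_faces s hs
  exact (convexHull_mono (by exact_mod_cast hst)).trans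
    (subset_iUnion (fun T : M.Elem => hull T.1) ⟨t, M.mem_elements.2 ⟨ht, hc⟩⟩)

omit [NeZero d] in
theorem interior_hull_subset (hΩ : IsOpen Ω) (hc : Convex ℝ Ω) (T : M.Elem) :
    interior (hull T.1) ⊆ Ω := by
  by_cases hne : Ω.Nonempty
  · have h1 := interior_mono (hull_subset_closure T)
    rwa [hc.interior_closure_eq_interior_of_nonempty_interior (by rwa [hΩ.interior_eq]),
      hΩ.interior_eq] at h1
  · have h1 := hull_subset_closure T
    exact (interior_subset.trans h1).trans fun x hx => absurd (closure_nonempty_iff.1 ⟨x, hx⟩) hne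

omit [NeZero d] in
theorem diam_elem_le (hb : Bornology.IsBounded Ω) (T : M.Elem) : diam T.1 ≤ Metric.diam Ω := by
  rw [← Metric.diam_closure]
  exact Metric.diam_mono (hull_subset_closure T) hb.closure

theorem disjoint_interior {T T' : M.Elem} (h : T ≠ T') :
    Disjoint (interior (hull T.1)) (interior (hull T'.1)) := by
  rw [disjoint_left]
  intro x hx hx'
  have h1 := M.inter_subset_convexHull (M.mem_elements.1 T.2).1 (M.mem_elements.1 T'.2).1
    ⟨interior_subset hx, interior_subset hx'⟩
  have hns : ¬ T.1 ⊆ T'.1 := fun hs => h (Subtype.ext (Finset.eq_of_subset_of_card_le hs (by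
    rw [(isSimplex T).card, (isSimplex T').card])))
  obtain ⟨v, hv, hv'⟩ := Finset.not_subset.1 hns
  have h2 : x ∈ hull (T.1.erase v) := by
    refine convexHull_mono ?_ h1
    intro w hw
    exact Finset.mem_coe.2 (Finset.mem_erase.2 ⟨fun h => hv' (h ▸ hw.2), hw.1⟩)
  have h3 := ((isSimplex T).mem_face_iff hv).1 h2
  exact ((isSimplex T).bary_pos_of_mem_interior hv hx).ne' h3.2

theorem pairwise_aedisjoint :
    Pairwise (Function.onFun (AEDisjoint (volume : Measure (E d))) fun T : M.Elem =>
      hull T.1) := by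
  intro T T' h
  have hae : ∀ T : M.Elem, interior (hull T.1) =ᵐ[(volume : Measure (E d))] hull T.1 := fun T =>
    interior_ae_eq_of_null_frontier ((convex_convexHull ℝ _).addHaar_frontier volume)
  exact ((disjoint_interior h).aedisjoint).congr (hae T).symm (hae T').symm

omit [NeZero d] in
theorem ae_eq_iUnion (hc : Convex ℝ Ω) :
    Ω =ᵐ[(volume : Measure (E d))] ⋃ T : M.Elem, hull T.1 := by
  rw [← closure_eq_iUnion]
  exact (closure_ae_eq_of_null_frontier (hc.addHaar_frontier volume)).symm

/-- An integral over the domain is the sum of the integrals over the elements. -/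
theorem integral_eq_sum (hc : Convex ℝ Ω) {G : Type*} [NormedAddCommGroup G] [NormedSpace ℝ G]
    {f : E d → G} (hf : ∀ T : M.Elem, IntegrableOn f (hull T.1)) :
    ∫ x in Ω, f x = ∑ T : M.Elem, ∫ x in hull T.1, f x := by
  have hi : IntegrableOn f (⋃ T : M.Elem, hull T.1) := integrableOn_finite_iUnion.2 hf
  have hs : ∀ T : M.Elem, NullMeasurableSet (hull T.1) (volume : Measure (E d)) := fun T =>
    (measurableSet_hull T.1).nullMeasurableSet
  have h1 := integral_iUnion_ae hs pairwise_aedisjoint hi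
  rw [tsum_fintype] at h1
  rw [← h1]
  exact setIntegral_congr_set (ae_eq_iUnion hc)

omit [NeZero d] in
theorem integrableOn_elem (hΩ : IsOpen Ω) (hc : Convex ℝ Ω) (T : M.Elem) {G : Type*}
    [NormedAddCommGroup G] {f : E d → G} (hf : IntegrableOn f Ω) : IntegrableOn f (hull T.1) := by
  rw [IntegrableOn, restrict_hull_eq]
  exact hf.mono_set (interior_hull_subset hΩ hc T)

omit [NeZero d] in
theorem broken_eq {Y : Type} [AddCommMonoid Y] (v : M.Elem → E d → Y) (T : M.Elem) {x : E d}
    [NeZero d] (hx : x ∈ interior (hull T.1)) : broken v x = v T x := by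
  rw [broken, Finset.sum_eq_single T]
  · rw [indicator_of_mem hx]
  · intro T' _ h
    exact indicator_of_notMem (fun h' => (disjoint_left.1 (disjoint_interior h)) h' hx) _
  · exact fun h => absurd (Finset.mem_univ _) h

theorem ae_broken_eq {Y : Type} [AddCommMonoid Y] (v : M.Elem → E d → Y) (T : M.Elem) :
    ∀ᵐ x ∂(volume.restrict (hull T.1)), broken v x = v T x := by
  rw [restrict_hull_eq]
  filter_upwards [ae_restrict_mem isOpen_interior.measurableSet] with x hx
  exact broken_eq v T hx

omit [NeZero d] in
theorem sum_sum_facetsOf {Y : Type*} [AddCommMonoid Y] (g : M.Elem → M.Facet → Y) :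
    ∑ T : M.Elem, ∑ F ∈ M.facetsOf T, g T F =
      ∑ F : M.Facet, ∑ T : M.Elem, open scoped Classical in if F ∈ M.facetsOf T then g T F else 0 := by
  classical
  rw [Finset.sum_comm]
  refine Finset.sum_congr rfl fun T _ => ?_
  rw [Finset.sum_ite_mem, Finset.univ_inter]

/-- Integration by parts with a piecewise constant function `c`. -/
theorem sum_integral_fderiv (c : M.Elem → ℝ) {φ : E d → ℝ} (hφ : ContDiff ℝ 1 φ) (e : E d) :
    ∑ T : M.Elem, c T * ∫ x in hull T.1, fderiv ℝ φ x e =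
      ∑ F : M.Facet, (∑ T : M.Elem, open scoped Classical in
        if F ∈ M.facetsOf T then c T * inner ℝ e (normal T.1 F.1) else 0) *
          ∫ y, φ y ∂(surf (hull F.1)) := by
  classical
  have h : ∀ T : M.Elem, c T * ∫ x in hull T.1, fderiv ℝ φ x e =
      ∑ F ∈ M.facetsOf T, c T * inner ℝ e (normal T.1 F.1) * ∫ y, φ y ∂(surf (hull F.1)) := by
    intro T
    rw [(isSimplex T).integral_fderiv hφ e, ← sum_facetsOf_eq T fun G =>
      inner ℝ e (normal T.1 G) * ∫ y, φ y ∂(surf (hull G)), Finset.mul_sum]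
    exact Finset.sum_congr rfl fun F _ => by ring
  rw [Finset.sum_congr rfl fun T _ => h T, sum_sum_facetsOf]
  refine Finset.sum_congr rfl fun F _ => ?_
  rw [Finset.sum_mul]
  exact Finset.sum_congr rfl fun T _ => by split_ifs <;> simp

theorem sum_integral_fderiv_eq_zero (hc : Convex ℝ Ω) {φ : E d → ℝ} (hφ : ContDiff ℝ 1 φ)
    (hφc : HasCompactSupport φ) (hφs : tsupport φ ⊆ Ω) (e : E d) :
    ∑ T : M.Elem, ∫ x in hull T.1, fderiv ℝ φ x e = 0 := by
  have hφ' : Continuous fun x => fderiv ℝ φ x := hφ.continuous_fderiv one_ne_zero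
  have hφcont := hφ.continuous
  have hφe : Continuous fun x => fderiv ℝ φ x e := by fun_prop
  rw [← integral_eq_sum hc fun T => integrableOn_hull hφe]
  have hd : ∀ x ∉ Ω, fderiv ℝ φ x = 0 := fun x hx =>
    fderiv_of_notMem_tsupport ℝ fun h => hx (hφs h)
  rw [setIntegral_eq_integral_of_forall_compl_eq_zero fun x hx => by rw [hd x hx]; simp]
  have := integral_mul_fderiv_eq_neg_fderiv_mul_of_integrable (μ := (volume : Measure (E d)))
    (f := fun _ => (1 : ℝ)) (g := φ) (v := e) (by simp)
    (by
      simp only [one_mul]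
      exact hφe.integrable_of_hasCompactSupport (hφc.fderiv_apply ℝ e))
    (by
      simp only [one_mul]
      exact hφcont.integrable_of_hasCompactSupport hφc)
    (fun x _ => differentiableAt_const _) (fun x _ => hφ.differentiable one_ne_zero x)
  simpa using this

/-- The normals to an interior face that point out of the two elements on its sides cancel. -/
theorem sum_normal_eq_zero (hΩ : IsOpen Ω) (hc : Convex ℝ Ω) {F : M.Facet}
    (hF : ¬ hull F.1 ⊆ frontier Ω) :
    ∑ T : M.Elem, (open scoped Classical in if F ∈ M.facetsOf T then normal T.1 F.1 else 0) = 0 := by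
  classical
  obtain ⟨T₀, hT₀⟩ := exists_elem F
  obtain ⟨v₀, hv₀, hFe⟩ := exists_eq_erase hT₀
  have hS := isSimplex T₀
  obtain ⟨y, hyF, hyn⟩ := not_subset.1 hF
  have hyΩ : y ∈ Ω := by
    by_contra h
    refine hyn ?_
    rw [hΩ.frontier_eq]
    exact ⟨hull_subset_closure T₀ (convexHull_mono (by exact_mod_cast mem_facetsOf.1 hT₀) hyF), h⟩
  rw [hFe] at hyF
  obtain ⟨z, hzΩ, hzF, hzpos⟩ := hS.exists_relint hv₀ hyF hΩ hyΩ
  -- the other faces do not meet a neighborhood of `z`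
  have hzG : ∀ G : M.Facet, G ≠ F → z ∉ hull G.1 := by
    intro G hG hz
    have h1 := M.inter_subset_convexHull (M.mem_facets.1 F.2).1 (M.mem_facets.1 G.2).1
      ⟨by rw [hFe]; exact hzF, hz⟩
    have hns : ¬ F.1 ⊆ G.1 := fun hs => hG (Subtype.ext (Finset.eq_of_subset_of_card_le hs (by
      rw [(M.mem_facets.1 F.2).2, (M.mem_facets.1 G.2).2])).symm)
    obtain ⟨w, hw, hw'⟩ := Finset.not_subset.1 hns
    have hwT : w ∈ T₀.1.erase v₀ := hFe ▸ hw
    have h2 : z ∈ hull (T₀.1.erase w) := by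
      refine convexHull_mono ?_ h1
      intro u hu
      exact Finset.mem_coe.2 (Finset.mem_erase.2 ⟨fun h => hw' (h ▸ hu.2),
        mem_facetsOf.1 hT₀ hu.1⟩)
    have h3 := (hS.mem_face_iff (Finset.mem_of_mem_erase hwT)).1 h2
    exact (hzpos w hwT).ne' h3.2
  set K : Set (E d) := ⋃ G : {G : M.Facet // G ≠ F}, hull G.1.1
  have hK : IsClosed K := isClosed_iUnion_of_finite fun G => (isCompact_hull _).isClosed
  have hO : Ω ∩ Kᶜ ∈ 𝓝 z := (hΩ.inter hK.isOpen_compl).mem_nhds ⟨hzΩ, fun h => by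
    obtain ⟨G, hG⟩ := mem_iUnion.1 h
    exact hzG G.1 G.2 hG⟩
  obtain ⟨φ, hφs, hφc, hφd, hφr, hφ1⟩ := exists_contDiff_tsupport_subset (n := 1) hO
  have hφcont := hφd.continuous
  have hφ0 : ∀ x, 0 ≤ φ x := fun x => (hφr (mem_range_self x)).1
  set I := ∫ y, φ y ∂(surf (hull F.1)) with hI
  have hI0 : I ≠ 0 := by
    intro h
    rw [hI, hFe] at h
    have := hS.eq_zero_of_integral_face hv₀ hφcont hφ0 h z hzF
    rw [hφ1] at this
    exact one_ne_zero this
  have key : ∀ e : E d, inner ℝ e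
      (∑ T : M.Elem, (if F ∈ M.facetsOf T then normal T.1 F.1 else 0)) * I = 0 := by
    intro e
    have h1 := sum_integral_fderiv (fun _ : M.Elem => (1 : ℝ)) hφd e
    simp only [one_mul] at h1
    rw [sum_integral_fderiv_eq_zero hc hφd hφc (hφs.trans inter_subset_left) e,
      Finset.sum_eq_single_of_mem F (Finset.mem_univ _) fun G _ hG => by
        rw [integral_surf_eq_zero fun x hx => image_eq_zero_of_notMem_tsupport fun h =>
          (hφs h).2 (mem_iUnion.2 ⟨⟨G, hG⟩, hx⟩), mul_zero]] at h1
    rw [h1, inner_sum]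
    congr 1
    exact Finset.sum_congr rfl fun T _ => by split_ifs <;> simp
  exact (inner_self_eq_zero (𝕜 := ℝ)).1 ((mul_eq_zero.1 (key _)).resolve_right hI0)

end SimplicialMesh

theorem integral_intervalIntegral_swap {K : Set (E d)} (hK : IsCompact K) {f : ℝ → E d → ℝ}
    (hf : Continuous (Function.uncurry f)) :
    ∫ y in K, (∫ s in (0 : ℝ)..1, f s y) = ∫ s in (0 : ℝ)..1, ∫ y in K, f s y := by
  simp only [intervalIntegral.integral_of_le zero_le_one]
  have hc : Continuous (Function.uncurry fun (y : E d) (s : ℝ) => f s y) :=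
    hf.comp continuous_swap
  have h1 : IntegrableOn (Function.uncurry fun (y : E d) (s : ℝ) => f s y) (K ×ˢ Ioc (0 : ℝ) 1)
      ((volume : Measure (E d)).prod (volume : Measure ℝ)) :=
    (ContinuousOn.integrableOn_compact (hK.prod isCompact_Icc) hc.continuousOn).mono_set
      (prod_mono subset_rfl Ioc_subset_Icc_self)
  rw [IntegrableOn, ← Measure.prod_restrict] at h1
  exact integral_integral_swap h1

namespace SimplicialMesh

variable [NeZero d] {Ω : Set (E d)} {M : SimplicialMesh Ω}

/-- A piecewise constant function that does not jump across the interior faces has no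
distributional gradient. -/
theorem sum_mul_integral_fderiv_eq_zero (hΩ : IsOpen Ω) (hc : Convex ℝ Ω) {c : M.Elem → ℝ}
    (h : ∀ F : M.Facet, ∀ T T' : M.Elem, F ∈ M.facetsOf T → F ∈ M.facetsOf T' → c T = c T')
    {φ : E d → ℝ} (hφ : ContDiff ℝ 1 φ) (hφs : tsupport φ ⊆ Ω) (e : E d) :
    ∑ T : M.Elem, c T * ∫ x in hull T.1, fderiv ℝ φ x e = 0 := by
  classical
  rw [sum_integral_fderiv c hφ e]
  refine Finset.sum_eq_zero fun F _ => ?_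
  by_cases hF : hull F.1 ⊆ frontier Ω
  · rw [integral_surf_eq_zero fun x hx => image_eq_zero_of_notMem_tsupport fun h => ?_, mul_zero]
    have := hF hx
    rw [hΩ.frontier_eq] at this
    exact this.2 (hφs h)
  · obtain ⟨T₀, hT₀⟩ := exists_elem F
    have h1 : ∀ T : M.Elem, (if F ∈ M.facetsOf T then c T * inner ℝ e (normal T.1 F.1) else 0) =
        c T₀ * inner ℝ e (if F ∈ M.facetsOf T then normal T.1 F.1 else 0) := by
      intro T
      split_ifs with hT
      · rw [h F T T₀ hT hT₀]
      · simp
    rw [Finset.sum_congr rfl fun T _ => h1 T, ← Finset.mul_sum, ← inner_sum,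
      sum_normal_eq_zero hΩ hc hF]
    simp

theorem sum_mul_integral_of_support (c : M.Elem → ℝ) {φ : E d → ℝ} (T : M.Elem)
    (hs : ∀ x ∉ interior (hull T.1), φ x = 0) :
    ∑ S : M.Elem, c S * ∫ x in hull S.1, φ x = c T * ∫ x, φ x := by
  rw [Finset.sum_eq_single T]
  · rw [setIntegral_eq_integral_of_forall_compl_eq_zero fun x hx => hs x fun h =>
      hx (interior_subset h)]
  · intro S _ hS
    rw [restrict_hull_eq, setIntegral_eq_zero_of_forall_eq_zero fun x hx => hs x fun h =>
      (disjoint_left.1 (disjoint_interior hS)) hx h, mul_zero]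
  · exact fun h => absurd (Finset.mem_univ _) h

/-- The elements are connected through their faces: a function on the set of elements that takes
equal values on neighbors is constant. The proof transports a bump function along a segment
joining two elements. -/
theorem eq_of_forall_adjacent (hΩ : IsOpen Ω) (hc : Convex ℝ Ω) {c : M.Elem → ℝ}
    (h : ∀ F : M.Facet, ∀ T T' : M.Elem, F ∈ M.facetsOf T → F ∈ M.facetsOf T' → c T = c T')
    (T T' : M.Elem) : c T = c T' := by
  obtain ⟨x, hx⟩ := (isSimplex T).interior_nonempty
  obtain ⟨x', hx'⟩ := (isSimplex T').interior_nonempty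
  obtain ⟨r, hr, hb⟩ := Metric.isOpen_iff.1 isOpen_interior x hx
  obtain ⟨r', hr', hb'⟩ := Metric.isOpen_iff.1 isOpen_interior x' hx'
  obtain ⟨ρ, hρ, hρrr⟩ := exists_between (lt_min hr hr')
  have hρr := hρrr.trans_le (min_le_left _ _)
  have hρr' := hρrr.trans_le (min_le_right _ _)
  let ψ : ContDiffBump (0 : E d) := ⟨ρ / 2, ρ, by positivity, by linarith⟩
  have hψ : ContDiff ℝ 1 ψ := ψ.contDiff
  set φ : ℝ → E d → ℝ := fun s y => ψ (y - (x + s • (x' - x)))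
  have hφ : ∀ s, ContDiff ℝ 1 (φ s) := fun s => hψ.comp (contDiff_id.sub contDiff_const)
  have hφz : ∀ s y, φ s y ≠ 0 → dist y (x + s • (x' - x)) < ρ := fun s y h => by
    contrapose! h
    exact ψ.zero_of_le_dist (by simpa [dist_eq_norm] using h)
  have hφts : ∀ s ∈ Icc (0 : ℝ) 1, tsupport (φ s) ⊆ Ω := by
    intro s hs
    have h1 : Function.support (φ s) ⊆ Metric.closedBall (x + s • (x' - x)) ρ := fun y hy =>
      (hφz s y hy).le
    refine (closure_minimal h1 Metric.isClosed_closedBall).trans fun y hy => ?_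
    rw [Metric.mem_closedBall, dist_eq_norm] at hy
    set z := y - (x + s • (x' - x)) with hz
    have e1 : y = (1 - s) • (x + z) + s • (x' + z) := by
      rw [hz]
      module
    rw [e1]
    refine hc (interior_hull_subset hΩ hc T (hb ?_)) (interior_hull_subset hΩ hc T' (hb' ?_))
      (by linarith [hs.2]) hs.1 (by ring)
    · simpa using hy.trans_lt hρr
    · simpa using hy.trans_lt hρr'
  set D : ℝ → E d → ℝ := fun s y => fderiv ℝ ψ (y - (x + s • (x' - x))) (x' - x)
  have hDc : Continuous (Function.uncurry D) := by
    have := hψ.continuous_fderiv one_ne_zero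
    simp only [D, Function.uncurry_def]
    fun_prop
  have key : ∀ S : M.Elem, (∫ y in hull S.1, φ 0 y) - ∫ y in hull S.1, φ 1 y =
      ∫ s in (0 : ℝ)..1, ∫ y in hull S.1, D s y := by
    intro S
    have h1 : ∀ y, φ 0 y - φ 1 y = ∫ s in (0 : ℝ)..1, D s y := by
      intro y
      have hd : ∀ s, HasDerivAt (fun s => φ s y) (-D s y) s := fun s => by
        have h1 : HasDerivAt (fun s : ℝ => y - (x + s • (x' - x))) (-(x' - x)) s := by
          simpa using (((hasDerivAt_id s).smul_const (x' - x)).const_add x).const_sub y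
        rw [← map_neg]
        exact (hψ.differentiable one_ne_zero _).hasFDerivAt.comp_hasDerivAt s h1
      have hcy : Continuous fun s => D s y := hDc.uncurry_right y
      have h2 := intervalIntegral.integral_eq_sub_of_hasDerivAt (fun s _ => hd s)
        (hcy.neg.intervalIntegrable 0 1)
      rw [intervalIntegral.integral_neg] at h2
      linarith
    rw [← integral_sub (integrableOn_hull (hφ 0).continuous) (integrableOn_hull (hφ 1).continuous)]
    simp only [h1]
    exact integral_intervalIntegral_swap (isCompact_hull S.1) hDc
  have hsum : ∑ S : M.Elem, c S * (∫ y in hull S.1, φ 0 y) =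
      ∑ S : M.Elem, c S * ∫ y in hull S.1, φ 1 y := by
    have hSc : ∀ S : M.Elem, Continuous fun s => ∫ y in hull S.1, D s y := fun S =>
      continuous_parametric_integral_of_continuous hDc (isCompact_hull S.1)
    rw [← sub_eq_zero, ← Finset.sum_sub_distrib]
    simp only [← mul_sub, key, ← intervalIntegral.integral_const_mul]
    rw [← intervalIntegral.integral_finsetSum fun S _ =>
      ((hSc S).const_mul (c S)).intervalIntegrable 0 1,
      intervalIntegral.integral_congr (g := fun _ => (0 : ℝ)) fun s hs => ?_]
    · simp
    · rw [uIcc_of_le zero_le_one] at hs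
      simpa only [φ, fderiv_comp_sub] using
        sum_mul_integral_fderiv_eq_zero hΩ hc h (hφ s) (hφts s hs) (x' - x)
  rw [sum_mul_integral_of_support c T, sum_mul_integral_of_support c T'] at hsum
  · simp only [φ, integral_sub_right_eq_self (μ := (volume : Measure (E d))) fun y => ψ y] at hsum
    exact mul_right_cancel₀ ψ.integral_pos.ne' hsum
  · intro y hy
    by_contra h
    exact hy (hb' (by simpa using (hφz 1 y h).trans hρr'))
  · intro y hy
    by_contra h
    exact hy (hb (by simpa using (hφz 0 y h).trans hρr))

end SimplicialMesh

/-! ### Raviart--Thomas--Nédélec interpolation -/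

theorem IsSimplex.exists_inball [NeZero d] {T : Finset (E d)} (hT : IsSimplex T) :
    ∃ σ x r, HasInball σ T x r := by
  obtain ⟨x, hx⟩ := hT.interior_nonempty
  obtain ⟨r, hr, hb⟩ := Metric.nhds_basis_closedBall.mem_iff.1
    (mem_interior_iff_mem_nhds.1 hx)
  exact ⟨diam T / (2 * r), x, r, hT, hr, hb, by field_simp; exact le_rfl⟩

/-- The field `w` interpolates on the element `T` a field with values `v` in the element and
values `g` on the faces. -/
structure IsInterp {Ω : Set (E d)} {M : SimplicialMesh Ω} (k : ℕ) (T : M.Elem) (v : E d → E d)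
    (g : M.Facet → E d → E d) (w : E d → E d) : Prop where
  mem : w ∈ RTN d (k + 1)
  moment : ∀ s ∈ vec (poly d ((k : ℤ) - 1)),
    ∫ x in hull T.1, inner ℝ (w x) (s x) = ∫ x in hull T.1, inner ℝ (v x) (s x)
  facet : ∀ F ∈ M.facetsOf T, ∀ x ∈ hull F.1, inner ℝ (w x) (normal T.1 F.1) =
    lproj (surf (hull F.1)) (facetPoly F.1 k) (fun y => inner ℝ (g F y) (normal T.1 F.1)) x

namespace SimplicialMesh

variable [NeZero d] {Ω : Set (E d)} {M : SimplicialMesh Ω}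

instance (F : M.Facet) : IsFiniteMeasure (surf (hull F.1)) := isFiniteMeasure_surf F

theorem norm_normal_facet {T : M.Elem} {F : M.Facet} (hF : F ∈ M.facetsOf T) :
    ‖normal T.1 F.1‖ = 1 := by
  obtain ⟨v, hv, h⟩ := exists_eq_erase hF
  rw [h]
  exact (isSimplex T).norm_normal hv

theorem memLp_facetPoly {F : M.Facet} {l : ℤ} {p : E d → E d} (hp : p ∈ vec (facetPoly F.1 l)) :
    MemLp p 2 (surf (hull F.1)) := (isL2Space_facetPoly F l).memLp_vec hp

end SimplicialMesh

open SimplicialMesh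

section Interp

variable [NeZero d]

theorem IsInterp.eq {Ω : Set (E d)} {M : SimplicialMesh Ω} {k : ℕ} {T : M.Elem} {v : E d → E d}
    {g : M.Facet → E d → E d} {w w' : E d → E d} (h : IsInterp k T v g w)
    (h' : IsInterp k T v g w') : w = w' := by
  have hc := continuous_of_mem_RTN h.mem
  have hc' := continuous_of_mem_RTN h'.mem
  have := (isSimplex T).eq_zero_of_dofs (w := w - w') ((RTN d (k + 1)).sub_mem h.mem h'.mem)
    (fun v hv x hx => by
      have h1 := h.facet (M.oppFacet T ⟨v, hv⟩) (oppFacet_mem T _) x hx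
      have h2 := h'.facet (M.oppFacet T ⟨v, hv⟩) (oppFacet_mem T _) x hx
      rw [Pi.sub_apply, inner_sub_left, sub_eq_zero]
      exact h1.trans h2.symm)
    (fun s hs => by
      have hsc := continuous_of_mem_vec hs
      simp only [Pi.sub_apply, inner_sub_left]
      rw [integral_sub (integrableOn_hull (by fun_prop)) (integrableOn_hull (by fun_prop)),
        h.moment s hs, h'.moment s hs, sub_self])
  exact sub_eq_zero.1 this

theorem exists_isInterp (k : ℕ) {σ : ℝ} (hσ : 1 ≤ σ) :
    ∃ C : ℝ, 0 < C ∧ ∀ {Ω : Set (E d)} {M : SimplicialMesh Ω} (T : M.Elem) (x₀ : E d) (r : ℝ),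
      HasInball σ T.1 x₀ r → ∀ (v : E d → E d) (g : M.Facet → E d → E d),
      MemLp v 2 (volume.restrict (hull T.1)) →
      (∀ F ∈ M.facetsOf T, MemLp (g F) 2 (surf (hull F.1))) →
      ∃ w, IsInterp k T v g w ∧ ∫ x in hull T.1, ‖w x‖ ^ 2 ≤ C * ((∫ x in hull T.1, ‖v x‖ ^ 2) +
        diam T.1 * ∑ F ∈ M.facetsOf T, ∫ x, ‖g F x‖ ^ 2 ∂(surf (hull F.1))) := by
  obtain ⟨C, hC, h⟩ := exists_RTN_field (d := d) k hσ
  refine ⟨C, hC, fun {Ω M} T x₀ r hT v g hv hg => ?_⟩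
  have hgn : ∀ F ∈ M.facetsOf T,
      MemLp (fun y => inner ℝ (g F y) (normal T.1 F.1)) 2 (surf (hull F.1)) :=
    fun F hF => (hg F hF).inner_const _
  have hex : ∀ F ∈ M.facetsOf T, ∃ q ∈ poly d k, (hull F.1).indicator q =
      lproj (surf (hull F.1)) (facetPoly F.1 k) (fun y => inner ℝ (g F y) (normal T.1 F.1)) :=
    fun F hF => mem_facetPoly_iff.1 ((isL2Space_facetPoly F k).lproj_spec (hgn F hF)).1
  choose! q hq hqe using hex
  classical
  set q' : E d → E d → ℝ := fun v => if hv : v ∈ T.1 then q (M.oppFacet T ⟨v, hv⟩) else 0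
  have hq' : ∀ v (hv : v ∈ T.1), q' v = q (M.oppFacet T ⟨v, hv⟩) := fun v hv => dif_pos hv
  obtain ⟨w, hw, hm, hn, hb⟩ := h T.1 x₀ r hT v hv q' fun v hv => by
    rw [hq' v hv]
    exact hq _ (oppFacet_mem T _)
  refine ⟨w, ⟨hw, hm, fun F hF x hx => ?_⟩, hb.trans ?_⟩
  · obtain ⟨v, hv, he⟩ := exists_eq_erase hF
    have hFe : F = M.oppFacet T ⟨v, hv⟩ := Subtype.ext he
    rw [← hqe F hF, indicator_of_mem hx, hFe, ← hq' v hv]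
    rw [he] at hx
    exact hn v hv x hx
  · have h0 := hT.diam_pos
    gcongr
    rw [sum_facetsOf T fun F => ∫ x, ‖g F x‖ ^ 2 ∂(surf (hull F.1)), ← Finset.sum_coe_sort T.1]
    refine Finset.sum_le_sum fun v _ => ?_
    have hF := oppFacet_mem T v
    set F := M.oppFacet T v
    have e1 : ∫ x, q' v x ^ 2 ∂(surf (hull (T.1.erase v))) =
        ∫ x, lproj (surf (hull F.1)) (facetPoly F.1 k)
          (fun y => inner ℝ (g F y) (normal T.1 F.1)) x ^ 2 ∂(surf (hull F.1)) := by
      refine integral_surf_congr fun x hx => ?_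
      have hx' : x ∈ hull F.1 := hx
      rw [← hqe F hF, indicator_of_mem hx', hq' v v.2]
    rw [e1]
    refine ((isL2Space_facetPoly F k).integral_lproj_sq_le (hgn F hF)).trans
      (integral_mono ((hgn F hF).integrable_sq) (integrable_norm_sq (hg F hF)) fun x => ?_)
    have h1 := abs_real_inner_le_norm (g F x) (normal T.1 F.1)
    rw [norm_normal_facet hF, mul_one] at h1
    calc _ = |inner ℝ (g F x) (normal T.1 F.1)| ^ 2 := (sq_abs _).symm
      _ ≤ _ := by gcongr

variable {Ω : Set (E d)} {M : SimplicialMesh Ω}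

theorem isInterp_interpRTN (k : ℕ) (T : M.Elem) {v : E d → E d}
    (hv : MemLp v 2 (volume.restrict (hull T.1)))
    (hg : ∀ F ∈ M.facetsOf T,
      MemLp (trace (interior (hull T.1)) (hull F.1) v) 2 (surf (hull F.1))) :
    IsInterp k T v (fun F => trace (interior (hull T.1)) (hull F.1) v)
      (interpRTN (k + 1) T v) := by
  obtain ⟨σ, x, r, hT⟩ := (isSimplex T).exists_inball
  obtain ⟨C, -, h⟩ := exists_isInterp (d := d) k hT.one_le
  obtain ⟨w, hw, -⟩ := h T x r hT v _ hv hg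
  have e1 : ((k + 1 : ℕ) : ℤ) - 2 = (k : ℤ) - 1 := by push_cast; ring
  have e2 : ((k + 1 : ℕ) : ℤ) - 1 = k := by push_cast; ring
  have hL := (isSimplex T).isL2Space_poly ((k : ℤ) - 1)
  have hmem : ∀ w : E d → E d, w ∈ RTN d (k + 1) → MemLp w 2 (volume.restrict (hull T.1)) :=
    fun w hw => memLp_hull (continuous_of_mem_RTN hw)
  have hs := Classical.epsilon_spec (p := fun w => w ∈ RTN d (k + 1) ∧
    lprojVec (volume.restrict (hull T.1)) (poly d (((k + 1 : ℕ) : ℤ) - 2)) w =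
      lprojVec (volume.restrict (hull T.1)) (poly d (((k + 1 : ℕ) : ℤ) - 2)) v ∧
    ∀ F ∈ M.facetsOf T, ∀ x ∈ hull F.1,
      inner ℝ (w x) (normal T.1 F.1) =
        lproj (surf (hull F.1)) (facetPoly F.1 (((k + 1 : ℕ) : ℤ) - 1))
          (fun y => inner ℝ (trace (interior (hull T.1)) (hull F.1) v y) (normal T.1 F.1)) x)
    ⟨w, hw.mem, by
      rw [e1]
      exact (hL.lprojVec_eq_lprojVec_iff (hmem w hw.mem) hv).2 hw.moment, by
      rw [e2]
      exact hw.facet⟩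
  change interpRTN (k + 1) T v ∈ _ ∧ lprojVec _ _ (interpRTN (k + 1) T v) = _ ∧
    ∀ F ∈ _, ∀ x ∈ _, inner ℝ (interpRTN (k + 1) T v x) _ = _ at hs
  obtain ⟨h1, h2, h3⟩ := hs
  rw [e1] at h2
  rw [e2] at h3
  exact ⟨h1, (hL.lprojVec_eq_lprojVec_iff (hmem _ h1) hv).1 h2, h3⟩

theorem isInterp_of_contDiff (k : ℕ) (T : M.Elem) {p : E d → E d} (hp : ContDiff ℝ ∞ p) :
    IsInterp k T p (fun _ => p) (interpRTN (k + 1) T p) := by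
  have htr : ∀ F ∈ M.facetsOf T,
      trace (interior (hull T.1)) (hull F.1) p =ᵐ[surf (hull F.1)] p := by
    intro F hF
    obtain ⟨v, hv, h⟩ := exists_eq_erase hF
    rw [h]
    exact (isSimplex T).trace_ae_eq_self hv hp
  have hpF : ∀ F : M.Facet, MemLp p 2 (surf (hull F.1)) := fun F =>
    memLp_surf hp.continuous.continuousOn
  obtain ⟨h1, h2, h3⟩ := isInterp_interpRTN k T (v := p) (memLp_hull hp.continuous)
    fun F hF => (memLp_congr_ae (htr F hF)).2 (hpF F)
  refine ⟨h1, h2, fun F hF x hx => ?_⟩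
  rw [h3 F hF x hx]
  refine congrFun ((isL2Space_facetPoly F k).lproj_congr
    (((memLp_congr_ae (htr F hF)).2 (hpF F)).inner_const _) ?_) x
  filter_upwards [htr F hF] with y hy
  rw [hy]

theorem interpFacet_of_contDiff (k : ℕ) {T : M.Elem} {F : M.Facet} (hF : F ∈ M.facetsOf T)
    {p : E d → E d} (hp : ContDiff ℝ ∞ p) :
    interpFacet k (interior (hull T.1)) F p = lprojVec (surf (hull F.1)) (facetPoly F.1 k) p := by
  obtain ⟨v, hv, h⟩ := exists_eq_erase hF
  have htr : trace (interior (hull T.1)) (hull F.1) p =ᵐ[surf (hull F.1)] p := by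
    rw [h]
    exact (isSimplex T).trace_ae_eq_self hv hp
  have hpF : MemLp p 2 (surf (hull F.1)) := memLp_surf hp.continuous.continuousOn
  exact (isL2Space_facetPoly F k).lprojVec_congr ((memLp_congr_ae htr).2 hpF) htr

theorem IsInterp.add {k : ℕ} {T : M.Elem} {v v' : E d → E d} {g g' : M.Facet → E d → E d}
    {w w' : E d → E d} (h : IsInterp k T v g w) (h' : IsInterp k T v' g' w')
    (hv : MemLp v 2 (volume.restrict (hull T.1))) (hv' : MemLp v' 2 (volume.restrict (hull T.1)))
    (hg : ∀ F ∈ M.facetsOf T, MemLp (g F) 2 (surf (hull F.1)))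
    (hg' : ∀ F ∈ M.facetsOf T, MemLp (g' F) 2 (surf (hull F.1))) :
    IsInterp k T (v + v') (g + g') (w + w') := by
  refine ⟨(RTN d (k + 1)).add_mem h.mem h'.mem, fun s hs => ?_, fun F hF x hx => ?_⟩
  · have hsm : MemLp s 2 (volume.restrict (hull T.1)) := memLp_hull (continuous_of_mem_vec hs)
    simp only [Pi.add_apply, inner_add_left]
    rw [integral_add (integrable_inner_of_memLp (memLp_hull (continuous_of_mem_RTN h.mem)) hsm)
        (integrable_inner_of_memLp (memLp_hull (continuous_of_mem_RTN h'.mem)) hsm),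
      integral_add (integrable_inner_of_memLp hv hsm) (integrable_inner_of_memLp hv' hsm),
      h.moment s hs, h'.moment s hs]
  · rw [Pi.add_apply, inner_add_left, h.facet F hF x hx, h'.facet F hF x hx]
    refine congrFun (((isL2Space_facetPoly F k).lproj_add ((hg F hF).inner_const _)
      ((hg' F hF).inner_const _)).symm.trans ?_) x
    congr 1
    funext y
    simp [inner_add_left]

theorem IsInterp.smul {k : ℕ} {T : M.Elem} {v : E d → E d} {g : M.Facet → E d → E d}
    {w : E d → E d} (h : IsInterp k T v g w) (c : ℝ)
    (hg : ∀ F ∈ M.facetsOf T, MemLp (g F) 2 (surf (hull F.1))) :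
    IsInterp k T (c • v) (c • g) (c • w) := by
  refine ⟨(RTN d (k + 1)).smul_mem c h.mem, fun s hs => ?_, fun F hF x hx => ?_⟩
  · simp only [Pi.smul_apply, real_inner_smul_left, integral_const_mul]
    rw [h.moment s hs]
  · rw [Pi.smul_apply, real_inner_smul_left, h.facet F hF x hx]
    refine congrFun (((isL2Space_facetPoly F k).lproj_smul c
      ((hg F hF).inner_const _)).symm.trans ?_) x
    congr 1
    funext y
    simp [real_inner_smul_left]

theorem isInterp_const (k : ℕ) (T : M.Elem) (c : E d) :
    IsInterp k T (fun _ => c) (fun _ _ => c) (fun _ => c) := by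
  refine ⟨vec_le_RTN k (const_mem_vec (by omega) c), fun _ _ => rfl, fun F hF x hx => ?_⟩
  have hm : (hull F.1).indicator (fun _ => (inner ℝ c (normal T.1 F.1) : ℝ)) ∈ facetPoly F.1 k :=
    mem_facetPoly_iff.2 ⟨_, const_mem_poly (by omega) _, rfl⟩
  have hL := (isL2Space_facetPoly F k)
  have hae : (fun _ => (inner ℝ c (normal T.1 F.1) : ℝ)) =ᵐ[surf (hull F.1)]
      (hull F.1).indicator (fun _ => (inner ℝ c (normal T.1 F.1) : ℝ)) := by
    filter_upwards [ae_mem_hull_surf F.1] with y hy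
    rw [indicator_of_mem hy]
  rw [hL.lproj_congr (memLp_const _) hae, hL.lproj_self hm, indicator_of_mem hx]

end Interp

/-! ### Linearity of the discrete operators -/

theorem frob_comm (A B : E d →L[ℝ] E d) : frob A B = frob B A :=
  Finset.sum_congr rfl fun _ _ => real_inner_comm _ _

theorem continuousOn_of_mem_facetPoly {F : Finset (E d)} {l : ℤ} {p : E d → ℝ}
    (hp : p ∈ facetPoly F l) : ContinuousOn p (hull F) := by
  obtain ⟨q, hq, rfl⟩ := mem_facetPoly_iff.1 hp
  exact (continuous_of_mem_poly hq).continuousOn.congr fun x hx => indicator_of_mem hx q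

theorem continuousOn_of_mem_vec_facetPoly {F : Finset (E d)} {l : ℤ} {p : E d → E d}
    (hp : p ∈ vec (facetPoly F l)) : ContinuousOn p (hull F) := by
  have h : ∀ i, ContinuousOn (fun x => p x i) (hull F) := fun i =>
    continuousOn_of_mem_facetPoly (hp i)
  exact (PiLp.continuous_toLp 2 _).comp_continuousOn (continuousOn_pi.2 h)

theorem continuous_laplacian {w : E d → E d} (hw : ContDiff ℝ 2 w) :
    Continuous (Laplacian.laplacian w) := by
  rw [show Laplacian.laplacian w = _ from
    InnerProductSpace.laplacian_eq_iteratedFDeriv_orthonormalBasis w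
      (EuclideanSpace.basisFun (Fin d) ℝ)]
  fun_prop

namespace IsLinOn

variable {X : Type*} [AddCommGroup X] [Module ℝ X] {V : Submodule ℝ X}

theorem fderiv {f : X → E d → E d} (hf : IsLinOn V f) (hd : ∀ x ∈ V, Differentiable ℝ (f x))
    (y : E d) : IsLinOn V fun x => fderiv ℝ (f x) y :=
  ⟨fun x hx z hz => by
    beta_reduce
    rw [hf.1 x hx z hz, fderiv_add (hd x hx y) (hd z hz y)],
   fun c x hx => by
    beta_reduce
    rw [hf.2 c x hx, fderiv_const_smul (hd x hx y) c]⟩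

theorem apply {Y : Type*} [AddCommGroup Y] [Module ℝ Y] {α : Type*} {f : X → α → Y}
    (hf : IsLinOn V f) (a : α) : IsLinOn V fun x => f x a :=
  ⟨fun x hx z hz => by
    beta_reduce
    rw [hf.1 x hx z hz, Pi.add_apply],
   fun c x hx => by
    beta_reduce
    rw [hf.2 c x hx, Pi.smul_apply]⟩

theorem clm_apply {f : X → E d →L[ℝ] E d} (hf : IsLinOn V f) (y : E d) :
    IsLinOn V fun x => f x y :=
  hf.comp (ContinuousLinearMap.apply ℝ (E d) y).toLinearMap

theorem frob_left {f : X → E d →L[ℝ] E d} (hf : IsLinOn V f) (B : E d →L[ℝ] E d) :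
    IsLinOn V fun x => frob (f x) B :=
  IsLinOn.sum fun i _ => (hf.clm_apply (basisVec i)).inner_left _

theorem integral_inner {α : Type*} [MeasurableSpace α] {m : Measure α} {f : X → α → E d}
    (hf : ∀ a, IsLinOn V fun x => f x a) (hm : ∀ x ∈ V, MemLp (f x) 2 m) {g : α → E d}
    (hg : MemLp g 2 m) : IsLinOn V fun x => ∫ a, inner ℝ (f x a) (g a) ∂m :=
  IsLinOn.integral (fun a => (hf a).inner_left (g a)) fun x hx =>
    integrable_inner_of_memLp (hm x hx) hg

theorem coe {W : Submodule ℝ X} (h : W ≤ V) {Y : Type*} [AddCommGroup Y] [Module ℝ Y] {f : X → Y}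
    (hf : IsLinOn V f) : IsLinOn W f :=
  ⟨fun x hx y hy => hf.1 x (h hx) y (h hy), fun c x hx => hf.2 c x (h hx)⟩

end IsLinOn

theorem isLinOn_laplacian {l : ℤ} (x : E d) :
    IsLinOn (vec (poly d l)) fun w : E d → E d => Laplacian.laplacian w x :=
  ⟨fun _ hv _ hw => ContDiffAt.laplacian_add (contDiff_of_mem_vec hv).contDiffAt
    (contDiff_of_mem_vec hw).contDiffAt,
   fun c _ hw => InnerProductSpace.laplacian_smul c (contDiff_of_mem_vec hw).contDiffAt⟩

theorem isLinOn_fderiv {l : ℤ} (x : E d) :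
    IsLinOn (vec (poly d l)) fun w : E d → E d => fderiv ℝ w x :=
  IsLinOn.fderiv (f := fun w => w) ⟨fun _ _ _ _ => rfl, fun _ _ _ => rfl⟩
    (fun _ h => differentiable_of_mem_vec h) x

/-! ### Discrete spaces -/

section Spaces

variable {Ω : Set (E d)} {M : SimplicialMesh Ω} {k : ℕ}

theorem mem_spaceU {v : HybridVec M} : v ∈ spaceU M k ↔
    (∀ T, v.1 T ∈ RTN d (k + 1)) ∧ ∀ F : M.Facet, v.2 F ∈ vec (facetPoly F.1 k) := by
  simp [spaceU, Submodule.mem_prod, Submodule.mem_pi]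

theorem mem_spaceP {q : HybridScal M} : q ∈ spaceP M k ↔
    (∀ T, q.1 T ∈ poly d k) ∧ ∀ F : M.Facet, q.2 F ∈ facetPoly F.1 k := by
  simp [spaceP, Submodule.mem_prod, Submodule.mem_pi]

variable {v : HybridVec M} (hv : v ∈ spaceU M k)

include hv

theorem continuous_elem (T : M.Elem) : Continuous (v.1 T) :=
  continuous_of_mem_RTN ((mem_spaceU.1 hv).1 T)

theorem continuous_fderiv_elem (T : M.Elem) : Continuous fun x => fderiv ℝ (v.1 T) x :=
  continuous_fderiv_of_mem_vec (RTN_le_vec k ((mem_spaceU.1 hv).1 T))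

theorem continuousOn_facet (F : M.Facet) : ContinuousOn (v.2 F) (hull F.1) :=
  continuousOn_of_mem_vec_facetPoly ((mem_spaceU.1 hv).2 F)

theorem memLp_elem (T : M.Elem) : MemLp (v.1 T) 2 (volume.restrict (hull T.1)) :=
  memLp_hull (continuous_elem hv T)

variable [NeZero d]

theorem memLp_facet (F : M.Facet) : MemLp (v.2 F) 2 (surf (hull F.1)) :=
  memLp_surf (continuousOn_facet hv F)

theorem memLp_jump (T : M.Elem) (F : M.Facet) :
    MemLp (fun x => v.2 F x - v.1 T x) 2 (surf (hull F.1)) :=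
  memLp_surf ((continuousOn_facet hv F).sub (continuous_elem hv T).continuousOn)

end Spaces

section Reconstructions

variable [NeZero d] {Ω : Set (E d)} {M : SimplicialMesh Ω} {k : ℕ}

omit [NeZero d] in
theorem isLinOn_elem (T : M.Elem) (x : E d) :
    IsLinOn (spaceU M k) fun v : HybridVec M => v.1 T x :=
  ⟨fun _ _ _ _ => rfl, fun _ _ _ => rfl⟩

omit [NeZero d] in
theorem isLinOn_facet (F : M.Facet) (x : E d) :
    IsLinOn (spaceU M k) fun v : HybridVec M => v.2 F x :=
  ⟨fun _ _ _ _ => rfl, fun _ _ _ => rfl⟩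

omit [NeZero d] in
theorem isLinOn_jump (T : M.Elem) (F : M.Facet) (x : E d) :
    IsLinOn (spaceU M k) fun v : HybridVec M => v.2 F x - v.1 T x :=
  (isLinOn_facet F x).sub (isLinOn_elem T x)

/-- The right-hand side of the problem that defines the gradient of the velocity
reconstruction. -/
def velRhs (T : M.Elem) (v : HybridVec M) (w : E d → E d) : ℝ :=
  -(∫ x in hull T.1, inner ℝ (v.1 T x) (Laplacian.laplacian w x)) +
    ∑ F ∈ M.facetsOf T,
      ∫ x, inner ℝ (v.2 F x) (fderiv ℝ w x (normal T.1 F.1)) ∂(surf (hull F.1))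

theorem isLinOn_velRhs_left (T : M.Elem) {w : E d → E d} {l : ℤ} (hw : w ∈ vec (poly d l)) :
    IsLinOn (spaceU M k) fun v => velRhs T v w := by
  have h2 := continuous_fderiv_of_mem_vec hw
  exact (IsLinOn.integral_inner (isLinOn_elem T) (fun v hv => memLp_elem hv T)
    (memLp_hull (continuous_laplacian (contDiff_of_mem_vec hw)))).neg.add (IsLinOn.sum fun F _ =>
      IsLinOn.integral_inner (isLinOn_facet F)
      (fun v hv => memLp_facet hv F) (memLp_surf (h2.clm_apply continuous_const).continuousOn))

theorem isLinOn_velRhs_right (T : M.Elem) {v : HybridVec M} (hv : v ∈ spaceU M k) (l : ℤ) :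
    IsLinOn (vec (poly d l)) (velRhs T v) := by
  have h1 : ∀ w ∈ vec (poly d l), Continuous (Laplacian.laplacian w) := fun w hw =>
    continuous_laplacian (contDiff_of_mem_vec hw)
  refine IsLinOn.add (IsLinOn.neg (IsLinOn.integral
    (fun x => (isLinOn_laplacian x).inner_right _) fun w hw =>
      integrable_inner_of_memLp (memLp_elem hv T) (memLp_hull (h1 w hw))))
    (IsLinOn.sum fun F _ => IsLinOn.integral
      (fun x => ((isLinOn_fderiv x).clm_apply _).inner_right _) fun w hw =>
        integrable_inner_of_memLp (memLp_facet hv F) (memLp_surf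
          ((continuous_fderiv_of_mem_vec hw).clm_apply continuous_const).continuousOn))

theorem isLinOn_meanVal (T : M.Elem) : IsLinOn (spaceU M k) (meanVal k T) := by
  unfold meanVal
  split_ifs
  · exact IsLinOn.sum fun F _ => (IsLinOn.integral (isLinOn_facet F) fun v hv =>
      (memLp_facet hv F).integrable (by norm_num)).const_smul _
  · exact IsLinOn.integral (isLinOn_elem T) fun v hv =>
      integrableOn_hull (continuous_elem hv T)

omit [NeZero d] in
theorem velRhs_const (T : M.Elem) (v : HybridVec M) (c : E d) : velRhs T v (fun _ => c) = 0 := by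
  have h : ∀ x, Laplacian.laplacian (fun _ : E d => c) x = 0 := by simp
  simp [velRhs, h]

/-- The property that defines the velocity reconstruction. -/
structure IsVelRec (k : ℕ) (T : M.Elem) (v : HybridVec M) (p : E d → E d) : Prop where
  mem : p ∈ vec (poly d (k + 1))
  grad : ∀ w ∈ vec (poly d (k + 1)),
    ∫ x in hull T.1, frob (fderiv ℝ p x) (fderiv ℝ w x) = velRhs T v w
  mean : ∫ x in hull T.1, p x = meanVal k T v

theorem IsSimplex.eq_const_of_integral_frob {T : Finset (E d)} (hT : IsSimplex T) {l : ℤ}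
    (hl : 0 ≤ l) {p : E d → E d} (hp : p ∈ vec (poly d l))
    (h : ∫ x in hull T, frob (fderiv ℝ p x) (fderiv ℝ p x) = 0) : ∃ c, p = fun _ => c := by
  obtain ⟨σ, x₀, r, hb⟩ := hT.exists_inball
  obtain ⟨C, -, hC⟩ := exists_poincare_inequality (d := d) hl hb.one_le
  have hc := continuous_fderiv_of_mem_vec hp
  have h1 : ∫ x in hull T, ‖fderiv ℝ p x‖ ^ 2 = 0 := by
    refine le_antisymm ?_ (integral_nonneg fun x => sq_nonneg _)
    rw [← h]
    exact integral_mono (integrableOn_hull (by fun_prop)) (integrableOn_hull (continuous_frob hc hc))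
      fun x => opNorm_sq_le_frob _
  have h2 := hC T x₀ r hb p hp
  rw [h1, mul_zero, mul_zero] at h2
  exact ⟨p x₀, funext fun x => sub_eq_zero.1 (congrFun ((hT.isL2Space_poly
    l).eq_zero_of_integral_norm_sq (v := fun x => p x - p x₀) ((vec (poly d l)).sub_mem hp
    (const_mem_vec hl (p x₀))) (le_antisymm h2 (integral_nonneg fun x => sq_nonneg _))) x)⟩

omit [NeZero d] in
theorem IsSimplex.volume_real_pos {T : Finset (E d)} (hT : IsSimplex T) :
    0 < volume.real (hull T) := by
  refine ENNReal.toReal_pos ?_ (isCompact_hull T).measure_lt_top.ne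
  exact ((isOpen_interior.measure_pos (volume : Measure (E d)) hT.interior_nonempty).trans_le
    (measure_mono interior_subset)).ne'

omit [NeZero d] in
theorem isLinOn_integral_hull {T : Finset (E d)} {l : ℤ} :
    IsLinOn (vec (poly d l)) fun w : E d → E d => ∫ x in hull T, w x :=
  IsLinOn.integral (fun x => IsLinOn.eval x) fun _ hw => integrableOn_hull (continuous_of_mem_vec hw)

omit [NeZero d] in
theorem isLinOn_integral_frob {T : Finset (E d)} {l : ℤ} {w : E d → E d}
    (hw : w ∈ vec (poly d l)) : IsLinOn (vec (poly d l)) fun p : E d → E d =>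
      ∫ x in hull T, frob (fderiv ℝ p x) (fderiv ℝ w x) :=
  IsLinOn.integral (fun x => (isLinOn_fderiv x).frob_left _) fun _ hp => integrableOn_hull
    (continuous_frob (continuous_fderiv_of_mem_vec hp) (continuous_fderiv_of_mem_vec hw))

theorem exists_isVelRec (T : M.Elem) {v : HybridVec M} (hv : v ∈ spaceU M k) :
    ∃ p, IsVelRec k T v p := by
  have hT := isSimplex T
  have hk : (0 : ℤ) ≤ k + 1 := by omega
  have hB1 : ∀ w ∈ vec (poly d (k + 1)), IsLinOn (vec (poly d (k + 1))) fun p : E d → E d =>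
      (∫ x in hull T.1, frob (fderiv ℝ p x) (fderiv ℝ w x)) +
        inner ℝ (∫ x in hull T.1, p x) (∫ x in hull T.1, w x) := fun w hw =>
    (isLinOn_integral_frob hw).add (isLinOn_integral_hull.inner_left _)
  have hsymm : ∀ p w : E d → E d, (∫ x in hull T.1, frob (fderiv ℝ p x) (fderiv ℝ w x)) +
        inner ℝ (∫ x in hull T.1, p x) (∫ x in hull T.1, w x) =
      (∫ x in hull T.1, frob (fderiv ℝ w x) (fderiv ℝ p x)) +
        inner ℝ (∫ x in hull T.1, w x) (∫ x in hull T.1, p x) := by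
    intro p w
    simp only [frob_comm (fderiv ℝ p _)]
    rw [real_inner_comm]
  obtain ⟨p, hp, h⟩ := IsLinOn.exists_represents (V := vec (poly d (k + 1)))
    (B := fun p w => (∫ x in hull T.1, frob (fderiv ℝ p x) (fderiv ℝ w x)) +
        inner ℝ (∫ x in hull T.1, p x) (∫ x in hull T.1, w x)) hB1
    (fun p hp => by
      have := hB1 p hp
      simpa only [hsymm _ p] using this)
    (fun p hp h0 => by
      have h1 : 0 ≤ ∫ x in hull T.1, frob (fderiv ℝ p x) (fderiv ℝ p x) :=
        integral_nonneg fun x => frob_self_nonneg _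
      have h2 : 0 ≤ (inner ℝ (∫ x in hull T.1, p x) (∫ x in hull T.1, p x) : ℝ) :=
        real_inner_self_nonneg
      obtain ⟨c, rfl⟩ := hT.eq_const_of_integral_frob hk hp (by linarith)
      have h3 := (inner_self_eq_zero (𝕜 := ℝ)).1 (show inner ℝ (∫ x in hull T.1, c)
        (∫ x in hull T.1, c) = 0 by linarith)
      rw [setIntegral_const, smul_eq_zero] at h3
      funext x
      exact h3.resolve_left hT.volume_real_pos.ne')
    ((isLinOn_velRhs_right T hv (k + 1)).add (isLinOn_integral_hull.inner_right (meanVal k T v)))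
  have hm : ∫ x in hull T.1, p x = meanVal k T v := by
    refine ext_inner_right ℝ fun c => ?_
    have h1 := h (fun _ => c) (const_mem_vec hk c)
    simp only [fderiv_fun_const, velRhs_const, setIntegral_const, inner_smul_right, zero_add,
      Pi.zero_apply] at h1
    have h2 : ∀ A : E d →L[ℝ] E d, frob A 0 = 0 := fun A => by simp [frob]
    simp only [h2, integral_zero, zero_add] at h1
    exact mul_left_cancel₀ hT.volume_real_pos.ne' h1
  refine ⟨p, hp, fun w hw => ?_, hm⟩
  have h1 := h w hw
  rw [hm] at h1
  exact add_right_cancel h1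

theorem IsVelRec.eq {T : M.Elem} {v : HybridVec M} {p p' : E d → E d} (h : IsVelRec k T v p)
    (h' : IsVelRec k T v p') : p = p' := by
  have hT := isSimplex T
  have hk : (0 : ℤ) ≤ k + 1 := by omega
  have hm := (vec (poly d (k + 1))).sub_mem h.mem h'.mem
  obtain ⟨c, hcst⟩ := hT.eq_const_of_integral_frob hk hm
    (((isLinOn_integral_frob hm).map_sub h.mem h'.mem).trans
      (sub_eq_zero.2 ((h.grad _ hm).trans (h'.grad _ hm).symm)))
  have h1 : ∫ x in hull T.1, (p - p') x = 0 :=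
    (isLinOn_integral_hull.map_sub h.mem h'.mem).trans
      (sub_eq_zero.2 (h.mean.trans h'.mean.symm))
  rw [hcst, setIntegral_const, smul_eq_zero] at h1
  have h2 := h1.resolve_left hT.volume_real_pos.ne'
  rw [h2] at hcst
  exact sub_eq_zero.1 hcst

theorem isVelRec_velRec (T : M.Elem) {v : HybridVec M} (hv : v ∈ spaceU M k) :
    IsVelRec k T v (velRec k T v) := by
  obtain ⟨p, hp⟩ := exists_isVelRec T hv
  have hs := Classical.epsilon_spec (p := fun p => p ∈ vec (poly d (k + 1)) ∧
    (∀ w ∈ vec (poly d (k + 1)),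
      ∫ x in hull T.1, frob (fderiv ℝ p x) (fderiv ℝ w x) = velRhs T v w) ∧
    ∫ x in hull T.1, p x = meanVal k T v) ⟨p, hp.mem, hp.grad, hp.mean⟩
  exact ⟨hs.1, hs.2.1, hs.2.2⟩

theorem velRec_mem (T : M.Elem) {v : HybridVec M} (hv : v ∈ spaceU M k) :
    velRec k T v ∈ vec (poly d (k + 1)) := (isVelRec_velRec T hv).mem

theorem isLinOn_velRec (T : M.Elem) : IsLinOn (spaceU M k) (velRec k T) :=
  ⟨fun v hv w hw => by
    have h := isVelRec_velRec T hv
    have h' := isVelRec_velRec T hw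
    exact (isVelRec_velRec T ((spaceU M k).add_mem hv hw)).eq ⟨(vec _).add_mem h.mem h'.mem,
      fun s hs => (isLinOn_integral_frob hs).add_eq (isLinOn_velRhs_left T hs) h.mem h'.mem hv hw
        (h.grad s hs) (h'.grad s hs), isLinOn_integral_hull.add_eq (isLinOn_meanVal T) h.mem h'.mem
        hv hw h.mean h'.mean⟩,
   fun c v hv => by
    have h := isVelRec_velRec T hv
    exact (isVelRec_velRec T ((spaceU M k).smul_mem c hv)).eq ⟨(vec _).smul_mem c h.mem,
      fun s hs => (isLinOn_integral_frob hs).smul_eq (isLinOn_velRhs_left T hs) c h.mem hv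
        (h.grad s hs), isLinOn_integral_hull.smul_eq (isLinOn_meanVal T) c h.mem hv h.mean⟩⟩

theorem isLinOn_interpRTN {X : Type*} [AddCommGroup X] [Module ℝ X] {V : Submodule ℝ X}
    (T : M.Elem) {A : X → E d → E d} (hA : IsLinOn V A) (hs : ∀ x ∈ V, ContDiff ℝ ∞ (A x)) :
    IsLinOn V fun x => interpRTN (k + 1) T (A x) := by
  have hm : ∀ x ∈ V, MemLp (A x) 2 (volume.restrict (hull T.1)) := fun x hx =>
    memLp_hull (hs x hx).continuous
  have hF : ∀ x ∈ V, ∀ F ∈ M.facetsOf T, MemLp (A x) 2 (surf (hull F.1)) := fun x hx F _ =>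
    memLp_surf (hs x hx).continuous.continuousOn
  constructor
  · intro x hx y hy
    have h := isInterp_of_contDiff k T (hs _ (V.add_mem hx hy))
    beta_reduce
    rw [hA.1 x hx y hy] at h ⊢
    exact h.eq ((isInterp_of_contDiff k T (hs x hx)).add (isInterp_of_contDiff k T (hs y hy))
      (hm x hx) (hm y hy) (hF x hx) (hF y hy))
  · intro c x hx
    have h := isInterp_of_contDiff k T (hs _ (V.smul_mem c hx))
    beta_reduce
    rw [hA.2 c x hx] at h ⊢
    exact h.eq ((isInterp_of_contDiff k T (hs x hx)).smul c (hF x hx))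

theorem contDiff_velRec (T : M.Elem) {v : HybridVec M} (hv : v ∈ spaceU M k) :
    ContDiff ℝ ∞ (velRec k T v) := contDiff_of_mem_vec (velRec_mem T hv)

theorem isLinOn_deltaT (T : M.Elem) (x : E d) : IsLinOn (spaceU M k) fun v => deltaT k T v x :=
  ((isLinOn_interpRTN T (isLinOn_velRec T) fun _ hv => contDiff_velRec T hv).apply x).sub
    (isLinOn_elem T x)

theorem deltaT_mem (T : M.Elem) {v : HybridVec M} (hv : v ∈ spaceU M k) :
    deltaT k T v ∈ RTN d (k + 1) :=
  (RTN d (k + 1)).sub_mem (isInterp_of_contDiff k T (contDiff_velRec T hv)).mem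
    ((mem_spaceU.1 hv).1 T)

theorem deltaF_eq {T : M.Elem} {F : M.Facet} (hF : F ∈ M.facetsOf T) {v : HybridVec M}
    (hv : v ∈ spaceU M k) : deltaF k T F v =
      fun x => lprojVec (surf (hull F.1)) (facetPoly F.1 k) (velRec k T v) x - v.2 F x := by
  funext x
  rw [deltaF, interpFacet_of_contDiff k hF (contDiff_velRec T hv)]

theorem memLp_velRec_surf (T : M.Elem) (F : M.Facet) {v : HybridVec M} (hv : v ∈ spaceU M k) :
    MemLp (velRec k T v) 2 (surf (hull F.1)) :=
  memLp_surf (contDiff_velRec T hv).continuous.continuousOn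

theorem isLinOn_deltaF {T : M.Elem} {F : M.Facet} (hF : F ∈ M.facetsOf T) (x : E d) :
    IsLinOn (spaceU M k) fun v => deltaF k T F v x :=
  (((isL2Space_facetPoly F k).isLinOn_lprojVec (fun y => (isLinOn_velRec (k := k) T).apply y)
    (fun _ hv => memLp_velRec_surf T F hv) x).sub (isLinOn_facet F x)).congr fun _ hv =>
      congrFun (deltaF_eq hF hv) x

theorem deltaF_mem {T : M.Elem} {F : M.Facet} (hF : F ∈ M.facetsOf T) {v : HybridVec M}
    (hv : v ∈ spaceU M k) : deltaF k T F v ∈ vec (facetPoly F.1 k) := by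
  rw [deltaF_eq hF hv]
  exact (vec _).sub_mem ((isL2Space_facetPoly F k).lprojVec_mem (memLp_velRec_surf T F hv))
    ((mem_spaceU.1 hv).2 F)

/-! ### The bilinear and trilinear forms -/

omit [NeZero d] in
theorem inner0_comm (w v : HybridVec M) : inner0 w v = inner0 v w := by
  unfold inner0
  simp only [real_inner_comm]

omit [NeZero d] in
theorem jForm_comm (α : M.Elem → ℝ) (w v : HybridVec M) : jForm α w v = jForm α v w := by
  unfold jForm
  simp only [real_inner_comm]

omit [NeZero d] in
theorem aForm_comm (w v : HybridVec M) : aForm k w v = aForm k v w := by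
  unfold aForm sForm
  simp only [real_inner_comm, frob_comm (fderiv ℝ (velRec k _ w) _)]

theorem isLinOn_jump_form (T : M.Elem) (F : M.Facet) {v : HybridVec M} (hv : v ∈ spaceU M k) :
    IsLinOn (spaceU M k) fun w : HybridVec M =>
      ∫ x, inner ℝ (w.2 F x - w.1 T x) (v.2 F x - v.1 T x) ∂(surf (hull F.1)) :=
  IsLinOn.integral_inner (isLinOn_jump T F) (fun _ hw => memLp_jump hw T F) (memLp_jump hv T F)

theorem isLinOn_inner0 {v : HybridVec M} (hv : v ∈ spaceU M k) :
    IsLinOn (spaceU M k) fun w => inner0 w v :=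
  IsLinOn.sum fun T _ => (IsLinOn.integral_inner (isLinOn_elem T) (fun _ hw => memLp_elem hw T)
    (memLp_elem hv T)).add ((IsLinOn.sum fun F _ => isLinOn_jump_form T F hv).const_mul _)

theorem isLinOn_inner0_right {w : HybridVec M} (hw : w ∈ spaceU M k) :
    IsLinOn (spaceU M k) (inner0 w) := by
  simpa only [inner0_comm _ w] using (isLinOn_inner0 hw)

theorem isLinOn_jForm (α : M.Elem → ℝ) {v : HybridVec M} (hv : v ∈ spaceU M k) :
    IsLinOn (spaceU M k) fun w => jForm α w v :=
  IsLinOn.sum fun T _ => (IsLinOn.sum fun F _ => isLinOn_jump_form T F hv).const_mul _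

theorem isLinOn_jForm_right (α : M.Elem → ℝ) {w : HybridVec M} (hw : w ∈ spaceU M k) :
    IsLinOn (spaceU M k) (jForm α w) := by
  simpa only [jForm_comm α _ w] using (isLinOn_jForm α hw)

theorem memLp_deltaT (T : M.Elem) {v : HybridVec M} (hv : v ∈ spaceU M k) :
    MemLp (deltaT k T v) 2 (volume.restrict (hull T.1)) :=
  memLp_hull (continuous_of_mem_RTN (deltaT_mem T hv))

theorem isLinOn_aForm {v : HybridVec M} (hv : v ∈ spaceU M k) :
    IsLinOn (spaceU M k) fun w => aForm k w v := by
  refine IsLinOn.sum fun T _ => IsLinOn.add (IsLinOn.integral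
    (fun x => ((isLinOn_velRec T).fderiv (fun w hw => differentiable_of_mem_vec
      (velRec_mem T hw)) x).frob_left _) fun w hw => integrableOn_hull
        (continuous_frob (continuous_fderiv_of_mem_vec (velRec_mem T hw))
          (continuous_fderiv_of_mem_vec (velRec_mem T hv)))) (IsLinOn.add ?_ ?_)
  · exact (IsLinOn.integral_inner (isLinOn_deltaT T) (fun w hw => memLp_deltaT T hw)
      (memLp_deltaT T hv)).const_mul _
  · exact (IsLinOn.sum fun F hF => IsLinOn.integral_inner (isLinOn_deltaF hF)
      (fun w hw => memLp_facetPoly (deltaF_mem hF hw)) (memLp_facetPoly (deltaF_mem hF hv))).const_mul _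

theorem isLinOn_aForm_right {w : HybridVec M} (hw : w ∈ spaceU M k) :
    IsLinOn (spaceU M k) (aForm k w) := by
  simpa only [aForm_comm _ w] using (isLinOn_aForm hw)

section

variable {w v z : HybridVec M} (hw : w ∈ spaceU M k) (hv : v ∈ spaceU M k) (hz : z ∈ spaceU M k)

include hw hv hz

omit [NeZero d] in
theorem integrableOn_convection (T : M.Elem) :
    IntegrableOn (fun x => (inner ℝ (fderiv ℝ (v.1 T) x (w.1 T x)) (z.1 T x) : ℝ)) (hull T.1) :=
  integrableOn_hull (((continuous_fderiv_elem hv T).clm_apply (continuous_elem hw T)).inner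
    (continuous_elem hz T))

theorem integrable_upwind (T : M.Elem) (F : M.Facet) :
    Integrable (fun x => (inner ℝ (w.1 T x) (normal T.1 F.1) : ℝ) *
        inner ℝ (v.2 F x - v.1 T x) (z.2 F x + z.1 T x)) (surf (hull F.1)) :=
  integrable_surf ((((continuous_elem hw T).inner continuous_const).continuousOn).mul
    (((continuousOn_facet hv F).sub (continuous_elem hv T).continuousOn).inner
      ((continuousOn_facet hz F).add (continuous_elem hz T).continuousOn)))

end

theorem isLinOn_tForm_left {v z : HybridVec M} (hv : v ∈ spaceU M k) (hz : z ∈ spaceU M k) :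
    IsLinOn (spaceU M k) fun w => tForm w v z :=
  IsLinOn.sum fun T _ => IsLinOn.add
    (IsLinOn.integral (fun x => ((isLinOn_elem T x).comp (fderiv ℝ (v.1 T) x).toLinearMap).inner_left
      _) fun _ hw => integrableOn_convection hw hv hz T)
    ((IsLinOn.sum fun F _ => IsLinOn.integral (fun x => ((isLinOn_elem T x).inner_left _).mul_const _)
      fun _ hw => integrable_upwind hw hv hz T F).const_mul _)

theorem isLinOn_tForm_mid {w z : HybridVec M} (hw : w ∈ spaceU M k) (hz : z ∈ spaceU M k) :
    IsLinOn (spaceU M k) fun v => tForm w v z :=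
  IsLinOn.sum fun T _ => IsLinOn.add
    (IsLinOn.integral (fun x => ((IsLinOn.fderiv (f := fun v : HybridVec M => v.1 T)
      ⟨fun _ _ _ _ => rfl, fun _ _ _ => rfl⟩
      (fun _ hv => differentiable_of_mem_vec (RTN_le_vec k ((mem_spaceU.1 hv).1 T))) x).clm_apply
        _).inner_left _) fun _ hv => integrableOn_convection hw hv hz T)
    ((IsLinOn.sum fun F _ => IsLinOn.integral (fun x => ((isLinOn_jump T F x).inner_left _).const_mul _)
      fun _ hv => integrable_upwind hw hv hz T F).const_mul _)

theorem isLinOn_tForm_right {w v : HybridVec M} (hw : w ∈ spaceU M k) (hv : v ∈ spaceU M k) :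
    IsLinOn (spaceU M k) (tForm w v) :=
  IsLinOn.sum fun T _ => IsLinOn.add
    (IsLinOn.integral (fun x => (isLinOn_elem T x).inner_right _)
      fun _ hz => integrableOn_convection hw hv hz T)
    ((IsLinOn.sum fun F _ => IsLinOn.integral (fun x => (((isLinOn_facet F x).add
      (isLinOn_elem T x)).inner_right _).const_mul _)
      fun _ hz => integrable_upwind hw hv hz T F).const_mul _)

omit [NeZero d] in
theorem jump_nonneg (T : M.Elem) (F : M.Facet) (v : HybridVec M) :
    0 ≤ ∫ x, inner ℝ (v.2 F x - v.1 T x) (v.2 F x - v.1 T x) ∂(surf (hull F.1)) :=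
  integral_nonneg fun _ => real_inner_self_nonneg

omit [NeZero d] in
theorem inner0_self_nonneg (v : HybridVec M) : 0 ≤ inner0 v v :=
  Finset.sum_nonneg fun T _ => add_nonneg (integral_nonneg fun _ => real_inner_self_nonneg)
    (mul_nonneg (diam_nonneg _) (Finset.sum_nonneg fun F _ => jump_nonneg T F v))

omit [NeZero d] in
theorem jForm_self_nonneg {α : M.Elem → ℝ} (hα : ∀ T, 0 ≤ α T) (v : HybridVec M) :
    0 ≤ jForm α v v :=
  Finset.sum_nonneg fun T _ => mul_nonneg (hα T) (Finset.sum_nonneg fun F _ => jump_nonneg T F v)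

theorem eq_zero_of_inner0 {v : HybridVec M} (hv : v ∈ spaceU M k) (h : inner0 v v = 0) : v = 0 := by
  have h1 : ∀ T : M.Elem, 0 ≤ ∫ x in hull T.1, inner ℝ (v.1 T x) (v.1 T x) := fun T =>
    integral_nonneg fun _ => real_inner_self_nonneg
  have h2 : ∀ T : M.Elem, 0 ≤ ∑ F ∈ M.facetsOf T,
      ∫ x, inner ℝ (v.2 F x - v.1 T x) (v.2 F x - v.1 T x) ∂(surf (hull F.1)) := fun T =>
    Finset.sum_nonneg fun F _ => jump_nonneg T F v
  have h3 := (Finset.sum_eq_zero_iff_of_nonneg fun T _ =>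
    add_nonneg (h1 T) (mul_nonneg (diam_nonneg _) (h2 T))).1 h
  have hT0 : ∀ T : M.Elem, v.1 T = 0 := by
    intro T
    have h4 := h3 T (Finset.mem_univ _)
    have h5 := mul_nonneg (diam_nonneg T.1) (h2 T)
    have h6 := h1 T
    refine ((isSimplex T).isL2Space_poly (k + 1)).eq_zero_of_integral_norm_sq
      (RTN_le_vec k ((mem_spaceU.1 hv).1 T)) ?_
    simp only [← real_inner_self_eq_norm_sq]
    linarith
  refine Prod.ext (funext hT0) (funext fun F => ?_)
  obtain ⟨T, hF⟩ := exists_elem F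
  have h4 := h3 T (Finset.mem_univ _)
  have h5 := mul_nonneg (diam_nonneg T.1) (h2 T)
  have h6 := h1 T
  have h8 := (mul_eq_zero.1 (le_antisymm (by linarith) h5)).resolve_left (isSimplex T).diam_pos.ne'
  refine (isL2Space_facetPoly F k).eq_zero_of_integral_norm_sq ((mem_spaceU.1 hv).2 F) ?_
  simpa only [hT0 T, Pi.zero_apply, sub_zero, real_inner_self_eq_norm_sq] using
    ((Finset.sum_eq_zero_iff_of_nonneg fun F _ => jump_nonneg T F v).1 h8 F hF)

end Reconstructions

/-! ### The velocity-pressure coupling -/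

theorem isLinOn_dvg {l : ℤ} (x : E d) : IsLinOn (vec (poly d l)) fun w : E d → E d => dvg w x :=
  IsLinOn.sum fun i _ => ((isLinOn_fderiv x).clm_apply (basisVec i)).comp
    (EuclideanSpace.proj (𝕜 := ℝ) i).toLinearMap

namespace IsLinOn

variable {X : Type*} [AddCommGroup X] [Module ℝ X] {V : Submodule ℝ X} {f : X → ℝ} {x y : X}

theorem add_eq_zero (hf : IsLinOn V f) (hx : x ∈ V) (hy : y ∈ V) (h₁ : f x = 0) (h₂ : f y = 0) :
    f (x + y) = 0 := by
  rw [hf.1 x hx y hy, h₁, h₂, add_zero]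

theorem smul_eq_zero (hf : IsLinOn V f) (c : ℝ) (hx : x ∈ V) (h : f x = 0) : f (c • x) = 0 := by
  rw [hf.2 c x hx, h, smul_zero]

end IsLinOn

section Coupling

variable [NeZero d] {Ω : Set (E d)} {M : SimplicialMesh Ω} {k : ℕ}

theorem green_elem (T : M.Elem) {p : E d → ℝ} {ψ : E d → E d} (hp : ContDiff ℝ 1 p)
    (hψ : ContDiff ℝ 1 ψ) :
    (∫ x in hull T.1, p x * dvg ψ x) + ∫ x in hull T.1, fderiv ℝ p x (ψ x) =
      ∑ F ∈ M.facetsOf T, ∫ y, p y * inner ℝ (ψ y) (normal T.1 F.1) ∂(surf (hull F.1)) := by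
  rw [(isSimplex T).integral_mul_dvg hp hψ, sum_facetsOf_eq T fun G =>
    ∫ y, p y * inner ℝ (ψ y) (normal T.1 G) ∂(surf (hull G))]

/-- The normal component of a Raviart--Thomas--Nédélec field is a polynomial on each face. -/
theorem indicator_normal_mem {T : M.Elem} {F : M.Facet} (hF : F ∈ M.facetsOf T) {w : E d → E d}
    (hw : w ∈ RTN d (k + 1)) :
    (hull F.1).indicator (fun x => (inner ℝ (w x) (normal T.1 F.1) : ℝ)) ∈ facetPoly F.1 k := by
  obtain ⟨v, hv, h⟩ := exists_eq_erase hF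
  obtain ⟨Q, hQ, hQw⟩ := exists_poly_normal hw (normal T.1 F.1)
    (height T.1 v + inner ℝ (normal T.1 F.1) v)
  refine mem_facetPoly_iff.2 ⟨Q, hQ, indicator_congr fun x hx => (hQw x ?_).symm⟩
  rw [h] at hx ⊢
  rw [← (isSimplex T).inner_normal_of_mem_face hv hx, inner_sub_right]
  ring

/-- The right-hand side of the problem that defines the discrete pressure gradient. -/
def gradRhs (T : M.Elem) (q : HybridScal M) (w : E d → E d) : ℝ :=
  -(∫ x in hull T.1, q.1 T x * dvg w x) +
    ∑ F ∈ M.facetsOf T, ∫ x, q.2 F x * inner ℝ (w x) (normal T.1 F.1) ∂(surf (hull F.1))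

section

variable {q : HybridScal M} (hq : q ∈ spaceP M k) {w : E d → E d} (hw : w ∈ RTN d (k + 1))

include hq

omit [NeZero d] in
theorem continuous_scal (T : M.Elem) : Continuous (q.1 T) :=
  continuous_of_mem_poly ((mem_spaceP.1 hq).1 T)

omit [NeZero d] in
theorem continuousOn_scal (F : M.Facet) : ContinuousOn (q.2 F) (hull F.1) :=
  continuousOn_of_mem_facetPoly ((mem_spaceP.1 hq).2 F)

include hw

omit [NeZero d] in
theorem integrableOn_mul_dvg (T : M.Elem) :
    IntegrableOn (fun x => q.1 T x * dvg w x) (hull T.1) :=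
  integrableOn_hull ((continuous_scal hq T).mul (continuous_dvg (contDiff_of_mem_RTN hw)))

theorem integrable_mul_normal (T : M.Elem) (F : M.Facet) :
    Integrable (fun x => q.2 F x * (inner ℝ (w x) (normal T.1 F.1) : ℝ)) (surf (hull F.1)) :=
  integrable_surf ((continuousOn_scal hq F).mul
    ((continuous_of_mem_RTN hw).inner continuous_const).continuousOn)

end

theorem isLinOn_gradRhs_right (T : M.Elem) {q : HybridScal M} (hq : q ∈ spaceP M k) :
    IsLinOn (RTN d (k + 1)) (gradRhs T q) :=
  IsLinOn.add (IsLinOn.neg (IsLinOn.integral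
    (fun x => ((isLinOn_dvg x).coe (RTN_le_vec k)).const_mul _) fun _ hw =>
      integrableOn_mul_dvg hq hw T)) (IsLinOn.sum fun F _ => IsLinOn.integral
        (fun x => ((IsLinOn.eval x).inner_left _).const_mul _) fun _ hw =>
          integrable_mul_normal hq hw T F)

theorem isLinOn_gradRhs_left (T : M.Elem) {w : E d → E d} (hw : w ∈ RTN d (k + 1)) :
    IsLinOn (spaceP M k) fun q => gradRhs T q w :=
  IsLinOn.add (IsLinOn.neg (IsLinOn.integral
    (fun _ => IsLinOn.mul_const ⟨fun _ _ _ _ => rfl, fun _ _ _ => rfl⟩ _) fun _ hq =>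
      integrableOn_mul_dvg hq hw T)) (IsLinOn.sum fun F _ => IsLinOn.integral
        (fun _ => IsLinOn.mul_const ⟨fun _ _ _ _ => rfl, fun _ _ _ => rfl⟩ _) fun _ hq =>
          integrable_mul_normal hq hw T F)

theorem gradRec_spec (T : M.Elem) {q : HybridScal M} (hq : q ∈ spaceP M k) :
    gradRec k T q ∈ RTN d (k + 1) ∧ ∀ w ∈ RTN d (k + 1),
      ∫ x in hull T.1, inner ℝ (gradRec k T q x) (w x) = gradRhs T q w := by
  have hm : ∀ w ∈ RTN d (k + 1), MemLp w 2 (volume.restrict (hull T.1)) := fun w hw =>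
    memLp_hull (continuous_of_mem_RTN hw)
  have hB : ∀ w ∈ RTN d (k + 1), IsLinOn (RTN d (k + 1)) fun g : E d → E d =>
      ∫ x in hull T.1, inner ℝ (g x) (w x) := fun w hw =>
    IsLinOn.integral_inner (fun x => IsLinOn.eval x) hm (hm w hw)
  obtain ⟨g, hg, h⟩ := IsLinOn.exists_represents (V := RTN d (k + 1))
    (B := fun g w => ∫ x in hull T.1, inner ℝ (g x) (w x)) hB
    (fun g hg => by simpa only [real_inner_comm] using hB g hg)
    (fun g hg h => by
      simp only [real_inner_self_eq_norm_sq] at h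
      exact ((isSimplex T).isL2Space_poly (k + 1)).eq_zero_of_integral_norm_sq
        (RTN_le_vec k hg) h)
    (isLinOn_gradRhs_right T hq)
  exact Classical.epsilon_spec (p := fun g => g ∈ RTN d (k + 1) ∧ ∀ w ∈ RTN d (k + 1),
    ∫ x in hull T.1, inner ℝ (g x) (w x) = gradRhs T q w) ⟨g, hg, h⟩

theorem bForm_eq {v : HybridVec M} (hv : v ∈ spaceU M k) {q : HybridScal M}
    (hq : q ∈ spaceP M k) : bForm k v q = ∑ T : M.Elem, gradRhs T q (v.1 T) := by
  refine Finset.sum_congr rfl fun T _ => ?_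
  rw [← (gradRec_spec T hq).2 _ ((mem_spaceU.1 hv).1 T)]
  simp only [real_inner_comm]

theorem isLinOn_bForm_left {q : HybridScal M} (hq : q ∈ spaceP M k) :
    IsLinOn (spaceU M k) fun v => bForm k v q :=
  IsLinOn.sum fun T _ => IsLinOn.integral_inner (isLinOn_elem T) (fun _ hv => memLp_elem hv T)
    (memLp_hull (continuous_of_mem_RTN (gradRec_spec T hq).1))

theorem isLinOn_bForm_right {v : HybridVec M} (hv : v ∈ spaceU M k) :
    IsLinOn (spaceP M k) (bForm k v) :=
  (IsLinOn.sum fun T _ => isLinOn_gradRhs_left T ((mem_spaceU.1 hv).1 T)).congr fun _ hq =>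
    bForm_eq hv hq

/-- The discrete field associated with the constant function `1`. -/
def oneScal (M : SimplicialMesh Ω) : HybridScal M :=
  (fun _ _ => 1, fun F => (hull F.1).indicator fun _ => 1)

omit [NeZero d] in
theorem oneScal_mem : oneScal M ∈ spaceP M k :=
  mem_spaceP.2 ⟨fun _ => const_mem_poly (by omega) 1, fun _ =>
    mem_facetPoly_iff.2 ⟨_, const_mem_poly (by omega) 1, rfl⟩⟩

theorem gradRhs_eq (T : M.Elem) {q : HybridScal M} (hq : q ∈ spaceP M k) {w : E d → E d}
    (hw : w ∈ RTN d (k + 1)) : gradRhs T q w = (∫ x in hull T.1, fderiv ℝ (q.1 T) x (w x)) +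
      ∑ F ∈ M.facetsOf T, ∫ x, (q.2 F x - q.1 T x) * inner ℝ (w x) (normal T.1 F.1)
        ∂(surf (hull F.1)) := by
  have h1 : ∀ F : M.Facet, ∫ x, (q.2 F x - q.1 T x) * inner ℝ (w x) (normal T.1 F.1)
      ∂(surf (hull F.1)) = (∫ x, q.2 F x * inner ℝ (w x) (normal T.1 F.1) ∂(surf (hull F.1))) -
        ∫ x, q.1 T x * inner ℝ (w x) (normal T.1 F.1) ∂(surf (hull F.1)) := by
    intro F
    simp only [sub_mul]
    exact integral_sub (integrable_mul_normal hq hw T F) (integrable_surf ((continuous_scal hq T).mul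
      ((continuous_of_mem_RTN hw).inner continuous_const)).continuousOn)
  rw [gradRhs, Finset.sum_congr rfl fun F _ => h1 F, Finset.sum_sub_distrib,
    ← green_elem T (contDiff_of_mem_poly ((mem_spaceP.1 hq).1 T)) (contDiff_of_mem_RTN hw)]
  ring

theorem bForm_oneScal {v : HybridVec M} (hv : v ∈ spaceU M k) : bForm k v (oneScal M) = 0 := by
  rw [bForm_eq hv oneScal_mem]
  refine Finset.sum_eq_zero fun T _ => ?_
  rw [gradRhs_eq T oneScal_mem ((mem_spaceU.1 hv).1 T)]
  have h1 : (∫ x in hull T.1, fderiv ℝ ((oneScal M).1 T) x (v.1 T x)) = 0 := by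
    simp [oneScal]
  rw [h1, zero_add]
  refine Finset.sum_eq_zero fun F _ => integral_surf_eq_zero fun x hx => ?_
  simp [oneScal, indicator_of_mem hx]

theorem integral_broken (hc : Convex ℝ Ω) {q : M.Elem → E d → ℝ} (hq : ∀ T, Continuous (q T)) :
    ∫ x in Ω, broken q x = ∑ T : M.Elem, ∫ x in hull T.1, q T x := by
  rw [integral_eq_sum (M := M) hc fun T =>
    (integrableOn_hull (hq T)).congr ((ae_broken_eq q T).mono fun _ h => h.symm)]
  exact Finset.sum_congr rfl fun T _ => integral_congr_ae (ae_broken_eq q T)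

theorem isLinOn_integral_broken (hc : Convex ℝ Ω) :
    IsLinOn (spaceP M k) fun q => ∫ x in Ω, broken q.1 x :=
  (IsLinOn.sum fun T _ => IsLinOn.integral (fun _ => ⟨fun _ _ _ _ => rfl, fun _ _ _ => rfl⟩)
    fun _ hq => integrableOn_hull (continuous_scal hq T)).congr fun _ hq =>
      integral_broken hc fun T => continuous_scal hq T

omit [NeZero d] in
/-- The subspace of the discrete fields that vanish on the boundary. -/
def subU0 (M : SimplicialMesh Ω) (k : ℕ) : Submodule ℝ (HybridVec M) where
  carrier := spaceU0 M k
  add_mem' hv hw := ⟨(spaceU M k).add_mem hv.1 hw.1, fun F hF => by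
    rw [Prod.snd_add, Pi.add_apply, hv.2 F hF, hw.2 F hF, add_zero]⟩
  zero_mem' := ⟨(spaceU M k).zero_mem, fun _ _ => rfl⟩
  smul_mem' c _ hv := ⟨(spaceU M k).smul_mem c hv.1, fun F hF => by
    rw [Prod.smul_snd, Pi.smul_apply, hv.2 F hF, smul_zero]⟩

omit [NeZero d] in
theorem subU0_le : subU0 M k ≤ spaceU M k := fun _ h => h.1

/-- The subspace of the discrete scalar fields with zero average. -/
def subP0 (M : SimplicialMesh Ω) (hc : Convex ℝ Ω) (k : ℕ) : Submodule ℝ (HybridScal M) where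
  carrier := spaceP0 M k
  add_mem' hq hr := ⟨(spaceP M k).add_mem hq.1 hr.1,
    (isLinOn_integral_broken hc).add_eq_zero hq.1 hr.1 hq.2 hr.2⟩
  zero_mem' := ⟨(spaceP M k).zero_mem, (isLinOn_integral_broken (k := k) hc).map_zero⟩
  smul_mem' c _ hq := ⟨(spaceP M k).smul_mem c hq.1,
    (isLinOn_integral_broken hc).smul_eq_zero c hq.1 hq.2⟩

/-- The subspace of the discretely divergence-free fields. -/
def subZ0 (M : SimplicialMesh Ω) (k : ℕ) : Submodule ℝ (HybridVec M) where
  carrier := spaceZ0 M k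
  add_mem' hv hw := ⟨(subU0 M k).add_mem hv.1 hw.1, fun q hq =>
    (isLinOn_bForm_left hq.1).add_eq_zero hv.1.1 hw.1.1 (hv.2 q hq) (hw.2 q hq)⟩
  zero_mem' := ⟨(subU0 M k).zero_mem, fun _ hq => (isLinOn_bForm_left hq.1).map_zero⟩
  smul_mem' c _ hv := ⟨(subU0 M k).smul_mem c hv.1, fun q hq =>
    (isLinOn_bForm_left hq.1).smul_eq_zero c hv.1.1 (hv.2 q hq)⟩

theorem subZ0_le : subZ0 M k ≤ spaceU M k := fun _ h => h.1.1

section DivergenceFree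

variable {v : HybridVec M}

/-- Testing with a pressure of zero average or with an arbitrary one is equivalent. -/
theorem bForm_eq_zero (hc : Convex ℝ Ω) (hv : v ∈ spaceZ0 M k) {q : HybridScal M}
    (hq : q ∈ spaceP M k) : bForm k v q = 0 := by
  rcases isEmpty_or_nonempty M.Elem with hE | hE
  · simp [bForm]
  have hone := oneScal_mem (M := M) (k := k)
  have hI := isLinOn_integral_broken (M := M) (k := k) hc
  have hV : ∫ x in Ω, broken (oneScal M).1 x ≠ 0 := by
    rw [integral_broken hc fun T => continuous_scal hone T]
    refine (Finset.sum_pos (fun T _ => ?_) Finset.univ_nonempty).ne'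
    simpa [oneScal] using (isSimplex T).volume_real_pos
  set c := (∫ x in Ω, broken q.1 x) / ∫ x in Ω, broken (oneScal M).1 x with hc'
  have hm := (spaceP M k).smul_mem c hone
  have h1 := hv.2 (q - c • oneScal M) ⟨(spaceP M k).sub_mem hq hm, (hI.map_sub hq hm).trans (by
    have := hI.2 c _ hone
    beta_reduce at this ⊢
    rw [this, smul_eq_mul, hc', div_mul_cancel₀ _ hV, sub_self])⟩
  have hL := isLinOn_bForm_right hv.1.1
  rwa [hL.map_sub hq hm, hL.2 c _ hone, bForm_oneScal hv.1.1, smul_zero, sub_zero] at h1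

theorem dvg_eq_zero_of_mem_spaceZ0 (hc : Convex ℝ Ω) (hv : v ∈ spaceZ0 M k) (T : M.Elem) :
    dvg (v.1 T) = 0 := by
  have hp : ∀ T : M.Elem, dvg (v.1 T) ∈ poly d k := fun T =>
    dvg_mem_poly_of_mem_RTN ((mem_spaceU.1 hv.1.1).1 T)
  set q : HybridScal M := (fun T => dvg (v.1 T), 0)
  have hq : q ∈ spaceP M k := mem_spaceP.2 ⟨hp, fun F => (facetPoly F.1 k).zero_mem⟩
  have h := bForm_eq_zero hc hv hq
  rw [bForm_eq hv.1.1 hq] at h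
  have h1 : ∀ T : M.Elem, gradRhs T q (v.1 T) = -∫ x in hull T.1, dvg (v.1 T) x ^ 2 := by
    simp [gradRhs, q, sq]
  rw [Finset.sum_congr rfl fun T _ => h1 T, Finset.sum_neg_distrib, neg_eq_zero,
    Finset.sum_eq_zero_iff_of_nonneg fun T _ => integral_nonneg fun x => sq_nonneg _] at h
  exact ((isSimplex T).isL2Space_poly k).definite _ (hp T) (h T (Finset.mem_univ _))

theorem sum_integral_mul_normal (hv : v ∈ spaceU M k) (F : M.Facet) {a : E d → ℝ}
    (ha : ContinuousOn a (hull F.1)) : ∑ T : M.Elem, (open scoped Classical in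
      if F ∈ M.facetsOf T then ∫ x, a x * inner ℝ (v.1 T x) (normal T.1 F.1) ∂(surf (hull F.1))
      else 0) = ∫ x, a x * ∑ T : M.Elem, (open scoped Classical in
        if F ∈ M.facetsOf T then (inner ℝ (v.1 T x) (normal T.1 F.1) : ℝ) else 0)
          ∂(surf (hull F.1)) := by
  simp only [Finset.mul_sum]
  rw [integral_finsetSum]
  · exact Finset.sum_congr rfl fun T _ => by split_ifs <;> simp
  · intro T _
    split_ifs
    · exact integrable_surf
        (ha.mul ((continuous_elem hv T).inner continuous_const).continuousOn)
    · simp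

/-- The normal components of a discretely divergence-free field are continuous across the interior
faces, and vanish on the boundary faces. -/
theorem sum_normal_component_eq_zero (hc : Convex ℝ Ω) (hv : v ∈ spaceZ0 M k) (F : M.Facet)
    {x : E d} (hx : x ∈ hull F.1) : ∑ T : M.Elem, (open scoped Classical in
      if F ∈ M.facetsOf T then (inner ℝ (v.1 T x) (normal T.1 F.1) : ℝ) else 0) = 0 := by
  set s : E d → ℝ := ∑ T : M.Elem, if F ∈ M.facetsOf T then
    (hull F.1).indicator (fun x => (inner ℝ (v.1 T x) (normal T.1 F.1) : ℝ)) else 0 with hs_def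
  have hs : s ∈ facetPoly F.1 k := by
    refine (facetPoly F.1 k).sum_mem fun T _ => ?_
    split_ifs with hF
    · exact indicator_normal_mem hF ((mem_spaceU.1 hv.1.1).1 T)
    · exact (facetPoly F.1 k).zero_mem
  have hsx : ∀ x ∈ hull F.1, s x = ∑ T : M.Elem, if F ∈ M.facetsOf T then
      (inner ℝ (v.1 T x) (normal T.1 F.1) : ℝ) else 0 := by
    intro x hx
    rw [hs_def, Finset.sum_apply]
    refine Finset.sum_congr rfl fun T _ => ?_
    split_ifs
    · rw [indicator_of_mem hx]
    · rfl
  rw [← hsx x hx]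
  suffices h : s = 0 by rw [h]; rfl
  set q : HybridScal M := (0, Pi.single F s)
  have hq : q ∈ spaceP M k := mem_spaceP.2 ⟨fun T => (poly d k).zero_mem, fun G => by
    by_cases hG : G = F
    · subst hG
      simpa [q] using hs
    · simp [q, Pi.single_eq_of_ne hG]⟩
  have h := bForm_eq_zero hc hv hq
  rw [bForm_eq hv.1.1 hq] at h
  refine (isL2Space_facetPoly F k).definite _ hs (Eq.trans ?_ h)
  have h1 : ∀ T : M.Elem, gradRhs T q (v.1 T) = if F ∈ M.facetsOf T then
      ∫ x, s x * inner ℝ (v.1 T x) (normal T.1 F.1) ∂(surf (hull F.1)) else 0 := by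
    intro T
    have h2 : ∀ G ∈ M.facetsOf T, G ≠ F →
        ∫ x, q.2 G x * inner ℝ (v.1 T x) (normal T.1 G.1) ∂(surf (hull G.1)) = 0 := by
      intro G _ hG
      simp [q, Pi.single_eq_of_ne hG]
    have h3 : gradRhs T q (v.1 T) = ∑ G ∈ M.facetsOf T,
        ∫ x, q.2 G x * inner ℝ (v.1 T x) (normal T.1 G.1) ∂(surf (hull G.1)) := by
      simp [gradRhs, q]
    rw [h3]
    split_ifs with hF
    · rw [Finset.sum_eq_single_of_mem F hF h2]
      simp [q]
    · exact Finset.sum_eq_zero fun G hG => h2 G hG fun h => hF (h ▸ hG)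
  rw [Finset.sum_congr rfl fun T _ => h1 T]
  exact (integral_surf_congr fun x hx => by rw [sq, hsx x hx]).trans
    (sum_integral_mul_normal hv.1.1 F (continuousOn_of_mem_facetPoly hs)).symm

end DivergenceFree

/-! ### Skew-symmetry of the convective form -/

theorem tForm_self_eq_zero (hc : Convex ℝ Ω) {w v : HybridVec M} (hw : w ∈ spaceZ0 M k)
    (hv : v ∈ spaceU M k) : tForm w v v = 0 := by
  have hwU := hw.1.1
  have hel : ∀ T : M.Elem, (∫ x in hull T.1, inner ℝ (fderiv ℝ (v.1 T) x (w.1 T x)) (v.1 T x)) =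
      1 / 2 * ∑ F ∈ M.facetsOf T, ∫ x, ‖v.1 T x‖ ^ 2 * inner ℝ (w.1 T x) (normal T.1 F.1)
        ∂(surf (hull F.1)) := by
    intro T
    have hvT : ContDiff ℝ 1 (v.1 T) := contDiff_of_mem_RTN ((mem_spaceU.1 hv).1 T)
    have h := green_elem T (p := fun x => ‖v.1 T x‖ ^ 2) (ψ := w.1 T) (hvT.norm_sq ℝ)
      (contDiff_of_mem_RTN ((mem_spaceU.1 hwU).1 T))
    have h1 : ∀ x, fderiv ℝ (fun x => ‖v.1 T x‖ ^ 2) x (w.1 T x) =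
        2 * inner ℝ (fderiv ℝ (v.1 T) x (w.1 T x)) (v.1 T x) := by
      intro x
      have := ((hvT.differentiable one_ne_zero) x).hasFDerivAt.norm_sq
      rw [this.fderiv]
      simp [real_inner_comm]
    rw [dvg_eq_zero_of_mem_spaceZ0 hc hw T] at h
    simp only [h1, Pi.zero_apply, mul_zero, integral_zero, zero_add] at h
    rw [integral_const_mul] at h
    linarith
  have hfa : ∀ (T : M.Elem) (F : M.Facet),
      ∫ x, inner ℝ (w.1 T x) (normal T.1 F.1) *
        inner ℝ (v.2 F x - v.1 T x) (v.2 F x + v.1 T x) ∂(surf (hull F.1)) =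
      (∫ x, ‖v.2 F x‖ ^ 2 * inner ℝ (w.1 T x) (normal T.1 F.1) ∂(surf (hull F.1))) -
        ∫ x, ‖v.1 T x‖ ^ 2 * inner ℝ (w.1 T x) (normal T.1 F.1) ∂(surf (hull F.1)) := by
    intro T F
    have hwn : Continuous fun x => (inner ℝ (w.1 T x) (normal T.1 F.1) : ℝ) :=
      (continuous_elem hwU T).inner continuous_const
    have h1 : Integrable (fun x => ‖v.2 F x‖ ^ 2 * (inner ℝ (w.1 T x) (normal T.1 F.1) : ℝ))
        (surf (hull F.1)) :=
      integrable_surf (((continuousOn_facet hv F).norm.pow 2).mul hwn.continuousOn)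
    have h2 : Integrable (fun x => ‖v.1 T x‖ ^ 2 * (inner ℝ (w.1 T x) (normal T.1 F.1) : ℝ))
        (surf (hull F.1)) :=
      integrable_surf ((((continuous_elem hv T).norm.pow 2).mul hwn).continuousOn)
    rw [← integral_sub h1 h2]
    congr 1
    funext x
    rw [inner_add_right, inner_sub_left, inner_sub_left, real_inner_self_eq_norm_sq,
      real_inner_self_eq_norm_sq, real_inner_comm (v.1 T x) (v.2 F x)]
    ring
  have h1 : tForm w v v = 1 / 2 * ∑ T : M.Elem, ∑ F ∈ M.facetsOf T,
      ∫ x, ‖v.2 F x‖ ^ 2 * inner ℝ (w.1 T x) (normal T.1 F.1) ∂(surf (hull F.1)) := by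
    rw [tForm, Finset.mul_sum]
    refine Finset.sum_congr rfl fun T _ => ?_
    rw [hel, Finset.sum_congr rfl fun F _ => hfa T F, Finset.sum_sub_distrib]
    ring
  rw [h1, sum_sum_facetsOf, Finset.sum_eq_zero, mul_zero]
  intro F _
  rw [sum_integral_mul_normal hwU F (a := fun x => ‖v.2 F x‖ ^ 2)
    ((continuousOn_facet hv F).norm.pow 2)]
  exact integral_surf_eq_zero fun x hx => by
    rw [sum_normal_component_eq_zero hc hw F hx, mul_zero]

theorem tForm_swap (hc : Convex ℝ Ω) {w v z : HybridVec M} (hw : w ∈ spaceZ0 M k)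
    (hv : v ∈ spaceU M k) (hz : z ∈ spaceU M k) : tForm w v z + tForm w z v = 0 := by
  have h := tForm_self_eq_zero hc hw ((spaceU M k).add_mem hv hz)
  have h1 := (isLinOn_tForm_mid hw.1.1 ((spaceU M k).add_mem hv hz)).1 v hv z hz
  beta_reduce at h1
  rw [h1, (isLinOn_tForm_right hw.1.1 hv).1 v hv z hz, (isLinOn_tForm_right hw.1.1 hz).1 v hv z hz,
    tForm_self_eq_zero hc hw hv, tForm_self_eq_zero hc hw hz] at h
  linarith

/-! ### Injectivity of the discrete pressure gradient -/

theorem eq_const_of_gradRhs (T : M.Elem) {q : HybridScal M} (hq : q ∈ spaceP M k)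
    (h : ∀ w ∈ RTN d (k + 1), gradRhs T q w = 0) :
    ∃ c : ℝ, q.1 T = (fun _ => c) ∧ ∀ F ∈ M.facetsOf T, ∀ x ∈ hull F.1, q.2 F x = c := by
  obtain ⟨σ, x₀, r, hT⟩ := (isSimplex T).exists_inball
  obtain ⟨C, -, hC⟩ := exists_RTN_field (d := d) k hT.one_le
  have hqT := (mem_spaceP.1 hq).1 T
  have hg : gradVec (q.1 T) ∈ vec (poly d ((k : ℤ) - 1)) := gradVec_mem_vec hqT
  have hex : ∀ F : M.Facet, ∃ p ∈ poly d k, (hull F.1).indicator p = q.2 F := fun F =>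
    mem_facetPoly_iff.1 ((mem_spaceP.1 hq).2 F)
  choose p hp hpe using hex
  set p' : E d → E d → ℝ := fun v =>
    if hv : v ∈ T.1 then p (M.oppFacet T ⟨v, hv⟩) - q.1 T else 0
  have hp' : ∀ v (hv : v ∈ T.1), p' v = p (M.oppFacet T ⟨v, hv⟩) - q.1 T := fun v hv => dif_pos hv
  obtain ⟨w, hw, hm, hn, -⟩ := hC T.1 x₀ r hT (gradVec (q.1 T)) (memLp_hull (continuous_of_mem_vec
    hg)) p' fun v hv => by
    rw [hp' v hv]
    exact (poly d k).sub_mem (hp _) hqT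
  have hn' : ∀ F ∈ M.facetsOf T, ∀ x ∈ hull F.1, inner ℝ (w x) (normal T.1 F.1) =
      q.2 F x - q.1 T x := by
    intro F hF x hx
    obtain ⟨v, hv, he⟩ := exists_eq_erase hF
    have hFe : F = M.oppFacet T ⟨v, hv⟩ := Subtype.ext he
    rw [← hpe F, indicator_of_mem hx, he, hn v hv x (he ▸ hx), hp' v hv, Pi.sub_apply, hFe]
  have h1 := h w hw
  rw [gradRhs_eq T hq hw] at h1
  have e1 : (∫ x in hull T.1, fderiv ℝ (q.1 T) x (w x)) =
      ∫ x in hull T.1, ‖gradVec (q.1 T) x‖ ^ 2 := by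
    simp only [← inner_gradVec, hm _ hg, real_inner_self_eq_norm_sq]
  have e2 : ∀ F ∈ M.facetsOf T, ∫ x, (q.2 F x - q.1 T x) * inner ℝ (w x) (normal T.1 F.1)
        ∂(surf (hull F.1)) = ∫ x, (q.2 F x - q.1 T x) ^ 2 ∂(surf (hull F.1)) := by
    intro F hF
    refine integral_surf_congr fun x hx => ?_
    rw [hn' F hF x hx, sq]
  rw [e1, Finset.sum_congr rfl e2] at h1
  have i1 : 0 ≤ ∫ x in hull T.1, ‖gradVec (q.1 T) x‖ ^ 2 := integral_nonneg fun x => sq_nonneg _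
  have i2 : ∀ F ∈ M.facetsOf T, 0 ≤ ∫ x, (q.2 F x - q.1 T x) ^ 2 ∂(surf (hull F.1)) :=
    fun F _ => integral_nonneg fun x => sq_nonneg _
  have i3 := Finset.sum_nonneg i2
  have z2 := (Finset.sum_eq_zero_iff_of_nonneg i2).1 (by linarith)
  have hder : ∀ x, fderiv ℝ (q.1 T) x = 0 := by
    intro x
    ext e
    rw [← inner_gradVec, ((isSimplex T).isL2Space_poly _).eq_zero_of_integral_norm_sq hg (by
      linarith)]
    simp
  have hconst : q.1 T = fun _ => q.1 T 0 :=
    funext fun x => is_const_of_fderiv_eq_zero (differentiable_of_mem_poly hqT) hder x 0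
  refine ⟨q.1 T 0, hconst, fun F hF x hx => ?_⟩
  have z3 := (isL2Space_facetPoly F k).definite _ (mem_facetPoly_iff.2 ⟨_, (poly d k).sub_mem (hp F)
      hqT, rfl⟩) (by
    rw [← z2 F hF]
    refine integral_surf_congr fun y hy => ?_
    rw [indicator_of_mem hy, ← hpe F, indicator_of_mem hy, Pi.sub_apply])
  have z4 := congrFun z3 x
  rw [indicator_of_mem hx, Pi.sub_apply, hconst] at z4
  rw [← hpe F, indicator_of_mem hx]
  exact sub_eq_zero.1 z4

/-- A discrete pressure of zero average with vanishing discrete gradient is zero. -/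
theorem eq_zero_of_bForm (hΩ : IsOpen Ω) (hc : Convex ℝ Ω) {q : HybridScal M}
    (hq : q ∈ spaceP0 M k) (h : ∀ v ∈ spaceU0 M k, bForm k v q = 0) : q = 0 := by
  have hgrad : ∀ T : M.Elem, ∀ w ∈ RTN d (k + 1), gradRhs T q w = 0 := by
    intro T w hw
    set v : HybridVec M := (Pi.single T w, 0)
    have hv : v ∈ spaceU M k := mem_spaceU.2 ⟨fun S => by
      by_cases hS : S = T
      · subst hS
        simpa [v] using hw
      · simp [v, Pi.single_eq_of_ne hS], fun F => (vec _).zero_mem⟩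
    have h1 := h v ⟨hv, fun _ _ => rfl⟩
    rw [bForm_eq hv hq.1, Finset.sum_eq_single_of_mem T (Finset.mem_univ _)] at h1
    · simpa [v] using h1
    · intro S _ hS
      have : v.1 S = 0 := by simp [v, Pi.single_eq_of_ne hS]
      rw [this]
      exact (isLinOn_gradRhs_right S hq.1).map_zero
  choose c hc1 hc2 using fun T => eq_const_of_gradRhs T hq.1 (hgrad T)
  have hadj : ∀ F : M.Facet, ∀ T T' : M.Elem, F ∈ M.facetsOf T → F ∈ M.facetsOf T' →
      c T = c T' := by
    intro F T T' hT hT'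
    obtain ⟨x, hx⟩ := M.nonempty_of_mem_faces (M.mem_facets.1 F.2).1
    have hx' : x ∈ hull F.1 := subset_convexHull ℝ _ hx
    rw [← hc2 T F hT x hx', hc2 T' F hT' x hx']
  have hzero : ∀ T, c T = 0 := by
    intro T
    have h1 := hq.2
    rw [integral_broken hc fun T => continuous_scal hq.1 T] at h1
    have h2 : ∀ S : M.Elem, ∫ x in hull S.1, q.1 S x = volume.real (hull S.1) * c T := by
      intro S
      rw [hc1 S, setIntegral_const, smul_eq_mul, (eq_of_forall_adjacent hΩ hc hadj) S T]
    rw [Finset.sum_congr rfl fun S _ => h2 S, ← Finset.sum_mul] at h1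
    exact (mul_eq_zero.1 h1).resolve_left (Finset.sum_pos
      (fun S _ => (isSimplex S).volume_real_pos) ⟨T, Finset.mem_univ _⟩).ne'
  refine Prod.ext (funext fun T => ?_) (funext fun F => ?_)
  · rw [hc1 T, hzero T]
    rfl
  · obtain ⟨T, hF⟩ := exists_elem F
    obtain ⟨p, -, hp⟩ := mem_facetPoly_iff.1 ((mem_spaceP.1 hq.1).2 F)
    funext x
    by_cases hx : x ∈ hull F.1
    · rw [hc2 T F hF x hx, hzero T]
      rfl
    · rw [← hp, indicator_of_notMem hx]
      rfl

end Coupling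

/-! ### Coercivity of the diffusion form -/

section Coercivity

variable [NeZero d] {Ω : Set (E d)} {M : SimplicialMesh Ω} {k : ℕ}

theorem SimplicialMesh.card_facetsOf (T : M.Elem) : (M.facetsOf T).card = d + 1 := by
  rw [Finset.card_eq_sum_ones, sum_facetsOf T fun _ => 1]
  simp [(isSimplex T).card]

theorem HasInball.trace_facet {σ : ℝ} {T : M.Elem} {x₀ : E d} {r : ℝ}
    (hT : HasInball σ T.1 x₀ r) {F : M.Facet} (hF : F ∈ M.facetsOf T) {φ : E d → E d}
    (hφ : ContDiff ℝ 1 φ) :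
    diam T.1 * ∫ y, ‖φ y‖ ^ 2 ∂(surf (hull F.1)) ≤
      σ * ((d + 1) * (∫ x in hull T.1, ‖φ x‖ ^ 2) +
        diam T.1 ^ 2 * ∫ x in hull T.1, ‖fderiv ℝ φ x‖ ^ 2) := by
  obtain ⟨v, hv, h⟩ := exists_eq_erase hF
  rw [h]
  have h1 := hT.isSimplex.trace_inequality hv hφ
  have h2 := hT.diam_le_height hv
  have h3 := hT.one_le
  have h4 : 0 ≤ ∫ y, ‖φ y‖ ^ 2 ∂(surf (hull (T.1.erase v))) :=
    integral_nonneg fun x => sq_nonneg _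
  calc _ ≤ σ * height T.1 v * ∫ y, ‖φ y‖ ^ 2 ∂(surf (hull (T.1.erase v))) := by gcongr
    _ = σ * (height T.1 v * ∫ y, ‖φ y‖ ^ 2 ∂(surf (hull (T.1.erase v)))) := by ring
    _ ≤ _ := by gcongr

theorem HasInball.le_lam {σ : ℝ} {T : M.Elem} {x₀ : E d} {r : ℝ} (hT : HasInball σ T.1 x₀ r) :
    (volume.real (Metric.ball (0 : E d) 1))⁻¹ ≤ lam T := by
  have hh := hT.diam_pos
  have hv := hT.isSimplex.volume_real_pos
  have hb : 0 < volume.real (Metric.ball (0 : E d) 1) := ENNReal.toReal_pos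
    (Metric.measure_ball_pos _ _ one_pos).ne' measure_ball_lt_top.ne
  have h1 : volume.real (hull T.1) ≤ diam T.1 ^ d * volume.real (Metric.ball (0 : E d) 1) := by
    have h2 : volume.real (hull T.1) ≤ volume.real (Metric.closedBall x₀ (diam T.1)) :=
      measureReal_mono (hull_subset_closedBall hT.center_mem) measure_closedBall_lt_top.ne
    have h3 := Measure.addHaar_real_closedBall (volume : Measure (E d)) x₀ hh.le
    rw [finrank_euclideanSpace_fin] at h3
    rwa [h3] at h2
  rw [lam, card_facetsOf]
  have h4 : (volume.real (Metric.ball (0 : E d) 1))⁻¹ ≤ diam T.1 ^ d / volume.real (hull T.1) := by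
    rw [le_div_iff₀ hv, inv_mul_le_iff₀ hb, mul_comm]
    exact h1
  refine h4.trans (le_mul_of_one_le_left (by positivity) ?_)
  push_cast
  linarith [(Nat.cast_nonneg d : (0 : ℝ) ≤ d)]

/-- The scaled local contribution to the stabilized diffusion form controls that of the discrete
`H¹` seminorm. The constant `c` is the value of the velocity reconstruction at the center of the
inscribed ball; both `v_T - c` and `v_F - c` are compared with the interpolates of the
reconstruction minus `c`. -/
theorem exists_local_coercivity (k : ℕ) {σ : ℝ} (hσ : 1 ≤ σ) :
    ∃ C : ℝ, 0 < C ∧ ∀ {Ω : Set (E d)} {M : SimplicialMesh Ω} (T : M.Elem) (x₀ : E d) (r : ℝ),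
      HasInball σ T.1 x₀ r → ∀ v ∈ spaceU M k,
      diam T.1 ^ 2 * (∫ x in hull T.1, frob (fderiv ℝ (v.1 T) x) (fderiv ℝ (v.1 T) x)) +
        diam T.1 * ∑ F ∈ M.facetsOf T, ∫ x, ‖v.2 F x - v.1 T x‖ ^ 2 ∂(surf (hull F.1)) ≤
      C * (diam T.1 ^ 2 * (∫ x in hull T.1,
          frob (fderiv ℝ (velRec k T v) x) (fderiv ℝ (velRec k T v) x)) +
        (∫ x in hull T.1, ‖deltaT k T v x‖ ^ 2) +
        diam T.1 * ∑ F ∈ M.facetsOf T, ∫ x, ‖deltaF k T F v x‖ ^ 2 ∂(surf (hull F.1))) := by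
  obtain ⟨C₁, hC₁, hint⟩ := exists_isInterp (d := d) k hσ
  obtain ⟨C₂, hC₂, hpoin⟩ := exists_poincare_inequality (d := d) (m := k + 1) (by omega) hσ
  obtain ⟨C₄, hC₄, hinv⟩ := exists_inverse_inequality (d := d) (k + 1) hσ
  set K₁ := C₁ * (C₂ + (d + 1) * (σ * ((d + 1) * C₂ + 1))) with hK₁
  have hK₁0 : 0 < K₁ := by positivity
  set K₂ := 2 * K₁ + 2 with hK₂
  refine ⟨d * C₄ * K₂ + (d + 1) * (4 * (σ * ((d + 1) * C₂ + 1))) + 4 +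
    (d + 1) * (2 * (σ * ((d + 1) + C₄)) * K₂), by positivity, fun {Ω M} T x₀ r hT v hv => ?_⟩
  have hh := hT.diam_pos
  set h := diam T.1 with hh_def
  set p := velRec k T v
  have hp : p ∈ vec (poly d (k + 1)) := velRec_mem T hv
  have hps : ContDiff ℝ ∞ p := contDiff_velRec T hv
  have hpf := continuous_fderiv_of_mem_vec hp
  set c := p x₀
  have hk : (0 : ℤ) ≤ k + 1 := by omega
  -- `p - c` and its interpolate `e`
  have hpc : (fun x => p x - c) ∈ vec (poly d (k + 1)) :=
    (vec _).sub_mem hp (const_mem_vec hk c)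
  have hpcs : ContDiff ℝ 1 fun x => p x - c := contDiff_of_mem_vec hpc
  have hpcF : ∀ F : M.Facet, MemLp (fun x => p x - c) 2 (surf (hull F.1)) := fun F =>
    memLp_surf hpcs.continuous.continuousOn
  have hfd : ∀ x, fderiv ℝ (fun x => p x - c) x = fderiv ℝ p x := fun x => fderiv_sub_const c
  obtain ⟨e, he, heb⟩ := hint T x₀ r hT (fun x => p x - c) (fun _ x => p x - c)
    (memLp_hull hpcs.continuous) fun F _ => hpcF F
  have heI : interpRTN (k + 1) T p = fun x => e x + c := by
    refine (isInterp_of_contDiff k T hps).eq ?_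
    have h1 := he.add (isInterp_const k T c) (memLp_hull hpcs.continuous)
      (memLp_hull continuous_const) (fun F _ => hpcF F) fun F _ => memLp_surf continuousOn_const
    have e1 : (fun x => p x - c) + (fun _ => c) = p := by
      funext x
      simp
    have e2 : ((fun (_ : M.Facet) x => p x - c) + fun _ _ => c) = fun _ => p := by
      funext F x
      simp
    rw [e1, e2] at h1
    exact h1
  set X := h ^ 2 * ∫ x in hull T.1, frob (fderiv ℝ p x) (fderiv ℝ p x) with hX
  set A := ∫ x in hull T.1, ‖p x - c‖ ^ 2
  set D := ∫ x in hull T.1, ‖deltaT k T v x‖ ^ 2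
  have hD0 : 0 ≤ D := integral_nonneg fun x => sq_nonneg _
  have hA0 : 0 ≤ A := integral_nonneg fun x => sq_nonneg _
  have hX0 : 0 ≤ X := mul_nonneg (by positivity) (integral_nonneg fun x => frob_self_nonneg _)
  have hPX : h ^ 2 * ∫ x in hull T.1, ‖fderiv ℝ p x‖ ^ 2 ≤ X :=
    mul_le_mul_of_nonneg_left (integral_mono (integrableOn_hull (by fun_prop))
      (integrableOn_hull (continuous_frob hpf hpf)) fun x => opNorm_sq_le_frob _) (by positivity)
  have hAX : A ≤ C₂ * X := (hpoin T.1 x₀ r hT p hp).trans (by gcongr)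
  -- the trace of `p - c`
  have hpF : ∀ F ∈ M.facetsOf T, h * ∫ x, ‖p x - c‖ ^ 2 ∂(surf (hull F.1)) ≤
      σ * ((d + 1) * C₂ + 1) * X := by
    intro F hF
    have h1 := hT.trace_facet hF hpcs
    simp only [hfd] at h1
    exact h1.trans ((mul_le_mul_of_nonneg_left (add_le_add (mul_le_mul_of_nonneg_left hAX
      (by positivity)) hPX) (by linarith)).trans_eq (by ring))
  have heX : ∫ x in hull T.1, ‖e x‖ ^ 2 ≤ K₁ * X := by
    have h1 := Finset.sum_le_sum hpF
    rw [← Finset.mul_sum, Finset.sum_const, card_facetsOf, nsmul_eq_mul] at h1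
    push_cast at h1
    exact heb.trans ((mul_le_mul_of_nonneg_left (add_le_add hAX h1) hC₁.le).trans_eq
      (by rw [hK₁]; ring))
  -- `g = v_T - c`
  set g : E d → E d := fun x => v.1 T x - c
  have hvT : v.1 T ∈ vec (poly d (k + 1)) := RTN_le_vec k ((mem_spaceU.1 hv).1 T)
  have hg : g ∈ vec (poly d (k + 1)) := (vec _).sub_mem hvT (const_mem_vec hk c)
  have hgs : ContDiff ℝ 1 g := contDiff_of_mem_vec hg
  have hgf : ∀ x, fderiv ℝ g x = fderiv ℝ (v.1 T) x := fun x => fderiv_sub_const c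
  have hvf := continuous_fderiv_of_mem_vec hvT
  have hge : ∀ x, g x = e x - deltaT k T v x := by
    intro x
    have : deltaT k T v x = e x + c - v.1 T x := by
      rw [deltaT]
      show interpRTN (k + 1) T p x - _ = _
      rw [heI]
    rw [this]
    show v.1 T x - c = _
    abel
  set G := ∫ x in hull T.1, ‖g x‖ ^ 2
  have hG0 : 0 ≤ G := integral_nonneg fun x => sq_nonneg _
  have hGX : G ≤ K₂ * (X + D) := by
    have h1 := integral_norm_sub_sq_le (memLp_hull (T := T.1) (continuous_of_mem_RTN he.mem))
      (memLp_hull (continuous_of_mem_RTN (deltaT_mem T hv)))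
    simp only [← hge] at h1
    rw [hK₂]
    linarith [mul_nonneg hK₁0.le hD0]
  have hginv := hinv T.1 x₀ r hT g hg
  -- the element term
  have t1 : h ^ 2 * (∫ x in hull T.1, frob (fderiv ℝ (v.1 T) x) (fderiv ℝ (v.1 T) x)) ≤
      d * C₄ * (K₂ * (X + D)) := by
    have h1 : ∫ x in hull T.1, frob (fderiv ℝ (v.1 T) x) (fderiv ℝ (v.1 T) x) ≤
        d * ∫ x in hull T.1, ‖fderiv ℝ g x‖ ^ 2 := by
      rw [← integral_const_mul]
      simp only [hgf]
      exact integral_mono (integrableOn_hull (continuous_frob hvf hvf))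
        (integrableOn_hull (by fun_prop)) fun x => frob_le_opNorm_sq _
    have h2 := mul_le_mul_of_nonneg_left (hginv.trans (mul_le_mul_of_nonneg_left hGX hC₄.le))
      (Nat.cast_nonneg d : (0 : ℝ) ≤ d)
    exact (mul_le_mul_of_nonneg_left h1 (by positivity)).trans (by linarith)
  -- the face terms
  have t2 : ∀ F ∈ M.facetsOf T, h * ∫ x, ‖v.2 F x - v.1 T x‖ ^ 2 ∂(surf (hull F.1)) ≤
      4 * (σ * ((d + 1) * C₂ + 1) * X) +
        4 * (h * ∫ x, ‖deltaF k T F v x‖ ^ 2 ∂(surf (hull F.1))) +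
        2 * (σ * ((d + 1) + C₄)) * (K₂ * (X + D)) := by
    intro F hF
    have hL := isL2Space_facetPoly F (k : ℤ)
    set b := lprojVec (surf (hull F.1)) (facetPoly F.1 k) fun x => p x - c
    have hb : b ∈ vec (facetPoly F.1 k) := hL.lprojVec_mem (hpcF F)
    have hbi : MemLp b 2 (surf (hull F.1)) := hL.memLp_vec hb
    have hbn : ∫ x, ‖b x‖ ^ 2 ∂(surf (hull F.1)) ≤ ∫ x, ‖p x - c‖ ^ 2 ∂(surf (hull F.1)) :=
      hL.integral_lprojVec_sq_le (hpcF F)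
    have hcF : ((hull F.1).indicator fun _ => c) ∈ vec (facetPoly F.1 k) := by
      intro i
      have : (fun x => (hull F.1).indicator (fun _ => c) x i) =
          (hull F.1).indicator fun _ => c i := by
        funext x
        by_cases hx : x ∈ hull F.1
        · simp [indicator_of_mem hx]
        · simp [indicator_of_notMem hx]
      rw [this]
      exact mem_facetPoly_iff.2 ⟨_, const_mem_poly (by omega) _, rfl⟩
    have hproj : lprojVec (surf (hull F.1)) (facetPoly F.1 k) p =
        b + (hull F.1).indicator fun _ => c := by
      refine hL.lprojVec_eq (memLp_velRec_surf T F hv) ((vec _).add_mem hb hcF) fun s hs => ?_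
      have hsm := hL.memLp_vec hs
      have i1 : ∫ x, inner ℝ ((b + (hull F.1).indicator fun _ => c) x) (s x)
          ∂(surf (hull F.1)) = ∫ x, (inner ℝ (b x) (s x) + inner ℝ c (s x))
          ∂(surf (hull F.1)) := by
        refine integral_surf_congr fun x hx => ?_
        rw [Pi.add_apply, indicator_of_mem hx, inner_add_left]
      rw [i1, integral_add (integrable_inner_of_memLp hbi hsm)
        (integrable_inner_of_memLp (memLp_const c) hsm), hL.lprojVec_spec (hpcF F) hs,
        ← integral_add (integrable_inner_of_memLp (hpcF F) hsm)
        (integrable_inner_of_memLp (memLp_const c) hsm)]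
      simp only [← inner_add_left, sub_add_cancel]
    have hdm : MemLp (deltaF k T F v) 2 (surf (hull F.1)) := memLp_facetPoly (deltaF_mem hF hv)
    have hgm : MemLp g 2 (surf (hull F.1)) := memLp_surf hgs.continuous.continuousOn
    have j1 : ∫ x, ‖v.2 F x - v.1 T x‖ ^ 2 ∂(surf (hull F.1)) ≤
        4 * (∫ x, ‖b x‖ ^ 2 ∂(surf (hull F.1))) +
          4 * (∫ x, ‖deltaF k T F v x‖ ^ 2 ∂(surf (hull F.1))) +
          2 * ∫ x, ‖g x‖ ^ 2 ∂(surf (hull F.1)) := by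
      have e : ∫ x, ‖v.2 F x - v.1 T x‖ ^ 2 ∂(surf (hull F.1)) =
          ∫ x, ‖b x - deltaF k T F v x - g x‖ ^ 2 ∂(surf (hull F.1)) := by
        refine integral_surf_congr fun x hx => ?_
        congr 2
        rw [deltaF_eq hF hv]
        show _ = b x - (lprojVec (surf (hull F.1)) (facetPoly F.1 k) p x - v.2 F x) -
          (v.1 T x - c)
        rw [hproj, Pi.add_apply, indicator_of_mem hx]
        abel
      rw [e]
      have s1 : _ ≤ 2 * (∫ x, ‖b x - deltaF k T F v x‖ ^ 2 ∂(surf (hull F.1))) + _ :=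
        integral_norm_sub_sq_le (hbi.sub hdm) hgm
      linarith [integral_norm_sub_sq_le hbi hdm]
    have j2 : h * ∫ x, ‖g x‖ ^ 2 ∂(surf (hull F.1)) ≤ σ * ((d + 1) + C₄) * (K₂ * (X + D)) := by
      have h1 := mul_le_mul_of_nonneg_left hginv (by linarith : 0 ≤ σ)
      have h2 := mul_le_mul_of_nonneg_left hGX (by positivity : 0 ≤ σ * ((d + 1) + C₄))
      exact (hT.trace_facet hF hgs).trans (by linarith)
    linarith [hpF F hF, mul_le_mul_of_nonneg_left hbn hh.le, mul_le_mul_of_nonneg_left j1 hh.le]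
  have t3 : h * ∑ F ∈ M.facetsOf T, ∫ x, ‖v.2 F x - v.1 T x‖ ^ 2 ∂(surf (hull F.1)) ≤
      (d + 1) * (4 * (σ * ((d + 1) * C₂ + 1) * X) +
        2 * (σ * ((d + 1) + C₄)) * (K₂ * (X + D))) +
      4 * (h * ∑ F ∈ M.facetsOf T, ∫ x, ‖deltaF k T F v x‖ ^ 2 ∂(surf (hull F.1))) := by
    rw [Finset.mul_sum, Finset.mul_sum, Finset.mul_sum]
    refine (Finset.sum_le_sum t2).trans (le_of_eq ?_)
    rw [Finset.sum_add_distrib, Finset.sum_add_distrib, Finset.sum_const, Finset.sum_const,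
      card_facetsOf, nsmul_eq_mul, nsmul_eq_mul]
    push_cast
    ring
  set Y := h * ∑ F ∈ M.facetsOf T, ∫ x, ‖deltaF k T F v x‖ ^ 2 ∂(surf (hull F.1))
  have hY0 : 0 ≤ Y := mul_nonneg hh.le (Finset.sum_nonneg fun F _ =>
    integral_nonneg fun x => sq_nonneg _)
  have a1 : 0 ≤ d * C₄ * K₂ := by positivity
  have a2 : 0 ≤ (d + 1) * (4 * (σ * ((d + 1) * C₂ + 1))) := by positivity
  have a3 : 0 ≤ (d + 1) * (2 * (σ * ((d + 1) + C₄)) * K₂) := by positivity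
  linarith [mul_nonneg a1 hY0, mul_nonneg a2 (add_nonneg hD0 hY0), mul_nonneg a3 hY0]

omit [NeZero d] in
theorem sForm_self_nonneg (T : M.Elem) (v : HybridVec M) : 0 ≤ sForm k T v v := by
  have h1 : 0 ≤ lam T := by
    unfold lam
    have := diam_nonneg T.1
    positivity
  have h2 := diam_nonneg T.1
  have h3 : 0 ≤ ∫ x in hull T.1, inner ℝ (deltaT k T v x) (deltaT k T v x) :=
    integral_nonneg fun _ => real_inner_self_nonneg
  have h4 : 0 ≤ ∑ F ∈ M.facetsOf T,
      ∫ x, inner ℝ (deltaF k T F v x) (deltaF k T F v x) ∂(surf (hull F.1)) :=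
    Finset.sum_nonneg fun F _ => integral_nonneg fun _ => real_inner_self_nonneg
  unfold sForm
  positivity

omit [NeZero d] in
theorem aForm_self_nonneg (v : HybridVec M) : 0 ≤ aForm k v v :=
  Finset.sum_nonneg fun T _ => add_nonneg (integral_nonneg fun _ => frob_self_nonneg _)
    (sForm_self_nonneg T v)

/-- The diffusion form is coercive, uniformly on shape-regular meshes. -/
theorem exists_coercivity (k : ℕ) {σ : ℝ} (hσ : 1 ≤ σ) :
    ∃ C : ℝ, 0 < C ∧ ∀ {Ω : Set (E d)} {M : SimplicialMesh Ω}, M.IsRegular σ →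
      ∀ v ∈ spaceU M k, norm1Sq v ≤ C * aForm k v v := by
  obtain ⟨C, hC, h⟩ := exists_local_coercivity (d := d) k hσ
  set κ := volume.real (Metric.ball (0 : E d) 1)
  have hκ : 0 < κ := ENNReal.toReal_pos
    (Metric.measure_ball_pos _ _ one_pos).ne' measure_ball_lt_top.ne
  refine ⟨C * (1 + κ), by positivity, fun {Ω M} hM v hv => ?_⟩
  rw [norm1Sq, aForm, Finset.mul_sum]
  refine Finset.sum_le_sum fun T _ => ?_
  obtain ⟨x₀, r, hr, hb, hd⟩ := hM T
  have hT : HasInball σ T.1 x₀ r := ⟨isSimplex T, hr, hb, hd⟩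
  have hh := hT.diam_pos
  have hl := hT.le_lam
  have h1 := h T x₀ r hT v hv
  set X := ∫ x in hull T.1, frob (fderiv ℝ (velRec k T v) x) (fderiv ℝ (velRec k T v) x)
  have hX0 : 0 ≤ X := integral_nonneg fun x => frob_self_nonneg _
  unfold sForm
  simp only [real_inner_self_eq_norm_sq]
  set D := ∫ x in hull T.1, ‖deltaT k T v x‖ ^ 2
  have hD0 : 0 ≤ D := integral_nonneg fun x => sq_nonneg _
  set Y := ∑ F ∈ M.facetsOf T, ∫ x, ‖deltaF k T F v x‖ ^ 2 ∂(surf (hull F.1))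
  have hY0 : 0 ≤ Y := Finset.sum_nonneg fun F _ => integral_nonneg fun x => sq_nonneg _
  set V := ∫ x in hull T.1, frob (fderiv ℝ (v.1 T) x) (fderiv ℝ (v.1 T) x)
  set J := ∑ F ∈ M.facetsOf T, ∫ x, ‖v.2 F x - v.1 T x‖ ^ 2 ∂(surf (hull F.1))
  set h' := diam T.1
  have e1 : V + h'⁻¹ * J = (h' ^ 2)⁻¹ * (h' ^ 2 * V + h' * J) := by
    field_simp
  have hm : 1 ≤ κ * lam T := by
    rwa [inv_le_iff_one_le_mul₀' hκ] at hl
  calc V + h'⁻¹ * J ≤ (h' ^ 2)⁻¹ * (C * (h' ^ 2 * X + D + h' * Y)) := by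
        rw [e1]
        gcongr
    _ = C * (X + (h' ^ 2)⁻¹ * D + h'⁻¹ * Y) := by field_simp
    _ ≤ C * (X + κ * lam T * ((h' ^ 2)⁻¹ * D) + h'⁻¹ * Y) := by
        have := le_mul_of_one_le_left (show 0 ≤ (h' ^ 2)⁻¹ * D by positivity) hm
        gcongr
    _ ≤ C * ((1 + κ) * (X + (lam T * (h' ^ 2)⁻¹ * D + h'⁻¹ * Y))) := by
        have hl0 : 0 < lam T := lt_of_lt_of_le (by positivity) hl
        have r1 : 0 ≤ κ * X := by positivity
        have r2 : 0 ≤ lam T * ((h' ^ 2)⁻¹ * D) := by positivity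
        have r3 : 0 ≤ κ * (h'⁻¹ * Y) := by positivity
        refine mul_le_mul_of_nonneg_left ?_ hC.le
        have e2 : (1 + κ) * (X + (lam T * (h' ^ 2)⁻¹ * D + h'⁻¹ * Y)) =
            X + κ * lam T * ((h' ^ 2)⁻¹ * D) + h'⁻¹ * Y +
              (κ * X + lam T * ((h' ^ 2)⁻¹ * D) + κ * (h'⁻¹ * Y)) := by ring
        rw [e2]
        linarith
    _ = _ := by ring

end Coercivity

/-! ### Interpolation of the initial data -/

section InitialData

variable [NeZero d] {Ω : Set (E d)} {M : SimplicialMesh Ω} {k : ℕ} (hΩ : IsOpen Ω)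
  (hc : Convex ℝ Ω) {u : E d → E d} (hu : MemH10 Ω u)

include hΩ hc hu

theorem isTrace_facet (F : M.Facet) : IsTrace Ω (hull F.1) u (trace Ω (hull F.1) u) := by
  obtain ⟨T, hF⟩ := exists_elem F
  obtain ⟨v, hv, h⟩ := exists_eq_erase hF
  obtain ⟨h1, φ, hφ, ht⟩ := hu
  rw [h]
  exact ((isSimplex T).trace_spec hv (interior_hull_subset hΩ hc T) h1 (fun n => (hφ n).1) ht).1

theorem memLp_trace (F : M.Facet) : MemLp (trace Ω (hull F.1) u) 2 (surf (hull F.1)) :=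
  (isTrace_facet hΩ hc hu F).1

theorem trace_interior_ae_eq {T : M.Elem} {F : M.Facet} (hF : F ∈ M.facetsOf T) :
    trace (interior (hull T.1)) (hull F.1) u =ᵐ[surf (hull F.1)] trace Ω (hull F.1) u := by
  obtain ⟨v, hv, h⟩ := exists_eq_erase hF
  rw [h]
  exact (isSimplex T).trace_interior_ae_eq hv hΩ (interior_hull_subset hΩ hc T) hu

omit [NeZero d] in
theorem memLp_hull_of_memH10 (T : M.Elem) : MemLp u 2 (volume.restrict (hull T.1)) := by
  rw [restrict_hull_eq]
  exact hu.1.1.mono_measure (Measure.restrict_mono (interior_hull_subset hΩ hc T) le_rfl)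

theorem isInterp_interp (T : M.Elem) :
    IsInterp k T u (fun F => trace Ω (hull F.1) u) ((interp M k u).1 T) := by
  have hm : ∀ F ∈ M.facetsOf T,
      MemLp (trace (interior (hull T.1)) (hull F.1) u) 2 (surf (hull F.1)) := fun F hF =>
    (memLp_congr_ae (trace_interior_ae_eq hΩ hc hu hF)).2 (memLp_trace hΩ hc hu F)
  obtain ⟨h1, h2, h3⟩ := isInterp_interpRTN k T (memLp_hull_of_memH10 hΩ hc hu T) hm
  refine ⟨h1, h2, fun F hF x hx => (h3 F hF x hx).trans ?_⟩
  refine congrFun ((isL2Space_facetPoly F k).lproj_congr ((hm F hF).inner_const _) ?_) x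
  filter_upwards [trace_interior_ae_eq hΩ hc hu hF] with y hy
  rw [hy]

theorem interp_mem_spaceU : interp M k u ∈ spaceU M k :=
  mem_spaceU.2 ⟨fun T => (isInterp_interp hΩ hc hu T).mem, fun F =>
    (isL2Space_facetPoly F k).lprojVec_mem (memLp_trace hΩ hc hu F)⟩

theorem trace_ae_eq_zero {F : M.Facet} (hF : hull F.1 ⊆ frontier Ω) :
    trace Ω (hull F.1) u =ᵐ[surf (hull F.1)] 0 := by
  obtain ⟨T, hT⟩ := exists_elem F
  obtain ⟨v, hv, h⟩ := exists_eq_erase hT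
  rw [h] at hF ⊢
  exact (isSimplex T).trace_ae_eq_zero hv hΩ (interior_hull_subset hΩ hc T) hF hu

theorem interp_mem_spaceU0 : interp M k u ∈ spaceU0 M k := by
  refine ⟨interp_mem_spaceU hΩ hc hu, fun F hF => ?_⟩
  have hL := isL2Space_facetPoly F k
  have h1 := hL.lprojVec_congr (memLp_trace hΩ hc hu F) (trace_ae_eq_zero hΩ hc hu hF)
  exact h1.trans (hL.lprojVec_self (vec _).zero_mem)

theorem gradRhs_interp (hdiv : IsDivFree Ω u) (T : M.Elem) {q : HybridScal M}
    (hq : q ∈ spaceP M k) : gradRhs T q ((interp M k u).1 T) = ∑ F ∈ M.facetsOf T,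
      ∫ x, q.2 F x * inner ℝ (trace Ω (hull F.1) u x) (normal T.1 F.1) ∂(surf (hull F.1)) := by
  have hI := isInterp_interp (k := k) hΩ hc hu T
  have hTΩ := interior_hull_subset hΩ hc T
  have hqT := (mem_spaceP.1 hq).1 T
  have hg := (isSimplex T).green_of_tendstoH1 hTΩ hu.1 (fun n => (hu.2.choose_spec.1 n).1)
    hu.2.choose_spec.2 (q := q.1 T) (contDiff_of_mem_poly hqT)
  have h0 : ∫ x in hull T.1, q.1 T x * ∑ i, weakGrad Ω u x (basisVec i) i = 0 := by
    rw [restrict_hull_eq]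
    refine integral_eq_zero_of_ae ?_
    filter_upwards [ae_restrict_of_ae_restrict_of_subset hTΩ hdiv] with x hx
    rw [hx, mul_zero, Pi.zero_apply]
  rw [h0, zero_add, ← sum_facetsOf_eq T fun G =>
    ∫ y, q.1 T y * inner ℝ (trace Ω (hull G) u y) (normal T.1 G) ∂(surf (hull G))] at hg
  rw [gradRhs_eq T hq hI.mem]
  have h1 : ∫ x in hull T.1, fderiv ℝ (q.1 T) x ((interp M k u).1 T x) =
      ∫ x in hull T.1, inner ℝ (gradVec (q.1 T) x) (u x) := by
    simp only [← inner_gradVec]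
    rw [hI.moment _ (gradVec_mem_vec hqT)]
    simp only [real_inner_comm]
  rw [h1, hg, ← Finset.sum_add_distrib]
  refine Finset.sum_congr rfl fun F hF => ?_
  have hL := isL2Space_facetPoly F k
  have ht := (memLp_trace hΩ hc hu F).inner_const (𝕜 := ℝ) (normal T.1 F.1)
  have hr1 : (hull F.1).indicator (q.1 T) ∈ facetPoly F.1 k := mem_facetPoly_iff.2 ⟨_, hqT, rfl⟩
  have hr2 := (mem_spaceP.1 hq).2 F
  have e1 : ∫ x, (q.2 F x - q.1 T x) * inner ℝ ((interp M k u).1 T x) (normal T.1 F.1)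
      ∂(surf (hull F.1)) = ∫ x, inner ℝ (trace Ω (hull F.1) u x) (normal T.1 F.1) *
        (q.2 F - (hull F.1).indicator (q.1 T)) x ∂(surf (hull F.1)) := by
    rw [← (hL.lproj_spec ht).2 _ ((facetPoly F.1 k).sub_mem hr2 hr1)]
    refine integral_surf_congr fun x hx => ?_
    rw [hI.facet F hF x hx, Pi.sub_apply, indicator_of_mem hx, mul_comm]
  have i1 := hL.integrable_mul ht hr1
  have i2 := hL.integrable_mul ht hr2
  have e2 : ∫ x, q.1 T x * inner ℝ (trace Ω (hull F.1) u x) (normal T.1 F.1) ∂(surf (hull F.1)) =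
      ∫ x, inner ℝ (trace Ω (hull F.1) u x) (normal T.1 F.1) *
        (hull F.1).indicator (q.1 T) x ∂(surf (hull F.1)) := by
    refine integral_surf_congr fun x hx => ?_
    rw [indicator_of_mem hx, mul_comm]
  rw [e1, e2]
  simp only [Pi.sub_apply, mul_sub]
  rw [integral_sub i2 i1, add_sub_cancel]
  simp only [mul_comm]

/-- The interpolate of a divergence-free field is discretely divergence-free. -/
theorem interp_mem_spaceZ0 (hdiv : IsDivFree Ω u) : interp M k u ∈ spaceZ0 M k := by
  refine ⟨interp_mem_spaceU0 hΩ hc hu, fun q hq => ?_⟩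
  rw [bForm_eq (interp_mem_spaceU hΩ hc hu) hq.1, Finset.sum_congr rfl fun T _ =>
    gradRhs_interp hΩ hc hu hdiv T hq.1, sum_sum_facetsOf]
  refine Finset.sum_eq_zero fun F _ => ?_
  by_cases hF : hull F.1 ⊆ frontier Ω
  · refine Finset.sum_eq_zero fun T _ => ?_
    split_ifs
    · refine integral_eq_zero_of_ae ?_
      filter_upwards [trace_ae_eq_zero hΩ hc hu hF] with x hx
      simp [hx]
    · rfl
  · have hi : Integrable (fun x => q.2 F x • trace Ω (hull F.1) u x) (surf (hull F.1)) :=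
      memLp_one_iff_integrable.1 ((memLp_trace hΩ hc hu F).smul
        ((isL2Space_facetPoly F k).memLp _ ((mem_spaceP.1 hq.1).2 F)))
    have h1 : ∀ n : E d, ∫ x, q.2 F x * inner ℝ (trace Ω (hull F.1) u x) n ∂(surf (hull F.1)) =
        inner ℝ n (∫ x, q.2 F x • trace Ω (hull F.1) u x ∂(surf (hull F.1))) := by
      intro n
      rw [← integral_inner hi]
      simp only [inner_smul_right, real_inner_comm]
    have h2 := sum_normal_eq_zero hΩ hc hF
    have h3 := congrArg (fun n : E d => (inner ℝ n
      (∫ x, q.2 F x • trace Ω (hull F.1) u x ∂(surf (hull F.1))) : ℝ)) h2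
    simp only [sum_inner, inner_zero_left] at h3
    refine (Finset.sum_congr rfl fun T _ => ?_).trans h3
    split_ifs
    · exact h1 _
    · rw [inner_zero_left]

omit hΩ hc hu in
/-- The local stability of the interpolator. -/
theorem exists_interp_local_bound (k : ℕ) {σ : ℝ} (hσ : 1 ≤ σ) :
    ∃ C : ℝ, 0 < C ∧ ∀ {Ω : Set (E d)} {M : SimplicialMesh Ω}, IsOpen Ω → Convex ℝ Ω →
      ∀ (T : M.Elem) (x₀ : E d) (r : ℝ), HasInball σ T.1 x₀ r → ∀ u, MemH10 Ω u →
      (∫ x in hull T.1, ‖(interp M k u).1 T x‖ ^ 2) + diam T.1 * ∑ F ∈ M.facetsOf T,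
        ∫ x, ‖(interp M k u).2 F x - (interp M k u).1 T x‖ ^ 2 ∂(surf (hull F.1)) ≤
      C * ((∫ x in hull T.1, ‖u x‖ ^ 2) +
        diam T.1 ^ 2 * ∫ x in hull T.1, ‖weakGrad Ω u x‖ ^ 2) := by
  obtain ⟨C₁, hC₁, h₁⟩ := exists_isInterp (d := d) k hσ
  obtain ⟨C₂, hC₂, h₂⟩ := exists_inverse_inequality (d := d) (k + 1) hσ
  refine ⟨(C₁ * (1 + (d + 1) * (σ * (d + 1)))) * (1 + (d + 1) * (2 * (σ * (d + 1 + C₂)))) +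
    (d + 1) * (2 * (σ * (d + 1))), by positivity, fun {Ω M} hΩ hc T x₀ r hT u hu => ?_⟩
  have hTΩ := interior_hull_subset hΩ hc T
  have hh := hT.diam_pos
  have hU := interp_mem_spaceU (M := M) (k := k) hΩ hc hu
  have hI := isInterp_interp (k := k) hΩ hc hu T
  set h := diam T.1
  set A := ∫ x in hull T.1, ‖u x‖ ^ 2
  set B := ∫ x in hull T.1, ‖weakGrad Ω u x‖ ^ 2
  have hA : 0 ≤ A := integral_nonneg fun x => sq_nonneg _
  have hB : 0 ≤ B := integral_nonneg fun x => sq_nonneg _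
  set Q := A + h ^ 2 * B with hQ
  have hQ0 : 0 ≤ Q := by positivity
  have htr : ∀ F ∈ M.facetsOf T, h * ∫ x, ‖trace Ω (hull F.1) u x‖ ^ 2 ∂(surf (hull F.1)) ≤
      σ * (d + 1) * Q := by
    intro F hF
    obtain ⟨v, hv, e⟩ := exists_eq_erase hF
    have h3 := isTrace_facet hΩ hc hu F
    rw [e] at h3 ⊢
    have h4 := (isSimplex T).trace_inequality_of_isTrace hv hTΩ hu.1 h3
    have h5 : 0 ≤ ∫ x, ‖trace Ω (hull (T.1.erase v)) u x‖ ^ 2 ∂(surf (hull (T.1.erase v))) :=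
      integral_nonneg fun x => sq_nonneg _
    have h6 := mul_le_mul_of_nonneg_right (hT.diam_le_height hv) h5
    have h7 : (d + 1) * A + h ^ 2 * B ≤ (d + 1) * Q := by
      have : 0 ≤ d * (h ^ 2 * B) := by positivity
      rw [hQ]
      linarith
    refine h6.trans ?_
    rw [mul_assoc, mul_assoc]
    exact mul_le_mul_of_nonneg_left (h4.trans h7) (by linarith)
  set w := (interp M k u).1 T
  set W := ∫ x in hull T.1, ‖w x‖ ^ 2
  have hW0 : 0 ≤ W := integral_nonneg fun x => sq_nonneg _
  have hW : W ≤ C₁ * (1 + (d + 1) * (σ * (d + 1))) * Q := by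
    obtain ⟨w', hw', hb⟩ := h₁ T x₀ r hT u (fun F => trace Ω (hull F.1) u)
      (memLp_hull_of_memH10 hΩ hc hu T) fun F _ => memLp_trace hΩ hc hu F
    rw [← hI.eq hw'] at hb
    refine hb.trans ?_
    rw [mul_assoc]
    refine mul_le_mul_of_nonneg_left ?_ hC₁.le
    have h3 := Finset.sum_le_sum htr
    rw [Finset.sum_const, card_facetsOf, nsmul_eq_mul, ← Finset.mul_sum] at h3
    push_cast at h3
    have h4 : 0 ≤ h ^ 2 * B := by positivity
    calc _ ≤ Q + (d + 1) * (σ * (d + 1) * Q) := add_le_add (by rw [hQ]; linarith) h3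
      _ = _ := by ring
  have hws : ContDiff ℝ 1 w := contDiff_of_mem_vec (RTN_le_vec k hI.mem)
  have hwg := h₂ T.1 x₀ r hT w (RTN_le_vec k hI.mem)
  have hj : ∀ F ∈ M.facetsOf T, h * ∫ x, ‖(interp M k u).2 F x - w x‖ ^ 2 ∂(surf (hull F.1)) ≤
      2 * (σ * (d + 1)) * Q + 2 * (σ * (d + 1 + C₂)) * W := by
    intro F hF
    have h3 := integral_norm_sub_sq_le (memLp_facet hU F)
      (memLp_surf hws.continuous.continuousOn : MemLp w 2 (surf (hull F.1)))
    have h4 : h * ∫ x, ‖(interp M k u).2 F x‖ ^ 2 ∂(surf (hull F.1)) ≤ σ * (d + 1) * Q :=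
      (mul_le_mul_of_nonneg_left ((isL2Space_facetPoly F k).integral_lprojVec_sq_le
        (memLp_trace hΩ hc hu F)) hh.le).trans (htr F hF)
    have h5 : h * ∫ x, ‖w x‖ ^ 2 ∂(surf (hull F.1)) ≤ σ * (d + 1 + C₂) * W := by
      refine (hT.trace_facet hF hws).trans ?_
      rw [mul_assoc, add_mul (d + 1 : ℝ) C₂ W]
      exact mul_le_mul_of_nonneg_left (add_le_add le_rfl hwg) (by linarith)
    have h6 := mul_le_mul_of_nonneg_left h3 hh.le
    linarith
  have hs := Finset.sum_le_sum hj
  rw [Finset.sum_const, card_facetsOf, nsmul_eq_mul, ← Finset.mul_sum] at hs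
  push_cast at hs
  have hW' := mul_le_mul_of_nonneg_left hW
    (by positivity : 0 ≤ 1 + (d + 1) * (2 * (σ * (d + 1 + C₂))))
  linarith

omit hΩ hc hu in
/-- The stability of the interpolator, uniformly on shape-regular meshes. -/
theorem exists_interp_bound (k : ℕ) {σ : ℝ} (hσ : 1 ≤ σ) {Ω : Set (E d)} (hΩ : IsOpen Ω)
    (hc : Convex ℝ Ω) (hb : Bornology.IsBounded Ω) :
    ∃ C : ℝ, 0 < C ∧ ∀ {M : SimplicialMesh Ω}, M.IsRegular σ → ∀ u, MemH10 Ω u →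
      inner0 (interp M k u) (interp M k u) ≤ C * h1SeminormSq Ω u := by
  obtain ⟨C, hC, h⟩ := exists_interp_local_bound (d := d) k hσ
  obtain ⟨R, hR⟩ := hb.exists_norm_le
  refine ⟨C * (4 * R ^ 2 + Metric.diam Ω ^ 2 + 1), by positivity, fun {M} hM u hu => ?_⟩
  have hG := hu.1.weakGrad_spec.1
  have i1 : IntegrableOn (fun x => ‖u x‖ ^ 2) Ω := integrable_norm_sq hu.1.1
  have i2 : IntegrableOn (fun x => ‖weakGrad Ω u x‖ ^ 2) Ω := integrable_norm_sq hG
  have i3 : IntegrableOn (fun x => frob (weakGrad Ω u x) (weakGrad Ω u x)) Ω := by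
    simp only [frob_self]
    exact integrable_finsetSum _ fun i _ => integrable_norm_sq
      ((ContinuousLinearMap.apply ℝ (E d) (basisVec i)).comp_memLp' hG)
  set X := ∫ x in Ω, ‖u x‖ ^ 2 with hX
  set Y := ∫ x in Ω, ‖weakGrad Ω u x‖ ^ 2 with hY
  have hXY : X ≤ 4 * R ^ 2 * Y := hu.poincare hR
  have hYh : Y ≤ h1SeminormSq Ω u := integral_mono i2 i3 fun x => opNorm_sq_le_frob _
  have hY0 : 0 ≤ Y := integral_nonneg fun x => sq_nonneg _
  have key : inner0 (interp M k u) (interp M k u) ≤ C * (X + Metric.diam Ω ^ 2 * Y) := by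
    rw [hX, hY, integral_eq_sum hc fun T : M.Elem => integrableOn_elem hΩ hc T i1,
      integral_eq_sum hc fun T : M.Elem => integrableOn_elem hΩ hc T i2, Finset.mul_sum,
      ← Finset.sum_add_distrib, Finset.mul_sum, inner0]
    refine Finset.sum_le_sum fun T _ => ?_
    obtain ⟨x₀, r, hr, hs, hd⟩ := hM T
    have h1 := h hΩ hc T x₀ r ⟨isSimplex T, hr, hs, hd⟩ u hu
    simp only [real_inner_self_eq_norm_sq]
    refine h1.trans (mul_le_mul_of_nonneg_left (add_le_add le_rfl
      (mul_le_mul_of_nonneg_right ?_ (integral_nonneg fun x => sq_nonneg _))) hC.le)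
    exact pow_le_pow_left₀ (diam_nonneg _) (diam_elem_le hb T) 2
  refine key.trans ?_
  rw [mul_assoc]
  refine mul_le_mul_of_nonneg_left ?_ hC.le
  have h2 : 0 ≤ (4 * R ^ 2 + Metric.diam Ω ^ 2 + 1) := by positivity
  have h3 := mul_le_mul_of_nonneg_left hYh h2
  linarith

end InitialData

/-! ### Curves in finite-dimensional function spaces -/

section Curves

variable {X : Type*} [AddCommGroup X] [Module ℝ X] {ι : Type*} {e : ι → X →ₗ[ℝ] ℝ}

/-- Linear forms that separate the points of a space span the dual of each finite-dimensional
subspace. -/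
theorem span_forms_eq_top (he : ∀ x, (∀ i, e i x = 0) → x = 0) (W : Submodule ℝ X)
    [FiniteDimensional ℝ W] : Submodule.span ℝ (range fun i => (e i).comp W.subtype) = ⊤ := by
  refine Submodule.span_eq_top_of_ne_zero fun x hx => ?_
  by_contra! h
  refine hx (Subtype.ext (he x fun i => ?_))
  exact h _ ⟨i, rfl⟩

variable {W : Submodule ℝ X} [FiniteDimensional ℝ W] {s : Set ℝ}

theorem continuousOn_of_forms (he : ∀ x, (∀ i, e i x = 0) → x = 0) {x : ℝ → W}
    (h : ∀ i, ContinuousOn (fun t => e i (x t)) s) (φ : Module.Dual ℝ W) :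
    ContinuousOn (fun t => φ (x t)) s := by
  have hφ : φ ∈ Submodule.span ℝ (range fun i => (e i).comp W.subtype) := by
    rw [span_forms_eq_top he]
    trivial
  induction hφ using Submodule.span_induction with
  | mem φ hφ =>
    obtain ⟨i, rfl⟩ := hφ
    exact h i
  | zero => exact continuousOn_const
  | add φ ψ _ _ h1 h2 => exact h1.add h2
  | smul c φ _ h1 => exact h1.const_smul c

theorem hasDerivWithinAt_of_forms (he : ∀ x, (∀ i, e i x = 0) → x = 0) {x : ℝ → W} {x' : W} {t : ℝ}
    (h : ∀ i, HasDerivWithinAt (fun t => e i (x t)) (e i x') s t) (φ : Module.Dual ℝ W) :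
    HasDerivWithinAt (fun t => φ (x t)) (φ x') s t := by
  have hφ : φ ∈ Submodule.span ℝ (range fun i => (e i).comp W.subtype) := by
    rw [span_forms_eq_top he]
    trivial
  induction hφ using Submodule.span_induction with
  | mem φ hφ =>
    obtain ⟨i, rfl⟩ := hφ
    exact h i
  | zero => exact hasDerivWithinAt_const _ _ _
  | add φ ψ _ _ h1 h2 => exact h1.add h2
  | smul c φ _ h1 => exact h1.const_smul c

variable {V : Type*} [AddCommGroup V] [Module ℝ V] [FiniteDimensional ℝ V]
  {G : Type*} [NormedAddCommGroup G] [NormedSpace ℝ G]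

theorem linear_eq_sum_coord (L : V →ₗ[ℝ] G) (v : V) :
    L v = ∑ i, (Module.finBasis ℝ V).coord i v • L (Module.finBasis ℝ V i) := by
  conv_lhs => rw [← (Module.finBasis ℝ V).sum_repr v]
  rw [map_sum]
  exact Finset.sum_congr rfl fun i _ => map_smul _ _ _

theorem continuousOn_linear {x : ℝ → V}
    (h : ∀ φ : Module.Dual ℝ V, ContinuousOn (fun t => φ (x t)) s) (L : V →ₗ[ℝ] G) :
    ContinuousOn (fun t => L (x t)) s := by
  simp_rw [fun t => linear_eq_sum_coord L (x t)]
  exact continuousOn_finsetSum _ fun i _ => (h _).smul continuousOn_const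

theorem hasDerivWithinAt_linear {x : ℝ → V} {x' : V} {t : ℝ}
    (h : ∀ φ : Module.Dual ℝ V, HasDerivWithinAt (fun t => φ (x t)) (φ x') s t) (L : V →ₗ[ℝ] G) :
    HasDerivWithinAt (fun t => L (x t)) (L x') s t := by
  simp_rw [fun t => linear_eq_sum_coord L (x t), linear_eq_sum_coord L x']
  exact HasDerivWithinAt.fun_sum fun i _ => (h _).smul_const _

end Curves

/-- The Lagrange multiplier of a functional that vanishes on the kernel of a constraint, as a
linear function of that functional. -/
theorem exists_multiplier {U P : Type*} [AddCommGroup U] [Module ℝ U] [FiniteDimensional ℝ U]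
    [AddCommGroup P] [Module ℝ P] (B : P →ₗ[ℝ] Module.Dual ℝ U)
    (hB : ∀ q, (∀ v, B q v = 0) → q = 0) :
    ∃ Ψ : Module.Dual ℝ U →ₗ[ℝ] P, ∀ l : Module.Dual ℝ U, (∀ v, (∀ q, B q v = 0) → l v = 0) →
      B (Ψ l) = l := by
  obtain ⟨Ψ, hΨ⟩ := B.exists_leftInverse_of_injective (LinearMap.ker_eq_bot'.2 fun q hq =>
    hB q fun v => LinearMap.congr_fun hq v)
  refine ⟨Ψ, fun l hl => ?_⟩
  have h : l ∈ LinearMap.range B := by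
    rw [← Subspace.dualCoannihilator_dualAnnihilator_eq (W := LinearMap.range B),
      Submodule.mem_dualAnnihilator]
    intro v hv
    rw [Submodule.mem_dualCoannihilator] at hv
    exact hl v fun q => hv _ ⟨q, rfl⟩
  obtain ⟨q, rfl⟩ := h
  rw [show Ψ (B q) = q from LinearMap.congr_fun hΨ q]

section DiscreteCurves

variable {Ω : Set (E d)} {M : SimplicialMesh Ω} {k : ℕ}

instance (F : Finset (E d)) (l : ℤ) : FiniteDimensional ℝ (facetPoly F l) := by
  unfold facetPoly
  infer_instance

instance : FiniteDimensional ℝ (spaceU M k) := by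
  refine FiniteDimensional.of_injective
    (V₂ := (M.Elem → RTN d (k + 1)) × ((F : M.Facet) → vec (facetPoly F.1 k)))
    { toFun := fun v => (fun T => ⟨v.1.1 T, (mem_spaceU.1 v.2).1 T⟩,
        fun F => ⟨v.1.2 F, (mem_spaceU.1 v.2).2 F⟩)
      map_add' := fun _ _ => rfl
      map_smul' := fun _ _ => rfl } fun v w h => ?_
  simp only [LinearMap.coe_mk, AddHom.coe_mk, Prod.mk.injEq] at h
  exact Subtype.ext (Prod.ext (funext fun T => congrArg Subtype.val (congrFun h.1 T))
    (funext fun F => congrArg Subtype.val (congrFun h.2 F)))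

/-- The point values of the element components of a discrete vector field. -/
def evalElem (T : M.Elem) (x : E d) : HybridVec M →ₗ[ℝ] E d where
  toFun v := v.1 T x
  map_add' _ _ := rfl
  map_smul' _ _ := rfl

/-- The point values of the face components of a discrete vector field. -/
def evalFacet (F : M.Facet) (x : E d) : HybridVec M →ₗ[ℝ] E d where
  toFun v := v.2 F x
  map_add' _ _ := rfl
  map_smul' _ _ := rfl

/-- The components of the point values of a discrete vector field. -/
def evalCoord (M : SimplicialMesh Ω) :
    ((M.Elem × E d) ⊕ (M.Facet × E d)) × Fin d → HybridVec M →ₗ[ℝ] ℝ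
  | (Sum.inl a, i) => (EuclideanSpace.proj (𝕜 := ℝ) i).toLinearMap.comp (evalElem a.1 a.2)
  | (Sum.inr a, i) => (EuclideanSpace.proj (𝕜 := ℝ) i).toLinearMap.comp (evalFacet a.1 a.2)

theorem evalCoord_separates (v : HybridVec M) (h : ∀ i, evalCoord M i v = 0) : v = 0 := by
  refine Prod.ext (funext fun T => funext fun x => ?_) (funext fun F => funext fun x => ?_)
  · ext i
    exact h (Sum.inl (T, x), i)
  · ext i
    exact h (Sum.inr (F, x), i)

/-- A continuously differentiable curve of discrete fields, tested with linear forms. -/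
theorem IsC1In.exists_isC1Dual {W : Submodule ℝ (HybridVec M)} [FiniteDimensional ℝ W] {tF : ℝ}
    {u u' : ℝ → HybridVec M} (h : IsC1In (W : Set (HybridVec M)) tF u u') :
    ∃ x x' : ℝ → W, IsC1Dual tF x x' ∧
      ∀ t ∈ Icc 0 tF, (x t : HybridVec M) = u t ∧ (x' t : HybridVec M) = u' t := by
  classical
  obtain ⟨h1, h2, h3, h4, h5⟩ := h
  have key : ∀ z : ℝ → HybridVec M, (∀ t ∈ Icc 0 tF, z t ∈ W) →
      ∃ x : ℝ → W, ∀ t ∈ Icc 0 tF, (x t : HybridVec M) = z t := fun z hz =>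
    ⟨fun t => if ht : z t ∈ W then ⟨z t, ht⟩ else 0, fun t ht => by
      beta_reduce
      rw [dif_pos (hz t ht)]⟩
  obtain ⟨x, hx⟩ := key u h1
  obtain ⟨x', hx'⟩ := key u' h2
  refine ⟨x, x', ⟨fun φ t ht => ?_, fun φ => ?_⟩, fun t ht => ⟨hx t ht, hx' t ht⟩⟩
  · refine hasDerivWithinAt_of_forms evalCoord_separates (fun i => ?_) φ
    have h6 : HasDerivWithinAt (fun s => evalCoord M i (u s)) (evalCoord M i (u' t))
        (Icc 0 tF) t := by
      obtain ⟨⟨T, y⟩ | ⟨F, y⟩, i⟩ := i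
      · exact ((EuclideanSpace.proj (𝕜 := ℝ) i).hasFDerivAt.comp_hasDerivWithinAt t
          ((h3 t ht).1 T y))
      · exact ((EuclideanSpace.proj (𝕜 := ℝ) i).hasFDerivAt.comp_hasDerivWithinAt t
          ((h3 t ht).2 F y))
    rw [hx' t ht]
    exact h6.congr (fun s hs => by rw [hx s hs]) (by rw [hx t ht])
  · refine continuousOn_of_forms evalCoord_separates (fun i => ?_) φ
    have h6 : ContinuousOn (fun s => evalCoord M i (u' s)) (Icc 0 tF) := by
      obtain ⟨⟨T, y⟩ | ⟨F, y⟩, i⟩ := i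
      · exact (EuclideanSpace.proj (𝕜 := ℝ) i).continuous.comp_continuousOn (h4 T y)
      · exact (EuclideanSpace.proj (𝕜 := ℝ) i).continuous.comp_continuousOn (h5 F y)
    exact h6.congr fun s hs => by rw [hx' s hs]

theorem IsC1Dual.isC1In {W : Submodule ℝ (HybridVec M)} [FiniteDimensional ℝ W] {tF : ℝ}
    {x x' : ℝ → W} (h : IsC1Dual tF x x') :
    IsC1In (W : Set (HybridVec M)) tF (fun t => x t) (fun t => x' t) :=
  ⟨fun t _ => (x t).2, fun t _ => (x' t).2, fun t ht =>
    ⟨fun T y => hasDerivWithinAt_linear (fun φ => h.1 φ t ht) ((evalElem T y).comp W.subtype),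
      fun F y => hasDerivWithinAt_linear (fun φ => h.1 φ t ht) ((evalFacet F y).comp W.subtype)⟩,
    fun T y => continuousOn_linear h.2 ((evalElem T y).comp W.subtype),
    fun F y => continuousOn_linear h.2 ((evalFacet F y).comp W.subtype)⟩

theorem IsC1In.deriv_unique {W W' : Set (HybridVec M)} {tF : ℝ} (htF : 0 < tF)
    {u u' v v' : ℝ → HybridVec M} (h : IsC1In W tF u u') (h' : IsC1In W' tF v v')
    (he : EqOn u v (Icc 0 tF)) : EqOn u' v' (Icc 0 tF) := by
  intro t ht
  have hU := uniqueDiffOn_Icc htF t ht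
  refine Prod.ext (funext fun T => funext fun x => ?_) (funext fun F => funext fun x => ?_)
  · exact hU.eq_deriv _ ((h.2.2.1 t ht).1 T x) (((h'.2.2.1 t ht).1 T x).congr
      (fun s hs => by rw [he hs]) (by rw [he ht]))
  · exact hU.eq_deriv _ ((h.2.2.1 t ht).2 F x) (((h'.2.2.1 t ht).2 F x).congr
      (fun s hs => by rw [he hs]) (by rw [he ht]))

theorem IsC1In.congr {W : Set (HybridVec M)} {tF : ℝ} {u u' v : ℝ → HybridVec M}
    (h : IsC1In W tF u u') (he : EqOn v u (Icc 0 tF)) : IsC1In W tF v u' :=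
  ⟨fun t ht => by rw [he ht]; exact h.1 t ht, h.2.1, fun t ht =>
    ⟨fun T x => ((h.2.2.1 t ht).1 T x).congr (fun s hs => by rw [he hs]) (by rw [he ht]),
      fun F x => ((h.2.2.1 t ht).2 F x).congr (fun s hs => by rw [he hs]) (by rw [he ht])⟩, h.2.2.2⟩

end DiscreteCurves

/-! ### The power of a source term -/

section Source

variable [NeZero d] {Ω : Set (E d)} {M : SimplicialMesh Ω} {k : ℕ} {v : HybridVec M}
  (hv : v ∈ spaceU M k)

include hv

omit [NeZero d] in
theorem memLp_broken : MemLp (broken v.1) 2 (volume.restrict Ω) := by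
  refine memLp_finsetSum _ fun T _ => ?_
  rw [memLp_indicator_iff_restrict isOpen_interior.measurableSet]
  refine (memLp_elem hv T).mono_measure ?_
  rw [restrict_hull_eq]
  exact Measure.restrict_mono_measure Measure.restrict_le_self _

theorem integral_norm_broken_sq_le (hc : Convex ℝ Ω) :
    ∫ x in Ω, ‖broken v.1 x‖ ^ 2 ≤ inner0 v v := by
  have h1 : ∀ T : M.Elem, (fun x => ‖broken v.1 x‖ ^ 2) =ᵐ[volume.restrict (hull T.1)]
      fun x => ‖v.1 T x‖ ^ 2 := by
    intro T
    filter_upwards [ae_broken_eq v.1 T] with x hx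
    rw [hx]
  have h2 : ∀ T : M.Elem, IntegrableOn (fun x => ‖v.1 T x‖ ^ 2) (hull T.1) := fun T =>
    integrable_norm_sq (memLp_elem hv T)
  rw [integral_eq_sum hc fun T => (integrable_congr (h1 T)).2 (h2 T), inner0]
  refine Finset.sum_le_sum fun T _ => ?_
  rw [integral_congr_ae (h1 T)]
  simp only [real_inner_self_eq_norm_sq]
  exact le_add_of_nonneg_right (mul_nonneg (diam_nonneg _)
    (Finset.sum_nonneg fun F _ => integral_nonneg fun x => sq_nonneg _))

omit [NeZero d] in
theorem integral_inner_broken (f : Lp (E d) 2 (volume.restrict Ω)) :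
    ∫ x in Ω, inner ℝ (f x) (broken v.1 x) = inner ℝ f ((memLp_broken hv).toLp _) := by
  rw [L2.inner_def]
  refine integral_congr_ae ?_
  filter_upwards [(memLp_broken hv).coeFn_toLp] with x hx
  rw [hx]

omit [NeZero d] in
theorem continuousOn_source {f : ℝ → Lp (E d) 2 (volume.restrict Ω)} {s : Set ℝ}
    (hf : ContinuousOn f s) :
    ContinuousOn (fun t => ∫ x in Ω, inner ℝ (f t x) (broken v.1 x)) s := by
  simp only [integral_inner_broken hv]
  exact hf.inner continuousOn_const

theorem two_mul_source_le (hc : Convex ℝ Ω) (f : Lp (E d) 2 (volume.restrict Ω)) :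
    2 * ∫ x in Ω, inner ℝ (f x) (broken v.1 x) ≤ ‖f‖ ^ 2 + inner0 v v := by
  have h1 := integral_norm_broken_sq_le hv hc
  rw [integral_norm_sq_toLp (memLp_broken hv)] at h1
  rw [integral_inner_broken hv]
  have h2 := real_inner_le_norm f ((memLp_broken hv).toLp _)
  have h3 := two_mul_le_add_sq ‖f‖ ‖(memLp_broken hv).toLp _‖
  linarith

omit [NeZero d] hv in
theorem isLinOn_source (f : Lp (E d) 2 (volume.restrict Ω)) :
    IsLinOn (spaceU M k) fun v => ∫ x in Ω, inner ℝ (f x) (broken v.1 x) := by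
  have h : ∀ x, IsLinOn (spaceU M k) fun v => broken v.1 x := fun x => by
    refine IsLinOn.sum fun T _ => ?_
    by_cases hx : x ∈ interior (hull T.1)
    · simp only [indicator_of_mem hx]
      exact isLinOn_elem T x
    · simp only [indicator_of_notMem hx]
      exact ⟨fun _ _ _ _ => (add_zero _).symm, fun _ _ _ => (smul_zero _).symm⟩
  exact IsLinOn.integral (fun x => (h x).inner_right _) fun v hv =>
    integrable_inner_of_memLp (Lp.memLp f) (memLp_broken hv)

end Source

/-! ### The discrete momentum and induction equations -/

section Residual

variable [NeZero d] {Ω : Set (E d)} {M : SimplicialMesh Ω} {k : ℕ}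

/-- The residual, tested with `z`, of the pressure-free equation with diffusion coefficient `ν`,
stabilization weights `β` and source `f`. The unknown `v` with time derivative `v'` is transported
by `w`, and `(b, c)` are the arguments of the second convective term. -/
def residual (k : ℕ) (ν : ℝ) (β : M.Elem → ℝ) (f : Lp (E d) 2 (volume.restrict Ω))
    (v' v w b c z : HybridVec M) : ℝ :=
  inner0 v' z + ν * aForm k v z + tForm w v z + jForm β v z - tForm b c z -
    ∫ x in Ω, inner ℝ (f x) (broken z.1 x)

theorem isLinOn_residual (ν : ℝ) (β : M.Elem → ℝ) (f : Lp (E d) 2 (volume.restrict Ω))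
    {v' v w b c : HybridVec M} (hv' : v' ∈ spaceU M k) (hv : v ∈ spaceU M k) (hw : w ∈ spaceU M k)
    (hb : b ∈ spaceU M k) (hc : c ∈ spaceU M k) :
    IsLinOn (spaceU M k) (residual k ν β f v' v w b c) :=
  (((((isLinOn_inner0_right hv').add ((isLinOn_aForm_right hv).const_mul ν)).add
    (isLinOn_tForm_right hw hv)).add (isLinOn_jForm_right β hv)).sub
      (isLinOn_tForm_right hb hc)).sub (isLinOn_source f)

/-- The residual of a curve of discretely divergence-free fields is a continuous function of
time. -/
theorem continuousOn_residual {tF : ℝ} (ν : ℝ) {β : ℝ → M.Elem → ℝ}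
    (hβ : ∀ T, ContinuousOn (fun t => β t T) (Icc 0 tF))
    {f : ℝ → Lp (E d) 2 (volume.restrict Ω)} (hf : ContinuousOn f (Icc 0 tF))
    {v v' w w' b b' c c' : ℝ → spaceU M k} (hv : IsC1Dual tF v v') (hw : IsC1Dual tF w w')
    (hb : IsC1Dual tF b b') (hc : IsC1Dual tF c c') {z : HybridVec M} (hz : z ∈ spaceU M k) :
    ContinuousOn (fun t => residual k ν (β t) (f t) (v' t) (v t) (w t) (b t) (c t) z)
      (Icc 0 tF) := by
  have hT : ∀ {a a' e e' : ℝ → spaceU M k}, IsC1Dual tF a a' → IsC1Dual tF e e' →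
      ContinuousOn (fun t => tForm (a t : HybridVec M) (e t) z) (Icc 0 tF) := fun ha he =>
    continuousOn_bilin (B := fun _ => LinearMap.mk₂ ℝ
      (fun a e : spaceU M k => tForm (a : HybridVec M) e z)
      (fun a a' e => (isLinOn_tForm_left e.2 hz).1 _ a.2 _ a'.2)
      (fun r a e => (isLinOn_tForm_left e.2 hz).2 r _ a.2)
      (fun a e e' => (isLinOn_tForm_mid a.2 hz).1 _ e.2 _ e'.2)
      (fun r a e => (isLinOn_tForm_mid a.2 hz).2 r _ e.2)) (fun _ _ => continuousOn_const)
      ha.continuousOn he.continuousOn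
  have h1 : ContinuousOn (fun t => inner0 (v' t : HybridVec M) z) (Icc 0 tF) :=
    hv.2 (isLinOn_inner0 hz).toLin
  have h2 : ContinuousOn (fun t => aForm k (v t : HybridVec M) z) (Icc 0 tF) :=
    hv.continuousOn (isLinOn_aForm hz).toLin
  have h3 : ContinuousOn (fun t => jForm (β t) (v t : HybridVec M) z) (Icc 0 tF) :=
    continuousOn_dual (l := fun t => (isLinOn_jForm (β t) hz).toLin)
      (fun u => continuousOn_finsetSum _ fun T _ => (hβ T).mul continuousOn_const) hv.continuousOn
  exact (((((h1.add (h2.const_smul ν)).add (hT hw hv)).add h3).sub (hT hb hc))).sub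
    (continuousOn_source hz hf)

end Residual

/-! ### The pressure-free problem as an evolution equation -/

section Multilinear

variable {X V Y : Type*} [AddCommGroup X] [Module ℝ X] [AddCommGroup V] [Module ℝ V]
  [AddCommGroup Y] [Module ℝ Y]

theorem IsLinOn.precomp {W : Submodule ℝ X} {f : X → Y} (hf : IsLinOn W f) (L : V →ₗ[ℝ] X)
    (hL : ∀ v, L v ∈ W) : IsLinOn ⊤ fun v => f (L v) :=
  ⟨fun x _ y _ => by beta_reduce; rw [map_add]; exact hf.1 _ (hL x) _ (hL y),
    fun c x _ => by beta_reduce; rw [map_smul]; exact hf.2 c _ (hL x)⟩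

/-- The bilinear map with given values. -/
def bilin (f : V → V → ℝ) (h₁ : ∀ y, IsLinOn ⊤ fun x => f x y) (h₂ : ∀ x, IsLinOn ⊤ (f x)) :
    V →ₗ[ℝ] V →ₗ[ℝ] ℝ :=
  LinearMap.mk₂ ℝ f (fun x x' y => (h₁ y).1 x trivial x' trivial)
    (fun c x y => (h₁ y).2 c x trivial) (fun x y y' => (h₂ x).1 y trivial y' trivial)
    fun c x y => (h₂ x).2 c y trivial

/-- The trilinear map with given values. -/
def trilin (f : V → V → V → ℝ) (h₁ : ∀ y z, IsLinOn ⊤ fun x => f x y z)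
    (h₂ : ∀ x z, IsLinOn ⊤ fun y => f x y z) (h₃ : ∀ x y, IsLinOn ⊤ (f x y)) :
    V →ₗ[ℝ] V →ₗ[ℝ] V →ₗ[ℝ] ℝ where
  toFun x := bilin (f x) (h₂ x) (h₃ x)
  map_add' x x' := LinearMap.ext₂ fun y z => (h₁ y z).1 x trivial x' trivial
  map_smul' c x := LinearMap.ext₂ fun y z => (h₁ y z).2 c x trivial

theorem IsC1Dual.map {tF : ℝ} {x x' : ℝ → X} (h : IsC1Dual tF x x') (L : X →ₗ[ℝ] V) :
    IsC1Dual tF (fun t => L (x t)) fun t => L (x' t) :=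
  ⟨fun φ => h.1 (φ.comp L), fun φ => h.2 (φ.comp L)⟩

theorem IsC1Dual.prodMk {tF : ℝ} {x x' : ℝ → X} {y y' : ℝ → V} (hx : IsC1Dual tF x x')
    (hy : IsC1Dual tF y y') : IsC1Dual tF (fun t => (x t, y t)) fun t => (x' t, y' t) := by
  have key : ∀ (φ : Module.Dual ℝ (X × V)) (a : X) (b : V), φ (a, b) =
      φ.comp (LinearMap.inl ℝ X V) a + φ.comp (LinearMap.inr ℝ X V) b := by
    intro φ a b
    simp [← map_add]
  refine ⟨fun φ t ht => ?_, fun φ => ?_⟩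
  · simp only [key φ]
    exact (hx.1 _ t ht).add (hy.1 _ t ht)
  · simp only [key φ]
    exact (hx.2 _).add (hy.2 _)

end Multilinear

theorem nonneg_of_pos_Ioc {tF : ℝ} (htF : 0 < tF) {β : ℝ → ℝ} (h : ContinuousOn β (Icc 0 tF))
    (h' : ∀ t ∈ Ioc 0 tF, 0 < β t) : ∀ t ∈ Icc 0 tF, 0 ≤ β t := by
  intro t ht
  refine ContinuousWithinAt.closure_le (f := fun _ => (0 : ℝ)) (s := Ioc 0 tF) ?_
    continuousWithinAt_const ((h t ht).mono Ioc_subset_Icc_self) fun s hs => (h' s hs).le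
  rwa [closure_Ioc htF.ne]

section PressureFree

variable [NeZero d] {Ω : Set (E d)} {M : SimplicialMesh Ω} {k : ℕ}

instance : FiniteDimensional ℝ (subZ0 M k) := Submodule.finiteDimensional_of_le subZ0_le

instance : FiniteDimensional ℝ (subU0 M k) := Submodule.finiteDimensional_of_le subU0_le

/-- The pairs of discretely divergence-free velocities and magnetic fields. -/
abbrev PairZ (M : SimplicialMesh Ω) (k : ℕ) : Type := subZ0 M k × subZ0 M k

/-- The velocity component of a pair. -/
def velZ {M : SimplicialMesh Ω} {k : ℕ} : PairZ M k →ₗ[ℝ] HybridVec M :=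
  (subZ0 M k).subtype.comp (LinearMap.fst ℝ _ _)

/-- The magnetic component of a pair. -/
def magZ {M : SimplicialMesh Ω} {k : ℕ} : PairZ M k →ₗ[ℝ] HybridVec M :=
  (subZ0 M k).subtype.comp (LinearMap.snd ℝ _ _)

theorem velZ_mem (p : PairZ M k) : velZ p ∈ spaceZ0 M k := p.1.2

theorem magZ_mem (p : PairZ M k) : magZ p ∈ spaceZ0 M k := p.2.2

theorem velZ_memU (p : PairZ M k) : velZ p ∈ spaceU M k := p.1.2.1.1

theorem magZ_memU (p : PairZ M k) : magZ p ∈ spaceU M k := p.2.2.1.1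

theorem IsLinOn.vel {Y : Type*} [AddCommGroup Y] [Module ℝ Y] {f : HybridVec M → Y}
    (hf : IsLinOn (spaceU M k) f) : IsLinOn ⊤ fun p : PairZ M k => f (velZ p) :=
  hf.precomp velZ velZ_memU

theorem IsLinOn.mag {Y : Type*} [AddCommGroup Y] [Module ℝ Y] {f : HybridVec M → Y}
    (hf : IsLinOn (spaceU M k) f) : IsLinOn ⊤ fun p : PairZ M k => f (magZ p) :=
  hf.precomp magZ magZ_memU

/-- The data of the evolution equation for the pair of the velocity and of the magnetic field. The
convective terms cancel when they are tested with the solution. -/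
def galerkin (hc : Convex ℝ Ω) {tF ν μ : ℝ} (hν : 0 < ν) (hμ : 0 < μ) {β γ : ℝ → M.Elem → ℝ}
    (hβ : ∀ T, ContinuousOn (fun t => β t T) (Icc 0 tF))
    (hγ : ∀ T, ContinuousOn (fun t => γ t T) (Icc 0 tF))
    (hβ₀ : ∀ T, ∀ t ∈ Icc 0 tF, 0 ≤ β t T) (hγ₀ : ∀ T, ∀ t ∈ Icc 0 tF, 0 ≤ γ t T)
    {f g : ℝ → Lp (E d) 2 (volume.restrict Ω)} (hf : ContinuousOn f (Icc 0 tF))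
    (hg : ContinuousOn g (Icc 0 tF)) : GalerkinData (PairZ M k) tF where
  m := bilin (fun p q => inner0 (velZ p) (velZ q) + inner0 (magZ p) (magZ q))
    (fun q => (isLinOn_inner0 (velZ_memU q)).vel.add (isLinOn_inner0 (magZ_memU q)).mag)
    fun p => (isLinOn_inner0_right (velZ_memU p)).vel.add (isLinOn_inner0_right (magZ_memU p)).mag
  A t := bilin (fun p q => ν * aForm k (velZ p) (velZ q) + jForm (β t) (velZ p) (velZ q) +
      (μ * aForm k (magZ p) (magZ q) + jForm (γ t) (magZ p) (magZ q)))
    (fun q => (((isLinOn_aForm (velZ_memU q)).vel.const_mul ν).add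
        (isLinOn_jForm (β t) (velZ_memU q)).vel).add
      (((isLinOn_aForm (magZ_memU q)).mag.const_mul μ).add
        (isLinOn_jForm (γ t) (magZ_memU q)).mag))
    fun p => (((isLinOn_aForm_right (velZ_memU p)).vel.const_mul ν).add
        (isLinOn_jForm_right (β t) (velZ_memU p)).vel).add
      (((isLinOn_aForm_right (magZ_memU p)).mag.const_mul μ).add
        (isLinOn_jForm_right (γ t) (magZ_memU p)).mag)
  Q := trilin (fun p r q => tForm (velZ p) (velZ r) (velZ q) - tForm (magZ p) (magZ r) (velZ q) +
      (tForm (velZ p) (magZ r) (magZ q) - tForm (magZ p) (velZ r) (magZ q)))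
    (fun r q => ((isLinOn_tForm_left (velZ_memU r) (velZ_memU q)).vel.sub
        (isLinOn_tForm_left (magZ_memU r) (velZ_memU q)).mag).add
      ((isLinOn_tForm_left (magZ_memU r) (magZ_memU q)).vel.sub
        (isLinOn_tForm_left (velZ_memU r) (magZ_memU q)).mag))
    (fun p q => ((isLinOn_tForm_mid (velZ_memU p) (velZ_memU q)).vel.sub
        (isLinOn_tForm_mid (magZ_memU p) (velZ_memU q)).mag).add
      ((isLinOn_tForm_mid (velZ_memU p) (magZ_memU q)).mag.sub
        (isLinOn_tForm_mid (magZ_memU p) (magZ_memU q)).vel))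
    fun p r => ((isLinOn_tForm_right (velZ_memU p) (velZ_memU r)).vel.sub
        (isLinOn_tForm_right (magZ_memU p) (magZ_memU r)).vel).add
      ((isLinOn_tForm_right (velZ_memU p) (magZ_memU r)).mag.sub
        (isLinOn_tForm_right (magZ_memU p) (velZ_memU r)).mag)
  l t := ((isLinOn_source (f t)).vel.add (isLinOn_source (g t)).mag).toLin.comp
    (Submodule.topEquiv (R := ℝ) (M := PairZ M k)).symm.toLinearMap
  symm p q := congrArg₂ (· + ·) (inner0_comm _ _) (inner0_comm _ _)
  pos p hp := by
    have h1 := inner0_self_nonneg (velZ p)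
    have h2 := inner0_self_nonneg (magZ p)
    change 0 < inner0 (velZ p) (velZ p) + inner0 (magZ p) (magZ p)
    refine lt_of_le_of_ne (add_nonneg h1 h2) fun h => hp ?_
    have h3 := eq_zero_of_inner0 (velZ_memU p) (by linarith)
    have h4 := eq_zero_of_inner0 (magZ_memU p) (by linarith)
    exact Prod.ext (Subtype.ext h3) (Subtype.ext h4)
  contA p q := by
    have hj : ∀ {α : ℝ → M.Elem → ℝ}, (∀ T, ContinuousOn (fun t => α t T) (Icc 0 tF)) →
        ∀ w v : HybridVec M, ContinuousOn (fun t => jForm (α t) w v) (Icc 0 tF) := fun hα w v =>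
      continuousOn_finsetSum _ fun T _ => (hα T).mul continuousOn_const
    exact (continuousOn_const.add (hj hβ _ _)).add (continuousOn_const.add (hj hγ _ _))
  contl q := (continuousOn_source (velZ_memU q) hf).add (continuousOn_source (magZ_memU q) hg)
  nonneg t ht p := add_nonneg (add_nonneg (mul_nonneg hν.le (aForm_self_nonneg _))
    (jForm_self_nonneg (fun T => hβ₀ T t ht) _)) (add_nonneg (mul_nonneg hμ.le
      (aForm_self_nonneg _)) (jForm_self_nonneg (fun T => hγ₀ T t ht) _))
  skew p := by
    have h1 := tForm_self_eq_zero hc (velZ_mem p) (velZ_memU p)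
    have h2 := tForm_self_eq_zero hc (velZ_mem p) (magZ_memU p)
    have h3 := tForm_swap hc (magZ_mem p) (magZ_memU p) (velZ_memU p)
    change tForm (velZ p) (velZ p) (velZ p) -
      tForm (magZ p) (magZ p) (velZ p) + (tForm (velZ p) (magZ p) (magZ p) -
        tForm (magZ p) (velZ p) (magZ p)) = 0
    linarith

section Solve

variable (hc : Convex ℝ Ω) {tF ν μ : ℝ} (htF : 0 < tF) (hν : 0 < ν) (hμ : 0 < μ)
  {β γ : ℝ → M.Elem → ℝ}
  (hβ : ∀ T, ContinuousOn (fun t => β t T) (Icc 0 tF))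
  (hγ : ∀ T, ContinuousOn (fun t => γ t T) (Icc 0 tF))
  (hβ₀ : ∀ T, ∀ t ∈ Icc 0 tF, 0 ≤ β t T) (hγ₀ : ∀ T, ∀ t ∈ Icc 0 tF, 0 ≤ γ t T)
  {f g : ℝ → Lp (E d) 2 (volume.restrict Ω)} (hf : ContinuousOn f (Icc 0 tF))
  (hg : ContinuousOn g (Icc 0 tF)) {u₀ b₀ : E d → E d}

/-- The evolution equation is the sum of the two discrete equations. -/
theorem galerkin_iff {t : ℝ} (p p' q : PairZ M k) :
    (galerkin hc hν hμ hβ hγ hβ₀ hγ₀ hf hg).Eqn t p' p q ↔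
    residual k ν (β t) (f t) (velZ p') (velZ p) (velZ p) (magZ p) (magZ p)
      (velZ q) + residual k μ (γ t) (g t) (magZ p') (magZ p) (velZ p)
        (magZ p) (velZ p) (magZ q) = 0 := by
  change inner0 _ _ + inner0 _ _ + (ν * aForm k _ _ + jForm (β t) _ _ +
    (μ * aForm k _ _ + jForm (γ t) _ _)) + (tForm _ _ _ - tForm _ _ _ + (tForm _ _ _ -
      tForm _ _ _)) = (∫ x in Ω, inner ℝ (f t x) (broken (velZ q).1 x)) +
        (∫ x in Ω, inner ℝ (g t x) (broken (magZ q).1 x)) ↔ _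
  unfold residual
  constructor <;> intro h <;> linarith

include htF

theorem solvesPressureFree_iff (hu₀ : interp M k u₀ ∈ spaceZ0 M k)
    (hb₀ : interp M k b₀ ∈ spaceZ0 M k) {u b : ℝ → HybridVec M} :
    SolvesPressureFree M k tF ν μ β γ f g u₀ b₀ u b ↔ ∃ x x' : ℝ → PairZ M k, IsC1Dual tF x x' ∧
      x 0 = (⟨_, hu₀⟩, ⟨_, hb₀⟩) ∧
      (∀ t ∈ Icc 0 tF, velZ (x t) = u t ∧ magZ (x t) = b t) ∧
      ∀ t ∈ Ioc 0 tF, ∀ q,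
        (galerkin hc hν hμ hβ hγ hβ₀ hγ₀ hf hg).Eqn t (x' t) (x t) q := by
  have h0 : (0 : ℝ) ∈ Icc 0 tF := ⟨le_rfl, htF.le⟩
  simp only [galerkin_iff]
  constructor
  · rintro ⟨u', b', hu, hb, h1, h2, h⟩
    obtain ⟨x, x', hx, ex⟩ := IsC1In.exists_isC1Dual (W := subZ0 M k) hu
    obtain ⟨y, y', hy, ey⟩ := IsC1In.exists_isC1Dual (W := subZ0 M k) hb
    refine ⟨_, _, hx.prodMk hy, Prod.ext (Subtype.ext ((ex 0 h0).1.trans h1))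
      (Subtype.ext ((ey 0 h0).1.trans h2)), fun t ht => ⟨(ex t ht).1, (ey t ht).1⟩,
      fun t ht q => ?_⟩
    have ht' := Ioc_subset_Icc_self ht
    have e1 : velZ (x t, y t) = u t := (ex t ht').1
    have e2 : magZ (x t, y t) = b t := (ey t ht').1
    have e3 : velZ (x' t, y' t) = u' t := (ex t ht').2
    have e4 : magZ (x' t, y' t) = b' t := (ey t ht').2
    rw [e1, e2, e3, e4]
    have r1 := (h t ht).1 _ (velZ_mem q)
    have r2 := (h t ht).2 _ (magZ_mem q)
    unfold residual
    linarith
  · rintro ⟨x, x', hx, h1, h2, h⟩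
    have hu := (IsC1Dual.isC1In (hx.map (LinearMap.fst ℝ _ _))).congr (v := u)
      fun t ht => (h2 t ht).1.symm
    have hb := (IsC1Dual.isC1In (hx.map (LinearMap.snd ℝ _ _))).congr (v := b)
      fun t ht => (h2 t ht).2.symm
    refine ⟨_, _, hu, hb, ?_, ?_, fun t ht => ⟨fun v hv => ?_, fun w hw => ?_⟩⟩
    · rw [← (h2 0 h0).1, h1]
      rfl
    · rw [← (h2 0 h0).2, h1]
      rfl
    · have ht' := Ioc_subset_Icc_self ht
      have h3 := h t ht (⟨v, hv⟩, 0)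
      have h4 : residual k μ (γ t) (g t) (magZ (x' t)) (magZ (x t)) (velZ (x t))
        (magZ (x t)) (velZ (x t)) (magZ ((⟨v, hv⟩, 0) : PairZ M k)) = 0 :=
        (isLinOn_residual (k := k) μ (γ t) (g t) (magZ_memU (x' t)) (magZ_memU (x t))
          (velZ_memU (x t)) (magZ_memU (x t)) (velZ_memU (x t))).map_zero
      rw [h4, add_zero, (h2 t ht').1, (h2 t ht').2] at h3
      exact sub_eq_zero.1 h3
    · have ht' := Ioc_subset_Icc_self ht
      have h3 := h t ht (0, ⟨w, hw⟩)
      have h4 : residual k ν (β t) (f t) (velZ (x' t)) (velZ (x t)) (velZ (x t))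
        (magZ (x t)) (magZ (x t)) (velZ ((0, ⟨w, hw⟩) : PairZ M k)) = 0 :=
        (isLinOn_residual (k := k) ν (β t) (f t) (velZ_memU (x' t)) (velZ_memU (x t))
          (velZ_memU (x t)) (magZ_memU (x t)) (magZ_memU (x t))).map_zero
      rw [h4, zero_add, (h2 t ht').1, (h2 t ht').2] at h3
      exact sub_eq_zero.1 h3

include hc hν hμ hβ hγ hβ₀ hγ₀ hf hg

theorem exists_solvesPressureFree (hu₀ : interp M k u₀ ∈ spaceZ0 M k)
    (hb₀ : interp M k b₀ ∈ spaceZ0 M k) :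
    ∃ u b : ℝ → HybridVec M, SolvesPressureFree M k tF ν μ β γ f g u₀ b₀ u b := by
  obtain ⟨x, x', hx, h0, h⟩ := GalerkinData.exists_solution htF
    (galerkin (k := k) hc hν hμ hβ hγ hβ₀ hγ₀ hf hg) (⟨_, hu₀⟩, ⟨_, hb₀⟩)
  exact ⟨_, _, (solvesPressureFree_iff hc htF hν hμ hβ hγ hβ₀ hγ₀ hf hg hu₀ hb₀).2
    ⟨x, x', hx, h0, fun t _ => ⟨rfl, rfl⟩, fun t ht q => h t (Ioc_subset_Icc_self ht) q⟩⟩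

theorem solvesPressureFree_unique (hu₀ : interp M k u₀ ∈ spaceZ0 M k)
    (hb₀ : interp M k b₀ ∈ spaceZ0 M k) {u b u₁ b₁ : ℝ → HybridVec M}
    (h : SolvesPressureFree M k tF ν μ β γ f g u₀ b₀ u b)
    (h₁ : SolvesPressureFree M k tF ν μ β γ f g u₀ b₀ u₁ b₁) :
    EqOn u₁ u (Icc 0 tF) ∧ EqOn b₁ b (Icc 0 tF) := by
  have key := fun u b => solvesPressureFree_iff (u := u) (b := b) hc htF hν hμ hβ hγ hβ₀ hγ₀ hf hg
    hu₀ hb₀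
  obtain ⟨x, x', hx, h0, e, h⟩ := (key u b).1 h
  obtain ⟨z, z', hz, h0', e', h'⟩ := (key u₁ b₁).1 h₁
  have := GalerkinData.solution_unique htF _ hz hx (h0'.trans h0.symm) h' h
  exact ⟨fun t ht => by rw [← (e t ht).1, ← (e' t ht).1, this ht],
    fun t ht => by rw [← (e t ht).2, ← (e' t ht).2, this ht]⟩

end Solve

end PressureFree

/-! ### Recovery of the pressures and energy estimate -/

section Pressure

variable {Ω : Set (E d)} {M : SimplicialMesh Ω} {k : ℕ} {tF : ℝ}

theorem IsC1In.mono {W W' : Set (HybridVec M)} (hW : W ⊆ W') {u u' : ℝ → HybridVec M}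
    (h : IsC1In W tF u u') : IsC1In W' tF u u' :=
  ⟨fun t ht => hW (h.1 t ht), fun t ht => hW (h.2.1 t ht), h.2.2⟩

theorem norm1Sq_nonneg (v : HybridVec M) : 0 ≤ norm1Sq v :=
  Finset.sum_nonneg fun _ _ => add_nonneg (integral_nonneg fun _ => frob_self_nonneg _)
    (mul_nonneg (inv_nonneg.2 (diam_nonneg _)) (Finset.sum_nonneg fun _ _ =>
      integral_nonneg fun _ => sq_nonneg _))

variable [NeZero d]

/-- A curve that satisfies the discrete divergence constraint also has a discretely divergence-free
time derivative. -/
theorem IsC1In.divFree (htF : 0 < tF) {u u' : ℝ → HybridVec M} (h : IsC1In (spaceU0 M k) tF u u')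
    (h0 : u 0 ∈ spaceZ0 M k) (hb : ∀ t ∈ Ioc 0 tF, ∀ q ∈ spaceP0 M k, bForm k (u t) q = 0) :
    IsC1In (spaceZ0 M k) tF u u' := by
  have hZ : ∀ t ∈ Icc 0 tF, u t ∈ spaceZ0 M k := by
    intro t ht
    rcases ht.1.eq_or_lt with rfl | h1
    · exact h0
    · exact ⟨h.1 t ht, hb t ⟨h1, ht.2⟩⟩
  refine ⟨hZ, fun t ht => ⟨h.2.1 t ht, fun q hq => ?_⟩, h.2.2⟩
  obtain ⟨x, x', hx, e⟩ := IsC1In.exists_isC1Dual (W := subU0 M k) h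
  have h1 := hx.1 ((isLinOn_bForm_left hq.1).coe subU0_le).toLin t ht
  have h2 : HasDerivWithinAt (fun _ : ℝ => (0 : ℝ)) (bForm k (x' t) q) (Icc 0 tF) t := by
    have h3 : ∀ s ∈ Icc 0 tF, (0 : ℝ) = bForm k (x s) q := fun s hs => by
      rw [(e s hs).1, (hZ s hs).2 q hq]
    exact h1.congr h3 (h3 t ht)
  rw [← (e t ht).2]
  exact (uniqueDiffOn_Icc htF t ht).eq_deriv _ h2 (hasDerivWithinAt_const _ _ _)

/-- A functional that vanishes on the discretely divergence-free fields is represented by a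
pressure, which depends continuously on time. -/
theorem exists_pressure (hΩ : IsOpen Ω) (hc : Convex ℝ Ω) {r : ℝ → HybridVec M → ℝ}
    (hr : ∀ t, IsLinOn (spaceU M k) (r t))
    (hcont : ∀ z ∈ spaceU M k, ContinuousOn (fun t => r t z) (Icc 0 tF))
    (h0 : ∀ t ∈ Ioc 0 tF, ∀ z ∈ spaceZ0 M k, r t z = 0) :
    ∃ p : ℝ → HybridScal M, IsC0In (spaceP0 M k) tF p ∧
      ∀ t ∈ Ioc 0 tF, ∀ z ∈ spaceU0 M k, r t z + bForm k z (p t) = 0 := by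
  let B : subP0 M hc k →ₗ[ℝ] Module.Dual ℝ (subU0 M k) := LinearMap.mk₂ ℝ
    (fun q v => bForm k (v : HybridVec M) (q : HybridScal M))
    (fun q q' v => (isLinOn_bForm_right v.2.1).1 _ q.2.1 _ q'.2.1)
    (fun c q v => (isLinOn_bForm_right v.2.1).2 c _ q.2.1)
    (fun q v v' => (isLinOn_bForm_left q.2.1).1 _ v.2.1 _ v'.2.1)
    fun c q v => (isLinOn_bForm_left q.2.1).2 c _ v.2.1
  obtain ⟨Ψ, hΨ⟩ := exists_multiplier B fun q hq => Subtype.ext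
    (eq_zero_of_bForm hΩ hc q.2 fun v hv => hq ⟨v, hv⟩)
  let l : ℝ → Module.Dual ℝ (subU0 M k) := fun t => ((hr t).coe subU0_le).toLin
  have key : ∀ L : subP0 M hc k →ₗ[ℝ] ℝ, ContinuousOn (fun t => L (Ψ (-l t))) (Ioc 0 tF) := by
    intro L
    obtain ⟨v, hv⟩ := (Module.evalEquiv ℝ (subU0 M k)).surjective (L.comp Ψ)
    have h1 : ∀ t, L (Ψ (-l t)) = -r t v := fun t => (LinearMap.congr_fun hv (-l t)).symm
    simp only [h1]
    exact ((hcont v v.2.1).mono Ioc_subset_Icc_self).neg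
  refine ⟨fun t => Ψ (-l t), ⟨fun t _ => (Ψ (-l t)).2, fun T x => key
    { toFun := fun q => q.1.1 T x, map_add' := fun _ _ => rfl, map_smul' := fun _ _ => rfl },
    fun F x => key
    { toFun := fun q => q.1.2 F x, map_add' := fun _ _ => rfl, map_smul' := fun _ _ => rfl }⟩,
    fun t ht z hz => ?_⟩
  have h1 := LinearMap.congr_fun (hΨ (-l t) fun v hv => ?_) ⟨z, hz⟩
  · change bForm k z (Ψ (-l t) : HybridScal M) = -r t z at h1
    rw [h1, add_neg_cancel]
  · change -r t v = 0
    rw [h0 t ht v ⟨v.2, fun q hq => hv ⟨q, hq⟩⟩, neg_zero]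

variable {ν μ : ℝ} {β γ : ℝ → M.Elem → ℝ} {f g : ℝ → Lp (E d) 2 (volume.restrict Ω)}
  {u₀ b₀ : E d → E d}

theorem SolvesScheme.solvesPressureFree (htF : 0 < tF) (hu₀ : interp M k u₀ ∈ spaceZ0 M k)
    (hb₀ : interp M k b₀ ∈ spaceZ0 M k) {u b : ℝ → HybridVec M} {p r : ℝ → HybridScal M}
    (h : SolvesScheme M k tF ν μ β γ f g u₀ b₀ u b p r) :
    SolvesPressureFree M k tF ν μ β γ f g u₀ b₀ u b := by
  obtain ⟨u', b', hu, hb, hp, hr, h1, h2, h3⟩ := h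
  refine ⟨u', b', hu.divFree htF (by rwa [h1]) fun t ht q hq => ((h3 t ht).2.2 q hq).1,
    hb.divFree htF (by rwa [h2]) fun t ht q hq => ((h3 t ht).2.2 q hq).2, h1, h2,
    fun t ht => ⟨fun v hv => ?_, fun w hw => ?_⟩⟩
  · rw [← (h3 t ht).1 v hv.1, hv.2 _ (hp.1 t ht), add_zero]
  · rw [← (h3 t ht).2.1 w hw.1, hw.2 _ (hr.1 t ht), add_zero]

theorem SolvesPressureFree.exists_solvesScheme (hΩ : IsOpen Ω) (hc : Convex ℝ Ω)
    (hβ : ∀ T, ContinuousOn (fun t => β t T) (Icc 0 tF))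
    (hγ : ∀ T, ContinuousOn (fun t => γ t T) (Icc 0 tF)) (hf : ContinuousOn f (Icc 0 tF))
    (hg : ContinuousOn g (Icc 0 tF)) {u b : ℝ → HybridVec M}
    (h : SolvesPressureFree M k tF ν μ β γ f g u₀ b₀ u b) :
    ∃ p r, SolvesScheme M k tF ν μ β γ f g u₀ b₀ u b p r := by
  obtain ⟨u', b', hu, hb, h1, h2, h3⟩ := h
  obtain ⟨x, x', hx, ex⟩ := IsC1In.exists_isC1Dual (W := spaceU M k) (hu.mono fun v hv => hv.1.1)
  obtain ⟨y, y', hy, ey⟩ := IsC1In.exists_isC1Dual (W := spaceU M k) (hb.mono fun v hv => hv.1.1)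
  obtain ⟨p, hp, hp'⟩ := exists_pressure (tF := tF) hΩ hc
    (fun t => isLinOn_residual ν (β t) (f t) (x' t).2 (x t).2 (x t).2 (y t).2 (y t).2)
    (fun z hz => continuousOn_residual ν hβ hf hx hx hy hy hz) fun t ht z hz => by
      have ht' := Ioc_subset_Icc_self ht
      rw [(ex t ht').1, (ex t ht').2, (ey t ht').1]
      exact sub_eq_zero.2 ((h3 t ht).1 z hz)
  obtain ⟨r, hr, hr'⟩ := exists_pressure (tF := tF) hΩ hc
    (fun t => isLinOn_residual μ (γ t) (g t) (y' t).2 (y t).2 (x t).2 (y t).2 (x t).2)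
    (fun z hz => continuousOn_residual μ hγ hg hy hx hy hx hz) fun t ht z hz => by
      have ht' := Ioc_subset_Icc_self ht
      rw [(ex t ht').1, (ey t ht').2, (ey t ht').1]
      exact sub_eq_zero.2 ((h3 t ht).2 z hz)
  refine ⟨p, r, u', b', hu.mono fun v hv => hv.1, hb.mono fun v hv => hv.1, hp, hr, h1, h2,
    fun t ht => ⟨fun v hv => ?_, fun w hw => ?_, fun q hq => ?_⟩⟩
  all_goals have ht' := Ioc_subset_Icc_self ht
  · have h4 := hp' t ht v hv
    rw [(ex t ht').1, (ex t ht').2, (ey t ht').1, residual] at h4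
    linarith
  · have h4 := hr' t ht w hw
    rw [(ex t ht').1, (ey t ht').2, (ey t ht').1, residual] at h4
    linarith
  · exact ⟨(hu.1 t ht').2 q hq, (hb.1 t ht').2 q hq⟩

/-- The pressures are determined by the velocity and by the magnetic field. -/
theorem SolvesScheme.pressure_unique (hΩ : IsOpen Ω) (hc : Convex ℝ Ω) (htF : 0 < tF)
    {u b u₁ b₁ : ℝ → HybridVec M} {p r p₁ r₁ : ℝ → HybridScal M}
    (h : SolvesScheme M k tF ν μ β γ f g u₀ b₀ u b p r)
    (h₁ : SolvesScheme M k tF ν μ β γ f g u₀ b₀ u₁ b₁ p₁ r₁)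
    (eu : EqOn u₁ u (Icc 0 tF)) (eb : EqOn b₁ b (Icc 0 tF)) :
    EqOn p₁ p (Ioc 0 tF) ∧ EqOn r₁ r (Ioc 0 tF) := by
  obtain ⟨u', b', hu, hb, hp, hr, -, -, h3⟩ := h
  obtain ⟨u₁', b₁', hu₁, hb₁, hp₁, hr₁, -, -, h4⟩ := h₁
  have eu' := hu₁.deriv_unique htF hu eu
  have eb' := hb₁.deriv_unique htF hb eb
  have key : ∀ q q' : HybridScal M, q ∈ spaceP0 M k → q' ∈ spaceP0 M k →
      (∀ v ∈ spaceU0 M k, bForm k v q = bForm k v q') → q = q' := fun q q' hq hq' he =>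
    sub_eq_zero.1 (eq_zero_of_bForm hΩ hc ((subP0 M hc k).sub_mem hq hq') fun v hv => by
      rw [(isLinOn_bForm_right hv.1).map_sub hq.1 hq'.1, he v hv, sub_self])
  constructor <;> intro t ht <;> have ht' := Ioc_subset_Icc_self ht
  · refine key _ _ (hp₁.1 t ht) (hp.1 t ht) fun v hv => ?_
    have e1 := (h3 t ht).1 v hv
    have e2 := (h4 t ht).1 v hv
    rw [eu ht', eb ht', eu' ht'] at e2
    linarith
  · refine key _ _ (hr₁.1 t ht) (hr.1 t ht) fun v hv => ?_
    have e1 := (h3 t ht).2.1 v hv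
    have e2 := (h4 t ht).2.1 v hv
    rw [eu ht', eb ht', eb' ht'] at e2
    linarith

end Pressure

section Energy

variable [NeZero d] {Ω : Set (E d)} {M : SimplicialMesh Ω} {k : ℕ} (hc : Convex ℝ Ω)
  {tF ν μ : ℝ} (htF : 0 < tF) (hν : 0 < ν) (hμ : 0 < μ) {β γ : ℝ → M.Elem → ℝ}
  (hβ : ∀ T, ContinuousOn (fun t => β t T) (Icc 0 tF))
  (hγ : ∀ T, ContinuousOn (fun t => γ t T) (Icc 0 tF))
  (hβ₀ : ∀ T, ∀ t ∈ Icc 0 tF, 0 ≤ β t T) (hγ₀ : ∀ T, ∀ t ∈ Icc 0 tF, 0 ≤ γ t T)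
  {f g : ℝ → Lp (E d) 2 (volume.restrict Ω)} (hf : ContinuousOn f (Icc 0 tF))
  (hg : ContinuousOn g (Icc 0 tF)) {u₀ b₀ : E d → E d}

include hc htF hν hμ hβ hγ hβ₀ hγ₀ hf hg

/-- The energy estimate in terms of the interpolates of the initial data: the solution is its own
test function, and the convective terms do not contribute to the energy balance. -/
theorem SolvesPressureFree.energy_le (hu₀ : interp M k u₀ ∈ spaceZ0 M k)
    (hb₀ : interp M k b₀ ∈ spaceZ0 M k) {C : ℝ} (hC : 0 < C)
    (hcoer : ∀ v ∈ spaceU M k, norm1Sq v ≤ C * aForm k v v) {u b : ℝ → HybridVec M}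
    (h : SolvesPressureFree M k tF ν μ β γ f g u₀ b₀ u b) :
    energyNormSq tF ν μ β γ u b ≤ (2 * C + 4) * (Real.exp tF *
      (inner0 (interp M k u₀) (interp M k u₀) + inner0 (interp M k b₀) (interp M k b₀) +
        ((∫ t in (0 : ℝ)..tF, ‖f t‖ ^ 2) + ∫ t in (0 : ℝ)..tF, ‖g t‖ ^ 2))) := by
  obtain ⟨x, x', hx, h0, e, h⟩ :=
    (solvesPressureFree_iff hc htF hν hμ hβ hγ hβ₀ hγ₀ hf hg hu₀ hb₀).1 h
  set P := galerkin (k := k) hc hν hμ hβ hγ hβ₀ hγ₀ hf hg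
  have hPm : ∀ p, P.m p p = inner0 (velZ p) (velZ p) + inner0 (magZ p) (magZ p) :=
    fun _ => rfl
  have hPA : ∀ t p, P.A t p p = ν * aForm k (velZ p) (velZ p) +
      jForm (β t) (velZ p) (velZ p) + (μ * aForm k (magZ p) (magZ p) +
      jForm (γ t) (magZ p) (magZ p)) := fun _ _ => rfl
  have hcu : ContinuousOn (fun t => ‖f t‖ ^ 2) (Icc 0 tF) := hf.norm.pow 2
  have hcg : ContinuousOn (fun t => ‖g t‖ ^ 2) (Icc 0 tF) := hg.norm.pow 2
  have hcA : ContinuousOn (fun t => 2 * P.A t (x t) (x t)) (Icc 0 tF) :=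
    continuousOn_const.mul (continuousOn_bilin P.contA hx.continuousOn hx.continuousOn)
  obtain ⟨g1, g2⟩ := gronwall_energy htF zero_le_one (y := fun t => P.m (x t) (x t))
    (y' := fun t => P.m (x' t) (x t) + P.m (x t) (x' t)) (D := fun t => 2 * P.A t (x t) (x t))
    (g := fun t => ‖f t‖ ^ 2 + ‖g t‖ ^ 2) (fun t ht => hx.hasDerivWithinAt_bilin P.m ht)
    hcA (hcu.add hcg) (fun t _ => add_nonneg (inner0_self_nonneg _) (inner0_self_nonneg _))
    (fun t ht => mul_nonneg two_pos.le (P.nonneg t ht _))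
    (fun t _ => by positivity) (fun t ht => by
      have e1 : _ = _ := h t ⟨ht.1, ht.2.le⟩ (x t)
      have e2 := two_mul_source_le (velZ_memU (x t)) hc (f t)
      have e3 := two_mul_source_le (magZ_memU (x t)) hc (g t)
      have e4 : P.l t (x t) = (∫ y in Ω, inner ℝ (f t y) (broken (velZ (x t)).1 y)) +
        ∫ y in Ω, inner ℝ (g t y) (broken (magZ (x t)).1 y) := rfl
      rw [P.skew, e4] at e1
      rw [P.symm (x t) (x' t), hPm]
      linarith)
  have h0' : P.m (x 0) (x 0) = inner0 (interp M k u₀) (interp M k u₀) +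
      inner0 (interp M k b₀) (interp M k b₀) := by
    rw [h0]
    rfl
  have hii : ∀ {φ : ℝ → ℝ}, ContinuousOn φ (Icc 0 tF) → IntervalIntegrable φ volume 0 tF :=
    fun hφ => ContinuousOn.intervalIntegrable (by rwa [uIcc_of_le htF.le])
  rw [h0', intervalIntegral.integral_add (hii hcu) (hii hcg), one_mul] at g1 g2
  set S := Real.exp tF *
      (inner0 (interp M k u₀) (interp M k u₀) + inner0 (interp M k b₀) (interp M k b₀) +
        ((∫ t in (0 : ℝ)..tF, ‖f t‖ ^ 2) + ∫ t in (0 : ℝ)..tF, ‖g t‖ ^ 2))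
  have s1 : sSup ((fun t => inner0 (u t) (u t)) '' Icc 0 tF) ≤ S := by
    refine csSup_le ((nonempty_Icc.2 htF.le).image _) ?_
    rintro _ ⟨t, ht, rfl⟩
    have h2 := g1 t ht
    have h3 := inner0_self_nonneg (b t)
    rw [hPm, (e t ht).1, (e t ht).2] at h2
    change inner0 (u t) (u t) ≤ S
    linarith
  have s2 : sSup ((fun t => inner0 (b t) (b t)) '' Icc 0 tF) ≤ S := by
    refine csSup_le ((nonempty_Icc.2 htF.le).image _) ?_
    rintro _ ⟨t, ht, rfl⟩
    have h2 := g1 t ht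
    have h3 := inner0_self_nonneg (u t)
    rw [hPm, (e t ht).1, (e t ht).2] at h2
    change inner0 (b t) (b t) ≤ S
    linarith
  have hint : ∀ {φ : ℝ → ℝ}, (∀ t ∈ Icc 0 tF, 0 ≤ φ t) →
      (∀ t ∈ Icc 0 tF, φ t ≤ (C + 1) * P.A t (x t) (x t)) →
      ∫ t in (0 : ℝ)..tF, φ t ≤ (C + 1) * S := by
    intro φ h1 h2
    have h3 : ∫ t in (0 : ℝ)..tF, φ t ≤ ∫ t in (0 : ℝ)..tF, (C + 1) * (2 * P.A t (x t) (x t)) := by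
      rw [intervalIntegral.integral_of_le htF.le, intervalIntegral.integral_of_le htF.le]
      refine integral_mono_of_nonneg ?_ ((hii hcA).const_mul (C + 1)).1 ?_
      · filter_upwards [ae_restrict_mem measurableSet_Ioc] with t ht
        exact h1 t (Ioc_subset_Icc_self ht)
      · filter_upwards [ae_restrict_mem measurableSet_Ioc] with t ht
        have ht' := Ioc_subset_Icc_self ht
        refine (h2 t ht').trans (mul_le_mul_of_nonneg_left ?_ (by linarith))
        have := P.nonneg t ht' (x t)
        linarith
    rw [intervalIntegral.integral_const_mul] at h3
    exact h3.trans (mul_le_mul_of_nonneg_left g2 (by linarith))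
  have hpart : ∀ {κ j a n : ℝ}, 0 < κ → 0 ≤ j → 0 ≤ a → n ≤ C * a →
      κ * n + j ≤ (C + 1) * (κ * a + j) := by
    intro κ j a n hκ hj ha hn
    have h1 := mul_le_mul_of_nonneg_left hn hκ.le
    have h2 : 0 ≤ κ * a := mul_nonneg hκ.le ha
    have h3 : 0 ≤ C * j := mul_nonneg hC.le hj
    linarith
  have hC1 : 0 ≤ C + 1 := by linarith
  have s3 : ∫ t in (0 : ℝ)..tF, (ν * norm1Sq (u t) + jForm (β t) (u t) (u t)) ≤ (C + 1) * S := by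
    refine hint (fun t ht => add_nonneg (mul_nonneg hν.le (norm1Sq_nonneg _))
      (jForm_self_nonneg (fun T => hβ₀ T t ht) _)) fun t ht => ?_
    rw [hPA, (e t ht).1, (e t ht).2]
    refine (hpart hν (jForm_self_nonneg (fun T => hβ₀ T t ht) (u t)) (aForm_self_nonneg _)
      (hcoer _ ?_)).trans (mul_le_mul_of_nonneg_left (le_add_of_nonneg_right (add_nonneg
        (mul_nonneg hμ.le (aForm_self_nonneg _)) (jForm_self_nonneg (fun T => hγ₀ T t ht) _))) hC1)
    rw [← (e t ht).1]
    exact velZ_memU _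
  have s4 : ∫ t in (0 : ℝ)..tF, (μ * norm1Sq (b t) + jForm (γ t) (b t) (b t)) ≤ (C + 1) * S := by
    refine hint (fun t ht => add_nonneg (mul_nonneg hμ.le (norm1Sq_nonneg _))
      (jForm_self_nonneg (fun T => hγ₀ T t ht) _)) fun t ht => ?_
    rw [hPA, (e t ht).1, (e t ht).2]
    refine (hpart hμ (jForm_self_nonneg (fun T => hγ₀ T t ht) (b t)) (aForm_self_nonneg _)
      (hcoer _ ?_)).trans (mul_le_mul_of_nonneg_left (le_add_of_nonneg_left (add_nonneg
        (mul_nonneg hν.le (aForm_self_nonneg _)) (jForm_self_nonneg (fun T => hβ₀ T t ht) _))) hC1)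
    rw [← (e t ht).2]
    exact magZ_memU _
  unfold energyNormSq
  linarith

end Energy

end

end MHD

theorem theorem1 (d : ℕ) (hd : d = 2 ∨ d = 3) (Ω : Set (MHD.E d))
    (hΩ_open : IsOpen Ω) (hΩ_nonempty : Ω.Nonempty) (hΩ_convex : Convex ℝ Ω)
    (hΩ_bounded : Bornology.IsBounded Ω)
    (hΩ_polytope : ∃ s : Finset (MHD.E d), closure Ω = convexHull ℝ (s : Set (MHD.E d)))
    (k : ℕ) (σ : ℝ) :
    ∃ C : ℝ, 0 < C ∧
      ∀ (M : MHD.SimplicialMesh Ω), M.IsRegular σ →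
      ∀ (tF ν μ : ℝ), 0 < tF → 0 < ν → 0 < μ →
      ∀ (β γ : ℝ → M.Elem → ℝ),
        (∀ T, ContinuousOn (fun t => β t T) (Set.Icc 0 tF)) →
        (∀ T, ContinuousOn (fun t => γ t T) (Set.Icc 0 tF)) →
        (∀ T, ∀ t ∈ Set.Ioc 0 tF, 0 < β t T) →
        (∀ T, ∀ t ∈ Set.Ioc 0 tF, 0 < γ t T) →
      ∀ (f g : ℝ → MeasureTheory.Lp (MHD.E d) 2 (MeasureTheory.volume.restrict Ω)),
        ContinuousOn f (Set.Icc 0 tF) → ContinuousOn g (Set.Icc 0 tF) →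
      ∀ (u₀ b₀ : MHD.E d → MHD.E d),
        MHD.MemH10 Ω u₀ → MHD.IsDivFree Ω u₀ → MHD.MemH10 Ω b₀ → MHD.IsDivFree Ω b₀ →
      -- existence and uniqueness for the scheme with pressures
      (∃ (u b : ℝ → MHD.HybridVec M) (p r : ℝ → MHD.HybridScal M),
        MHD.SolvesScheme M k tF ν μ β γ f g u₀ b₀ u b p r ∧
        ∀ (u₁ b₁ : ℝ → MHD.HybridVec M) (p₁ r₁ : ℝ → MHD.HybridScal M),
          MHD.SolvesScheme M k tF ν μ β γ f g u₀ b₀ u₁ b₁ p₁ r₁ →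
          Set.EqOn u₁ u (Set.Icc 0 tF) ∧ Set.EqOn b₁ b (Set.Icc 0 tF) ∧
          Set.EqOn p₁ p (Set.Ioc 0 tF) ∧ Set.EqOn r₁ r (Set.Ioc 0 tF)) ∧
      -- existence and uniqueness for the pressure-free formulation
      (∃ (u b : ℝ → MHD.HybridVec M),
        MHD.SolvesPressureFree M k tF ν μ β γ f g u₀ b₀ u b ∧
        ∀ (u₁ b₁ : ℝ → MHD.HybridVec M),
          MHD.SolvesPressureFree M k tF ν μ β γ f g u₀ b₀ u₁ b₁ →
          Set.EqOn u₁ u (Set.Icc 0 tF) ∧ Set.EqOn b₁ b (Set.Icc 0 tF)) ∧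
      -- equivalence of the two formulations
      (∀ (u b : ℝ → MHD.HybridVec M),
        MHD.SolvesPressureFree M k tF ν μ β γ f g u₀ b₀ u b ↔
          ∃ (p r : ℝ → MHD.HybridScal M), MHD.SolvesScheme M k tF ν μ β γ f g u₀ b₀ u b p r) ∧
      -- energy bound
      ∀ (u b : ℝ → MHD.HybridVec M) (p r : ℝ → MHD.HybridScal M),
        MHD.SolvesScheme M k tF ν μ β γ f g u₀ b₀ u b p r →
        MHD.energyNormSq tF ν μ β γ u b ≤
          C * Real.exp tF *
            ((∫ t in (0 : ℝ)..tF, ‖f t‖ ^ 2) + (∫ t in (0 : ℝ)..tF, ‖g t‖ ^ 2) +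
              MHD.h1SeminormSq Ω u₀ + MHD.h1SeminormSq Ω b₀) := by
  have : NeZero d := ⟨by omega⟩
  by_cases hσ : 1 ≤ σ
  swap
  · -- An element contains a ball of diameter at most its own: no mesh is regular with `σ < 1`.
    refine ⟨1, one_pos, fun M hM => absurd ?_ hσ⟩
    obtain ⟨x, hx⟩ := hΩ_nonempty
    have hx' := subset_closure hx
    rw [MHD.SimplicialMesh.closure_eq_iUnion (M := M), Set.mem_iUnion] at hx'
    obtain ⟨T, -⟩ := hx'
    obtain ⟨x₀, r, hr, hs, hd⟩ := hM T
    exact MHD.HasInball.one_le ⟨MHD.SimplicialMesh.isSimplex T, hr, hs, hd⟩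
  obtain ⟨C₁, hC₁, hcoer⟩ := MHD.exists_coercivity (d := d) k hσ
  obtain ⟨C₂, hC₂, hint⟩ := MHD.exists_interp_bound (d := d) k hσ hΩ_open hΩ_convex hΩ_bounded
  refine ⟨(2 * C₁ + 4) * (C₂ + 1), by positivity, ?_⟩
  intro M hM tF ν μ htF hν hμ β γ hβ hγ hβ₀ hγ₀ f g hf hg u₀ b₀ hu₀ hud hb₀ hbd
  have hβ₁ : ∀ T, ∀ t ∈ Set.Icc 0 tF, 0 ≤ β t T := fun T =>
    MHD.nonneg_of_pos_Ioc htF (hβ T) (hβ₀ T)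
  have hγ₁ : ∀ T, ∀ t ∈ Set.Icc 0 tF, 0 ≤ γ t T := fun T =>
    MHD.nonneg_of_pos_Ioc htF (hγ T) (hγ₀ T)
  have hIu : MHD.interp M k u₀ ∈ MHD.spaceZ0 M k :=
    MHD.interp_mem_spaceZ0 hΩ_open hΩ_convex hu₀ hud
  have hIb : MHD.interp M k b₀ ∈ MHD.spaceZ0 M k :=
    MHD.interp_mem_spaceZ0 hΩ_open hΩ_convex hb₀ hbd
  obtain ⟨u, b, hub⟩ := MHD.exists_solvesPressureFree hΩ_convex htF hν hμ hβ hγ hβ₁ hγ₁ hf hg hIu hIb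
  have huniq : ∀ u₁ b₁, MHD.SolvesPressureFree M k tF ν μ β γ f g u₀ b₀ u₁ b₁ →
      Set.EqOn u₁ u (Set.Icc 0 tF) ∧ Set.EqOn b₁ b (Set.Icc 0 tF) := fun u₁ b₁ h₁ =>
    MHD.solvesPressureFree_unique hΩ_convex htF hν hμ hβ hγ hβ₁ hγ₁ hf hg hIu hIb hub h₁
  refine ⟨?_, ⟨u, b, hub, huniq⟩, fun u b => ⟨fun h =>
    h.exists_solvesScheme hΩ_open hΩ_convex hβ hγ hf hg, fun ⟨p, r, h⟩ =>
      h.solvesPressureFree htF hIu hIb⟩, fun u b p r h => ?_⟩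
  · obtain ⟨p, r, hpr⟩ := hub.exists_solvesScheme hΩ_open hΩ_convex hβ hγ hf hg
    refine ⟨u, b, p, r, hpr, fun u₁ b₁ p₁ r₁ h₁ => ?_⟩
    obtain ⟨eu, eb⟩ := huniq u₁ b₁ (h₁.solvesPressureFree htF hIu hIb)
    exact ⟨eu, eb, hpr.pressure_unique hΩ_open hΩ_convex htF h₁ eu eb⟩
  · have h1 := (h.solvesPressureFree htF hIu hIb).energy_le hΩ_convex htF hν hμ hβ hγ hβ₁ hγ₁ hf hg
      hIu hIb hC₁ fun v hv => hcoer hM v hv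
    have h2 := hint hM u₀ hu₀
    have h3 := hint hM b₀ hb₀
    have h4 : ∀ v, 0 ≤ MHD.h1SeminormSq Ω v := fun v =>
      MeasureTheory.integral_nonneg fun _ => MHD.frob_self_nonneg _
    have h5 : ∀ φ : ℝ → MeasureTheory.Lp (MHD.E d) 2 (MeasureTheory.volume.restrict Ω),
        0 ≤ ∫ t in (0 : ℝ)..tF, ‖φ t‖ ^ 2 := fun φ =>
      intervalIntegral.integral_nonneg htF.le fun t _ => sq_nonneg _
    refine h1.trans ?_
    rw [mul_assoc (2 * C₁ + 4), mul_assoc (2 * C₁ + 4), mul_comm (C₂ + 1), mul_assoc (Real.exp tF)]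
    refine mul_le_mul_of_nonneg_left (mul_le_mul_of_nonneg_left ?_ (Real.exp_pos _).le)
      (by positivity)
    have h6 := mul_nonneg hC₂.le (h5 f)
    have h7 := mul_nonneg hC₂.le (h5 g)
    have h8 := h4 u₀
    have h9 := h4 b₀
    linarith
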